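/- \textbf{Theorem ($\{P_4\}$-Deletion with a nice tree decomposition).} All graphs are finite, simple and undirected, and $P_4$ is the path on four vertices. For a graph $G$ let ${\bf tm}_{\{P_4\}}(G)$ (resp. ${\bf m}_{\{P_4\}}(G)$) be the minimum of $|S|$ over all $S\subseteq V(G)$ such that $G\setminus S$ does not contain $P_4$ as a topological minor (resp. as a minor). $\{P_4\}$-\textsc{TM-Deletion} (resp. $\{P_4\}$-\textsc{M-Deletion}) asks, given $G$ and $k\in\mathbb N$, whether ${\bf tm}_{\{P_4\}}(G)\le k$ (resp. ${\bf m}_{\{P_4\}}(G)\le k$); $\{P_4\}$-\textsc{Deletion} stands for both problems. A nice tree decomposition of $G$ is a tree decomposition $(T,\{X_t\}_{t\in V(T)})$ of $G$ with a root $r\in V(T)$ such that $X_r=\emptyset$; every node has at most two children; $X_t=\emptyset$ for every node $t$ without children (a leaf node); if $t$ has exactly one child $t'$, then $X_t=X_{t'}\cup\{v\}$ for some $v\notin X_{t'}$ or $X_t=X_{t'}\setminus\{v\}$ for some $v\in X_{t'}$; and if $t$ has exactly two children $t',t''$, then $X_t=X_{t'}=X_{t''}$. Its width is $w=\max_t|X_t|-1$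 (read as $0$ if all bags are empty). Let $n=|V(G)|$. If a nice tree decomposition of $G$ of width $w$ with $O(n)$ nodes is given, then $\{P_4\}$-\textsc{Deletion} can be solved in time $O(36^{w}\cdot w\cdot n)$. Precisely: there is one program for a random access machine (unit-cost instructions: constants, copying, addition, truncated subtraction, indirect loads and stores, tests for zero; memory cells outside the input are initially $0$) such that for every constant $C$ there is a constant $K$ for which the following holds. Let $k\in\mathbb N$, let $G$ be a graph with vertex set $\{0,\dots,n-1\}$, and let a nice tree decomposition of $G$ of width $w$ be given whose tree has at most $C(n+1)$ leaf nodes (in particular, this holds if the tree has at most $C(n+1)$ nodes). Let the input consist of $n$, the number of edges, the number of nodes, the root, $k$, a list of the edges, and, for each node, lists of its bag and of its children, where all these lists are in arbitrary order. Then, on every word length $b\ge K\,(w+\lfloor\log_2(n+k+2)\rfloor)$, i.e. when constants and sums must stay below $2^b$, the program halts after at most $$K\cdot 36^{w}\cdot (w+1)\cdot (n+1)$$ time units, its first output is $1$ if ${\bf tm}_{\{P_4\}}(G)\le k$, equivalently ${\bf m}_{\{P_4\}}(G)\le k$, and $0$ otherwise, and its second output is ${\bf tm}_{\{P_4\}}(G)={\bf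 m}_{\{P_4\}}(G)$. -/

import Mathlib

/-! ### Minors, topological minors, and the deletion problems -/

/-- A topological minor model of `H` in `G`: distinct branch vertices, and for every edge of `H` a
path of `G` between the corresponding branch vertices (the path of `y x` is that of `x y`
traversed backwards, so there is one path per edge), such that the internal vertices of a path are
neither branch vertices nor vertices of another path. -/
structure TopologicalMinorModel {α β : Type*} (H : SimpleGraph α) (G : SimpleGraph β) where
  branch : α ↪ β
  path : ∀ x y : α, H.Adj x y → G.Walk (branch x) (branch y)
  isPath : ∀ (x y : α) (h : H.Adj x y), (path x y h).IsPath
  path_symm : ∀ (x y : α) (h : H.Adj x y), path y x h.symm = (path x y h).reverse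
  internal_ne_branch : ∀ (x y : α) (h : H.Adj x y), ∀ v ∈ (path x y h).support,
    v ≠ branch x → v ≠ branch y → ∀ z : α, v ≠ branch z
  internal_notMem : ∀ (x y : α) (h : H.Adj x y) (x' y' : α) (h' : H.Adj x' y'),
    s(x, y) ≠ s(x', y') → ∀ v ∈ (path x y h).support,
      v ≠ branch x → v ≠ branch y → v ∉ (path x' y' h').support

/-- `G` contains `H` as a topological minor. -/
def IsTopologicalMinor {α β : Type*} (H : SimpleGraph α) (G : SimpleGraph β) : Prop :=
  Nonempty (TopologicalMinorModel H G)

/-- `G` contains `H` as a minor: there are pairwise disjoint branch sets, each inducing a connected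
non-empty subgraph of `G`, and adjacent vertices of `H` have adjacent branch sets. -/
def IsMinor {α β : Type*} (H : SimpleGraph α) (G : SimpleGraph β) : Prop :=
  ∃ φ : α → Set β,
    (∀ x, (G.induce (φ x)).Connected) ∧
    (∀ x y, x ≠ y → Disjoint (φ x) (φ y)) ∧
    (∀ x y, H.Adj x y → ∃ x' ∈ φ x, ∃ y' ∈ φ y, G.Adj x' y')

/-- `S` is a solution of the deletion problem of the collection `F` in the topological minor
version: `G ∖ S` contains no graph of `F` as a topological minor. -/
def IsTMSolution {V : Type*} (F : Set (Σ h : ℕ, SimpleGraph (Fin h))) (G : SimpleGraph V)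
    (S : Finset V) : Prop :=
  ∀ H ∈ F, ¬ IsTopologicalMinor H.2 (G.induce {v : V | v ∉ S})

/-- `S` is a solution of the deletion problem of the collection `F` in the minor version:
`G ∖ S` contains no graph of `F` as a minor. -/
def IsMSolution {V : Type*} (F : Set (Σ h : ℕ, SimpleGraph (Fin h))) (G : SimpleGraph V)
    (S : Finset V) : Prop :=
  ∀ H ∈ F, ¬ IsMinor H.2 (G.induce {v : V | v ∉ S})

/-- The collection whose only member is the path on four vertices. -/
def collectionP4 : Set (Σ h : ℕ, SimpleGraph (Fin h)) :=
  {⟨4, SimpleGraph.pathGraph 4⟩}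

/-! ### Nice tree decompositions -/

/-- A tree decomposition of `G` with node set `τ`. -/
structure TreeDecomposition {V : Type*} (G : SimpleGraph V) (τ : Type*) where
  tree : SimpleGraph τ
  isTree : tree.IsTree
  bag : τ → Finset V
  vertex_mem : ∀ v : V, ∃ t : τ, v ∈ bag t
  edge_mem : ∀ u v : V, G.Adj u v → ∃ t : τ, u ∈ bag t ∧ v ∈ bag t
  path_mem : ∀ (x y z : τ) (p : tree.Walk x y), p.IsPath → z ∈ p.support →
    ∀ v : V, v ∈ bag x → v ∈ bag y → v ∈ bag z

namespace TreeDecomposition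

variable {V τ : Type*} {G : SimpleGraph V}

/-- The width, i.e. the maximum size of a bag minus one (`0` if all bags are empty). -/
def width [Fintype τ] (D : TreeDecomposition G τ) : ℕ :=
  (Finset.univ.sup fun t => (D.bag t).card) - 1

/-- The children of `t` when the tree is rooted at `r`. -/
def children (D : TreeDecomposition G τ) (r t : τ) : Set τ :=
  {t' | D.tree.Adj t t' ∧ D.tree.dist r t' = D.tree.dist r t + 1}

/-- The leaf nodes (nodes without children) when the tree is rooted at `r`. -/
def leaves (D : TreeDecomposition G τ) (r : τ) : Set τ :=
  {t | D.children r t = ∅}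

/-- `D`, rooted at `r`, is a nice tree decomposition. -/
structure IsNice [DecidableEq V] (D : TreeDecomposition G τ) (r : τ) : Prop where
  root : D.bag r = ∅
  atMostTwo : ∀ t, (D.children r t).encard ≤ 2
  leaf : ∀ t, D.children r t = ∅ → D.bag t = ∅
  introduceOrForget : ∀ t t', D.children r t = {t'} →
    (∃ v, v ∉ D.bag t' ∧ D.bag t = insert v (D.bag t')) ∨
    (∃ v, v ∈ D.bag t' ∧ D.bag t = (D.bag t').erase v)
  join : ∀ t t' t'', t' ≠ t'' → D.children r t = {t', t''} →
    D.bag t = D.bag t' ∧ D.bag t = D.bag t''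

end TreeDecomposition

/-! ### Random access machines with bounded word length -/

namespace RAM

/-- Programs of a random access machine with registers `0, 1, 2, …` (a program mentions only
finitely many of them) and a word-addressed memory, in structured form. Each of the first six
instructions takes one time unit, and so does each test of `ifPos` and of `whilePos`. -/
inductive Program : Type
  /-- write the constant `c` into register `x` -/
  | const (x c : ℕ) : Program
  /-- copy register `y` into register `x` -/
  | copy (x y : ℕ) : Program
  /-- write the sum of registers `y` and `z` into register `x` -/
  | add (x y z : ℕ) : Program
  /-- write the truncated difference of registers `y` and `z` into register `x` -/
  | sub (x y z : ℕ) : Program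
  /-- read into register `x` the memory word whose address is in register `y` -/
  | load (x y : ℕ) : Program
  /-- write register `y` into the memory word whose address is in register `x` -/
  | store (x y : ℕ) : Program
  /-- run `p`, then `q` -/
  | seq (p q : Program) : Program
  /-- run `p` if register `x` is positive, and `q` otherwise -/
  | ifPos (x : ℕ) (p q : Program) : Program
  /-- run `p` as long as register `x` is positive -/
  | whilePos (x : ℕ) (p : Program) : Program

/-- The contents of the registers and of the memory. -/
structure State : Type where
  reg : ℕ → ℕ
  mem : ℕ → ℕ

/-- Write `a` into register `x`. -/
def State.setReg (s : State) (x a : ℕ) : State :=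
  { s with reg := Function.update s.reg x a }

/-- Write `a` into the memory word with address `i`. -/
def State.setMem (s : State) (i a : ℕ) : State :=
  { s with mem := Function.update s.mem i a }

/-- The initial state: all registers are `0`, and the memory holds the input from address `0`
on, followed by zeros. -/
def State.init (input : List ℕ) : State where
  reg := fun _ => 0
  mem := fun i => input.getD i 0

/-- `Exec b p s s' t`: on the machine with word length `b`, the program `p` started in state `s`
halts in state `s'` after exactly `t` time units. A constant or a sum that does not fit into a
word of `b` bits blocks the machine (no rule applies). -/
inductive Exec (b : ℕ) : Program → State → State → ℕ → Prop
  | const (s : State) (x c : ℕ) (h : c < 2 ^ b) :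
      Exec b (.const x c) s (s.setReg x c) 1
  | copy (s : State) (x y : ℕ) :
      Exec b (.copy x y) s (s.setReg x (s.reg y)) 1
  | add (s : State) (x y z : ℕ) (h : s.reg y + s.reg z < 2 ^ b) :
      Exec b (.add x y z) s (s.setReg x (s.reg y + s.reg z)) 1
  | sub (s : State) (x y z : ℕ) :
      Exec b (.sub x y z) s (s.setReg x (s.reg y - s.reg z)) 1
  | load (s : State) (x y : ℕ) :
      Exec b (.load x y) s (s.setReg x (s.mem (s.reg y))) 1
  | store (s : State) (x y : ℕ) :
      Exec b (.store x y) s (s.setMem (s.reg x) (s.reg y)) 1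
  | seq {p q : Program} {s s' s'' : State} {t t' : ℕ} (h : Exec b p s s' t)
      (h' : Exec b q s' s'' t') : Exec b (.seq p q) s s'' (t + t')
  | ifPos_pos {x : ℕ} {p q : Program} {s s' : State} {t : ℕ} (hx : 0 < s.reg x)
      (h : Exec b p s s' t) : Exec b (.ifPos x p q) s s' (t + 1)
  | ifPos_zero {x : ℕ} {p q : Program} {s s' : State} {t : ℕ} (hx : s.reg x = 0)
      (h : Exec b q s s' t) : Exec b (.ifPos x p q) s s' (t + 1)
  | whilePos_pos {x : ℕ} {p : Program} {s s' s'' : State} {t t' : ℕ} (hx : 0 < s.reg x)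
      (h : Exec b p s s' t) (h' : Exec b (.whilePos x p) s' s'' t') :
      Exec b (.whilePos x p) s s'' (t + t' + 1)
  | whilePos_zero {x : ℕ} {p : Program} {s : State} (hx : s.reg x = 0) :
      Exec b (.whilePos x p) s s 1

end RAM

/-! ### The input of the algorithm -/

/-- The lists by which a graph on `{0, …, n - 1}` and a rooted tree decomposition with nodes
`0, …, N - 1` are presented: a list of the edges (each edge once, in one of its two orientations),
and for each node a list of its bag and a list of its children. The orders are arbitrary. -/
structure Listing {n N : ℕ} (G : SimpleGraph (Fin n)) (D : TreeDecomposition G (Fin N))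
    (r : Fin N) where
  edges : List (Fin n × Fin n)
  edges_nodup : (edges.map fun e => s(e.1, e.2)).Nodup
  mem_edges : ∀ u v : Fin n, G.Adj u v ↔ s(u, v) ∈ edges.map fun e => s(e.1, e.2)
  bag : Fin N → List (Fin n)
  bag_nodup : ∀ t, (bag t).Nodup
  mem_bag : ∀ t v, v ∈ bag t ↔ v ∈ D.bag t
  children : Fin N → List (Fin N)
  children_nodup : ∀ t, (children t).Nodup
  mem_children : ∀ t t', t' ∈ children t ↔ t' ∈ D.children r t

/-- The input word: `n`, the number of edges, `N`, the root, `k`; then the two ends of each edge;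
then, for each node in increasing order, the size and the elements of its bag and the number and
the list of its children. -/
def Listing.encode {n N : ℕ} {G : SimpleGraph (Fin n)} {D : TreeDecomposition G (Fin N)}
    {r : Fin N} (L : Listing G D r) (k : ℕ) : List ℕ :=
  [n, L.edges.length, N, (r : ℕ), k]
    ++ L.edges.flatMap (fun e => [(e.1 : ℕ), (e.2 : ℕ)])
    ++ (List.finRange N).flatMap (fun t =>
        (L.bag t).length :: (L.bag t).map (fun v => (v : ℕ))
          ++ (L.children t).length :: (L.children t).map (fun t' => (t' : ℕ)))

set_option autoImplicit false
set_option linter.constructorNameAsVariable false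
set_option linter.unusedSimpArgs false

/-! Containing `P_4` as a minor, as a topological minor or as a subgraph is the same thing, and a
graph avoids `P_4` if and only if each of its components is a star (possibly a single vertex or
edge) or a triangle. This can be certified locally. Every edge either charges a deletion to one of
its ends, or is declared an edge of a star with one end as centre and the other as leaf, or is
declared an edge of a triangle; every triangle of the graph is selected or not. A vertex then only
checks what it has received: nothing, only deletions, only roles as centre, exactly one role as
leaf, or two triangle edges together with one selected triangle. By `hits_of_config` the deleted
vertices of such a configuration meet all `P_4`; by `opt_config`, `isFinal_config` and
`cost_config_le` every solution gives a configuration that is no more expensive.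

What a vertex has received so far is summarised by one of nine labels, and only 26 ordered pairs of
labels can be added without contradiction (`lab_add`, `opList_complete`). A table stores the best
cost for each vector of labels on a scope of at most `W` vertices, where `W` is the largest size of
a bag. Combining two tables therefore means running through `26 ^ W` tuples of compatible pairs. A
vertex owns `O(W ^ 2)` edges and triangles, and each takes one combination in time `O(W * 26 ^ W)`;
since 26 < 36, the total `W ^ 3 * 26 ^ W` is `O(36 ^ w)` (`cube_mul_pow_le`).

The tables are organised by bucket elimination. The vertices are numbered by their first occurrence
in a breadth-first search of the decomposition from the root. The smaller members of the bag of the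
first occurrence form the list `bl i`, and the members of a list belong to each other's lists, so
the order is a perfect elimination order of a chordal supergraph. Going from the largest vertex
down, `i` absorbs the items that it owns, is removed, and hands its table to its parent, the largest
member of `bl i` (`wp_bucket`, `Forest.step`). A greedy colouring with `W` colours assigns each
vertex a digit position in base 9, so tables with different scopes need no reindexing. The nodes of
the decomposition enter only through polynomial terms, and `IsNice.card_le` bounds their number by
the leaves, `n` and `W`.

Programs are written in a structured language whose weakest preconditions keep track of time and of
the size of numbers; `Cmd.comp_exec` carries their specifications over to the random access machine.
`wp_main` is the specification of the algorithm, and `Listing.exec_program` combines it with the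
estimates. -/

/-! ### A structured machine with named registers and arrays -/

namespace VM

/-- The registers of the structured machine. -/
inductive Reg
  | out | opt | n | m | N | W | M | big | p | q | t | bl | cl | h | x | y | z | u | v | i | j | l
  | cnt | bp | tail | c | fp | pA | pB | pC | sc | pos | len | row | xa | xb | xc | s | off | ri | rj
  | a | b | wt | pp
  deriving DecidableEq

/-- The arrays of the structured machine. -/
inductive Arr
  | ptr | que | idx | col | bst | ben | bls | used | row | adj | pow | ra | rb | rc | ta | tb | tc
  | tab | acc
  deriving DecidableEq

theorem Reg.ctorIdx_injective : Function.Injective Reg.ctorIdx := fun a b h => by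
  rw [← Reg.ofNat_ctorIdx a, h, Reg.ofNat_ctorIdx]

theorem Arr.ctorIdx_injective : Function.Injective Arr.ctorIdx := fun a b h => by
  rw [← Arr.ofNat_ctorIdx a, h, Arr.ofNat_ctorIdx]

/-- The number 32 is the stride with which the arrays are interleaved in memory. As a power of two
it allows addresses to be computed by doubling. -/
theorem Arr.ctorIdx_lt (a : Arr) : a.ctorIdx < 32 := by cases a <;> decide

/-- The contents of the registers and of the (infinite) arrays. -/
@[ext] structure St where
  r : Reg → ℕ
  a : Arr → ℕ → ℕ

/-- Write `v` into register `x`. -/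
def St.set (s : St) (x : Reg) (v : ℕ) : St := { s with r := Function.update s.r x v }

/-- Write `v` into the cell `i` of the array `A`. -/
def St.put (s : St) (A : Arr) (i v : ℕ) : St :=
  { s with a := Function.update s.a A (Function.update (s.a A) i v) }

theorem St.set_r (s : St) (x y : Reg) (v : ℕ) : (s.set x v).r y = if y = x then v else s.r y := by
  simp [St.set, Function.update_apply]

@[simp] theorem St.set_r_self (s : St) (x : Reg) (v : ℕ) : (s.set x v).r x = v := by
  simp [St.set]

theorem St.set_r_ne (s : St) {x y : Reg} (v : ℕ) (h : y ≠ x) : (s.set x v).r y = s.r y := by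
  simp [St.set, h]

@[simp] theorem St.set_a (s : St) (x : Reg) (v : ℕ) : (s.set x v).a = s.a := rfl

@[simp] theorem St.put_r (s : St) (A : Arr) (i v : ℕ) : (s.put A i v).r = s.r := rfl

@[simp] theorem St.put_a_self (s : St) (A : Arr) (i v : ℕ) :
    (s.put A i v).a A = Function.update (s.a A) i v := by
  simp [St.put]

theorem St.put_a_ne (s : St) {A B : Arr} (i v : ℕ) (h : B ≠ A) : (s.put A i v).a B = s.a B := by
  simp [St.put, h]

/-- Expressions. -/
inductive Ex
  | lit (c : ℕ)
  | reg (x : Reg)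
  | add (e f : Ex)
  | sub (e f : Ex)
  | arr (A : Arr) (e : Ex)
  | inp (e : Ex)

/-- The input, an upper bound `β` on its length, and a strict upper bound `H` on the constants, sums
and array indices that may occur. -/
structure Env where
  I : ℕ → ℕ
  β : ℕ
  H : ℕ

/-- The value of an expression. -/
def Ex.ev (E : Env) (s : St) : Ex → ℕ
  | lit c => c
  | reg x => s.r x
  | add e f => e.ev E s + f.ev E s
  | sub e f => e.ev E s - f.ev E s
  | arr A e => s.a A (e.ev E s)
  | inp e => E.I (e.ev E s)

/-- The bounds are respected in the evaluation of an expression. -/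
def Ex.ok (E : Env) (s : St) : Ex → Prop
  | lit c => c < E.H
  | reg _ => True
  | add e f => e.ok E s ∧ f.ok E s ∧ e.ev E s + f.ev E s < E.H
  | sub e f => e.ok E s ∧ f.ok E s
  | arr _ e => e.ok E s ∧ e.ev E s < E.H
  | inp e => e.ok E s ∧ e.ev E s < E.β

/-- The running time of an expression. -/
def Ex.cost : Ex → ℕ
  | lit _ => 1
  | reg _ => 1
  | add e f => e.cost + f.cost + 1
  | sub e f => e.cost + f.cost + 1
  | arr _ e => e.cost + 9
  | inp e => e.cost + 1

/-- Programs; `rep e p` runs `p` as many times as the value of `e` at the beginning. -/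
inductive Cmd
  | skip
  | set (x : Reg) (e : Ex)
  | put (A : Arr) (e f : Ex)
  | seq (p q : Cmd)
  | ite (e : Ex) (p q : Cmd)
  | rep (e : Ex) (p : Cmd)

/-- Weakest precondition of an iteration. -/
def iterWp (f : St → (St → ℕ → Prop) → Prop) : ℕ → St → (St → ℕ → Prop) → Prop
  | 0, s, Q => Q s 1
  | n + 1, s, Q => f s fun s₁ t₁ => iterWp f n s₁ fun s₂ t₂ => Q s₂ (t₁ + 2 + t₂ + 1)

/-- Weakest precondition: from `s` the program `p` respects the bounds and ends in a state and
after a time that satisfy `Q`. -/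
def Cmd.wp (E : Env) : Cmd → St → (St → ℕ → Prop) → Prop
  | skip, s, Q => Q s 1
  | set x e, s, Q => e.ok E s ∧ Q (s.set x (e.ev E s)) (e.cost + 1)
  | put A e f, s, Q => e.ok E s ∧ f.ok E s ∧ e.ev E s < E.H ∧
      Q (s.put A (e.ev E s) (f.ev E s)) (e.cost + f.cost + 9)
  | seq p q, s, Q => p.wp E s fun s₁ t₁ => q.wp E s₁ fun s₂ t₂ => Q s₂ (t₁ + t₂)
  | ite e p q, s, Q => e.ok E s ∧ (0 < e.ev E s → p.wp E s fun s' t => Q s' (e.cost + (t + 1))) ∧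
      (e.ev E s = 0 → q.wp E s fun s' t => Q s' (e.cost + (t + 1)))
  | rep e p, s, Q => e.ok E s ∧
      iterWp (fun s Q => p.wp E s Q) (e.ev E s) s fun s' t => Q s' (e.cost + t)

theorem iterWp_mono {f : St → (St → ℕ → Prop) → Prop}
    (hf : ∀ s Q Q', (∀ s' t, Q s' t → Q' s' t) → f s Q → f s Q') (n : ℕ) :
    ∀ (s : St) (Q Q' : St → ℕ → Prop), (∀ s' t, Q s' t → Q' s' t) →
      iterWp f n s Q → iterWp f n s Q' := by
  induction n with
  | zero => intro s Q Q' h; exact h s 1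
  | succ n ih =>
    intro s Q Q' h hw
    exact hf _ _ _ (fun s₁ t₁ => ih s₁ _ _ fun s₂ t₂ => h _ _) hw

theorem Cmd.wp_mono {E : Env} {p : Cmd} : ∀ {s : St} {Q Q' : St → ℕ → Prop}, p.wp E s Q →
    (∀ s' t, Q s' t → Q' s' t) → p.wp E s Q' := by
  induction p with
  | skip => intro s Q Q' h hq; exact hq _ _ h
  | set x e => intro s Q Q' h hq; exact ⟨h.1, hq _ _ h.2⟩
  | put A e f => intro s Q Q' h hq; exact ⟨h.1, h.2.1, h.2.2.1, hq _ _ h.2.2.2⟩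
  | seq p q ihp ihq =>
    intro s Q Q' h hq
    exact ihp h fun s₁ t₁ h₁ => ihq h₁ fun s₂ t₂ => hq _ _
  | ite e p q ihp ihq =>
    intro s Q Q' h hq
    exact ⟨h.1, fun he => ihp (h.2.1 he) fun s' t => hq _ _,
      fun he => ihq (h.2.2 he) fun s' t => hq _ _⟩
  | rep e p ih =>
    intro s Q Q' h hq
    exact ⟨h.1, iterWp_mono (f := fun s Q => p.wp E s Q) (fun s Q Q' hq hw => ih hw hq) _ _ _ _
      (fun s' t => hq s' (e.cost + t)) h.2⟩

/-- The registers that a program writes. -/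
def Cmd.wr : Cmd → List Reg
  | skip => []
  | set x _ => [x]
  | put _ _ _ => []
  | seq p q => p.wr ++ q.wr
  | ite _ p q => p.wr ++ q.wr
  | rep _ p => p.wr

/-- The arrays that a program writes. -/
def Cmd.wa : Cmd → List Arr
  | skip => []
  | set _ _ => []
  | put A _ _ => [A]
  | seq p q => p.wa ++ q.wa
  | ite _ p q => p.wa ++ q.wa
  | rep _ p => p.wa

/-- The states `s` and `s'` agree outside the registers and arrays that `p` writes. -/
structure Frame (p : Cmd) (s s' : St) : Prop where
  r : ∀ x, x ∉ p.wr → s'.r x = s.r x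
  a : ∀ A, A ∉ p.wa → s'.a A = s.a A

/-- With the frame attached to every postcondition, a specification has to mention only what a
program changes; that some register or array is untouched is then decided on the syntactic lists
`Cmd.wr` and `Cmd.wa`. -/
theorem Cmd.wp_frame {E : Env} {p : Cmd} : ∀ {s : St} {Q : St → ℕ → Prop}, p.wp E s Q →
    p.wp E s fun s' t => Q s' t ∧ Frame p s s' := by
  induction p with
  | skip => intro s Q h; exact ⟨h, fun _ _ => rfl, fun _ _ => rfl⟩
  | set x e =>
    intro s Q h
    refine ⟨h.1, h.2, fun y hy => ?_, fun _ _ => rfl⟩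
    simp only [Cmd.wr, List.mem_singleton] at hy
    exact St.set_r_ne _ _ hy
  | put A e f =>
    intro s Q h
    refine ⟨h.1, h.2.1, h.2.2.1, h.2.2.2, fun _ _ => rfl, fun B hB => ?_⟩
    simp only [Cmd.wa, List.mem_singleton] at hB
    exact St.put_a_ne _ _ _ hB
  | seq p q ihp ihq =>
    intro s Q h
    refine Cmd.wp_mono (p := p) (ihp h) fun s₁ t₁ h₁ =>
      Cmd.wp_mono (p := q) (ihq h₁.1) fun s₂ t₂ h₂ => ⟨h₂.1, ?_, ?_⟩
    · intro x hx
      simp only [Cmd.wr, List.mem_append, not_or] at hx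
      rw [h₂.2.r x hx.2, h₁.2.r x hx.1]
    · intro x hx
      simp only [Cmd.wa, List.mem_append, not_or] at hx
      rw [h₂.2.a x hx.2, h₁.2.a x hx.1]
  | ite e p q ihp ihq =>
    intro s Q h
    refine ⟨h.1, fun he => Cmd.wp_mono (ihp (h.2.1 he)) fun s' t h' => ⟨h'.1, ?_, ?_⟩,
      fun he => Cmd.wp_mono (ihq (h.2.2 he)) fun s' t h' => ⟨h'.1, ?_, ?_⟩⟩ <;>
    · intro x hx
      simp only [Cmd.wa, Cmd.wr, List.mem_append, not_or] at hx
      first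
        | exact h'.2.r x hx.1
        | exact h'.2.a x hx.1
        | exact h'.2.r x hx.2
        | exact h'.2.a x hx.2
  | rep e p ih =>
    intro s Q h
    refine ⟨h.1, ?_⟩
    have key : ∀ (n : ℕ) (s : St) (Q : St → ℕ → Prop), iterWp (fun s Q => p.wp E s Q) n s Q →
        iterWp (fun s Q => p.wp E s Q) n s fun s' t => Q s' t ∧ Frame (.rep e p) s s' := by
      intro n
      induction n with
      | zero => intro s Q h; exact ⟨h, fun _ _ => rfl, fun _ _ => rfl⟩
      | succ n ihn =>
        intro s Q h
        refine Cmd.wp_mono (ih h) fun s₁ t₁ h₁ => ?_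
        refine iterWp_mono (f := fun s Q => p.wp E s Q) (fun s Q Q' hq hw => Cmd.wp_mono hw hq)
          _ _ _ _ ?_ (ihn _ _ h₁.1)
        intro s₂ t₂ h₂
        refine ⟨h₂.1, fun x hx => ?_, fun x hx => ?_⟩
        · rw [h₂.2.r x hx, h₁.2.r x hx]
        · rw [h₂.2.a x hx, h₁.2.a x hx]
    exact key _ _ _ h.2

/-- The loop rule: an invariant, and a bound for the time of each iteration. -/
theorem wp_rep {E : Env} {e : Ex} {p : Cmd} {s : St} {Q : St → ℕ → Prop} (I : ℕ → St → Prop)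
    (T : ℕ) (hok : e.ok E s) (h0 : I 0 s)
    (hstep : ∀ i s', i < e.ev E s → Frame p s s' → I i s' →
      p.wp E s' fun s'' t => I (i + 1) s'' ∧ t ≤ T)
    (hend : ∀ s' t, Frame p s s' → I (e.ev E s) s' → t ≤ e.cost + 1 + e.ev E s * (T + 3) → Q s' t) :
    (Cmd.rep e p).wp E s Q := by
  refine ⟨hok, ?_⟩
  -- `k` counts the iterations still to come and `i` those already done. The summand `3` in `T + 3`
  -- pays for the two instructions that decrement the counter and for the test.
  have key : ∀ (k i : ℕ) (s' : St) (Q' : St → ℕ → Prop), i + k = e.ev E s → Frame p s s' → I i s' →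
      (∀ s'' t, Frame p s s'' → I (i + k) s'' → t ≤ 1 + k * (T + 3) → Q' s'' t) →
      iterWp (fun s Q => p.wp E s Q) k s' Q' := by
    intro k
    induction k with
    | zero => intro i s' Q' _ hfr hI hq; exact hq _ _ hfr hI (by omega)
    | succ k ih =>
      intro i s' Q' hik hfr hI hq
      refine Cmd.wp_mono (Cmd.wp_frame (hstep i s' (by omega) hfr hI)) fun s₁ t₁ h₁ => ?_
      have hfr' : Frame p s s₁ :=
        ⟨fun x hx => by rw [h₁.2.r x hx, hfr.r x hx], fun x hx => by rw [h₁.2.a x hx, hfr.a x hx]⟩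
      refine ih (i + 1) s₁ _ (by omega) hfr' h₁.1.1 fun s₂ t₂ hfr₂ hI₂ ht₂ => ?_
      refine hq _ _ hfr₂ (by rwa [Nat.add_right_comm] at hI₂) ?_
      have := h₁.1.2
      rw [Nat.succ_mul]
      omega
  refine key (e.ev E s) 0 s _ (by omega) ⟨fun _ _ => rfl, fun _ _ => rfl⟩ h0 fun s'' t hfr hI ht => ?_
  refine hend _ _ hfr (by rwa [Nat.zero_add] at hI) (by omega)

/-! ### Compilation -/

/-- Code that leaves the value of an expression in the scratch register `2 * d + 3`. -/
def Ex.comp : Ex → ℕ → RAM.Program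
  | lit c, d => .const (2 * d + 3) c
  | reg x, d => .copy (2 * d + 3) (2 * x.ctorIdx)
  | add e f, d => .seq (.seq (e.comp d) (f.comp (d + 1)))
      (.add (2 * d + 3) (2 * d + 3) (2 * (d + 1) + 3))
  | sub e f, d => .seq (.seq (e.comp d) (f.comp (d + 1)))
      (.sub (2 * d + 3) (2 * d + 3) (2 * (d + 1) + 3))
  | arr A e, d => .seq (e.comp d) (.seq (addr A d) (.load (2 * d + 3) (2 * d + 3)))
  | inp e, d => .seq (e.comp d) (.load (2 * d + 3) (2 * d + 3))
where
  /-- Replace an array index by the address of the cell. -/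
  addr (A : Arr) (d : ℕ) : RAM.Program :=
    let x := 2 * d + 3
    .seq (.seq (.seq (.seq (.add x x x) (.add x x x)) (.seq (.add x x x) (.add x x x)))
      (.seq (.add x x x) (.add x x 1))) (.seq (.const (2 * (d + 1) + 3) A.ctorIdx)
        (.add x x (2 * (d + 1) + 3)))

/-- Code for a program; the scratch registers below `2 * d + 3` are left alone. -/
def Cmd.comp : Cmd → ℕ → RAM.Program
  | skip, d => .const (2 * d + 3) 0
  | set x e, d => .seq (e.comp d) (.copy (2 * x.ctorIdx) (2 * d + 3))
  | put A e f, d => .seq (.seq (e.comp d) (Ex.comp.addr A d))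
      (.seq (f.comp (d + 1)) (.store (2 * d + 3) (2 * (d + 1) + 3)))
  | seq p q, d => .seq (p.comp d) (q.comp d)
  | ite e p q, d => .seq (e.comp d) (.ifPos (2 * d + 3) (p.comp d) (q.comp d))
  | rep e p, d => .seq (e.comp d) (.whilePos (2 * d + 3)
      (.seq (p.comp (d + 1)) (.seq (.const (2 * (d + 1) + 3) 1)
        (.sub (2 * d + 3) (2 * d + 3) (2 * (d + 1) + 3)))))

/-- The state `σ` of the random access machine represents the state `s`. -/
structure Rel (E : Env) (s : St) (σ : RAM.State) : Prop where
  reg : ∀ x : Reg, σ.reg (2 * x.ctorIdx) = s.r x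
  base : σ.reg 1 = E.β
  inp : ∀ i < E.β, σ.mem i = E.I i
  arr : ∀ (A : Arr) (i : ℕ), σ.mem (E.β + 32 * i + A.ctorIdx) = s.a A i

/-- The scratch registers from `2 * d + 3` on. -/
def Scratch (d y : ℕ) : Prop := ∃ e, d ≤ e ∧ y = 2 * e + 3

/-- Named registers are even, the base of the arrays is register 1, and scratch registers are odd
from 3 on, so scratch work cannot disturb the representation. -/
theorem Rel.congr {E : Env} {s : St} {σ σ' : RAM.State} {d : ℕ} (h : Rel E s σ)
    (hm : σ'.mem = σ.mem) (hr : ∀ y, ¬ Scratch d y → σ'.reg y = σ.reg y) : Rel E s σ' where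
  reg x := by
    rw [hr _ (by rintro ⟨e, _, he⟩; omega), h.reg]
  base := by rw [hr _ (by rintro ⟨e, _, he⟩; omega), h.base]
  inp := by rw [hm]; exact h.inp
  arr := by rw [hm]; exact h.arr

/-- Five doublings multiply the index by 32; three more units add the base and the number of the
array. The base `E.β` places all arrays behind the input. -/
theorem comp_addr_exec {E : Env} {b : ℕ} {s : St} {σ : RAM.State}
    (hb : E.β + 32 * E.H + 32 ≤ 2 ^ b) (A : Arr) (d : ℕ) (hσ : Rel E s σ)
    (hi : σ.reg (2 * d + 3) < E.H) :
    ∃ σ', RAM.Exec b (Ex.comp.addr A d) σ σ' 8 ∧ σ'.mem = σ.mem ∧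
      σ'.reg (2 * d + 3) = E.β + 32 * σ.reg (2 * d + 3) + A.ctorIdx ∧
      (∀ y, ¬ Scratch d y → σ'.reg y = σ.reg y) := by
  have hA := A.ctorIdx_lt
  have hβ := hσ.base
  have add : ∀ (σ₀ : RAM.State) (v : ℕ), σ₀.reg (2 * d + 3) = v → v < 32 * E.H → σ₀.mem = σ.mem →
      (∀ y, ¬ Scratch d y → σ₀.reg y = σ.reg y) → 2 * v < 32 * E.H →
      ∃ σ₁, RAM.Exec b (.add (2 * d + 3) (2 * d + 3) (2 * d + 3)) σ₀ σ₁ 1 ∧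
        σ₁.reg (2 * d + 3) = 2 * v ∧ σ₁.mem = σ.mem ∧
        (∀ y, ¬ Scratch d y → σ₁.reg y = σ.reg y) := by
    intro σ₀ v h1 h2 h3 h4 h5
    refine ⟨_, .add _ _ _ _ (by omega), ?_, h3, ?_⟩
    · simp [RAM.State.setReg, h1]; omega
    · intro y hy
      have : y ≠ 2 * d + 3 := fun h => hy ⟨d, le_rfl, h⟩
      simp [RAM.State.setReg, this, h4 y hy]
  obtain ⟨σ₁, e₁, v₁, m₁, r₁⟩ := add σ _ rfl (by omega) rfl (fun _ _ => rfl) (by omega)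
  obtain ⟨σ₂, e₂, v₂, m₂, r₂⟩ := add σ₁ _ v₁ (by omega) m₁ r₁ (by omega)
  obtain ⟨σ₃, e₃, v₃, m₃, r₃⟩ := add σ₂ _ v₂ (by omega) m₂ r₂ (by omega)
  obtain ⟨σ₄, e₄, v₄, m₄, r₄⟩ := add σ₃ _ v₃ (by omega) m₃ r₃ (by omega)
  obtain ⟨σ₅, e₅, v₅, m₅, r₅⟩ := add σ₄ _ v₄ (by omega) m₄ r₄ (by omega)
  have hb₅ : σ₅.reg 1 = E.β := by rw [r₅ 1 (by rintro ⟨e, _, he⟩; omega), hβ]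
  refine ⟨_, .seq (.seq (.seq (.seq e₁ e₂) (.seq e₃ e₄)) (.seq e₅ (.add _ _ _ _ ?_)))
    (.seq (.const _ _ _ ?_) (.add _ _ _ _ ?_)), ?_, ?_, ?_⟩
  · rw [v₅, hb₅]; omega
  · omega
  · simp [RAM.State.setReg, v₅, hb₅]; omega
  · exact m₅
  · simp [RAM.State.setReg, v₅, hb₅]; ring
  · intro y hy
    have h1 : y ≠ 2 * d + 3 := fun h => hy ⟨d, le_rfl, h⟩
    have h2 : y ≠ 2 * (d + 1) + 3 := fun h => hy ⟨d + 1, by omega, h⟩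
    simp [RAM.State.setReg, h1, h2, r₅ y hy]

theorem Scratch.mono {d d' y : ℕ} (h : d ≤ d') (hy : Scratch d' y) : Scratch d y :=
  let ⟨e, he, h'⟩ := hy; ⟨e, h.trans he, h'⟩

/-- The scratch registers act as a stack: the second operand is evaluated one level higher and thus
leaves the value of the first one alone. -/
theorem Ex.comp_exec {E : Env} {b : ℕ} (hb : E.β + 32 * E.H + 32 ≤ 2 ^ b) {s : St} (e : Ex) :
    ∀ {σ : RAM.State} (d : ℕ), Rel E s σ → e.ok E s →
      ∃ σ', RAM.Exec b (e.comp d) σ σ' e.cost ∧ σ'.mem = σ.mem ∧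
        σ'.reg (2 * d + 3) = e.ev E s ∧ (∀ y, ¬ Scratch d y → σ'.reg y = σ.reg y) := by
  have hself : ∀ (σ : RAM.State) (d v : ℕ), (∀ y, ¬ Scratch d y →
      (σ.setReg (2 * d + 3) v).reg y = σ.reg y) := by
    intro σ d v y hy
    have : y ≠ 2 * d + 3 := fun h => hy ⟨d, le_rfl, h⟩
    simp [RAM.State.setReg, this]
  have hbin : ∀ (e f : Ex), (∀ {σ : RAM.State} (d : ℕ), Rel E s σ → e.ok E s →
      ∃ σ', RAM.Exec b (e.comp d) σ σ' e.cost ∧ σ'.mem = σ.mem ∧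
        σ'.reg (2 * d + 3) = e.ev E s ∧ (∀ y, ¬ Scratch d y → σ'.reg y = σ.reg y)) →
      (∀ {σ : RAM.State} (d : ℕ), Rel E s σ → f.ok E s →
      ∃ σ', RAM.Exec b (f.comp d) σ σ' f.cost ∧ σ'.mem = σ.mem ∧
        σ'.reg (2 * d + 3) = f.ev E s ∧ (∀ y, ¬ Scratch d y → σ'.reg y = σ.reg y)) →
      ∀ {σ : RAM.State} (d : ℕ), Rel E s σ → e.ok E s → f.ok E s →
      ∃ σ', RAM.Exec b (.seq (e.comp d) (f.comp (d + 1))) σ σ' (e.cost + f.cost) ∧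
        σ'.mem = σ.mem ∧ σ'.reg (2 * d + 3) = e.ev E s ∧ σ'.reg (2 * (d + 1) + 3) = f.ev E s ∧
        (∀ y, ¬ Scratch d y → σ'.reg y = σ.reg y) := by
    intro e f ihe ihf σ d hσ h1 h2
    obtain ⟨σ₁, e₁, m₁, v₁, r₁⟩ := ihe d hσ h1
    obtain ⟨σ₂, e₂, m₂, v₂, r₂⟩ := ihf (d + 1) (hσ.congr m₁ r₁) h2
    refine ⟨σ₂, .seq e₁ e₂, m₂.trans m₁, ?_, v₂, fun y hy => ?_⟩
    · rw [r₂ _ (by rintro ⟨e, _, he⟩; omega), v₁]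
    · rw [r₂ _ (fun h => hy (h.mono (by omega))), r₁ _ hy]
  induction e with
  | lit c =>
    intro σ d hσ hok
    have : c < E.H := hok
    exact ⟨_, .const _ _ _ (by omega), rfl, by simp [RAM.State.setReg, Ex.ev], hself _ _ _⟩
  | reg x =>
    intro σ d hσ hok
    exact ⟨_, .copy _ _ _, rfl, by simp [RAM.State.setReg, Ex.ev, hσ.reg], hself _ _ _⟩
  | add e f ihe ihf =>
    intro σ d hσ hok
    obtain ⟨σ', e', m', v', w', r'⟩ := hbin e f ihe ihf d hσ hok.1 hok.2.1
    have := hok.2.2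
    refine ⟨_, .seq e' (.add _ _ _ _ (by omega)), m', ?_, fun y hy => ?_⟩
    · simp [RAM.State.setReg, Ex.ev, v', w']
    · rw [hself _ _ _ _ hy, r' y hy]
  | sub e f ihe ihf =>
    intro σ d hσ hok
    obtain ⟨σ', e', m', v', w', r'⟩ := hbin e f ihe ihf d hσ hok.1 hok.2
    refine ⟨_, .seq e' (.sub _ _ _ _), m', ?_, fun y hy => ?_⟩
    · simp [RAM.State.setReg, Ex.ev, v', w']
    · rw [hself _ _ _ _ hy, r' y hy]
  | arr A e ih =>
    intro σ d hσ hok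
    obtain ⟨σ', e', m', v', r'⟩ := ih d hσ hok.1
    obtain ⟨σ₂, e₂, m₂, v₂, r₂⟩ := comp_addr_exec hb A d (hσ.congr m' r') (by rw [v']; exact hok.2)
    refine ⟨_, .seq e' (.seq e₂ (.load _ _ _)), by rw [← m', ← m₂]; rfl, ?_, fun y hy => ?_⟩
    · simp [RAM.State.setReg, Ex.ev, v₂, m₂, m', v', hσ.arr]
    · rw [hself _ _ _ _ hy, r₂ y hy, r' y hy]
  | inp e ih =>
    intro σ d hσ hok
    obtain ⟨σ', e', m', v', r'⟩ := ih d hσ hok.1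
    refine ⟨_, .seq e' (.load _ _ _), m', ?_, fun y hy => ?_⟩
    · simp [RAM.State.setReg, Ex.ev, m', v', hσ.inp _ hok.2]
    · rw [hself _ _ _ _ hy, r' y hy]

/-- The time is transferred exactly, so bounds proved for `Cmd.wp` hold on the random access
machine. The last clause protects the counters of enclosing loops, which are kept in the scratch
registers of lower levels. -/
theorem Cmd.comp_exec {E : Env} {b : ℕ} (hb : E.β + 32 * E.H + 32 ≤ 2 ^ b) (p : Cmd) :
    ∀ {s : St} {σ : RAM.State} {Q : St → ℕ → Prop} (d : ℕ), Rel E s σ → p.wp E s Q →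
      ∃ s' σ' t, RAM.Exec b (p.comp d) σ σ' t ∧ Rel E s' σ' ∧ Q s' t ∧
        ∀ e < d, σ'.reg (2 * e + 3) = σ.reg (2 * e + 3) := by
  have hns : ∀ {d e : ℕ}, e < d → ¬ Scratch d (2 * e + 3) := by
    rintro d e h ⟨e', _, h'⟩; omega
  induction p with
  | skip =>
    intro s σ Q d hσ hw
    refine ⟨s, _, 1, .const _ _ _ (by omega), hσ.congr (d := d) rfl ?_, hw, fun e he => ?_⟩
    · intro y hy
      have : y ≠ 2 * d + 3 := fun h => hy ⟨d, le_rfl, h⟩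
      simp [RAM.State.setReg, this]
    · have : e ≠ d := by omega
      simp [RAM.State.setReg, this]
  | set x e =>
    intro s σ Q d hσ hw
    obtain ⟨σ', e', m', v', r'⟩ := e.comp_exec hb d hσ hw.1
    have hσ' := hσ.congr m' r'
    refine ⟨s.set x (e.ev E s), _, _, .seq e' (.copy _ _ _), ⟨fun y => ?_, ?_, hσ'.inp, hσ'.arr⟩, hw.2,
      fun e he => ?_⟩
    · by_cases h : y = x
      · subst h; simp [RAM.State.setReg, v']
      · have : y.ctorIdx ≠ x.ctorIdx := fun h' => h (Reg.ctorIdx_injective h')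
        simp [RAM.State.setReg, this, St.set_r_ne _ _ h, hσ'.reg]
    · have : 1 ≠ 2 * x.ctorIdx := by omega
      simp [RAM.State.setReg, this, hσ'.base]
    · have : 2 * e + 3 ≠ 2 * x.ctorIdx := by omega
      simp [RAM.State.setReg, this, r' _ (hns he)]
  | put A e f =>
    intro s σ Q d hσ hw
    obtain ⟨σ₁, e₁, m₁, v₁, r₁⟩ := e.comp_exec hb d hσ hw.1
    obtain ⟨σ₂, e₂, m₂, v₂, r₂⟩ := comp_addr_exec hb A d (hσ.congr m₁ r₁)
      (by rw [v₁]; exact hw.2.2.1)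
    have hσ₂ := (hσ.congr m₁ r₁).congr m₂ r₂
    obtain ⟨σ₃, e₃, m₃, v₃, r₃⟩ := f.comp_exec hb (d + 1) hσ₂ hw.2.1
    have hσ₃ := hσ₂.congr m₃ r₃
    have hx : σ₃.reg (2 * d + 3) = E.β + 32 * e.ev E s + A.ctorIdx := by
      rw [r₃ _ (hns (by omega)), v₂, v₁]
    have ht : e.cost + 8 + (f.cost + 1) = e.cost + f.cost + 9 := by ring
    refine ⟨s.put A (e.ev E s) (f.ev E s), _, _, .seq (.seq e₁ e₂) (.seq e₃ (.store _ _ _)),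
      ⟨hσ₃.reg, hσ₃.base, fun i hi => ?_, fun B i => ?_⟩, ht ▸ hw.2.2.2, fun e he => ?_⟩
    · have : i ≠ E.β + 32 * e.ev E s + A.ctorIdx := by omega
      simp [RAM.State.setMem, hx, this, hσ₃.inp i hi]
    · have hA := A.ctorIdx_lt
      have hB := B.ctorIdx_lt
      simp only [RAM.State.setMem, hx, v₃, Function.update_apply]
      by_cases h : B = A
      · subst h
        simp only [St.put_a_self, Function.update_apply, ← hσ₃.arr]
        by_cases hi : i = e.ev E s
        · simp [hi]
        · rw [if_neg (by omega), if_neg hi]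
      -- Cells of different arrays have addresses that differ modulo the stride.
      · have : B.ctorIdx ≠ A.ctorIdx := fun h' => h (Arr.ctorIdx_injective h')
        rw [if_neg (by omega), St.put_a_ne _ _ _ h, hσ₃.arr]
    · simp [RAM.State.setMem, r₃ _ (hns (show e < d + 1 by omega)), r₂ _ (hns he), r₁ _ (hns he)]
  | seq p q ihp ihq =>
    intro s σ Q d hσ hw
    obtain ⟨s₁, σ₁, t₁, e₁, h₁, hq₁, r₁⟩ := ihp d hσ hw
    obtain ⟨s₂, σ₂, t₂, e₂, h₂, hq₂, r₂⟩ := ihq d h₁ hq₁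
    exact ⟨s₂, σ₂, _, .seq e₁ e₂, h₂, hq₂, fun e he => by rw [r₂ e he, r₁ e he]⟩
  | ite e p q ihp ihq =>
    intro s σ Q d hσ hw
    obtain ⟨σ', e', m', v', r'⟩ := e.comp_exec hb d hσ hw.1
    rcases Nat.eq_zero_or_pos (e.ev E s) with h0 | h0
    · obtain ⟨s₁, σ₁, t₁, e₁, h₁, hq₁, r₁⟩ := ihq d (hσ.congr m' r') (hw.2.2 h0)
      exact ⟨s₁, σ₁, _, .seq e' (.ifPos_zero (by omega) e₁), h₁, hq₁,
        fun e he => by rw [r₁ e he, r' _ (hns he)]⟩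
    · obtain ⟨s₁, σ₁, t₁, e₁, h₁, hq₁, r₁⟩ := ihp d (hσ.congr m' r') (hw.2.1 h0)
      exact ⟨s₁, σ₁, _, .seq e' (.ifPos_pos (by omega) e₁), h₁, hq₁,
        fun e he => by rw [r₁ e he, r' _ (hns he)]⟩
  | rep e p ih =>
    intro s σ Q d hσ hw
    -- The scratch register of level `d` holds the number of iterations still to run; the body is
    -- compiled one level higher and preserves it.
    have key : ∀ (n : ℕ) (s : St) (σ : RAM.State) (Q : St → ℕ → Prop), Rel E s σ →
        σ.reg (2 * d + 3) = n → iterWp (fun s Q => p.wp E s Q) n s Q →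
        ∃ s' σ' t, RAM.Exec b (.whilePos (2 * d + 3)
          (.seq (p.comp (d + 1)) (.seq (.const (2 * (d + 1) + 3) 1)
            (.sub (2 * d + 3) (2 * d + 3) (2 * (d + 1) + 3))))) σ σ' t ∧ Rel E s' σ' ∧ Q s' t ∧
          ∀ e < d, σ'.reg (2 * e + 3) = σ.reg (2 * e + 3) := by
      intro n
      induction n with
      | zero => intro s σ Q hσ hn hw; exact ⟨s, σ, 1, .whilePos_zero hn, hσ, hw, fun _ _ => rfl⟩
      | succ n ihn =>
        intro s σ Q hσ hn hw
        obtain ⟨s₁, σ₁, t₁, e₁, h₁, hq₁, r₁⟩ := ih (d + 1) hσ hw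
        have hd : σ₁.reg (2 * d + 3) = n + 1 := by rw [r₁ d (by omega), hn]
        obtain ⟨s₂, σ₂, t₂, e₂, h₂, hq₂, r₂⟩ := ihn s₁
          ((σ₁.setReg (2 * (d + 1) + 3) 1).setReg (2 * d + 3) n) _ (h₁.congr (d := d) rfl fun y hy => by
            have h1 : y ≠ 2 * d + 3 := fun h => hy ⟨d, le_rfl, h⟩
            have h2 : y ≠ 2 * (d + 1) + 3 := fun h => hy ⟨d + 1, by omega, h⟩
            simp [RAM.State.setReg, h1, h2]) (by simp [RAM.State.setReg]) hq₁
        have e₃ : RAM.Exec b (.sub (2 * d + 3) (2 * d + 3) (2 * (d + 1) + 3))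
            (σ₁.setReg (2 * (d + 1) + 3) 1)
            ((σ₁.setReg (2 * (d + 1) + 3) 1).setReg (2 * d + 3) n) 1 := by
          have := RAM.Exec.sub (b := b) (σ₁.setReg (2 * (d + 1) + 3) 1) (2 * d + 3) (2 * d + 3)
            (2 * (d + 1) + 3)
          simpa [RAM.State.setReg, hd] using this
        refine ⟨s₂, σ₂, _, .whilePos_pos (by omega) (.seq e₁ (.seq (.const _ _ _ (by omega)) e₃)) e₂,
          h₂, hq₂, fun e he => ?_⟩
        · rw [r₂ e he, ← r₁ e (by omega)]
          have h1 : e ≠ d := by omega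
          have h2 : e ≠ d + 1 := by omega
          simp [RAM.State.setReg, h1, h2]
    obtain ⟨σ', e', m', v', r'⟩ := e.comp_exec hb d hσ hw.1
    obtain ⟨s₁, σ₁, t₁, e₁, h₁, hq₁, r₁⟩ := key _ s σ' _ (hσ.congr m' r') v' hw.2
    exact ⟨s₁, σ₁, _, .seq e' e₁, h₁, hq₁, fun e he => by rw [r₁ e he, r' _ (hns he)]⟩

end VM

/-! ### Paths on four vertices as minors -/

/-- `G` has a path on four vertices as a subgraph. -/
def HasPath4 {V : Type*} (G : SimpleGraph V) : Prop :=
  ∃ a b c d : V, a ≠ c ∧ a ≠ d ∧ b ≠ d ∧ G.Adj a b ∧ G.Adj b c ∧ G.Adj c d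

theorem HasPath4.isMinor {V : Type*} {G : SimpleGraph V} (h : HasPath4 G) :
    IsMinor (SimpleGraph.pathGraph 4) G := by
  obtain ⟨a, b, c, d, hac, had, hbd, hab, hbc, hcd⟩ := h
  refine ⟨fun x => {(![a, b, c, d] : Fin 4 → V) x}, fun x => ?_, ?_, ?_⟩
  · haveI : Nonempty ({(![a, b, c, d] : Fin 4 → V) x} : Set V) := ⟨⟨_, rfl⟩⟩
    exact ⟨fun u v => by
      obtain ⟨u, rfl⟩ := u
      obtain ⟨v, rfl⟩ := v
      exact SimpleGraph.Reachable.refl _⟩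
  · intro x y hxy
    rw [Set.disjoint_singleton]
    have := hab.ne
    have := hbc.ne
    have := hcd.ne
    fin_cases x <;> fin_cases y <;> simp_all [eq_comm]
  · intro x y hxy
    refine ⟨_, rfl, _, rfl, ?_⟩
    rw [SimpleGraph.pathGraph_adj] at hxy
    have := hab.symm
    have := hbc.symm
    have := hcd.symm
    fin_cases x <;> fin_cases y <;> simp_all

theorem HasPath4.isTopologicalMinor {V : Type*} {G : SimpleGraph V} (h : HasPath4 G) :
    IsTopologicalMinor (SimpleGraph.pathGraph 4) G := by
  obtain ⟨a, b, c, d, hac, had, hbd, hab, hbc, hcd⟩ := h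
  have hadj : ∀ x y, (SimpleGraph.pathGraph 4).Adj x y →
      G.Adj ((![a, b, c, d] : Fin 4 → V) x) ((![a, b, c, d] : Fin 4 → V) y) := by
    intro x y hxy
    rw [SimpleGraph.pathGraph_adj] at hxy
    have := hab.symm
    have := hbc.symm
    have := hcd.symm
    fin_cases x <;> fin_cases y <;> simp_all
  have hinj : Function.Injective (![a, b, c, d] : Fin 4 → V) := by
    intro x y hxy
    have := hab.ne
    have := hbc.ne
    have := hcd.ne
    fin_cases x <;> fin_cases y <;> simp_all [eq_comm]
  have hsupp : ∀ x y (h : (SimpleGraph.pathGraph 4).Adj x y) v,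
      v ∈ (SimpleGraph.Walk.cons (hadj x y h) .nil).support →
      v ≠ (![a, b, c, d] : Fin 4 → V) x → v ≠ (![a, b, c, d] : Fin 4 → V) y → False := by
    intro x y h v hv h1 h2
    simp only [SimpleGraph.Walk.support_cons, SimpleGraph.Walk.support_nil, List.mem_cons,
      List.not_mem_nil, or_false] at hv
    tauto
  exact ⟨{
    branch := ⟨_, hinj⟩
    path := fun x y h => .cons (hadj x y h) .nil
    isPath := fun x y h => by
      simp only [SimpleGraph.Walk.cons_isPath_iff, SimpleGraph.Walk.support_nil,
        List.mem_singleton]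
      exact ⟨.nil, (hadj x y h).ne⟩
    path_symm := fun x y h => by simp
    internal_ne_branch := fun x y h v hv h1 h2 => (hsupp x y h v hv h1 h2).elim
    internal_notMem := fun x y h _ _ _ _ v hv h1 h2 => (hsupp x y h v hv h1 h2).elim }⟩

/-- Serves to prolong an edge inside a branch set. -/
theorem exists_adj_of_connected_induce {V : Type*} {G : SimpleGraph V} {s : Set V}
    (h : (G.induce s).Connected) {x y : V} (hx : x ∈ s) (hy : y ∈ s) (hxy : x ≠ y) :
    ∃ z ∈ s, G.Adj x z := by
  obtain ⟨p⟩ := h.preconnected ⟨x, hx⟩ ⟨y, hy⟩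
  cases p with
  | nil => exact absurd rfl hxy
  | cons hadj p => exact ⟨_, Subtype.coe_prop _, hadj⟩

/-- An edge between the two middle branch sets becomes the middle edge of the path. It is prolonged
at its end in branch set 1 by the edge towards branch set 0, if that edge starts at the same vertex,
and otherwise by a neighbour inside branch set 1; the other end is symmetric. Disjointness of the
branch sets keeps the four vertices apart. -/
theorem IsMinor.hasPath4 {V : Type*} {G : SimpleGraph V}
    (h : IsMinor (SimpleGraph.pathGraph 4) G) : HasPath4 G := by
  obtain ⟨φ, hc, hd, ha⟩ := h
  obtain ⟨x0, hx0, y1, hy1, h01⟩ := ha 0 1 (by simp [SimpleGraph.pathGraph_adj])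
  obtain ⟨x1, hx1, y2, hy2, h12⟩ := ha 1 2 (by simp [SimpleGraph.pathGraph_adj])
  obtain ⟨x2, hx2, y3, hy3, h23⟩ := ha 2 3 (by simp [SimpleGraph.pathGraph_adj])
  have hne : ∀ {i j : Fin 4} {u v : V}, i ≠ j → u ∈ φ i → v ∈ φ j → u ≠ v :=
    fun hij hu hv => Set.disjoint_iff_forall_ne.mp (hd _ _ hij) hu hv
  obtain ⟨a, ha, hax⟩ : ∃ a, (a ∈ φ 0 ∨ a ∈ φ 1) ∧ G.Adj x1 a := by
    by_cases h : x1 = y1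
    · exact ⟨x0, .inl hx0, by rw [h]; exact h01.symm⟩
    · obtain ⟨z, hz, hz'⟩ := exists_adj_of_connected_induce (hc 1) hx1 hy1 h
      exact ⟨z, .inr hz, hz'⟩
  obtain ⟨d, hd', hdx⟩ : ∃ d, (d ∈ φ 2 ∨ d ∈ φ 3) ∧ G.Adj y2 d := by
    by_cases h : y2 = x2
    · exact ⟨y3, .inr hy3, by rw [h]; exact h23⟩
    · obtain ⟨z, hz, hz'⟩ := exists_adj_of_connected_induce (hc 2) hy2 hx2 h
      exact ⟨z, .inl hz, hz'⟩
  refine ⟨a, x1, y2, d, ?_, ?_, ?_, hax.symm, h12, hdx⟩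
  · rcases ha with ha | ha <;> exact hne (by decide) ha hy2
  · rcases ha with ha | ha <;> rcases hd' with hd' | hd' <;> exact hne (by decide) ha hd'
  · rcases hd' with hd' | hd' <;> exact hne (by decide) hx1 hd'

/-- The first steps of the paths of the model suffice. From branch vertex 1, take one step towards 0
and one towards 2. If the latter arrives at branch vertex 2, a step towards 3 completes the path;
otherwise the path from 1 to 2 has length at least two and its next vertex does so. -/
theorem IsTopologicalMinor.hasPath4 {V : Type*} {G : SimpleGraph V}
    (h : IsTopologicalMinor (SimpleGraph.pathGraph 4) G) : HasPath4 G := by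
  obtain ⟨m⟩ := h
  have h10 : (SimpleGraph.pathGraph 4).Adj 1 0 := by simp [SimpleGraph.pathGraph_adj]
  have h12 : (SimpleGraph.pathGraph 4).Adj 1 2 := by simp [SimpleGraph.pathGraph_adj]
  have h23 : (SimpleGraph.pathGraph 4).Adj 2 3 := by simp [SimpleGraph.pathGraph_adj]
  have hbr : ∀ {i j : Fin 4}, i ≠ j → m.branch i ≠ m.branch j := fun h => m.branch.injective.ne h
  have hnil : ∀ {i j : Fin 4} (h : (SimpleGraph.pathGraph 4).Adj i j), ¬ (m.path i j h).Nil :=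
    fun h hn => hbr h.ne hn.eq
  have hsnd : ∀ {i j : Fin 4} (h : (SimpleGraph.pathGraph 4).Adj i j),
      (m.path i j h).snd ∈ (m.path i j h).support := fun h => (m.path _ _ h).getVert_mem_support 1
  have hadj := fun {i j : Fin 4} (h : (SimpleGraph.pathGraph 4).Adj i j) =>
    SimpleGraph.Walk.adj_snd (hnil h)
  -- The second vertex of a path is either its end, a branch vertex foreign to the other path, or an
  -- internal vertex, which no other path contains.
  have sep : ∀ {i j i' j' : Fin 4} (h : (SimpleGraph.pathGraph 4).Adj i j)
      (h' : (SimpleGraph.pathGraph 4).Adj i' j'), s(i, j) ≠ s(i', j') → j ≠ j' → j ≠ i' →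
      (m.path i j h).snd ∉ (m.path i' j' h').support := by
    intro i j i' j' h h' hs h2 h3 hv
    by_cases hb : (m.path i j h).snd = m.branch j
    · rw [hb] at hv
      exact m.internal_ne_branch _ _ h' _ hv (hbr h3) (hbr h2) j rfl
    · exact m.internal_notMem _ _ h _ _ h' hs _ (hsnd h) (hadj h).ne' hb hv
  have ha := sep h10 h12 (by decide) (by decide) (by decide)
  by_cases hc : (m.path 1 2 h12).snd = m.branch 2
  · have h12' := hadj h12
    rw [hc] at h12'
    refine ⟨_, _, _, _, ?_, ?_, ?_, (hadj h10).symm, h12', hadj h23⟩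
    · intro h; apply ha; rw [h]; exact SimpleGraph.Walk.end_mem_support _
    · intro h
      have := sep h10 h23 (by decide) (by decide) (by decide)
      rw [h] at this
      exact this (hsnd h23)
    · intro h
      have := sep h23 h12 (by decide) (by decide) (by decide)
      rw [← h] at this
      exact this (SimpleGraph.Walk.start_mem_support _)
  · have hp := m.isPath 1 2 h12
    have hlen : 2 ≤ (m.path 1 2 h12).length := by
      by_contra hl
      exact hc ((m.path 1 2 h12).getVert_of_length_le (by omega))
    have hadj' : G.Adj (m.path 1 2 h12).snd ((m.path 1 2 h12).getVert 2) :=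
      (m.path 1 2 h12).adj_getVert_succ (by omega)
    refine ⟨_, _, _, _, ?_, ?_, ?_, (hadj h10).symm, hadj h12, hadj'⟩
    · intro h; apply ha; rw [h]; exact hsnd h12
    · intro h; apply ha; rw [h]; exact SimpleGraph.Walk.getVert_mem_support _ _
    · intro h
      have := hp.getVert_injOn (x₁ := 0) (x₂ := 2) (by simp) (by simpa using hlen)
        (by simpa using h)
      omega

theorem isTMSolution_collectionP4 {V : Type*} {G : SimpleGraph V} {S : Finset V} :
    IsTMSolution collectionP4 G S ↔ ¬ HasPath4 (G.induce {v : V | v ∉ S}) := by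
  simp only [IsTMSolution, collectionP4, Set.mem_singleton_iff, forall_eq]
  exact not_congr ⟨fun h => h.hasPath4, fun h => h.isTopologicalMinor⟩

theorem isMSolution_collectionP4 {V : Type*} {G : SimpleGraph V} {S : Finset V} :
    IsMSolution collectionP4 G S ↔ ¬ HasPath4 (G.induce {v : V | v ∉ S}) := by
  simp only [IsMSolution, collectionP4, Set.mem_singleton_iff, forall_eq]
  exact not_congr ⟨fun h => h.hasPath4, fun h => h.isMinor⟩

/-! ### Labels -/

/-- The numbers of contributions that a vertex has received: deleted (`0`), centre of a star
(`1`), leaf of a star (`2`), edge of a triangle (`3`), triangle (`4`). -/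
abbrev Contrib := Fin 5 → ℕ

/-- One contribution of the kind `a`. -/
def unit (a : Fin 5) : Contrib := Pi.single a 1

theorem unit_apply (a b : Fin 5) : unit a b = if b = a then 1 else 0 := by
  simp [unit, Pi.single_apply]

/-- The label of a vertex; `9` stands for a contradiction. -/
def lab (x : Contrib) : ℕ :=
  if x 1 = 0 ∧ x 2 = 0 ∧ x 3 = 0 ∧ x 4 = 0 then (if x 0 = 0 then 0 else 1)
  else if x 0 = 0 ∧ x 2 = 0 ∧ x 3 = 0 ∧ x 4 = 0 then 2
  else if x 0 = 0 ∧ x 1 = 0 ∧ x 2 = 1 ∧ x 3 = 0 ∧ x 4 = 0 then 3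
  else if x 0 = 0 ∧ x 1 = 0 ∧ x 2 = 0 ∧ x 3 = 1 ∧ x 4 = 0 then 4
  else if x 0 = 0 ∧ x 1 = 0 ∧ x 2 = 0 ∧ x 3 = 0 ∧ x 4 = 1 then 5
  else if x 0 = 0 ∧ x 1 = 0 ∧ x 2 = 0 ∧ x 3 = 2 ∧ x 4 = 0 then 6
  else if x 0 = 0 ∧ x 1 = 0 ∧ x 2 = 0 ∧ x 3 = 1 ∧ x 4 = 1 then 7
  else if x 0 = 0 ∧ x 1 = 0 ∧ x 2 = 0 ∧ x 3 = 2 ∧ x 4 = 1 then 8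
  else 9

/-- The labels of a vertex all of whose items have been taken into account. -/
def IsFinal (x : Contrib) : Prop := lab x = 0 ∨ lab x = 1 ∨ lab x = 2 ∨ lab x = 3 ∨ lab x = 8

/-- The cost of a vertex: `1` if it is deleted. -/
def cost (x : Contrib) : ℕ := if lab x = 1 then 1 else 0

/-- The second alternative unites the labels `0` and `2`: an isolated vertex is a centre without
leaves. -/
theorem IsFinal.cases {x : Contrib} (h : IsFinal x) :
    (lab x = 1 ∧ 0 < x 0 ∧ x 1 = 0 ∧ x 2 = 0 ∧ x 3 = 0 ∧ x 4 = 0) ∨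
    (lab x ≠ 1 ∧ x 0 = 0 ∧ x 2 = 0 ∧ x 3 = 0 ∧ x 4 = 0) ∨
    (lab x ≠ 1 ∧ x 0 = 0 ∧ x 1 = 0 ∧ x 2 = 1 ∧ x 3 = 0 ∧ x 4 = 0) ∨
    (lab x ≠ 1 ∧ x 0 = 0 ∧ x 1 = 0 ∧ x 2 = 0 ∧ x 3 = 2 ∧ x 4 = 1) := by
  unfold IsFinal lab at h
  unfold lab
  split_ifs at h ⊢ <;> first | omega | (simp_all; done) | (simp_all; omega)

/-- `x` and `y` stand for two edges at one surviving vertex. With two edges it can only be a centre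
or a corner of a triangle, and in the latter case both triangle edges are accounted for and the
triangle is selected. -/
theorem IsFinal.mid {t x y : Contrib} (h : IsFinal t) (h0 : lab t ≠ 1) (hle : ∀ a, x a + y a ≤ t a)
    (hx : x 1 = 1 ∨ x 2 = 1 ∨ x 3 = 1) (hy : y 1 = 1 ∨ y 2 = 1 ∨ y 3 = 1) :
    (x 2 = 0 ∧ x 3 = 0 ∧ y 2 = 0 ∧ y 3 = 0) ∨
      (x 1 = 0 ∧ x 2 = 0 ∧ y 1 = 0 ∧ y 2 = 0 ∧ x 3 = 1 ∧ y 3 = 1 ∧ t 3 = 2 ∧ t 4 = 1) := by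
  have h1 := hle 1
  have h2 := hle 2
  have h3 := hle 3
  have := h.cases
  omega

theorem IsFinal.zero {x : Contrib} (h : IsFinal x) (h0 : lab x ≠ 1) : x 0 = 0 := by
  have := h.cases
  omega

theorem IsFinal.four {x : Contrib} (h : IsFinal x) (h0 : 0 < x 4) : x 0 = 0 ∧ x 1 = 0 ∧ x 2 = 0 := by
  have := h.cases
  omega

/-! ### Ordered graphs and configurations -/

/-- A graph on `{1, …, n}` with lists `bl i` of smaller vertices: every smaller neighbour of `i` is
in `bl i`, and the members of `bl i` are pairwise in each other's lists. -/
structure ElimOrder where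
  n : ℕ
  adj : ℕ → ℕ → Prop
  bl : ℕ → List ℕ
  symm : ∀ i j, adj i j → adj j i
  ne : ∀ i j, adj i j → i ≠ j
  le : ∀ i j, adj i j → 1 ≤ i ∧ i ≤ n
  nodup : ∀ i, (bl i).Nodup
  mem_lt : ∀ i j, j ∈ bl i → 1 ≤ j ∧ j < i
  clique : ∀ i x u, x ∈ bl i → u ∈ bl i → x < u → x ∈ bl u
  edge : ∀ i j, adj i j → j < i → j ∈ bl i

/-- Items: `⟨i, (j, j)⟩` stands for the edge between `i` and `j`, and `⟨i, (j, k)⟩` for the triangle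
on `i`, `j` and `k`. -/
abbrev Item := Σ _ : ℕ, ℕ × ℕ

namespace ElimOrder

variable (O : ElimOrder)

/-- The possible contributions of an item to all vertices. -/
def Opt (it : Item) (δ : ℕ → Contrib) : Prop :=
  (it.2.1 = it.2.2 ∧ O.adj it.1 it.2.1 ∧
    (δ = Pi.single it.1 (unit 0) ∨ δ = Pi.single it.2.1 (unit 0) ∨
      δ = Pi.single it.1 (unit 1) + Pi.single it.2.1 (unit 2) ∨
      δ = Pi.single it.1 (unit 2) + Pi.single it.2.1 (unit 1) ∨
      δ = Pi.single it.1 (unit 3) + Pi.single it.2.1 (unit 3))) ∨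
  (it.2.2 < it.2.1 ∧ (O.adj it.1 it.2.1 ∧ O.adj it.1 it.2.2 ∧ O.adj it.2.1 it.2.2) ∧
    (δ = 0 ∨ δ = Pi.single it.1 (unit 4) + Pi.single it.2.1 (unit 4) + Pi.single it.2.2 (unit 4))) ∨
  (¬ (it.2.1 = it.2.2 ∧ O.adj it.1 it.2.1) ∧
    ¬ (it.2.2 < it.2.1 ∧ O.adj it.1 it.2.1 ∧ O.adj it.1 it.2.2 ∧ O.adj it.2.1 it.2.2) ∧ δ = 0)

/-- The items owned by the vertices in `D`. -/
def items (D : Finset ℕ) : Finset Item := D.sigma fun i => (O.bl i).toFinset ×ˢ (O.bl i).toFinset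

/-- The contributions of the items owned by `D`. -/
def tot (D : Finset ℕ) (o : Item → ℕ → Contrib) : ℕ → Contrib := ∑ it ∈ O.items D, o it

/-- `S` meets all paths on four vertices. -/
def Hits (S : Finset ℕ) : Prop :=
  ∀ a b c d, a ≠ c → a ≠ d → b ≠ d → O.adj a b → O.adj b c → O.adj c d →
    a ∉ S → b ∉ S → c ∉ S → d ∉ S → False

/-- The item of the edge between `u` and `v`. -/
def eit (u v : ℕ) : Item := ⟨max u v, (min u v, min u v)⟩

theorem eit_comm (u v : ℕ) : eit u v = eit v u := by simp [eit, max_comm, min_comm]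

theorem eit_inj {u v w : ℕ} (h : eit u v = eit u w) : v = w := by
  simp only [eit, Sigma.mk.injEq, heq_eq_eq, Prod.mk.injEq] at h
  omega

variable {O}

/-- An edge is owned by its larger end, whose list contains the smaller one. -/
theorem eit_mem {u v : ℕ} (h : O.adj u v) : eit u v ∈ O.items (Finset.Icc 1 O.n) := by
  have h1 := O.le _ _ h
  have h2 := O.le _ _ (O.symm _ _ h)
  have hne := O.ne _ _ h
  simp only [items, eit, Finset.mem_sigma, Finset.mem_Icc, Finset.mem_product, List.mem_toFinset,
    and_self]
  refine ⟨by omega, ?_⟩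
  rcases lt_or_gt_of_ne hne with h' | h'
  · rw [max_eq_right h'.le, min_eq_left h'.le]; exact O.edge _ _ (O.symm _ _ h) h'
  · rw [max_eq_left h'.le, min_eq_right h'.le]; exact O.edge _ _ h h'

theorem opt_eit {o : Item → ℕ → Contrib} (ho : ∀ it, O.Opt it (o it)) {u v : ℕ} (h : O.adj u v) :
    (o (eit u v) u = unit 0 ∧ o (eit u v) v = 0) ∨ (o (eit u v) u = 0 ∧ o (eit u v) v = unit 0) ∨
    (o (eit u v) u = unit 1 ∧ o (eit u v) v = unit 2) ∨
    (o (eit u v) u = unit 2 ∧ o (eit u v) v = unit 1) ∨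
    (o (eit u v) u = unit 3 ∧ o (eit u v) v = unit 3) := by
  have hne := O.ne _ _ h
  have key : ∀ u v, O.adj u v → v < u →
    (o (eit u v) u = unit 0 ∧ o (eit u v) v = 0) ∨ (o (eit u v) u = 0 ∧ o (eit u v) v = unit 0) ∨
    (o (eit u v) u = unit 1 ∧ o (eit u v) v = unit 2) ∨
    (o (eit u v) u = unit 2 ∧ o (eit u v) v = unit 1) ∨
    (o (eit u v) u = unit 3 ∧ o (eit u v) v = unit 3) := by
    intro u v h huv
    have he : eit u v = ⟨u, (v, v)⟩ := by simp [eit, huv.le]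
    have := ho ⟨u, (v, v)⟩
    rw [he]
    simp only [Opt, lt_irrefl, false_and, true_and, h, not_true_eq_false, or_false] at this
    rcases this with h | h | h | h | h <;> rw [h] <;> simp [huv.ne, huv.ne']
  rcases lt_or_gt_of_ne hne with h' | h'
  · have := key v u (O.symm _ _ h) h'
    rw [eit_comm]
    tauto
  · exact key u v h h'

theorem sum_le_tot (o : Item → ℕ → Contrib) {D : Finset ℕ} {P : Finset Item} (hP : P ⊆ O.items D)
    (v : ℕ) (a : Fin 5) : ∑ it ∈ P, o it v a ≤ O.tot D o v a := by
  simp only [tot, Finset.sum_apply]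
  exact Finset.sum_le_sum_of_subset hP

/-- Different edges at `u` are different items, so their contributions add up within the total. -/
theorem tot_ge_two (o : Item → ℕ → Contrib) {u v w : ℕ} (h1 : O.adj u v) (h2 : O.adj u w)
    (hvw : v ≠ w) (a : Fin 5) :
    o (eit u v) u a + o (eit u w) u a ≤ O.tot (Finset.Icc 1 O.n) o u a := by
  have := sum_le_tot (O := O) o (P := {eit u v, eit u w}) (D := Finset.Icc 1 O.n)
    (by simp [Finset.insert_subset_iff, eit_mem h1, eit_mem h2]) u a
  rwa [Finset.sum_pair (fun h => hvw (eit_inj h))] at this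

theorem tot_ge_three (o : Item → ℕ → Contrib) {u v w x : ℕ} (h1 : O.adj u v) (h2 : O.adj u w)
    (h3 : O.adj u x) (hvw : v ≠ w) (hvx : v ≠ x) (hwx : w ≠ x) (a : Fin 5) :
    o (eit u v) u a + o (eit u w) u a + o (eit u x) u a ≤ O.tot (Finset.Icc 1 O.n) o u a := by
  have := sum_le_tot (O := O) o (P := {eit u v, eit u w, eit u x}) (D := Finset.Icc 1 O.n)
    (by simp [Finset.insert_subset_iff, eit_mem h1, eit_mem h2, eit_mem h3]) u a
  rw [Finset.sum_insert, Finset.sum_pair (fun h => hwx (eit_inj h))] at this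
  · omega
  · simp only [Finset.mem_insert, Finset.mem_singleton, not_or]
    exact ⟨fun h => hvw (eit_inj h), fun h => hvx (eit_inj h)⟩

theorem tot_ge_one (o : Item → ℕ → Contrib) {u v : ℕ} (h1 : O.adj u v) (a : Fin 5) :
    o (eit u v) u a ≤ O.tot (Finset.Icc 1 O.n) o u a := by
  simpa using sum_le_tot (O := O) o (P := {eit u v}) (D := Finset.Icc 1 O.n)
    (by simp [eit_mem h1]) u a

/-- Only a selected triangle contributes kind `4`, and it does so at all three corners. -/
theorem exists_triangle {o : Item → ℕ → Contrib} (ho : ∀ it, O.Opt it (o it)) {b : ℕ}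
    (h : 0 < O.tot (Finset.Icc 1 O.n) o b 4) :
    ∃ p q, p ≠ q ∧ O.adj b p ∧ O.adj b q ∧ O.adj p q ∧ 0 < O.tot (Finset.Icc 1 O.n) o p 4 ∧
      0 < O.tot (Finset.Icc 1 O.n) o q 4 := by
  have h' := h
  simp only [tot, Finset.sum_apply] at h'
  obtain ⟨it, hit, hpos⟩ := Finset.exists_ne_zero_of_sum_ne_zero h'.ne'
  have hle : ∀ v, o it v 4 ≤ O.tot (Finset.Icc 1 O.n) o v 4 := fun v => by
    simpa using sum_le_tot (O := O) o (P := {it}) (by simpa using hit) v 4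
  obtain ⟨i, j, k⟩ := it
  have hv := ho ⟨i, (j, k)⟩
  rcases hv with ⟨h1, h2, h3⟩ | ⟨h1, ⟨h2, h3, h4⟩, h5⟩ | ⟨_, _, h3⟩
  · exfalso
    have : ∀ (x y : ℕ) (a : Fin 5), a ≠ 4 → (Pi.single x (unit a) : ℕ → Contrib) y 4 = 0 := by
      intro x y a ha
      rw [Pi.single_apply]
      split_ifs
      · rw [unit_apply, if_neg ha.symm]
      · rfl
    apply hpos
    rcases h3 with h | h | h | h | h <;> rw [h] <;> simp [this]
  · rcases h5 with h5 | h5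
    · rw [h5] at hpos; simp at hpos
    · dsimp only at h1 h2 h3 h4 h5
      have hij := O.ne _ _ h2
      have hik := O.ne _ _ h3
      have hjk := O.ne _ _ h4
      have hi : 0 < O.tot (Finset.Icc 1 O.n) o i 4 := lt_of_lt_of_le (by rw [h5]; simp [unit]) (hle i)
      have hj : 0 < O.tot (Finset.Icc 1 O.n) o j 4 := lt_of_lt_of_le (by rw [h5]; simp [unit]) (hle j)
      have hk : 0 < O.tot (Finset.Icc 1 O.n) o k 4 := lt_of_lt_of_le (by rw [h5]; simp [unit]) (hle k)
      have hb : b = i ∨ b = j ∨ b = k := by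
        by_contra hcon
        push Not at hcon
        apply hpos
        rw [h5]
        simp [hcon.1, hcon.2.1, hcon.2.2]
      rcases hb with rfl | rfl | rfl
      · exact ⟨j, k, hjk, h2, h3, h4, hj, hk⟩
      · exact ⟨i, k, hik, O.symm _ _ h2, h4, h3, hi, hk⟩
      · exact ⟨i, j, hij, O.symm _ _ h3, O.symm _ _ h4, h2, hi, hj⟩
  · rw [h3] at hpos; simp at hpos

/-- The edge between two vertices that are not deleted is an edge of a star or of a triangle. -/
theorem edge_type {o : Item → ℕ → Contrib} (ho : ∀ it, O.Opt it (o it)) {u v : ℕ} (h : O.adj u v)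
    (hu : O.tot (Finset.Icc 1 O.n) o u 0 = 0) (hv : O.tot (Finset.Icc 1 O.n) o v 0 = 0) :
    (o (eit u v) u 1 = 1 ∧ o (eit u v) v 2 = 1) ∨ (o (eit u v) u 2 = 1 ∧ o (eit u v) v 1 = 1) ∨
    (o (eit u v) u 3 = 1 ∧ o (eit u v) v 3 = 1) := by
  have tu := tot_ge_one o h 0
  have tv := tot_ge_one o (O.symm _ _ h) 0
  rw [eit_comm v u] at tv
  rcases opt_eit ho h with ⟨e1, e2⟩ | ⟨e1, e2⟩ | ⟨e1, e2⟩ | ⟨e1, e2⟩ | ⟨e1, e2⟩ <;>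
    rw [e1, hu] at tu <;> rw [e2, hv] at tv <;> rw [e1, e2] <;> simp_all [unit_apply]

/-- The deleted vertices of a configuration meet all paths on four vertices. -/
theorem hits_of_config {o : Item → ℕ → Contrib} (ho : ∀ it, O.Opt it (o it))
    (hf : ∀ v ∈ Finset.Icc 1 O.n, IsFinal (O.tot (Finset.Icc 1 O.n) o v)) :
    O.Hits ((Finset.Icc 1 O.n).filter fun v => lab (O.tot (Finset.Icc 1 O.n) o v) = 1) := by
  intro a b c d hac had hbd hab hbc hcd ha hb hc hd
  have ge1 := fun u v (h : O.adj u v) => tot_ge_one o h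
  have ge2 := fun u v w (h : O.adj u v) (h' : O.adj u w) (hvw : v ≠ w) => tot_ge_two o h h' hvw
  have ge3 := fun u v w x (h : O.adj u v) (h' : O.adj u w) (h'' : O.adj u x) (h1 : v ≠ w)
    (h2 : v ≠ x) (h3 : w ≠ x) => tot_ge_three o h h' h'' h1 h2 h3
  have et := fun u v (h : O.adj u v) => edge_type ho h
  have tri := fun b => exists_triangle ho (b := b)
  generalize O.tot (Finset.Icc 1 O.n) o = T at *
  have hmem : ∀ {u v}, O.adj u v → u ∈ Finset.Icc 1 O.n := fun h => Finset.mem_Icc.mpr (O.le _ _ h)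
  have hba := O.symm _ _ hab
  have hcb := O.symm _ _ hbc
  have hdc := O.symm _ _ hcd
  have ma := hmem hab
  have mb := hmem hbc
  have mc := hmem hcd
  have md := hmem hdc
  simp only [Finset.mem_filter, ma, mb, mc, md, true_and] at ha hb hc hd
  have fa := (hf a ma).zero ha
  have fb := (hf b mb).zero hb
  have fc := (hf c mc).zero hc
  have fd := (hf d md).zero hd
  have tb := ge2 _ _ _ hba hbc hac
  have tc := ge2 _ _ _ hcb hcd hbd
  rw [eit_comm b a] at tb
  rw [eit_comm c b] at tc
  have eab := et _ _ hab fa fb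
  have ebc := et _ _ hbc fb fc
  have ecd := et _ _ hcd fc fd
  -- Both `b` and `c` lie on two edges of the path, so `IsFinal.mid` applies to them, and neither is
  -- a leaf. A star edge between them would have a leaf as one of its ends; hence the edge `bc` is a
  -- triangle edge and both vertices are corners.
  have h3b : T b 4 = 1 ∧ T b 3 = 2 ∧
      o (eit a b) b 3 = 1 ∧ o (eit b c) b 3 = 1 ∧ o (eit b c) c 3 = 1 ∧
      o (eit c d) c 3 = 1 ∧ T c 3 = 2 := by
    have kb := IsFinal.mid (hf b mb) hb tb (x := o (eit a b) b) (y := o (eit b c) b)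
      (by rcases eab with ⟨_, h⟩ | ⟨_, h⟩ | ⟨_, h⟩ <;> simp [h])
      (by rcases ebc with ⟨h, _⟩ | ⟨h, _⟩ | ⟨h, _⟩ <;> simp [h])
    have kc := IsFinal.mid (hf c mc) hc tc (x := o (eit b c) c) (y := o (eit c d) c)
      (by rcases ebc with ⟨_, h⟩ | ⟨_, h⟩ | ⟨_, h⟩ <;> simp [h])
      (by rcases ecd with ⟨h, _⟩ | ⟨h, _⟩ | ⟨h, _⟩ <;> simp [h])
    have h1 : ¬ (o (eit b c) b 2 = 0 ∧ o (eit b c) b 3 = 0 ∧ o (eit b c) c 2 = 0) := by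
      rintro ⟨h1, h2, h3⟩; rcases ebc with ⟨h4, h5⟩ | ⟨h4, h5⟩ | ⟨h4, h5⟩ <;> omega
    rcases kb with ⟨-, -, e1, e2⟩ | ⟨-, -, h2, h3, e1, e2, e3, e4⟩ <;>
      rcases kc with ⟨e5, e6, -, -⟩ | ⟨h6, h7, -, -, e7, e8, e9, e10⟩
    · exact absurd ⟨e1, e2, e5⟩ h1
    · exact (by
        rcases ebc with ⟨h4, h5⟩ | ⟨h4, h5⟩ | ⟨h4, h5⟩
        · omega
        · omega
        · omega)
    · rcases ebc with ⟨h4, h5⟩ | ⟨h4, h5⟩ | ⟨h4, h5⟩ <;> omega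
    · exact ⟨e4, e3, e1, e2, e7, e8, e9⟩
  obtain ⟨hb4, hb3, eb1, eb2, ec1, ec2, hc3⟩ := h3b
  -- The edges from `b` to `a` and `c` are its only two triangle edges, so the triangle selected at
  -- `b` is `abc`. Then `c` has three triangle edges, to `b`, `d` and `a`, which is one too many.
  obtain ⟨p, q, hpq, hbp, hbq, hadj, hp4, hq4⟩ := tri b (by omega)
  have mp := hmem hadj
  have mq := hmem (O.symm _ _ hadj)
  -- A corner of a selected triangle has no role in a star, so an edge between two such corners must
  -- be a triangle edge.
  have typ : ∀ {u v}, O.adj u v → u ∈ Finset.Icc 1 O.n → v ∈ Finset.Icc 1 O.n →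
      0 < T u 4 → 0 < T v 4 →
      o (eit u v) u 3 = 1 ∧ o (eit u v) v 3 = 1 := by
    intro u v huv mu mv hu hv
    have fu := (hf u mu).four hu
    have fv := (hf v mv).four hv
    have tu1 := ge1 _ _ huv 1
    have tu2 := ge1 _ _ huv 2
    have := et _ _ huv fu.1 fv.1
    omega
  have inb : ∀ {x}, O.adj b x → x ∈ Finset.Icc 1 O.n → 0 < T x 4 →
      x = a ∨ x = c := by
    intro x hbx mx hx
    by_contra hcon
    push Not at hcon
    have := ge3 _ _ _ _ hba hbc hbx hac hcon.1.symm hcon.2.symm 3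
    rw [eit_comm b a, eb1, eb2, (typ hbx mb mx (by omega) hx).1, hb3] at this
    omega
  have hcc : O.adj c a ∧ o (eit c a) c 3 = 1 := by
    rcases inb hbp mp hp4 with rfl | rfl <;> rcases inb hbq mq hq4 with rfl | rfl
    · exact absurd rfl hpq
    · exact ⟨O.symm _ _ hadj, (typ (O.symm _ _ hadj) mq mp hq4 hp4).1⟩
    · exact ⟨hadj, (typ hadj mp mq hp4 hq4).1⟩
    · exact absurd rfl hpq
  have := ge3 _ _ _ _ hcb hcd hcc.1 hbd (O.ne _ _ hab).symm had.symm 3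
  rw [eit_comm c b, ec1, ec2, hcc.2, hc3] at this
  omega

end ElimOrder

/-! ### From solutions to configurations -/

theorem isFinal_of {x : Contrib} (h : (x 1 = 0 ∧ x 2 = 0 ∧ x 3 = 0 ∧ x 4 = 0) ∨
    (x 0 = 0 ∧ x 2 = 0 ∧ x 3 = 0 ∧ x 4 = 0) ∨
    (x 0 = 0 ∧ x 1 = 0 ∧ x 2 = 1 ∧ x 3 = 0 ∧ x 4 = 0) ∨
    (x 0 = 0 ∧ x 1 = 0 ∧ x 2 = 0 ∧ x 3 = 2 ∧ x 4 = 1)) : IsFinal x := by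
  unfold IsFinal lab
  rcases h with h | h | h | h
  · by_cases h0 : x 0 = 0 <;> simp [h, h0]
  · by_cases h0 : x 1 = 0 <;> simp [h, h0]
  · simp [h]
  · simp [h]

theorem lab_eq_one {x : Contrib} (h : lab x = 1) : 0 < x 0 := by
  unfold lab at h
  split_ifs at h <;> omega

namespace ElimOrder

open Classical in
/-- The contribution to `u` of the edge between `u` and `v` when `S` is deleted. -/
noncomputable def edgeContrib (O : ElimOrder) (S : Finset ℕ) (u v : ℕ) : Contrib :=
  -- An edge with both ends in `S` is charged to the larger end only.
  if u ∈ S then (if v ∈ S ∧ u < v then 0 else unit 0)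
  else if v ∈ S then 0
  else if ∃ w, w ∉ S ∧ O.adj u w ∧ O.adj v w then unit 3
  -- In a component that is a single edge, the larger end is chosen as the leaf.
  else if (∀ w, w ∉ S → O.adj u w → w = v) ∧ (v < u ∨ ¬ ∀ w, w ∉ S → O.adj v w → w = u) then unit 2
  else unit 1

open Classical in
/-- The configuration of a solution `S`. -/
noncomputable def config (O : ElimOrder) (S : Finset ℕ) (it : Item) : ℕ → Contrib :=
  if it.2.1 = it.2.2 ∧ O.adj it.1 it.2.1 then
    Pi.single it.1 (O.edgeContrib S it.1 it.2.1) + Pi.single it.2.1 (O.edgeContrib S it.2.1 it.1)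
  else if (it.2.2 < it.2.1 ∧ O.adj it.1 it.2.1 ∧ O.adj it.1 it.2.2 ∧ O.adj it.2.1 it.2.2) ∧
      it.1 ∉ S ∧ it.2.1 ∉ S ∧ it.2.2 ∉ S then
    Pi.single it.1 (unit 4) + Pi.single it.2.1 (unit 4) + Pi.single it.2.2 (unit 4)
  else 0

variable {O : ElimOrder} {S : Finset ℕ}

/-- Another neighbour of `v` would prolong the path through `x`, `u` and `v` to a `P_4`; it cannot
be `x` itself, since then the edge `uv` would lie in a surviving triangle. -/
theorem Hits.leaf (hS : O.Hits S) {u v : ℕ} (h : O.adj u v) (hu : u ∉ S) (hv : v ∉ S)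
    (hw : ¬ ∃ w, w ∉ S ∧ O.adj u w ∧ O.adj v w) (h1 : ¬ ∀ w, w ∉ S → O.adj u w → w = v) :
    ∀ w, w ∉ S → O.adj v w → w = u := by
  intro w hwS hvw
  by_contra hne
  push Not at h1
  obtain ⟨x, hxS, hux, hxv⟩ := h1
  refine hS x u v w hxv ?_ (Ne.symm hne) (O.symm _ _ hux) h hvw hxS hu hv hwS
  rintro rfl
  exact hw ⟨x, hxS, hux, hvw⟩

/-- `edgeContrib` is evaluated separately at the two ends of an edge; the point is that the results
fit together. For a star edge exactly one end has to be the leaf: the comparison of the ends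
prevents two leaves, and `Hits.leaf` prevents that there is none. -/
theorem opt_config (hS : O.Hits S) (it : Item) : O.Opt it (O.config S it) := by
  obtain ⟨i, j, k⟩ := it
  unfold Opt config
  dsimp only
  split_ifs with h1 h2
  · refine .inl ⟨h1.1, h1.2, ?_⟩
    have hne := O.ne _ _ h1.2
    have hex : (∃ w, w ∉ S ∧ O.adj j w ∧ O.adj i w) ↔ ∃ w, w ∉ S ∧ O.adj i w ∧ O.adj j w := by
      simp only [and_comm]
    unfold edgeContrib
    by_cases hi : i ∈ S
    · by_cases hj : j ∈ S
      · rcases lt_or_gt_of_ne hne with h | h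
        · simp [hi, hj, h, h.not_gt]
        · simp [hi, hj, h, h.not_gt]
      · simp [hi, hj]
    · by_cases hj : j ∈ S
      · simp [hi, hj]
      · by_cases hw : ∃ w, w ∉ S ∧ O.adj i w ∧ O.adj j w
        · rw [if_neg hi, if_neg hj, if_pos hw, if_neg hj, if_neg hi, if_pos (hex.mpr hw)]
          tauto
        · rw [if_neg hi, if_neg hj, if_neg hw, if_neg hj, if_neg hi, if_neg (fun h => hw (hex.mp h))]
          have l1 := hS.leaf h1.2 hi hj hw
          by_cases a : ∀ w, w ∉ S → O.adj i w → w = j <;>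
          by_cases b : ∀ w, w ∉ S → O.adj j w → w = i
          · rcases lt_or_gt_of_ne hne with h | h
            · rw [if_neg (by rintro ⟨_, h' | h'⟩; exacts [absurd h h'.not_gt, h' b]), if_pos ⟨b, .inl h⟩]
              tauto
            · rw [if_pos ⟨a, .inl h⟩, if_neg (by rintro ⟨_, h' | h'⟩; exacts [absurd h h'.not_gt, h' a])]
              tauto
          · rw [if_pos ⟨a, .inr b⟩, if_neg (fun h => b h.1)]; tauto
          · rw [if_neg (fun h => a h.1), if_pos ⟨b, .inr a⟩]; tauto
          · exact absurd (l1 a) b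
  · refine .inr (.inl ⟨h2.1.1, h2.1.2, .inr rfl⟩)
  · by_cases h : k < j ∧ O.adj i j ∧ O.adj i k ∧ O.adj j k
    · exact .inr (.inl ⟨h.1, h.2, .inl rfl⟩)
    · exact .inr (.inr ⟨h1, h, rfl⟩)

theorem config_eit {u v : ℕ} (h : O.adj u v) : O.config S (eit u v) u = O.edgeContrib S u v := by
  have hne := O.ne _ _ h
  have h' := O.symm _ _ h
  rcases lt_or_gt_of_ne hne with hlt | hlt
  · have : eit u v = ⟨v, (u, u)⟩ := by simp [eit, hlt.le]
    rw [this]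
    simp [config, h', hne]
  · have : eit u v = ⟨u, (v, v)⟩ := by simp [eit, hlt.le]
    rw [this]
    simp [config, h, hne]

/-- Nonzero contributions to a vertex come only from its own edges and from selected triangles at
it; the totals of the configuration are computed through this. -/
theorem config_cases {D : Finset ℕ} {it : Item} (hit : it ∈ O.items D) {v : ℕ} {a : Fin 5}
    (h : O.config S it v a ≠ 0) :
    (∃ w, O.adj v w ∧ it = eit v w ∧ O.config S it v = O.edgeContrib S v w) ∨
    ((it.2.2 < it.2.1 ∧ it.2.1 < it.1) ∧ (O.adj it.1 it.2.1 ∧ O.adj it.1 it.2.2 ∧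
      O.adj it.2.1 it.2.2) ∧ (it.1 ∉ S ∧ it.2.1 ∉ S ∧ it.2.2 ∉ S) ∧
      (v = it.1 ∨ v = it.2.1 ∨ v = it.2.2) ∧ O.config S it v = unit 4) := by
  obtain ⟨i, j, k⟩ := it
  have hj : j ∈ O.bl i := by
    simp only [items, Finset.mem_sigma, Finset.mem_product, List.mem_toFinset] at hit
    exact hit.2.1
  have hlt := (O.mem_lt _ _ hj).2
  by_cases h1 : j = k ∧ O.adj i j
  · left
    obtain ⟨rfl, h1⟩ := h1
    have he : (⟨i, (j, j)⟩ : Item) = eit i j := by simp [eit, hlt.le]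
    by_cases hvi : v = i
    · subst hvi
      exact ⟨j, h1, he, by rw [he, config_eit h1]⟩
    · by_cases hvj : v = j
      · subst hvj
        exact ⟨i, O.symm _ _ h1, by rw [he, eit_comm], by
          rw [he, eit_comm, config_eit (O.symm _ _ h1)]⟩
      · exfalso
        apply h
        simp [config, h1, hvi, hvj]
  · right
    unfold config at h ⊢
    dsimp only at h ⊢
    rw [if_neg h1] at h ⊢
    split_ifs at h ⊢ with h2
    · have hij := O.ne _ _ h2.1.2.1
      have hik := O.ne _ _ h2.1.2.2.1
      have hjk := O.ne _ _ h2.1.2.2.2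
      refine ⟨⟨h2.1.1, hlt⟩, h2.1.2, h2.2, ?_⟩
      by_cases hvi : v = i
      · subst hvi; simp [hij, hik]
      · by_cases hvj : v = j
        · subst hvj; simp [hij.symm, hjk]
        · by_cases hvk : v = k
          · subst hvk; simp [hik.symm, hjk.symm]
          · exfalso; apply h; simp [hvi, hvj, hvk]
    · simp at h

theorem tot_config_eq_zero {D : Finset ℕ} {v : ℕ} {a : Fin 5}
    (h1 : ∀ w, O.adj v w → O.edgeContrib S v w a = 0)
    (h2 : a = 4 → v ∉ S → ∀ p q, p ∉ S → q ∉ S → O.adj v p → O.adj v q → O.adj p q → False) :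
    O.tot D (O.config S) v a = 0 := by
  simp only [tot, Finset.sum_apply]
  refine Finset.sum_eq_zero fun it hit => ?_
  by_contra h
  rcases config_cases hit h with ⟨w, hw, -, he⟩ | ⟨-, ⟨h3, h4, h5⟩, ⟨h6, h7, h8⟩, h9, he⟩
  · rw [he] at h; exact h (h1 w hw)
  · rw [he, unit_apply] at h
    have ha : a = 4 := by by_contra ha; simp [ha] at h
    rcases h9 with rfl | rfl | rfl
    · exact h2 ha h6 _ _ h7 h8 h3 h4 h5
    · exact h2 ha h7 _ _ h6 h8 (O.symm _ _ h3) h5 h4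
    · exact h2 ha h8 _ _ h6 h7 (O.symm _ _ h4) (O.symm _ _ h5) h3

theorem tot_config_two {v p q : ℕ} (hpq : p ≠ q) (hp : O.adj v p) (hq : O.adj v q)
    (h : ∀ w, O.adj v w → w ≠ p → w ≠ q → O.edgeContrib S v w 3 = 0) :
    O.tot (Finset.Icc 1 O.n) (O.config S) v 3 = O.edgeContrib S v p 3 + O.edgeContrib S v q 3 := by
  simp only [tot, Finset.sum_apply]
  rw [← config_eit hp, ← config_eit hq, ← Finset.sum_pair
    (f := fun it => O.config S it v 3) (fun he => hpq (eit_inj he))]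
  symm
  refine Finset.sum_subset (by simp [Finset.insert_subset_iff, eit_mem hp, eit_mem hq]) ?_
  intro it hit hne
  by_contra hc
  rcases config_cases hit hc with ⟨w, hw, he, he'⟩ | ⟨-, -, -, -, he⟩
  · refine hc ?_
    rw [he']
    refine h w hw ?_ ?_ <;> rintro rfl <;> exact hne (by simp [he])
  · exact hc (by rw [he]; simp [unit_apply])

theorem tot_config_one {v p : ℕ} (hp : O.adj v p) {a : Fin 5} (ha : a ≠ 4)
    (h : ∀ w, O.adj v w → w ≠ p → O.edgeContrib S v w a = 0) :
    O.tot (Finset.Icc 1 O.n) (O.config S) v a = O.edgeContrib S v p a := by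
  simp only [tot, Finset.sum_apply]
  rw [← config_eit hp]
  refine Finset.sum_eq_single_of_mem _ (eit_mem hp) fun it hit hne => ?_
  by_contra hc
  rcases config_cases hit hc with ⟨w, hw, he, he'⟩ | ⟨-, -, -, -, he⟩
  · refine hc ?_
    rw [he']
    refine h w hw ?_
    rintro rfl
    exact hne he
  · exact hc (by rw [he, unit_apply, if_neg ha])

/-- When all `P_4` are hit, a corner of a surviving triangle has no surviving neighbour outside it,
so no second triangle survives there. The triangle corresponds to just one item, because items list
the corners in decreasing order. -/
theorem tot_config_triangle (hS : O.Hits S) {v p q : ℕ} (hp : O.adj v p) (hq : O.adj v q)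
    (hpq : O.adj p q) (hvS : v ∉ S) (hpS : p ∉ S) (hqS : q ∉ S) :
    O.tot (Finset.Icc 1 O.n) (O.config S) v 4 = 1 := by
  have hnb : ∀ w, O.adj v w → w ∉ S → w = p ∨ w = q := by
    intro w hw hwS
    by_contra hc
    push Not at hc
    exact hS w v p q hc.1 hc.2 (O.ne _ _ hq) (O.symm _ _ hw) hp hpq hwS hvS hpS hqS
  have hvp := O.ne _ _ hp
  have hvq := O.ne _ _ hq
  have hne := O.ne _ _ hpq
  obtain ⟨i, j, k, hkj, hji, hset⟩ : ∃ i j k, k < j ∧ j < i ∧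
      ((v = i ∧ p = j ∧ q = k) ∨ (v = i ∧ p = k ∧ q = j) ∨ (v = j ∧ p = i ∧ q = k) ∨
        (v = j ∧ p = k ∧ q = i) ∨ (v = k ∧ p = i ∧ q = j) ∨ (v = k ∧ p = j ∧ q = i)) := by
    rcases lt_or_gt_of_ne hvp with h1 | h1 <;> rcases lt_or_gt_of_ne hvq with h2 | h2 <;>
      rcases lt_or_gt_of_ne hne with h3 | h3
    · exact ⟨q, p, v, h1, h3, by simp⟩
    · exact ⟨p, q, v, h2, h3, by simp⟩
    · omega
    · exact ⟨p, v, q, h2, h1, by simp⟩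
    · exact ⟨q, v, p, h1, h2, by simp⟩
    · omega
    · exact ⟨v, q, p, h3, h2, by simp⟩
    · exact ⟨v, p, q, h3, h1, by simp⟩
  have hp' := O.symm _ _ hp
  have hq' := O.symm _ _ hq
  have hpq' := O.symm _ _ hpq
  obtain ⟨aij, aik, ajk, iS, jS, kS⟩ : O.adj i j ∧ O.adj i k ∧ O.adj j k ∧ i ∉ S ∧ j ∉ S ∧ k ∉ S := by
    rcases hset with h | h | h | h | h | h <;> obtain ⟨rfl, rfl, rfl⟩ := h <;>
      refine ⟨?_, ?_, ?_, ?_, ?_, ?_⟩ <;> assumption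
  have hval : O.config S ⟨i, (j, k)⟩ v = unit 4 := by
    unfold config
    dsimp only
    rw [if_neg (by simp; omega), if_pos ⟨⟨hkj, aij, aik, ajk⟩, iS, jS, kS⟩]
    rcases hset with h | h | h | h | h | h <;> obtain ⟨rfl, rfl, rfl⟩ := h <;>
      simp [hkj.ne, hji.ne, (hkj.trans hji).ne, hkj.ne', hji.ne', (hkj.trans hji).ne']
  simp only [tot, Finset.sum_apply]
  rw [Finset.sum_eq_single_of_mem (⟨i, (j, k)⟩ : Item), hval]
  · simp [unit_apply]
  · simp only [items, Finset.mem_sigma, Finset.mem_product, List.mem_toFinset, Finset.mem_Icc]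
    exact ⟨O.le _ _ aij, O.edge _ _ aij hji, O.edge _ _ aik (hkj.trans hji)⟩
  · rintro ⟨i', j', k'⟩ hit hne'
    by_contra hc
    rcases config_cases hit hc with ⟨w, hw, -, he'⟩ | ⟨⟨h1, h2⟩, ⟨a1, a2, a3⟩, ⟨s1, s2, s3⟩, h9, -⟩
    · rw [he'] at hc
      unfold edgeContrib at hc
      split_ifs at hc <;> simp [unit_apply] at hc
    · dsimp only at *
      have b1 := O.symm _ _ a1
      have b2 := O.symm _ _ a2
      have b3 := O.symm _ _ a3
      apply hne'
      rcases h9 with rfl | rfl | rfl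
      · have := hnb _ a1 s2
        have := hnb _ a2 s3
        have : v = i ∧ j' = j ∧ k' = k := by omega
        simp [this]
      · have := hnb _ b1 s1
        have := hnb _ a3 s3
        have : i' = i ∧ v = j ∧ k' = k := by omega
        simp [this]
      · have := hnb _ b2 s1
        have := hnb _ b3 s2
        have : i' = i ∧ j' = j ∧ v = k := by omega
        simp [this]

/-- A deleted vertex receives only kind `0`. A survivor in a triangle has exactly two surviving
neighbours. Any other survivor either is a leaf on some edge, and then has no further surviving
neighbour, or receives nothing but the role of a centre. -/
theorem isFinal_config (hS : O.Hits S) (v : ℕ) :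
    IsFinal (O.tot (Finset.Icc 1 O.n) (O.config S) v) := by
  apply isFinal_of
  by_cases hv : v ∈ S
  · left
    refine ⟨?_, ?_, ?_, ?_⟩ <;> refine tot_config_eq_zero (fun w _ => ?_) (fun _ h => absurd hv h) <;>
      simp only [edgeContrib, hv, if_true] <;> split_ifs <;> simp [unit_apply]
  · right
    have h0 : O.tot (Finset.Icc 1 O.n) (O.config S) v 0 = 0 :=
      tot_config_eq_zero (fun w _ => by
        simp only [edgeContrib, hv, if_false]; split_ifs <;> simp [unit_apply]) (by simp)
    by_cases ht : ∃ p q, p ∉ S ∧ q ∉ S ∧ O.adj v p ∧ O.adj v q ∧ O.adj p q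
    · obtain ⟨p, q, hpS, hqS, hp, hq, hpq⟩ := ht
      have hnb : ∀ w, O.adj v w → w ∉ S → w = p ∨ w = q := by
        intro w hw hwS
        by_contra hc
        push Not at hc
        exact hS w v p q hc.1 hc.2 (O.ne _ _ hq) (O.symm _ _ hw) hp hpq hwS hv hpS hqS
      have hcp : O.edgeContrib S v p = unit 3 := by
        simp only [edgeContrib, hv, hpS, if_false]; rw [if_pos ⟨q, hqS, hq, hpq⟩]
      have hcq : O.edgeContrib S v q = unit 3 := by
        simp only [edgeContrib, hv, hqS, if_false]; rw [if_pos ⟨p, hpS, hp, O.symm _ _ hpq⟩]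
      have hcS : ∀ w, w ∈ S → O.edgeContrib S v w = 0 := fun w hw => by simp [edgeContrib, hv, hw]
      have hcw : ∀ w a, a ≠ 3 → O.adj v w → O.edgeContrib S v w a = 0 := by
        intro w a ha hw
        by_cases hwS : w ∈ S
        · rw [hcS w hwS]; rfl
        · rcases hnb w hw hwS with rfl | rfl
          · rw [hcp, unit_apply, if_neg ha]
          · rw [hcq, unit_apply, if_neg ha]
      refine .inr (.inr ⟨h0, tot_config_eq_zero (fun w => hcw w _ (by decide)) (by simp),
        tot_config_eq_zero (fun w => hcw w _ (by decide)) (by simp), ?_,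
        tot_config_triangle hS hp hq hpq hv hpS hqS⟩)
      rw [tot_config_two (O.ne _ _ hpq) hp hq, hcp, hcq]
      · simp [unit_apply]
      · intro w hw h1 h2
        by_cases hwS : w ∈ S
        · rw [hcS w hwS]; rfl
        · rcases hnb w hw hwS with h | h
          · exact absurd h h1
          · exact absurd h h2
    · have h3 : ∀ w, O.adj v w → O.edgeContrib S v w 3 = 0 := by
        intro w hw
        simp only [edgeContrib, hv, if_false]
        split_ifs with h1 h2 <;> simp [unit_apply]
        obtain ⟨x, hx, hvx, hwx⟩ := h2
        exact ht ⟨w, x, h1, hx, hw, hvx, hwx⟩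
      have h4 : ∀ w, O.adj v w → O.edgeContrib S v w 4 = 0 := by
        intro w hw
        simp only [edgeContrib, hv, if_false]
        split_ifs <;> simp [unit_apply]
      have t3 := tot_config_eq_zero (D := Finset.Icc 1 O.n) h3 (by simp)
      have t4 := tot_config_eq_zero (D := Finset.Icc 1 O.n) h4
        (fun _ _ p q h1 h2 h3 h4 h5 => ht ⟨p, q, h1, h2, h3, h4, h5⟩)
      by_cases hl : ∃ w, O.adj v w ∧ O.edgeContrib S v w 2 ≠ 0
      · obtain ⟨w, hw, hl⟩ := hl
        have hwu : O.edgeContrib S v w = unit 2 ∧ ∀ x, x ∉ S → O.adj v x → x = w := by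
          simp only [edgeContrib, hv, if_false] at hl ⊢
          split_ifs at hl ⊢ with h1 h2 h3 <;> simp [unit_apply] at hl ⊢
          exact h3.1
        have hx : ∀ a x, O.adj v x → x ≠ w → O.edgeContrib S v x a = 0 := by
          intro a x hx hxw
          have : x ∈ S := by
            by_contra h
            exact hxw (hwu.2 x h hx)
          simp [edgeContrib, hv, this]
        refine .inr (.inl ⟨h0, ?_, ?_, t3, t4⟩)
        · rw [tot_config_one hw (by decide) (hx _), hwu.1]; simp [unit_apply]
        · rw [tot_config_one hw (by decide) (hx _), hwu.1]; simp [unit_apply]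
      · push Not at hl
        exact .inl ⟨h0, tot_config_eq_zero hl (by simp), t3, t4⟩

/-- The inequality may be strict: a member of `S` to which no edge is charged counts as isolated and
not as deleted. -/
theorem cost_config_le :
    ∑ v ∈ Finset.Icc 1 O.n, cost (O.tot (Finset.Icc 1 O.n) (O.config S) v) ≤ S.card := by
  simp only [cost, ← Finset.card_filter]
  refine Finset.card_le_card fun v hv => ?_
  by_contra hvS
  have h := lab_eq_one (Finset.mem_filter.mp hv).2
  have h0 : O.tot (Finset.Icc 1 O.n) (O.config S) v 0 = 0 :=
    tot_config_eq_zero (fun w _ => by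
      simp only [edgeContrib, hvS, if_false]; split_ifs <;> simp [unit_apply]) (by simp)
  omega

end ElimOrder

/-! ### The addition of labels -/

theorem lab_cases {x : Contrib} (h : lab x ≠ 9) :
    (lab x = 0 ∧ x 0 = 0 ∧ x 1 = 0 ∧ x 2 = 0 ∧ x 3 = 0 ∧ x 4 = 0) ∨
    (lab x = 1 ∧ x 0 ≠ 0 ∧ x 1 = 0 ∧ x 2 = 0 ∧ x 3 = 0 ∧ x 4 = 0) ∨
    (lab x = 2 ∧ x 0 = 0 ∧ x 1 ≠ 0 ∧ x 2 = 0 ∧ x 3 = 0 ∧ x 4 = 0) ∨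
    (lab x = 3 ∧ x 0 = 0 ∧ x 1 = 0 ∧ x 2 = 1 ∧ x 3 = 0 ∧ x 4 = 0) ∨
    (lab x = 4 ∧ x 0 = 0 ∧ x 1 = 0 ∧ x 2 = 0 ∧ x 3 = 1 ∧ x 4 = 0) ∨
    (lab x = 5 ∧ x 0 = 0 ∧ x 1 = 0 ∧ x 2 = 0 ∧ x 3 = 0 ∧ x 4 = 1) ∨
    (lab x = 6 ∧ x 0 = 0 ∧ x 1 = 0 ∧ x 2 = 0 ∧ x 3 = 2 ∧ x 4 = 0) ∨
    (lab x = 7 ∧ x 0 = 0 ∧ x 1 = 0 ∧ x 2 = 0 ∧ x 3 = 1 ∧ x 4 = 1) ∨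
    (lab x = 8 ∧ x 0 = 0 ∧ x 1 = 0 ∧ x 2 = 0 ∧ x 3 = 2 ∧ x 4 = 1) := by
  unfold lab at h ⊢
  by_cases c0 : x 1 = 0 ∧ x 2 = 0 ∧ x 3 = 0 ∧ x 4 = 0
  · by_cases c : x 0 = 0 <;> simp [c0, c]
  by_cases c1 : x 0 = 0 ∧ x 2 = 0 ∧ x 3 = 0 ∧ x 4 = 0
  · have : x 1 ≠ 0 := fun h => c0 ⟨h, c1.2⟩
    simp [c1, this]
  by_cases c2 : x 0 = 0 ∧ x 1 = 0 ∧ x 2 = 1 ∧ x 3 = 0 ∧ x 4 = 0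
  · simp [c2]
  by_cases c3 : x 0 = 0 ∧ x 1 = 0 ∧ x 2 = 0 ∧ x 3 = 1 ∧ x 4 = 0
  · simp [c3]
  by_cases c4 : x 0 = 0 ∧ x 1 = 0 ∧ x 2 = 0 ∧ x 3 = 0 ∧ x 4 = 1
  · simp [c4]
  by_cases c5 : x 0 = 0 ∧ x 1 = 0 ∧ x 2 = 0 ∧ x 3 = 2 ∧ x 4 = 0
  · simp [c5]
  by_cases c6 : x 0 = 0 ∧ x 1 = 0 ∧ x 2 = 0 ∧ x 3 = 1 ∧ x 4 = 1
  · simp [c6]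
  by_cases c7 : x 0 = 0 ∧ x 1 = 0 ∧ x 2 = 0 ∧ x 3 = 2 ∧ x 4 = 1
  · simp [c7]
  rw [if_neg c0, if_neg c1, if_neg c2, if_neg c3, if_neg c4, if_neg c5, if_neg c6, if_neg c7] at h
  exact absurd rfl h

theorem lab_ne_nine {x : Contrib} : lab x ≠ 9 ↔ (x 1 = 0 ∧ x 2 = 0 ∧ x 3 = 0 ∧ x 4 = 0) ∨
    (x 0 = 0 ∧ x 2 = 0 ∧ x 3 = 0 ∧ x 4 = 0) ∨
    (x 0 = 0 ∧ x 1 = 0 ∧ x 2 ≤ 1 ∧ x 3 = 0 ∧ x 4 = 0) ∨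
    (x 0 = 0 ∧ x 1 = 0 ∧ x 2 = 0 ∧ x 3 ≤ 2 ∧ x 4 ≤ 1) := by
  constructor
  · intro h
    rcases lab_cases h with h | h | h | h | h | h | h | h | h <;> simp [h]
  · rintro (h | h | ⟨h0, h1, h2, h3, h4⟩ | ⟨h0, h1, h2, h3, h4⟩)
    · by_cases h0 : x 0 = 0 <;> simp [lab, h, h0]
    · by_cases h0 : x 1 = 0 <;> simp [lab, h, h0]
    · have : x 2 = 0 ∨ x 2 = 1 := by omega
      rcases this with h2 | h2 <;> simp [lab, h0, h1, h2, h3, h4]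
    · have : x 3 = 0 ∨ x 3 = 1 ∨ x 3 = 2 := by omega
      have : x 4 = 0 ∨ x 4 = 1 := by omega
      rcases this with h4 | h4 <;> rcases ‹x 3 = 0 ∨ _› with h3 | h3 | h3 <;>
        simp [lab, h0, h1, h2, h3, h4]

/-- Contributions only grow, so a contradiction is never repaired and can be discarded at once. -/
theorem lab_ne_nine_of_add {x y : Contrib} (h : lab (x + y) ≠ 9) : lab x ≠ 9 := by
  rw [lab_ne_nine] at h ⊢
  simp only [Pi.add_apply] at h
  omega

theorem lab_lt_nine {x : Contrib} (h : lab x ≠ 9) : lab x < 9 := by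
  unfold lab at h ⊢
  split_ifs at h ⊢ <;> omega

theorem IsFinal.lab_ne_nine {x : Contrib} (h : IsFinal x) : lab x ≠ 9 := by
  unfold IsFinal at h; omega

theorem lab_zero : lab 0 = 0 := by simp [lab]

theorem lab_unit (a : Fin 5) : lab (unit a) = a + 1 := by
  fin_cases a <;> simp [lab, unit_apply]

/-- The compatible pairs of labels with their sums. -/
def opList : List (ℕ × ℕ × ℕ) :=
  [(0, 0, 0), (1, 0, 1), (2, 0, 2), (3, 0, 3), (4, 0, 4), (5, 0, 5), (6, 0, 6), (7, 0, 7),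
    (8, 0, 8), (0, 1, 1), (0, 2, 2), (0, 3, 3), (0, 4, 4), (0, 5, 5), (0, 6, 6), (0, 7, 7),
    (0, 8, 8), (1, 1, 1), (2, 2, 2), (4, 4, 6), (4, 5, 7), (5, 4, 7), (4, 7, 8), (7, 4, 8),
    (5, 6, 8), (6, 5, 8)]

/-- The final labels with their costs. -/
def finalList : List (ℕ × ℕ × ℕ) :=
  -- The neutral row is repeated so that the special colour also has 26 rows. The middle entry is
  -- the label demanded of the second table: `1` exactly for a deleted vertex.
  [(0, 0, 0), (2, 0, 0), (3, 0, 0), (8, 0, 0), (1, 1, 0)] ++ List.replicate 21 (0, 0, 0)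

/-- The sum of two labels, according to `opList`. -/
def opTab (a b : ℕ) : ℕ := ((opList.find? fun t => t.1 = a ∧ t.2.1 = b).map (·.2.2)).getD 9

/-- Nothing but the label has to be remembered: for deletions and centres only their presence
matters, and the other kinds are counted exactly within the few numbers that are admissible. -/
theorem lab_add {x y : Contrib} (hx : lab x ≠ 9) (hy : lab y ≠ 9) :
    lab (x + y) = opTab (lab x) (lab y) := by
  rcases lab_cases hx with h | h | h | h | h | h | h | h | h <;>
  rcases lab_cases hy with k | k | k | k | k | k | k | k | k <;>
  · obtain ⟨h, h0, h1, h2, h3, h4⟩ := h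
    obtain ⟨k, k0, k1, k2, k3, k4⟩ := k
    rw [h, k]
    simp [lab, h0, h1, h2, h3, h4, k0, k1, k2, k3, k4, opTab, opList]

/-- Of the 81 pairs of labels only 26 are compatible; this number is the base of the exponential in
the running time of a convolution. -/
theorem opList_complete {x y : Contrib} (hx : lab x ≠ 9) (hy : lab y ≠ 9) (h : lab (x + y) ≠ 9) :
    ∃ k < 26, opList.getD k (0, 0, 0) = (lab x, lab y, lab (x + y)) := by
  have key : ∀ a < 9, ∀ b < 9, opTab a b ≠ 9 →
      ∃ k < 26, opList.getD k (0, 0, 0) = (a, b, opTab a b) := by decide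
  rw [lab_add hx hy] at h ⊢
  exact key _ (lab_lt_nine hx) _ (lab_lt_nine hy) h

theorem opList_sound {x y : Contrib} (hx : lab x ≠ 9) (hy : lab y ≠ 9) {k : ℕ} (hk : k < 26)
    (h1 : (opList.getD k (0, 0, 0)).1 = lab x) (h2 : (opList.getD k (0, 0, 0)).2.1 = lab y) :
    lab (x + y) = (opList.getD k (0, 0, 0)).2.2 ∧ lab (x + y) ≠ 9 := by
  have key : ∀ k < 26, opTab (opList.getD k (0, 0, 0)).1 (opList.getD k (0, 0, 0)).2.1 =
    (opList.getD k (0, 0, 0)).2.2 ∧ (opList.getD k (0, 0, 0)).2.2 ≠ 9 := by decide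
  have := key k hk
  rw [lab_add hx hy, ← h1, ← h2]
  exact ⟨this.1, this.1.symm ▸ this.2⟩

/-- The relation between the labels at the colour `p`: the addition of labels, and the removal of
final labels at the special colour `c`. -/
def relAt (c p k : ℕ) : ℕ × ℕ × ℕ :=
  (opList ++ finalList).getD ((if p = c then 26 else 0) + k) (0, 0, 0)

theorem relAt_of_ne {c p k : ℕ} (h : p ≠ c) (hk : k < 26) :
    relAt c p k = opList.getD k (0, 0, 0) := by
  rw [relAt, if_neg h, zero_add, List.getD_append _ _ _ _ (by simpa [opList] using hk)]

theorem relAt_self {c k : ℕ} : relAt c c k = finalList.getD k (0, 0, 0) := by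
  rw [relAt, if_pos rfl, List.getD_append_right _ _ _ _ (by simp [opList])]
  simp [opList]

/-- Row `0` is neutral for the addition of labels and for the removal of a vertex alike. It serves
colours that do not occur in a scope, and it allows the list of tuples to be extended in place. -/
theorem relAt_zero (c p : ℕ) : relAt c p 0 = (0, 0, 0) := by
  by_cases h : p = c
  · subst h; rw [relAt_self]; rfl
  · rw [relAt_of_ne h (by norm_num)]; rfl

theorem relAt_lt (c p : ℕ) {k : ℕ} (hk : k < 26) :
    (relAt c p k).1 < 9 ∧ (relAt c p k).2.1 < 9 ∧ (relAt c p k).2.2 < 9 := by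
  by_cases h : p = c
  · subst h; rw [relAt_self]; revert k; decide
  · rw [relAt_of_ne h hk]; revert k; decide

/-- Ensures that colours outside the scope keep the digit `0`. -/
theorem relAt_eq_zero (c p : ℕ) {k : ℕ} (hk : k < 26) (h1 : (relAt c p k).1 = 0)
    (h2 : (relAt c p k).2.1 = 0) : (relAt c p k).2.2 = 0 := by
  by_cases h : p = c
  · subst h; rw [relAt_self] at *; revert k; decide
  · rw [relAt_of_ne h hk] at *; revert k; decide

/-! ### Sets of partial configurations -/

namespace ElimOrder

/-- A partial configuration: contributions to the vertices, and a cost. -/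
abbrev Partial := (ℕ → Contrib) × ℕ

/-- Sums of two partial configurations. -/
def convSet (R S : Set Partial) : Set Partial :=
  {p | ∃ a ∈ R, ∃ b ∈ S, p = (a.1 + b.1, a.2 + b.2) ∧ ∀ v, lab ((a.1 + b.1) v) ≠ 9}

/-- The partial configurations in which the vertex `v` is final, with `v` removed. -/
def forgetSet (v : ℕ) (R : Set Partial) : Set Partial :=
  {p | ∃ a ∈ R, IsFinal (a.1 v) ∧ p = (Function.update a.1 v 0, a.2 + cost (a.1 v))}

variable (O : ElimOrder)

/-- The contributions of one item. -/
def optSet (it : Item) : Set Partial := {p | O.Opt it p.1 ∧ p.2 = 0}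

/-- The configurations of the items that are owned by `D` or belong to `P`, with the vertices in `D`
removed. -/
def midSet (D : Finset ℕ) (P : Finset Item) : Set Partial :=
  {p | ∃ o : Item → ℕ → Contrib, (∀ it, O.Opt it (o it)) ∧ (∀ v ∈ D, IsFinal (O.tot D o v)) ∧
    p.1 = (fun v => if v ∈ D then 0 else O.tot D o v) + ∑ it ∈ P, o it ∧
    p.2 = ∑ v ∈ D, cost (O.tot D o v) ∧ ∀ v, lab (p.1 v) ≠ 9}

variable {O}

theorem Opt.support {it : Item} {δ : ℕ → Contrib} (h : O.Opt it δ) {v : ℕ} (h1 : v ≠ it.1)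
    (h2 : v ≠ it.2.1) (h3 : v ≠ it.2.2) : δ v = 0 := by
  rcases h with ⟨-, -, h⟩ | ⟨-, -, h⟩ | ⟨-, -, h⟩
  · rcases h with h | h | h | h | h <;> rw [h] <;> simp [h1, h2]
  · rcases h with h | h <;> rw [h] <;> simp [h1, h2, h3]
  · rw [h]; rfl

theorem mem_items {D : Finset ℕ} {it : Item} :
    it ∈ O.items D ↔ it.1 ∈ D ∧ it.2.1 ∈ O.bl it.1 ∧ it.2.2 ∈ O.bl it.1 := by
  simp [items]

theorem tot_apply_eq_zero {o : Item → ℕ → Contrib} (ho : ∀ it, O.Opt it (o it)) {D : Finset ℕ}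
    {v : ℕ} (hv : v ∉ D) (h : ∀ d ∈ D, v ∉ O.bl d) : O.tot D o v = 0 := by
  rw [tot, Finset.sum_apply]
  refine Finset.sum_eq_zero fun it hit => ?_
  rw [mem_items] at hit
  refine (ho it).support ?_ ?_ ?_
  · rintro rfl; exact hv hit.1
  · rintro rfl; exact h _ hit.1 hit.2.1
  · rintro rfl; exact h _ hit.1 hit.2.2

theorem exists_opt (it : Item) : ∃ δ, O.Opt it δ := by
  by_cases h1 : it.2.1 = it.2.2 ∧ O.adj it.1 it.2.1
  · exact ⟨_, .inl ⟨h1.1, h1.2, .inl rfl⟩⟩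
  · by_cases h2 : it.2.2 < it.2.1 ∧ O.adj it.1 it.2.1 ∧ O.adj it.1 it.2.2 ∧ O.adj it.2.1 it.2.2
    · exact ⟨_, .inr (.inl ⟨h2.1, h2.2, .inl rfl⟩)⟩
    · exact ⟨_, .inr (.inr ⟨h1, h2, rfl⟩)⟩

theorem midSet_empty : O.midSet ∅ ∅ = {(0, 0)} := by
  ext ⟨σ, k⟩
  simp only [midSet, Set.mem_ofPred_eq, Set.mem_singleton_iff, Prod.mk.injEq]
  constructor
  · rintro ⟨o, -, -, rfl, rfl, -⟩
    simp [tot, items]; rfl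
  · rintro ⟨rfl, rfl⟩
    choose o ho using exists_opt (O := O)
    exact ⟨o, ho, by simp, by simp [tot, items]; rfl, by simp, fun v => by simp [lab_zero]⟩

theorem tot_congr {o o' : Item → ℕ → Contrib} {D : Finset ℕ} (h : ∀ it ∈ O.items D, o it = o' it) :
    O.tot D o = O.tot D o' := Finset.sum_congr rfl h

/-- Options of different items are independent: the choice for `it` can be overwritten without
affecting the totals of `D` or the other members of `P`. -/
theorem convSet_optSet {D : Finset ℕ} {P : Finset Item} {it : Item} (hP : it ∉ P)
    (hD : it ∉ O.items D) : convSet (O.midSet D P) (O.optSet it) = O.midSet D (insert it P) := by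
  classical
  ext p
  constructor
  · rintro ⟨a, ⟨o, ho, hf, h1, h2, hg⟩, b, ⟨hb, hb'⟩, rfl, hgood⟩
    have ht : O.tot D (Function.update o it b.1) = O.tot D o := tot_congr fun it' hit' => by
      rw [Function.update_of_ne]; rintro rfl; exact hD hit'
    refine ⟨Function.update o it b.1, fun it' => ?_, ?_, ?_, ?_, hgood⟩
    · by_cases h : it' = it
      · subst h; rwa [Function.update_self]
      · rw [Function.update_of_ne h]; exact ho it'
    · rwa [ht]
    · rw [ht, Finset.sum_insert hP, Function.update_self]
      have : ∑ x ∈ P, Function.update o it b.1 x = ∑ x ∈ P, o x := Finset.sum_congr rfl fun x hx => by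
        rw [Function.update_of_ne]; rintro rfl; exact hP hx
      rw [this]
      dsimp only
      rw [h1]
      abel
    · rw [ht, ← h2, hb', add_zero]
  · rintro ⟨o, ho, hf, h1, h2, hg⟩
    rw [Finset.sum_insert hP] at h1
    have h1' : p.1 = ((fun v => if v ∈ D then 0 else O.tot D o v) + ∑ it ∈ P, o it) + o it := by
      rw [h1]; abel
    refine ⟨((fun v => if v ∈ D then 0 else O.tot D o v) + ∑ it ∈ P, o it, p.2),
      ⟨o, ho, hf, rfl, h2, fun v => ?_⟩, (o it, 0), ⟨ho it, rfl⟩, ?_, ?_⟩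
    · have := hg v
      rw [h1'] at this
      exact lab_ne_nine_of_add this
    · exact Prod.ext h1' (by simp)
    · rw [← h1']; exact hg

/-- Allows the program to skip pairs that are neither an edge nor a triangle. -/
theorem midSet_insert_trivial {D : Finset ℕ} {P : Finset Item} {it : Item}
    (h : ∀ δ, O.Opt it δ → δ = 0) : O.midSet D (insert it P) = O.midSet D P := by
  classical
  by_cases hP : it ∈ P
  · rw [Finset.insert_eq_of_mem hP]
  · ext p
    simp only [midSet, Set.mem_ofPred_eq]
    refine exists_congr fun o => and_congr_right fun ho => ?_
    rw [Finset.sum_insert hP, h _ (ho it), zero_add]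

/-- All of `D` lies above `i`, whereas the items owned by `i` touch only `i` and smaller vertices.
Hence they change neither the totals nor the costs inside `D`, and `i` can be finalised by itself.
-/
theorem forgetSet_midSet {D : Finset ℕ} {i : ℕ} (hD : ∀ d ∈ D, i < d) :
    forgetSet i (O.midSet D (O.items {i})) = O.midSet (insert i D) ∅ := by
  classical
  have hi : i ∉ D := fun h => lt_irrefl _ (hD i h)
  have htot : ∀ o : Item → ℕ → Contrib, O.tot (insert i D) o = O.tot D o + ∑ it ∈ O.items {i}, o it := by
    intro o
    have : O.items (insert i D) = O.items D ∪ O.items {i} := by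
      ext it; simp [mem_items]; tauto
    rw [tot, this, Finset.sum_union, tot]
    rw [Finset.disjoint_left]
    intro it h1 h2
    rw [mem_items] at h1 h2
    rw [Finset.mem_singleton] at h2
    exact hi (h2.1 ▸ h1.1)
  have hz : ∀ {o : Item → ℕ → Contrib}, (∀ it, O.Opt it (o it)) → ∀ v ∈ D, (∑ it ∈ O.items {i}, o it) v = 0 := by
    intro o ho v hv
    refine tot_apply_eq_zero ho (D := {i}) ?_ ?_
    · have := hD v hv; simp; omega
    · intro d hd hvd
      have := hD v hv
      have := (O.mem_lt _ _ hvd).2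
      simp at hd
      omega
  have heq : ∀ {o : Item → ℕ → Contrib}, (∀ it, O.Opt it (o it)) → ∀ v ∈ D, O.tot (insert i D) o v = O.tot D o v := by
    intro o ho v hv
    rw [htot, Pi.add_apply, hz ho v hv, add_zero]
  ext p
  constructor
  · rintro ⟨a, ⟨o, ho, hf, h1, h2, hg⟩, hfin, rfl⟩
    have hai : a.1 i = O.tot (insert i D) o i := by rw [h1, htot]; simp [hi]
    refine ⟨o, ho, ?_, ?_, ?_, ?_⟩
    · intro v hv
      rcases Finset.mem_insert.mp hv with rfl | hv
      · rwa [← hai]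
      · rw [heq ho v hv]; exact hf v hv
    · funext v
      dsimp only
      by_cases hvi : v = i
      · subst hvi; simp
      · rw [Function.update_of_ne hvi, h1, htot]
        by_cases hv : v ∈ D
        · simpa [hv] using hz ho v hv
        · simp [hv, hvi]
    · dsimp only
      rw [Finset.sum_insert hi, ← hai, h2, add_comm]
      congr 1
      exact Finset.sum_congr rfl fun v hv => by rw [heq ho v hv]
    · intro v
      dsimp only
      by_cases hvi : v = i
      · subst hvi; simp [lab_zero]
      · rw [Function.update_of_ne hvi]; exact hg v
  · rintro ⟨o, ho, hf, h1, h2, hg⟩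
    have h1i := congrFun h1
    refine ⟨((fun v => if v ∈ D then 0 else O.tot D o v) + ∑ it ∈ O.items {i}, o it,
      ∑ v ∈ D, cost (O.tot D o v)), ⟨o, ho, fun v hv => ?_, rfl, rfl, fun v => ?_⟩, ?_, ?_⟩
    · rw [← heq ho v hv]; exact hf v (Finset.mem_insert_of_mem hv)
    · by_cases hvi : v = i
      · subst hvi
        have := (hf v (Finset.mem_insert_self _ _)).lab_ne_nine
        rw [htot] at this
        simpa [hi] using this
      · by_cases hv : v ∈ D
        · simp only [Pi.add_apply, hv, if_true, hz ho v hv, add_zero, lab_zero]; decide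
        · have := hg v
          rw [h1i v, htot] at this
          simpa [hv, hvi] using this
    · have := hf i (Finset.mem_insert_self _ _)
      rw [htot] at this
      simpa [hi] using this
    · refine Prod.ext ?_ ?_
      · funext v
        rw [h1i v]
        dsimp only
        by_cases hvi : v = i
        · subst hvi; simp
        · rw [Function.update_of_ne hvi, htot]
          by_cases hv : v ∈ D
          · simpa [hv] using (hz ho v hv).symm
          · simp [hv, hvi]
      · dsimp only
        rw [h2, Finset.sum_insert hi, add_comm]
        congr 1
        · exact Finset.sum_congr rfl fun v hv => by rw [heq ho v hv]
        · rw [htot]; simp [hi]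

/-- The hypotheses say that the items of either side do not touch the removed vertices of the other.
Choices for the two sides can then be made separately and glued according to the owner of an item.
-/
theorem convSet_midSet {D D' : Finset ℕ} (hd : Disjoint D D') (h : ∀ d ∈ D, ∀ v ∈ D', v ∉ O.bl d)
    (h' : ∀ d ∈ D', ∀ v ∈ D, v ∉ O.bl d) :
    convSet (O.midSet D ∅) (O.midSet D' ∅) = O.midSet (D ∪ D') ∅ := by
  classical
  have hdi : Disjoint (O.items D) (O.items D') := by
    rw [Finset.disjoint_left]
    intro it h1 h2
    rw [mem_items] at h1 h2
    exact Finset.disjoint_left.mp hd h1.1 h2.1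
  have htot : ∀ o : Item → ℕ → Contrib, O.tot (D ∪ D') o = O.tot D o + O.tot D' o := by
    intro o
    have : O.items (D ∪ D') = O.items D ∪ O.items D' := by
      ext it; simp [mem_items]; tauto
    rw [tot, this, Finset.sum_union hdi, tot, tot]
  have hz : ∀ {o : Item → ℕ → Contrib}, (∀ it, O.Opt it (o it)) → ∀ v ∈ D, O.tot D' o v = 0 := fun ho v hv =>
    tot_apply_eq_zero ho (Finset.disjoint_left.mp hd hv) fun d hd' => h' d hd' v hv
  have hz' : ∀ {o : Item → ℕ → Contrib}, (∀ it, O.Opt it (o it)) → ∀ v ∈ D', O.tot D o v = 0 := fun ho v hv =>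
    tot_apply_eq_zero ho (Finset.disjoint_right.mp hd hv) fun d hd' => h d hd' v hv
  ext p
  simp only [convSet, midSet, Finset.sum_empty, add_zero, Set.mem_ofPred_eq]
  constructor
  · rintro ⟨a, ⟨o, ho, hf, h1, h2, -⟩, b, ⟨o', ho', hf', h1', h2', -⟩, rfl, hg⟩
    let oo : Item → ℕ → Contrib := fun it => if it ∈ O.items D then o it else o' it
    have hoo : ∀ it, O.Opt it (oo it) := fun it => by
      dsimp only [oo]; split_ifs; exacts [ho it, ho' it]
    have t1 : O.tot D oo = O.tot D o := tot_congr fun it hit => if_pos hit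
    have t2 : O.tot D' oo = O.tot D' o' :=
      tot_congr fun it hit => if_neg (Finset.disjoint_right.mp hdi hit)
    refine ⟨oo, hoo, ?_, ?_, ?_, hg⟩
    · intro v hv
      rcases Finset.mem_union.mp hv with hv | hv
      · rw [htot, Pi.add_apply, hz hoo v hv, add_zero, t1]; exact hf v hv
      · rw [htot, Pi.add_apply, hz' hoo v hv, zero_add, t2]; exact hf' v hv
    · funext v
      simp only [h1, h1', htot, Pi.add_apply, Finset.mem_union]
      by_cases hv : v ∈ D
      · simp [hv, ← t2, hz hoo v hv]
      · by_cases hv' : v ∈ D'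
        · simp [hv, hv', ← t1, hz' hoo v hv']
        · simp [hv, hv', t1, t2]
    · rw [Finset.sum_union hd]
      dsimp only
      rw [h2, h2']
      congr 1
      · exact Finset.sum_congr rfl fun v hv => by
          rw [htot, Pi.add_apply, hz hoo v hv, add_zero, t1]
      · exact Finset.sum_congr rfl fun v hv => by
          rw [htot, Pi.add_apply, hz' hoo v hv, zero_add, t2]
  · rintro ⟨o, ho, hf, h1, h2, hg⟩
    have e1 : ∀ v ∈ D, O.tot (D ∪ D') o v = O.tot D o v := fun v hv => by
      rw [htot, Pi.add_apply, hz ho v hv, add_zero]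
    have e2 : ∀ v ∈ D', O.tot (D ∪ D') o v = O.tot D' o v := fun v hv => by
      rw [htot, Pi.add_apply, hz' ho v hv, zero_add]
    have hsum : p.1 = (fun v => if v ∈ D then 0 else O.tot D o v) +
        (fun v => if v ∈ D' then 0 else O.tot D' o v) := by
      rw [h1]
      funext v
      simp only [htot, Pi.add_apply, Finset.mem_union]
      by_cases hv : v ∈ D
      · simp [hv, hz ho v hv]
      · by_cases hv' : v ∈ D'
        · simp [hv, hv', hz' ho v hv']
        · simp [hv, hv']
    rw [hsum] at hg
    refine ⟨(fun v => if v ∈ D then 0 else O.tot D o v, ∑ v ∈ D, cost (O.tot D o v)),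
      ⟨o, ho, fun v hv => ?_, rfl, rfl, fun v => lab_ne_nine_of_add (hg v)⟩,
      (fun v => if v ∈ D' then 0 else O.tot D' o v, ∑ v ∈ D', cost (O.tot D' o v)),
      ⟨o, ho, fun v hv => ?_, rfl, rfl, fun v => lab_ne_nine_of_add (y :=
        (fun v => if v ∈ D then 0 else O.tot D o v) v) (by rw [add_comm]; exact hg v)⟩,
      Prod.ext hsum ?_, hg⟩
    · rw [← e1 v hv]; exact hf v (Finset.mem_union_left _ hv)
    · rw [← e2 v hv]; exact hf v (Finset.mem_union_right _ hv)
    · dsimp only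
      rw [h2, Finset.sum_union hd]
      congr 1
      · exact Finset.sum_congr rfl fun v hv => by rw [e1 v hv]
      · exact Finset.sum_congr rfl fun v hv => by rw [e2 v hv]

/-- Every partial configuration is supported on `Z`, and no label is contradictory. -/
def On (Z : Finset ℕ) (R : Set Partial) : Prop :=
  ∀ p ∈ R, (∀ v, v ∉ Z → p.1 v = 0) ∧ ∀ v, lab (p.1 v) ≠ 9

/-- This is what bounds the size of tables. The condition `hD` is maintained by `Forest`: neighbours
of removed vertices that are not themselves removed belong to the scope of `i`. -/
theorem on_midSet {D : Finset ℕ} {P : Finset Item} {i : ℕ} (hP : P ⊆ O.items {i})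
    (hD : ∀ d ∈ D, ∀ v ∈ O.bl d, v ∈ D ∨ v = i ∨ v ∈ O.bl i) :
    On (insert i (O.bl i).toFinset) (O.midSet D P) := by
  rintro p ⟨o, ho, -, h1, -, hg⟩
  refine ⟨fun v hv => ?_, hg⟩
  simp only [Finset.mem_insert, List.mem_toFinset, not_or] at hv
  rw [h1, Pi.add_apply, Finset.sum_apply]
  have h2 : ∑ it ∈ P, o it v = 0 := by
    refine Finset.sum_eq_zero fun it hit => ?_
    have := mem_items.mp (hP hit)
    rw [Finset.mem_singleton] at this
    obtain ⟨h, h', h''⟩ := this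
    rw [h] at h' h''
    refine (ho it).support ?_ ?_ ?_
    · rw [h]; exact hv.1
    · rintro rfl; exact hv.2 h'
    · rintro rfl; exact hv.2 h''
  rw [h2, add_zero]
  by_cases hvD : v ∈ D
  · simp [hvD]
  · simp only [hvD, if_false]
    refine tot_apply_eq_zero ho hvD fun d hd hvd => ?_
    have := hD d hd v hvd
    tauto

theorem on_optSet {it : Item} {i : ℕ} (hit : it ∈ O.items {i}) :
    On (insert i (O.bl i).toFinset) (O.optSet it) := by
  rintro p ⟨hp, -⟩
  have := mem_items.mp hit
  rw [Finset.mem_singleton] at this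
  obtain ⟨h, h', h''⟩ := this
  rw [h] at h' h''
  refine ⟨fun v hv => ?_, fun v => ?_⟩
  · simp only [Finset.mem_insert, List.mem_toFinset, not_or] at hv
    refine hp.support ?_ ?_ ?_
    · rw [h]; exact hv.1
    · rintro rfl; exact hv.2 h'
    · rintro rfl; exact hv.2 h''
  · have hne1 := (O.mem_lt _ _ h').2
    have hne2 := (O.mem_lt _ _ h'').2
    have z := lab_zero
    rcases hp with ⟨h1, h2, h3⟩ | ⟨h1, h2, h3⟩ | ⟨-, -, h3⟩
    · have hne := O.ne _ _ h2
      rcases h3 with h3 | h3 | h3 | h3 | h3 <;> rw [h3] <;> by_cases hv : v = it.1 <;>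
        by_cases hv' : v = it.2.1 <;> subst_vars <;> simp_all [lab_unit, Pi.single_apply]
    · have hne := O.ne _ _ h2.1
      have hne' := O.ne _ _ h2.2.1
      have hne'' := O.ne _ _ h2.2.2
      rcases h3 with h3 | h3 <;> rw [h3] <;> by_cases hv : v = it.1 <;>
        by_cases hv' : v = it.2.1 <;> by_cases hv'' : v = it.2.2 <;> subst_vars <;>
        simp_all [lab_unit, Pi.single_apply]
    · rw [h3]; simp [z]

end ElimOrder

/-! ### Tables -/

/-- The number with base-`9` digits `a 0, …, a (W - 1)`. -/
def code9 (W : ℕ) (a : ℕ → ℕ) : ℕ := ∑ p ∈ Finset.range W, a p * 9 ^ p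

theorem code9_lt {W : ℕ} {a : ℕ → ℕ} (h : ∀ p < W, a p < 9) : code9 W a < 9 ^ W := by
  induction W with
  | zero => simp [code9]
  | succ W ih =>
    have h1 := ih fun p hp => h p (by omega)
    have h2 : a W * 9 ^ W ≤ 8 * 9 ^ W := Nat.mul_le_mul_right _ (by have := h W (by omega); omega)
    rw [code9, Finset.sum_range_succ, pow_succ]
    rw [code9] at h1
    omega

theorem code9_inj {W : ℕ} {a b : ℕ → ℕ} (ha : ∀ p < W, a p < 9) (hb : ∀ p < W, b p < 9)
    (h : code9 W a = code9 W b) : ∀ p < W, a p = b p := by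
  induction W with
  | zero => intro p hp; omega
  | succ W ih =>
    have la := code9_lt (W := W) fun p hp => ha p (by omega)
    have lb := code9_lt (W := W) fun p hp => hb p (by omega)
    have h' : code9 W a + a W * 9 ^ W = code9 W b + b W * 9 ^ W := by
      simpa [code9, Finset.sum_range_succ] using h
    have hW : a W = b W := by
      have h1 : (code9 W a + a W * 9 ^ W) / 9 ^ W = a W := by
        rw [Nat.add_mul_div_right _ _ (by positivity), Nat.div_eq_of_lt la, zero_add]
      have h2 : (code9 W b + b W * 9 ^ W) / 9 ^ W = b W := by
        rw [Nat.add_mul_div_right _ _ (by positivity), Nat.div_eq_of_lt lb, zero_add]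
      rw [← h1, h', h2]
    rw [hW] at h'
    intro p hp
    rcases Nat.lt_succ_iff_lt_or_eq.mp hp with hp | rfl
    · exact ih (fun p hp => ha p (by omega)) (fun p hp => hb p (by omega)) (by omega) p hp
    · exact hW

theorem code9_congr {W : ℕ} {a b : ℕ → ℕ} (h : ∀ p < W, a p = b p) : code9 W a = code9 W b :=
  Finset.sum_congr rfl fun p hp => by rw [h p (Finset.mem_range.mp hp)]

/-- The table `h` is the max-plus convolution of `f` and `g` with respect to the relations
`relAt c p` between the digits at the positions `p < W`. -/
structure IsConv (W big c : ℕ) (f g h : ℕ → ℕ) : Prop where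
  le : ∀ κ : ℕ → ℕ, (∀ p, κ p < 26) →
    f (code9 W fun p => (relAt c p (κ p)).1) + g (code9 W fun p => (relAt c p (κ p)).2.1) - big ≤
      h (code9 W fun p => (relAt c p (κ p)).2.2)
  ex : ∀ x < 9 ^ W, 0 < h x → ∃ κ : ℕ → ℕ, (∀ p, κ p < 26) ∧
    x = code9 W (fun p => (relAt c p (κ p)).2.2) ∧
    h x = f (code9 W fun p => (relAt c p (κ p)).1) + g (code9 W fun p => (relAt c p (κ p)).2.1) - big

namespace ElimOrder

/-- A colouring of `{1, …, n}` with `W` colours in which `i` and the members of `bl i` have different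
colours. -/
structure Colouring (O : ElimOrder) (W : ℕ) where
  col : ℕ → ℕ
  lt : ∀ i, 1 ≤ i → i ≤ O.n → col i < W
  ne : ∀ i, ∀ j ∈ O.bl i, col j ≠ col i

variable {O : ElimOrder} {W : ℕ} (χ : O.Colouring W)

/-- The scope of the tables at `i`. -/
def scope (O : ElimOrder) (i : ℕ) : Finset ℕ := insert i (O.bl i).toFinset

theorem scope_subset {i : ℕ} (h1 : 1 ≤ i) (hi : i ≤ O.n) : O.scope i ⊆ Finset.Icc 1 O.n := by
  intro v hv
  simp only [scope, Finset.mem_insert, List.mem_toFinset] at hv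
  rw [Finset.mem_Icc]
  rcases hv with rfl | hv
  · exact ⟨h1, hi⟩
  · have := O.mem_lt _ _ hv; omega

/-- By the clique property of a scope, the smaller of two members is in the list of the larger, so
the condition on the colours of lists separates all of them. -/
theorem Colouring.injOn (i : ℕ) : Set.InjOn χ.col (O.scope i) := by
  have key : ∀ u ∈ O.scope i, ∀ v ∈ O.scope i, u < v → χ.col u ≠ χ.col v := by
    intro u hu v hv huv
    simp only [scope, Finset.mem_insert, List.mem_toFinset] at hu hv
    rcases hv with rfl | hv
    · rcases hu with rfl | hu
      · omega
      · exact χ.ne _ _ hu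
    · rcases hu with rfl | hu
      · have := O.mem_lt _ _ hv; omega
      · exact χ.ne _ _ (O.clique _ _ _ hu hv huv)
  intro u hu v hv huv
  by_contra hne
  rcases lt_or_gt_of_ne hne with h | h
  · exact key u hu v hv h huv
  · exact key v hv u hu h huv.symm

/-- The digit of the colour `p`. -/
def digit (σ : ℕ → Contrib) (p : ℕ) : ℕ := ∑ v ∈ (Finset.Icc 1 O.n).filter (χ.col · = p), lab (σ v)

/-- The index of a partial configuration in a table. -/
def enc (σ : ℕ → Contrib) : ℕ := code9 W (digit χ σ)

variable {χ}

theorem digit_of_mem {Z : Finset ℕ} (hZ : Z ⊆ Finset.Icc 1 O.n) (hinj : Set.InjOn χ.col Z)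
    {σ : ℕ → Contrib} (hσ : ∀ v, v ∉ Z → σ v = 0) {v : ℕ} (hv : v ∈ Z) :
    digit χ σ (χ.col v) = lab (σ v) := by
  rw [digit, Finset.sum_eq_single_of_mem v]
  · simp [Finset.mem_Icc.mp (hZ hv)]
  · intro u hu huv
    rw [hσ u, lab_zero]
    intro huZ
    exact huv (hinj huZ hv (Finset.mem_filter.mp hu).2)

theorem digit_of_notMem {Z : Finset ℕ} {σ : ℕ → Contrib} (hσ : ∀ v, v ∉ Z → σ v = 0) {p : ℕ}
    (hp : ∀ v ∈ Z, χ.col v ≠ p) : digit χ σ p = 0 := by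
  rw [digit]
  refine Finset.sum_eq_zero fun v hv => ?_
  rw [hσ v, lab_zero]
  intro h
  exact hp v h (Finset.mem_filter.mp hv).2

theorem digit_lt {Z : Finset ℕ} (hZ : Z ⊆ Finset.Icc 1 O.n) (hinj : Set.InjOn χ.col Z)
    {σ : ℕ → Contrib} (hσ : ∀ v, v ∉ Z → σ v = 0) (hg : ∀ v, lab (σ v) ≠ 9) (p : ℕ) :
    digit χ σ p < 9 := by
  by_cases h : ∃ v ∈ Z, χ.col v = p
  · obtain ⟨v, hv, rfl⟩ := h
    rw [digit_of_mem hZ hinj hσ hv]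
    exact lab_lt_nine (hg v)
  · push Not at h
    rw [digit_of_notMem hσ h]
    norm_num

theorem enc_eq {σ : ℕ → Contrib} : enc χ σ = ∑ v ∈ Finset.Icc 1 O.n, lab (σ v) * 9 ^ χ.col v := by
  rw [enc, code9]
  simp only [digit, Finset.sum_mul]
  rw [← Finset.sum_fiberwise_of_maps_to (s := Finset.Icc 1 O.n) (t := Finset.range W) (g := χ.col)]
  · refine Finset.sum_congr rfl fun p _ => Finset.sum_congr rfl fun v hv => ?_
    rw [(Finset.mem_filter.mp hv).2]
  · intro v hv
    rw [Finset.mem_Icc] at hv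
    exact Finset.mem_range.mpr (χ.lt v hv.1 hv.2)

theorem enc_lt {Z : Finset ℕ} (hZ : Z ⊆ Finset.Icc 1 O.n) (hinj : Set.InjOn χ.col Z)
    {σ : ℕ → Contrib} (hσ : ∀ v, v ∉ Z → σ v = 0) (hg : ∀ v, lab (σ v) ≠ 9) :
    enc χ σ < 9 ^ W := code9_lt fun p _ => digit_lt hZ hinj hσ hg p

variable (χ)

/-- The table `f` holds `big - k` for the smallest cost `k` of a partial configuration in `R` with
the given index. -/
structure Rep (big : ℕ) (f : ℕ → ℕ) (R : Set Partial) : Prop where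
  le : ∀ p ∈ R, big - p.2 ≤ f (enc χ p.1)
  ex : ∀ x < 9 ^ W, 0 < f x → ∃ p ∈ R, enc χ p.1 = x ∧ f x = big - p.2

variable {χ}

/-- The relation `comb` covers both uses of a convolution: the addition of labels, and the removal
of a final vertex. Entries have the form `big - cost`, with `0` for infeasible indices. Since no
entry of a table that represents a set exceeds `big`, the truncated value `f + g - big` is positive
only if both entries are, and then it is `big` minus the sum of the costs. -/
theorem rep_conv {big c : ℕ} {Z : Finset ℕ} (hZ : Z ⊆ Finset.Icc 1 O.n) (hinj : Set.InjOn χ.col Z)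
    (comb : ℕ → Contrib → Contrib → Contrib → Prop)
    (hc : ∀ v ∈ Z, ∀ x y z, lab x ≠ 9 → lab y ≠ 9 → comb v x y z →
      ∃ k < 26, relAt c (χ.col v) k = (lab x, lab y, lab z))
    (hs : ∀ v ∈ Z, ∀ x y k, k < 26 → lab x ≠ 9 → lab y ≠ 9 → (relAt c (χ.col v) k).1 = lab x →
      (relAt c (χ.col v) k).2.1 = lab y → ∃ z, comb v x y z ∧ lab z = (relAt c (χ.col v) k).2.2)
    {R S : Set Partial} (hR : On Z R) (hS : On Z S) {f g h : ℕ → ℕ} (hf : Rep χ big f R)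
    (hg : Rep χ big g S) (hh : IsConv W big c f g h) :
    Rep χ big h {p | ∃ a ∈ R, ∃ b ∈ S, (∀ v, v ∉ Z → p.1 v = 0) ∧
      (∀ v ∈ Z, comb v (a.1 v) (b.1 v) (p.1 v)) ∧ p.2 = a.2 + b.2} := by
  classical
  constructor
  · rintro ⟨σ, k⟩ ⟨a, ha, b, hb, hσ, hcomb, rfl⟩
    have key : ∀ p, ∃ k < 26, relAt c p k = (digit χ a.1 p, digit χ b.1 p, digit χ σ p) := by
      intro p
      by_cases hp : ∃ v ∈ Z, χ.col v = p
      · obtain ⟨v, hv, rfl⟩ := hp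
        rw [digit_of_mem hZ hinj (hR a ha).1 hv, digit_of_mem hZ hinj (hS b hb).1 hv,
          digit_of_mem hZ hinj hσ hv]
        exact hc v hv _ _ _ ((hR a ha).2 v) ((hS b hb).2 v) (hcomb v hv)
      · push Not at hp
        refine ⟨0, by norm_num, ?_⟩
        rw [digit_of_notMem (hR a ha).1 hp, digit_of_notMem (hS b hb).1 hp,
          digit_of_notMem hσ hp, relAt_zero]
    choose κ hκ hκ' using key
    have := hh.le κ hκ
    simp only [hκ'] at this
    have h1 := hf.le a ha
    have h2 := hg.le b hb
    have e : ∀ σ, enc χ σ = code9 W fun p => digit χ σ p := fun _ => rfl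
    rw [e] at h1 h2 ⊢
    dsimp only at this ⊢
    omega
  · intro x hx hpos
    obtain ⟨κ, hκ, rfl, hval⟩ := hh.ex x hx hpos
    have lA : code9 W (fun p => (relAt c p (κ p)).1) < 9 ^ W :=
      code9_lt fun p _ => (relAt_lt c p (hκ p)).1
    have lB : code9 W (fun p => (relAt c p (κ p)).2.1) < 9 ^ W :=
      code9_lt fun p _ => (relAt_lt c p (hκ p)).2.1
    have bf : f (code9 W fun p => (relAt c p (κ p)).1) ≤ big := by
      rcases Nat.eq_zero_or_pos (f (code9 W fun p => (relAt c p (κ p)).1)) with h0 | h0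
      · omega
      · obtain ⟨a, -, -, h⟩ := hf.ex _ lA h0; omega
    have bg : g (code9 W fun p => (relAt c p (κ p)).2.1) ≤ big := by
      rcases Nat.eq_zero_or_pos (g (code9 W fun p => (relAt c p (κ p)).2.1)) with h0 | h0
      · omega
      · obtain ⟨a, -, -, h⟩ := hg.ex _ lB h0; omega
    obtain ⟨a, ha, ea, va⟩ := hf.ex _ lA (by omega)
    obtain ⟨b, hb, eb, vb⟩ := hg.ex _ lB (by omega)
    have da := code9_inj (fun p _ => digit_lt hZ hinj (hR a ha).1 (hR a ha).2 p)
      (fun p _ => (relAt_lt c p (hκ p)).1) ea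
    have db := code9_inj (fun p _ => digit_lt hZ hinj (hS b hb).1 (hS b hb).2 p)
      (fun p _ => (relAt_lt c p (hκ p)).2.1) eb
    have hcol : ∀ v ∈ Z, χ.col v < W := fun v hv => by
      have := Finset.mem_Icc.mp (hZ hv); exact χ.lt v this.1 this.2
    have key : ∀ v, ∃ z, v ∈ Z → comb v (a.1 v) (b.1 v) z ∧
        lab z = (relAt c (χ.col v) (κ (χ.col v))).2.2 := by
      intro v
      by_cases hv : v ∈ Z
      · obtain ⟨z, hz⟩ := hs v hv (a.1 v) (b.1 v) (κ (χ.col v)) (hκ _) ((hR a ha).2 v)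
          ((hS b hb).2 v)
          (by rw [← da _ (hcol v hv), digit_of_mem hZ hinj (hR a ha).1 hv])
          (by rw [← db _ (hcol v hv), digit_of_mem hZ hinj (hS b hb).1 hv])
        exact ⟨z, fun _ => hz⟩
      · exact ⟨0, fun h => absurd h hv⟩
    choose ζ hζ using key
    have hσ : ∀ v, v ∉ Z → (fun v => if v ∈ Z then ζ v else 0) v = 0 := fun v hv => if_neg hv
    refine ⟨(fun v => if v ∈ Z then ζ v else 0, a.2 + b.2), ⟨a, ha, b, hb, hσ, fun v hv => ?_, rfl⟩,
      ?_, ?_⟩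
    · dsimp only
      rw [if_pos hv]
      exact (hζ v hv).1
    · refine code9_congr fun p hp => ?_
      by_cases hpZ : ∃ v ∈ Z, χ.col v = p
      · obtain ⟨v, hv, rfl⟩ := hpZ
        rw [digit_of_mem hZ hinj hσ hv, if_pos hv, (hζ v hv).2]
      · push Not at hpZ
        rw [digit_of_notMem hσ hpZ]
        refine (relAt_eq_zero c p (hκ p) ?_ ?_).symm
        · rw [← da p hp, digit_of_notMem (hR a ha).1 hpZ]
        · rw [← db p hp, digit_of_notMem (hS b hb).1 hpZ]
    · dsimp only
      omega

/-- Convolution without a special colour. -/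
theorem rep_convSet {big : ℕ} {Z : Finset ℕ} (hZ : Z ⊆ Finset.Icc 1 O.n) (hinj : Set.InjOn χ.col Z)
    {R S : Set Partial} (hR : On Z R) (hS : On Z S) {f g h : ℕ → ℕ} (hf : Rep χ big f R)
    (hg : Rep χ big g S) (hh : IsConv W big W f g h) : Rep χ big h (convSet R S) := by
  have hcol : ∀ v ∈ Z, χ.col v ≠ W := fun v hv => by
    have := Finset.mem_Icc.mp (hZ hv); exact (χ.lt v this.1 this.2).ne
  have := rep_conv hZ hinj (fun _ x y z => z = x + y ∧ lab z ≠ 9) (c := W)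
    (fun v hv x y z hx hy hz => by
      obtain ⟨rfl, hz⟩ := hz
      obtain ⟨k, hk, h⟩ := opList_complete hx hy hz
      exact ⟨k, hk, by rw [relAt_of_ne (hcol v hv) hk, h]⟩)
    (fun v hv x y k hk hx hy h1 h2 => by
      rw [relAt_of_ne (hcol v hv) hk] at h1 h2 ⊢
      have := opList_sound hx hy hk h1 h2
      exact ⟨x + y, ⟨rfl, this.2⟩, this.1⟩)
    hR hS hf hg hh
  convert this using 1
  ext p
  constructor
  · rintro ⟨a, ha, b, hb, rfl, hgood⟩
    exact ⟨a, ha, b, hb, fun v hv => by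
      simp [(hR a ha).1 v hv, (hS b hb).1 v hv], fun v _ => ⟨rfl, hgood v⟩, rfl⟩
  · rintro ⟨a, ha, b, hb, hσ, hcomb, h2⟩
    have : p.1 = a.1 + b.1 := by
      funext v
      by_cases hv : v ∈ Z
      · exact (hcomb v hv).1
      · simp [hσ v hv, (hR a ha).1 v hv, (hS b hb).1 v hv]
    refine ⟨a, ha, b, hb, Prod.ext this h2, fun v => ?_⟩
    by_cases hv : v ∈ Z
    · rw [← this]; exact (hcomb v hv).2
    · simp only [Pi.add_apply, (hR a ha).1 v hv, (hS b hb).1 v hv, add_zero, lab_zero]; decide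

/-- Convolution with a special colour. -/
theorem rep_forgetSet {big : ℕ} {Z : Finset ℕ} (hZ : Z ⊆ Finset.Icc 1 O.n)
    (hinj : Set.InjOn χ.col Z) {i : ℕ} (hi : i ∈ Z) {R : Set Partial} (hR : On Z R)
    {f g h : ℕ → ℕ} (hf : Rep χ big f R)
    (hg : Rep χ big g {((0 : ℕ → Contrib), 0), (Pi.single i (unit 0), 1)})
    (hh : IsConv W big (χ.col i) f g h) : Rep χ big h (forgetSet i R) := by
  have hS : On Z {((0 : ℕ → Contrib), 0), (Pi.single i (unit 0), 1)} := by
    rintro p (rfl | rfl)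
    · exact ⟨fun _ _ => rfl, fun v => by simp [lab_zero]⟩
    · refine ⟨fun v hv => ?_, fun v => ?_⟩
      · have : v ≠ i := by rintro rfl; exact hv hi
        simp [this]
      · by_cases hv : v = i
        · subst hv; simp [lab_unit]
        · simp [hv, lab_zero]
  have hcol : ∀ v ∈ Z, v ≠ i → χ.col v ≠ χ.col i := fun v hv hvi h => hvi (hinj hv hi h)
  -- The second table offers label `0` at `i` for free and label `1` at cost one. At the colour of
  -- `i` the relation matches each final label with the one that charges the right cost, and leaves
  -- the digit `0`.
  have := rep_conv hZ hinj (fun v x y z => if v = i then z = 0 ∧ IsFinal x ∧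
      ((lab x ≠ 1 ∧ lab y = 0) ∨ (lab x = 1 ∧ lab y = 1)) else z = x + y ∧ lab z ≠ 9) (c := χ.col i)
    (fun v hv x y z hx hy hz => by
      by_cases hvi : v = i
      · subst hvi
        simp only [if_true, IsFinal] at hz
        obtain ⟨rfl, hz, hz'⟩ := hz
        simp only [lab_zero, relAt_self]
        rcases hz with h | h | h | h | h
        · exact ⟨0, by norm_num, by have : lab y = 0 := by omega
                                    rw [h, this]; rfl⟩
        · exact ⟨4, by norm_num, by have : lab y = 1 := by omega
                                    rw [h, this]; rfl⟩
        · exact ⟨1, by norm_num, by have : lab y = 0 := by omega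
                                    rw [h, this]; rfl⟩
        · exact ⟨2, by norm_num, by have : lab y = 0 := by omega
                                    rw [h, this]; rfl⟩
        · exact ⟨3, by norm_num, by have : lab y = 0 := by omega
                                    rw [h, this]; rfl⟩
      · rw [if_neg hvi] at hz
        obtain ⟨rfl, hz⟩ := hz
        obtain ⟨k, hk, h⟩ := opList_complete hx hy hz
        exact ⟨k, hk, by rw [relAt_of_ne (hcol v hv hvi) hk, h]⟩)
    (fun v hv x y k hk hx hy h1 h2 => by
      by_cases hvi : v = i
      · subst hvi
        rw [relAt_self] at h1 h2 ⊢
        simp only [if_true, IsFinal]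
        refine ⟨0, ⟨rfl, ?_⟩, ?_⟩
        · have : ∀ k < 26, ((finalList.getD k (0, 0, 0)).1 = 0 ∨ (finalList.getD k (0, 0, 0)).1 = 1 ∨
            (finalList.getD k (0, 0, 0)).1 = 2 ∨ (finalList.getD k (0, 0, 0)).1 = 3 ∨
            (finalList.getD k (0, 0, 0)).1 = 8) ∧ (((finalList.getD k (0, 0, 0)).1 ≠ 1 ∧
            (finalList.getD k (0, 0, 0)).2.1 = 0) ∨ ((finalList.getD k (0, 0, 0)).1 = 1 ∧
            (finalList.getD k (0, 0, 0)).2.1 = 1)) := by decide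
          rw [← h1, ← h2]
          exact this k hk
        · have : ∀ k < 26, 0 = (finalList.getD k (0, 0, 0)).2.2 := by decide
          rw [lab_zero]; exact this k hk
      · rw [relAt_of_ne (hcol v hv hvi) hk] at h1 h2 ⊢
        have := opList_sound hx hy hk h1 h2
        simp only [if_neg hvi]
        exact ⟨x + y, ⟨rfl, this.2⟩, this.1⟩)
    hR hS hf hg hh
  convert this using 1
  ext p
  constructor
  · rintro ⟨a, ha, hfin, rfl⟩
    have hother : ∀ v, v ≠ i → lab (a.1 v) ≠ 9 := fun v _ => (hR a ha).2 v
    by_cases h1 : lab (a.1 i) = 1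
    · refine ⟨a, ha, _, .inr rfl, fun v hv => ?_, fun v hv => ?_, by simp [cost, h1]⟩
      · have : v ≠ i := by rintro rfl; exact hv hi
        simp [this, (hR a ha).1 v hv]
      · by_cases hvi : v = i
        · subst hvi; simp [h1, hfin, lab_unit]
        · simp [hvi, hother v hvi]
    · refine ⟨a, ha, _, .inl rfl, fun v hv => ?_, fun v hv => ?_, by simp [cost, h1]⟩
      · have : v ≠ i := by rintro rfl; exact hv hi
        simp [this, (hR a ha).1 v hv]
      · by_cases hvi : v = i
        · subst hvi; simp [h1, hfin, lab_zero]
        · simp [hvi, hother v hvi]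
  · rintro ⟨a, ha, b, hb, hσ, hcomb, h2⟩
    have hci := hcomb i hi
    simp only [if_true] at hci
    have hb0 : ∀ v, v ≠ i → b.1 v = 0 := by
      intro v hv
      rcases hb with rfl | rfl
      · rfl
      · simp [hv]
    refine ⟨a, ha, hci.2.1, Prod.ext ?_ ?_⟩
    · funext v
      dsimp only
      by_cases hvi : v = i
      · subst hvi; rw [hci.1, Function.update_self]
      · rw [Function.update_of_ne hvi]
        by_cases hv : v ∈ Z
        · have := hcomb v hv
          rw [if_neg hvi, hb0 v hvi, add_zero] at this
          exact this.1
        · rw [hσ v hv, (hR a ha).1 v hv]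
    · rw [h2]
      dsimp only
      congr 1
      rcases hb with rfl | rfl
      · have := hci.2.2
        simp only [lab_zero, Pi.zero_apply] at this
        simp [cost]; omega
      · have := hci.2.2
        simp only [lab_unit, Pi.single_eq_same] at this
        simp [cost]; simp at this; omega

/-! ### The tables of the items -/

theorem enc_single {i : ℕ} (hi : i ∈ Finset.Icc 1 O.n) (x : Contrib) :
    enc χ (Pi.single i x) = lab x * 9 ^ χ.col i := by
  rw [enc_eq, Finset.sum_eq_single_of_mem i hi]
  · simp
  · intro v _ hv; simp [hv, lab_zero]

theorem enc_add {σ τ : ℕ → Contrib} (h : ∀ v, σ v = 0 ∨ τ v = 0) :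
    enc χ (σ + τ) = enc χ σ + enc χ τ := by
  rw [enc_eq, enc_eq, enc_eq, ← Finset.sum_add_distrib]
  refine Finset.sum_congr rfl fun v _ => ?_
  rw [Pi.add_apply]
  rcases h v with h | h <;> rw [h] <;> simp [lab_zero]

theorem enc_zero : enc χ (0 : ℕ → Contrib) = 0 := by
  rw [enc_eq]; simp [lab_zero]

theorem rep_of_list {big : ℕ} {R : Set Partial} (l : List (ℕ × ℕ)) {g : ℕ → ℕ}
    (hR : ∀ p ∈ R, (enc χ p.1, p.2) ∈ l) (hl : ∀ q ∈ l, ∃ p ∈ R, q = (enc χ p.1, p.2))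
    (hg : ∀ q ∈ l, g q.1 = big - q.2) (hg0 : ∀ x < 9 ^ W, (∀ q ∈ l, q.1 ≠ x) → g x = 0) :
    Rep χ big g R := by
  constructor
  · intro p hp
    exact (hg _ (hR p hp)).ge
  · intro x hx hpos
    by_cases h : ∀ q ∈ l, q.1 ≠ x
    · rw [hg0 x hx h] at hpos; omega
    · push Not at h
      obtain ⟨q, hq, rfl⟩ := h
      obtain ⟨p, hp, rfl⟩ := hl q hq
      exact ⟨p, hp, rfl, hg _ hq⟩

/-- The five indices are those of the five options for an edge: by `lab_unit` a single contribution
of kind `a` has label `a + 1`, which is multiplied by the weight of the colour. -/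
theorem rep_edge {big i j : ℕ} (h : O.adj i j) {g : ℕ → ℕ}
    (hg : ∀ x < 9 ^ W, g x = if x = 9 ^ χ.col i ∨ x = 9 ^ χ.col j ∨
      x = 2 * 9 ^ χ.col i + 3 * 9 ^ χ.col j ∨ x = 3 * 9 ^ χ.col i + 2 * 9 ^ χ.col j ∨
      x = 4 * 9 ^ χ.col i + 4 * 9 ^ χ.col j then big else 0)
    (hlt : 4 * 9 ^ χ.col i + 4 * 9 ^ χ.col j < 9 ^ W) :
    Rep χ big g (O.optSet ⟨i, (j, j)⟩) := by
  have hi : i ∈ Finset.Icc 1 O.n := Finset.mem_Icc.mpr (O.le _ _ h)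
  have hj : j ∈ Finset.Icc 1 O.n := Finset.mem_Icc.mpr (O.le _ _ (O.symm _ _ h))
  have hne := O.ne _ _ h
  have henc : ∀ x y, enc χ (Pi.single i x + Pi.single j y : ℕ → Contrib) =
      lab x * 9 ^ χ.col i + lab y * 9 ^ χ.col j := by
    intro x y
    rw [enc_add, enc_single hi, enc_single hj]
    intro v
    by_cases hv : v = i
    · subst hv; simp [hne]
    · simp [hv]
  have hopt : ∀ δ, O.Opt ⟨i, (j, j)⟩ δ ↔ (δ = Pi.single i (unit 0) ∨ δ = Pi.single j (unit 0) ∨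
      δ = Pi.single i (unit 1) + Pi.single j (unit 2) ∨
      δ = Pi.single i (unit 2) + Pi.single j (unit 1) ∨
      δ = Pi.single i (unit 3) + Pi.single j (unit 3)) := by
    intro δ; simp [Opt, h]
  have l1 : ∀ a, lab (unit a) = a + 1 := lab_unit
  refine rep_of_list [(9 ^ χ.col i, 0), (9 ^ χ.col j, 0), (2 * 9 ^ χ.col i + 3 * 9 ^ χ.col j, 0),
    (3 * 9 ^ χ.col i + 2 * 9 ^ χ.col j, 0), (4 * 9 ^ χ.col i + 4 * 9 ^ χ.col j, 0)] ?_ ?_ ?_ ?_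
  · rintro ⟨δ, k⟩ ⟨hδ, rfl : k = 0⟩
    rcases (hopt δ).mp hδ with rfl | rfl | rfl | rfl | rfl <;>
      simp [henc, enc_single hi, enc_single hj, l1]
  · intro q hq
    simp only [List.mem_cons, List.not_mem_nil, or_false] at hq
    rcases hq with rfl | rfl | rfl | rfl | rfl
    · exact ⟨(Pi.single i (unit 0), 0), ⟨(hopt _).mpr (by simp), rfl⟩, by simp [enc_single hi, l1]⟩
    · exact ⟨(Pi.single j (unit 0), 0), ⟨(hopt _).mpr (by simp), rfl⟩, by simp [enc_single hj, l1]⟩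
    · exact ⟨(Pi.single i (unit 1) + Pi.single j (unit 2), 0), ⟨(hopt _).mpr (by simp), rfl⟩,
        by simp [henc, l1]⟩
    · exact ⟨(Pi.single i (unit 2) + Pi.single j (unit 1), 0), ⟨(hopt _).mpr (by simp), rfl⟩,
        by simp [henc, l1]⟩
    · exact ⟨(Pi.single i (unit 3) + Pi.single j (unit 3), 0), ⟨(hopt _).mpr (by simp), rfl⟩,
        by simp [henc, l1]⟩
  · intro q hq
    simp only [List.mem_cons, List.not_mem_nil, or_false] at hq
    rcases hq with rfl | rfl | rfl | rfl | rfl <;> rw [hg] <;> first | omega | simp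
  · intro x hx hne
    rw [hg x hx, if_neg]
    simp only [List.mem_cons, List.not_mem_nil, or_false, forall_eq_or_imp, forall_eq] at hne
    rintro (rfl | rfl | rfl | rfl | rfl) <;> simp at hne

theorem rep_triangle {big i j k : ℕ} (hkj : k < j) (hij : O.adj i j) (hik : O.adj i k)
    (hjk : O.adj j k) {g : ℕ → ℕ}
    (hg : ∀ x < 9 ^ W, g x = if x = 0 ∨
      x = 5 * 9 ^ χ.col i + 5 * 9 ^ χ.col j + 5 * 9 ^ χ.col k then big else 0)
    (hlt : 5 * 9 ^ χ.col i + 5 * 9 ^ χ.col j + 5 * 9 ^ χ.col k < 9 ^ W) :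
    Rep χ big g (O.optSet ⟨i, (j, k)⟩) := by
  have hi : i ∈ Finset.Icc 1 O.n := Finset.mem_Icc.mpr (O.le _ _ hij)
  have hj : j ∈ Finset.Icc 1 O.n := Finset.mem_Icc.mpr (O.le _ _ hjk)
  have hk : k ∈ Finset.Icc 1 O.n := Finset.mem_Icc.mpr (O.le _ _ (O.symm _ _ hjk))
  have hne := O.ne _ _ hij
  have hne' := O.ne _ _ hik
  have hne'' := O.ne _ _ hjk
  have henc : ∀ x, enc χ (Pi.single i x + Pi.single j x + Pi.single k x : ℕ → Contrib) =
      lab x * 9 ^ χ.col i + lab x * 9 ^ χ.col j + lab x * 9 ^ χ.col k := by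
    intro x
    rw [enc_add, enc_add, enc_single hi, enc_single hj, enc_single hk]
    · intro v
      by_cases hv : v = i
      · subst hv; simp [hne]
      · simp [hv]
    · intro v
      by_cases hv : v = k
      · subst hv; simp [hne'.symm, hne''.symm]
      · simp [hv]
  have hopt : ∀ δ, O.Opt ⟨i, (j, k)⟩ δ ↔ (δ = 0 ∨
      δ = Pi.single i (unit 4) + Pi.single j (unit 4) + Pi.single k (unit 4)) := by
    intro δ; simp [Opt, hij, hik, hjk, hkj, hne''.symm, hkj.ne']
  refine rep_of_list [(0, 0), (5 * 9 ^ χ.col i + 5 * 9 ^ χ.col j + 5 * 9 ^ χ.col k, 0)] ?_ ?_ ?_ ?_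
  · rintro ⟨δ, k⟩ ⟨hδ, rfl : k = 0⟩
    rcases (hopt δ).mp hδ with rfl | rfl <;> simp [henc, enc_zero, lab_unit]
  · intro q hq
    simp only [List.mem_cons, List.not_mem_nil, or_false] at hq
    rcases hq with rfl | rfl
    · exact ⟨(0, 0), ⟨(hopt _).mpr (by simp), rfl⟩, by simp [enc_zero]⟩
    · exact ⟨(Pi.single i (unit 4) + Pi.single j (unit 4) + Pi.single k (unit 4), 0),
        ⟨(hopt _).mpr (.inr rfl), rfl⟩, by simp [henc, lab_unit]⟩
  · intro q hq
    simp only [List.mem_cons, List.not_mem_nil, or_false] at hq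
    rcases hq with rfl | rfl <;> rw [hg] <;> first | omega | simp
  · intro x hx hne
    rw [hg x hx, if_neg]
    simp only [List.mem_cons, List.not_mem_nil, or_false, forall_eq_or_imp, forall_eq] at hne
    rintro (rfl | rfl) <;> simp at hne

theorem rep_delete {big i : ℕ} (hi : i ∈ Finset.Icc 1 O.n) {g : ℕ → ℕ}
    (hg : ∀ x < 9 ^ W, g x = if x = 0 then big else if x = 9 ^ χ.col i then big - 1 else 0) :
    Rep χ big g {((0 : ℕ → Contrib), 0), (Pi.single i (unit 0), 1)} := by
  have hi' := Finset.mem_Icc.mp hi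
  have hlt : 9 ^ χ.col i < 9 ^ W := Nat.pow_lt_pow_right (by norm_num) (χ.lt i hi'.1 hi'.2)
  have hpos : 0 < 9 ^ χ.col i := by positivity
  refine rep_of_list [(0, 0), (9 ^ χ.col i, 1)] ?_ ?_ ?_ ?_
  · rintro p (rfl | rfl) <;> simp [enc_zero, enc_single hi, lab_unit]
  · intro q hq
    simp only [List.mem_cons, List.not_mem_nil, or_false] at hq
    rcases hq with rfl | rfl
    · exact ⟨_, .inl rfl, by simp [enc_zero]⟩
    · exact ⟨_, .inr rfl, by simp [enc_single hi, lab_unit]⟩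
  · intro q hq
    simp only [List.mem_cons, List.not_mem_nil, or_false] at hq
    rcases hq with rfl | rfl
    · rw [hg 0 (by omega)]; simp
    · rw [hg _ hlt]; simp
  · intro x hx hne
    simp only [List.mem_cons, List.not_mem_nil, or_false, forall_eq_or_imp, forall_eq] at hne
    rw [hg x hx, if_neg (Ne.symm hne.1), if_neg (Ne.symm hne.2)]

theorem rep_zero {big : ℕ} {g : ℕ → ℕ} (hg : ∀ x < 9 ^ W, g x = if x = 0 then big else 0) :
    Rep χ big g {((0 : ℕ → Contrib), 0)} := by
  refine rep_of_list [(0, 0)] ?_ ?_ ?_ ?_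
  · rintro p rfl; simp [enc_zero]
  · intro q hq
    simp only [List.mem_cons, List.not_mem_nil, or_false] at hq
    exact ⟨_, rfl, by simp [hq, enc_zero]⟩
  · intro q hq
    simp only [List.mem_cons, List.not_mem_nil, or_false] at hq
    rw [hq, hg 0 (by positivity)]; simp
  · intro x hx hne
    simp only [List.mem_cons, List.not_mem_nil, or_false, forall_eq] at hne
    rw [hg x hx, if_neg (Ne.symm hne)]

end ElimOrder

/-! ### The list of all tuples of related digits -/

/-- The index with base-`9` digits `f p (k p)`, where the `k p` are the base-`26` digits of `i`. -/
def tuple (f : ℕ → ℕ → ℕ) : ℕ → ℕ → ℕ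
  | 0, _ => 0
  | W + 1, i => tuple f W (i % 26 ^ W) + f W (i / 26 ^ W) * 9 ^ W

/-- Together with `tuple_eq`: a counter below `26 ^ W` runs through all choices of one of 26 rows
for each of `W` colours, simultaneously for the three columns `f`. -/
theorem exists_tuple (W : ℕ) (κ : ℕ → ℕ) (hκ : ∀ p, κ p < 26) :
    ∃ i < 26 ^ W, ∀ f, tuple f W i = code9 W fun p => f p (κ p) := by
  induction W with
  | zero => exact ⟨0, by norm_num, fun f => by simp [tuple, code9]⟩
  | succ W ih =>
    obtain ⟨i, hi, h⟩ := ih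
    have hlt : κ W * 26 ^ W ≤ 25 * 26 ^ W := Nat.mul_le_mul_right _ (by have := hκ W; omega)
    refine ⟨i + κ W * 26 ^ W, by rw [pow_succ]; omega, fun f => ?_⟩
    rw [tuple, Nat.add_mul_mod_self_right, Nat.mod_eq_of_lt hi,
      Nat.add_mul_div_right _ _ (by positivity), Nat.div_eq_of_lt hi, zero_add, h]
    simp [code9, Finset.sum_range_succ]

theorem tuple_eq (W i : ℕ) (hi : i < 26 ^ W) :
    ∃ κ : ℕ → ℕ, (∀ p, κ p < 26) ∧ ∀ f, tuple f W i = code9 W fun p => f p (κ p) := by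
  induction W generalizing i with
  | zero => exact ⟨fun _ => 0, by simp, fun f => by simp [tuple, code9]⟩
  | succ W ih =>
    obtain ⟨κ, hκ, h⟩ := ih (i % 26 ^ W) (Nat.mod_lt _ (by positivity))
    have hlt : i / 26 ^ W < 26 := Nat.div_lt_of_lt_mul (by rw [pow_succ] at hi; exact hi)
    refine ⟨Function.update κ W (i / 26 ^ W), fun p => ?_, fun f => ?_⟩
    · rw [Function.update_apply]; split_ifs; exacts [hlt, hκ p]
    · rw [tuple, h]
      simp only [code9, Finset.sum_range_succ, Function.update_self]
      congr 1
      refine Finset.sum_congr rfl fun p hp => ?_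
      rw [Function.update_of_ne (Finset.mem_range.mp hp).ne]

theorem tuple_lt {f : ℕ → ℕ → ℕ} (hf : ∀ p k, k < 26 → f p k < 9) {W i : ℕ} (hi : i < 26 ^ W) :
    tuple f W i < 9 ^ W := by
  obtain ⟨κ, hκ, h⟩ := tuple_eq W i hi
  rw [h]
  exact code9_lt fun p _ => hf p _ (hκ p)

/-- As row `0` is neutral, the list for `W` colours is an initial segment of the list for one more
colour. -/
theorem tuple_succ_of_lt {f : ℕ → ℕ → ℕ} {W i : ℕ} (hf : f W 0 = 0) (hi : i < 26 ^ W) :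
    tuple f (W + 1) i = tuple f W i := by
  rw [tuple, Nat.mod_eq_of_lt hi, Nat.div_eq_of_lt hi, hf, zero_mul, add_zero]

theorem tuple_succ_add {f : ℕ → ℕ → ℕ} {W i k : ℕ} (hi : i < 26 ^ W) :
    tuple f (W + 1) (k * 26 ^ W + i) = tuple f W i + f W k * 9 ^ W := by
  rw [tuple, Nat.mul_add_mod_self_right, Nat.mod_eq_of_lt hi, add_comm (k * _),
    Nat.add_mul_div_right _ _ (by positivity), Nat.div_eq_of_lt hi, zero_add]

/-! ### The convolution of two tables as a program -/

namespace VM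

instance : Coe Reg Ex := ⟨Ex.reg⟩
instance (n : ℕ) : OfNat Ex n := ⟨Ex.lit n⟩
instance : Add Ex := ⟨Ex.add⟩
instance : Sub Ex := ⟨Ex.sub⟩

theorem ofNat_eq (n : ℕ) : (OfNat.ofNat n : Ex) = Ex.lit n := rfl
theorem add_eq (e f : Ex) : e + f = Ex.add e f := rfl
theorem sub_eq (e f : Ex) : e - f = Ex.sub e f := rfl

/-- A sequence of programs. -/
def block : List Cmd → Cmd
  | [] => .skip
  | [p] => p
  | p :: q :: l => .seq p (block (q :: l))

theorem St.put_a (s : St) (A B : Arr) (i v : ℕ) :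
    (s.put A i v).a B = if B = A then Function.update (s.a A) i v else s.a B := by
  split_ifs with h
  · subst h; exact St.put_a_self _ _ _ _
  · exact St.put_a_ne _ _ _ h

theorem St.set_set (s : St) (x : Reg) (u v : ℕ) : (s.set x u).set x v = s.set x v := by
  simp [St.set]

/-- Sequential composition with separate specifications. -/
theorem wp_seq {E : Env} {p q : Cmd} {s : St} {Q : St → ℕ → Prop} (R : St → ℕ → Prop)
    (hp : p.wp E s R) (hq : ∀ s' t', Frame p s s' → R s' t' → q.wp E s' fun s'' t => Q s'' (t' + t)) :
    (Cmd.seq p q).wp E s Q :=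
  Cmd.wp_mono (p := p) (Cmd.wp_frame (p := p) hp) fun s' t' h => hq s' t' h.2 h.1

/-- Multiplication by the register `wt`. -/
def mulTo (x : Reg) (A : Arr) : Cmd :=
  block [.set x 0, .rep (.arr A Reg.off) (.set x (x + Reg.wt))]

/-- There is no multiplication instruction, but one factor is a digit, so at most eight additions
are needed. -/
theorem wp_mulTo {E : Env} {x : Reg} {A : Arr} {s : St} {Q : St → ℕ → Prop} (hx : x ≠ .wt)
    (hx' : x ≠ .off) (h0 : 0 < E.H) (hoff : s.r .off < E.H)
    (hb : s.a A (s.r .off) * s.r .wt < E.H) (h9 : s.a A (s.r .off) < 9)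
    (hQ : ∀ t, t ≤ 70 → Q (s.set x (s.a A (s.r .off) * s.r .wt)) t) :
    (mulTo x A).wp E s Q := by
  refine ⟨h0, ?_⟩
  have ev : (Ex.arr A (Ex.reg .off)).ev E (s.set x (Ex.ev E s 0)) = s.a A (s.r .off) := by
    simp [Ex.ev, St.set_r, hx'.symm]
  refine wp_rep (fun i s' => s' = s.set x (i * s.r .wt)) 4 ?_ ?_ ?_ ?_
  · simp [Ex.ok, Ex.ev, St.set_r, hx'.symm, hoff]
  · simp [Ex.ev, ofNat_eq]
  · rintro i s' hi - rfl
    rw [ev] at hi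
    have : (i + 1) * s.r .wt ≤ s.a A (s.r .off) * s.r .wt := Nat.mul_le_mul_right _ hi
    rw [add_mul, one_mul] at this
    simp only [Cmd.wp, add_eq, Ex.ok, Ex.ev, St.set_r, hx.symm, if_true, if_false, Ex.cost,
      St.set_set, true_and, add_mul, one_mul]
    omega
  · rintro s' t - rfl ht
    rw [ev] at ht ⊢
    refine hQ _ ?_
    simp only [Ex.cost, ofNat_eq] at *
    omega

/-- The tuples of related digits for one more colour. -/
def extendRow : Cmd :=
  block [.put .ta Reg.pos (.arr .ta Reg.x + Reg.xa), .put .tb Reg.pos (.arr .tb Reg.x + Reg.xb),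
    .put .tc Reg.pos (.arr .tc Reg.x + Reg.xc), .set .x (Reg.x + 1), .set .pos (Reg.pos + 1)]

/-- The tuples of related digits for one more colour. -/
def extend : Cmd :=
  block [.set .wt (.arr .pow Reg.c),
    -- With truncated subtraction this sum is zero exactly at the special colour, whose rows start
    -- at position 26.
    .ite ((Reg.c - Reg.sc) + (Reg.sc - Reg.c)) (.set .off 0) (.set .off 26),
    .set .pos 0,
    .rep 26 (block [mulTo .xa .ra, mulTo .xb .rb, mulTo .xc .rc, .set .x 0, .rep Reg.len extendRow,
      .set .off (Reg.off + 1)]),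
    .set .len Reg.pos, .set .c (Reg.c + 1)]

/-- The lists of the tuples of related digits. -/
def buildTuples : Cmd :=
  block [.put .ta 0 0, .put .tb 0 0, .put .tc 0 0, .set .len 1, .set .c 0, .rep Reg.W extend]

/-- The convolution of the tables at `pA` and `pB` into a new table. -/
def applyTuples : Cmd :=
  block [.set .pC Reg.fp, .set .fp (Reg.fp + Reg.M), .set .x 0,
    .rep Reg.len (block [
      .set .s ((.arr .tab (Reg.pA + .arr .ta Reg.x) + .arr .tab (Reg.pB + .arr .tb Reg.x)) - Reg.big),
      .set .y (Reg.pC + .arr .tc Reg.x),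
      -- The difference is positive exactly if the new value beats the stored one. A fresh table
      -- consists of zeros, that is, of infeasible entries.
      .ite (Reg.s - .arr .tab Reg.y) (.put .tab Reg.y Reg.s) .skip,
      .set .x (Reg.x + 1)])]

/-- The convolution of the tables at `pA` and `pB` with the special colour `sc`. -/
def conv : Cmd := .seq buildTuples applyTuples

/-- The columns of `relAt`. -/
def colA (c p k : ℕ) : ℕ := (relAt c p k).1
/-- The columns of `relAt`. -/
def colB (c p k : ℕ) : ℕ := (relAt c p k).2.1
/-- The columns of `relAt`. -/
def colC (c p k : ℕ) : ℕ := (relAt c p k).2.2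

/-- The constants that the convolution uses. -/
structure Tables (W : ℕ) (s : St) : Prop where
  w : s.r .W = W
  m : s.r .M = 9 ^ W
  pow : ∀ p ≤ W, s.a .pow p = 9 ^ p
  ra : ∀ k < 52, s.a .ra k = ((opList ++ finalList).getD k (0, 0, 0)).1
  rb : ∀ k < 52, s.a .rb k = ((opList ++ finalList).getD k (0, 0, 0)).2.1
  rc : ∀ k < 52, s.a .rc k = ((opList ++ finalList).getD k (0, 0, 0)).2.2

/-- The lists of tuples for the first `j` colours. -/
structure Tuples (c j : ℕ) (s : St) : Prop where
  ta : ∀ i < 26 ^ j, s.a .ta i = tuple (colA c) j i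
  tb : ∀ i < 26 ^ j, s.a .tb i = tuple (colB c) j i
  tc : ∀ i < 26 ^ j, s.a .tc i = tuple (colC c) j i

theorem Tables.frame {W : ℕ} {s s' : St} {p : Cmd} (h : Tables W s) (hf : Frame p s s')
    (hr : ∀ x ∈ [Reg.W, .M], x ∉ p.wr) (ha : ∀ A ∈ [Arr.pow, .ra, .rb, .rc], A ∉ p.wa) :
    Tables W s' where
  w := by rw [hf.r _ (hr _ (by simp)), h.w]
  m := by rw [hf.r _ (hr _ (by simp)), h.m]
  pow := by rw [hf.a _ (ha _ (by simp))]; exact h.pow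
  ra := by rw [hf.a _ (ha _ (by simp))]; exact h.ra
  rb := by rw [hf.a _ (ha _ (by simp))]; exact h.rb
  rc := by rw [hf.a _ (ha _ (by simp))]; exact h.rc

end VM

namespace VM

theorem wp_block_cons {E : Env} (p q : Cmd) (l : List Cmd) (s : St) (Q : St → ℕ → Prop) :
    (block (p :: q :: l)).wp E s Q ↔ p.wp E s fun s₁ t₁ => (block (q :: l)).wp E s₁ fun s₂ t₂ =>
      Q s₂ (t₁ + t₂) := Iff.rfl

theorem block_singleton (p : Cmd) : block [p] = p := rfl

theorem colA_zero (c p : ℕ) : colA c p 0 = 0 := by rw [colA, relAt_zero]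
theorem colB_zero (c p : ℕ) : colB c p 0 = 0 := by rw [colB, relAt_zero]
theorem colC_zero (c p : ℕ) : colC c p 0 = 0 := by rw [colC, relAt_zero]
theorem colA_lt (c p : ℕ) {k : ℕ} (hk : k < 26) : colA c p k < 9 := (relAt_lt c p hk).1
theorem colB_lt (c p : ℕ) {k : ℕ} (hk : k < 26) : colB c p k < 9 := (relAt_lt c p hk).2.1
theorem colC_lt (c p : ℕ) {k : ℕ} (hk : k < 26) : colC c p k < 9 := (relAt_lt c p hk).2.2

/-- The lists of tuples for the first `j` colours and some tuples for one more colour. -/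
def TuplesOn (n c j : ℕ) (s : St) : Prop :=
  ∀ i, i < 26 ^ j ∨ i < n → s.a .ta i = tuple (colA c) (j + 1) i ∧
    s.a .tb i = tuple (colB c) (j + 1) i ∧ s.a .tc i = tuple (colC c) (j + 1) i

/-- New tuples are written at position `k * 26 ^ j + i` and read from position `i`. For `k = 0`
every old tuple is replaced by itself, so the old list remains available for the following rows. -/
theorem wp_extendRow {E : Env} {c j k i W : ℕ} (hj : j < W) (hk : k < 26) (hi : i < 26 ^ j)
    (hH : 26 ^ W + 9 ^ W + 100 < E.H) {s : St} (hx : s.r .x = i) (hpos : s.r .pos = k * 26 ^ j + i)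
    (ha : s.r .xa = colA c j k * 9 ^ j) (hb : s.r .xb = colB c j k * 9 ^ j)
    (hc : s.r .xc = colC c j k * 9 ^ j) (ht : TuplesOn (k * 26 ^ j + i) c j s) :
    extendRow.wp E s fun s' t => (s'.r .x = i + 1 ∧ s'.r .pos = k * 26 ^ j + i + 1 ∧
      TuplesOn (k * 26 ^ j + (i + 1)) c j s') ∧ t ≤ 100 := by
  have h1 : k * 26 ^ j + i < 26 ^ (j + 1) := by
    have : k * 26 ^ j ≤ 25 * 26 ^ j := Nat.mul_le_mul_right _ (by omega)
    rw [pow_succ]; omega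
  have h2 : 26 ^ (j + 1) ≤ 26 ^ W := Nat.pow_le_pow_right (by norm_num) hj
  have h3 : 9 ^ (j + 1) ≤ 9 ^ W := Nat.pow_le_pow_right (by norm_num) hj
  have key : ∀ f : ℕ → ℕ → ℕ, (∀ p k, k < 26 → f p k < 9) → f j 0 = 0 →
      tuple f (j + 1) i + f j k * 9 ^ j = tuple f (j + 1) (k * 26 ^ j + i) ∧
      tuple f (j + 1) (k * 26 ^ j + i) < E.H := by
    intro f hf h0
    rw [tuple_succ_of_lt h0 hi, tuple_succ_add hi]
    have h := tuple_lt (f := f) hf h1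
    rw [tuple_succ_add hi] at h
    exact ⟨rfl, by omega⟩
  obtain ⟨a1, a2⟩ := key (colA c) (fun p k => colA_lt c p) (colA_zero c j)
  obtain ⟨b1, b2⟩ := key (colB c) (fun p k => colB_lt c p) (colB_zero c j)
  obtain ⟨c1, c2⟩ := key (colC c) (fun p k => colC_lt c p) (colC_zero c j)
  obtain ⟨ra, rb, rc⟩ := ht i (.inl hi)
  have hp1 : 0 < 26 ^ W := by positivity
  have hp2 : 0 < 9 ^ W := by positivity
  have hp3 : k * 26 ^ j + i < E.H := by omega
  have hp4 : i + 100 < E.H := by omega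
  have hp5 : k * 26 ^ j + i + 1 < E.H := by omega
  clear hH h1 h2 h3 key hj hk
  simp only [extendRow, block, Cmd.wp, ofNat_eq, add_eq, sub_eq, Ex.ok, Ex.ev, Ex.cost, St.set_r,
    St.put_r, St.put_a, St.set_a, reduceCtorEq, if_true, if_false, hx, hpos, ha, hb, hc, ra, rb, rc,
    a1, b1, c1, true_and, and_true]
  refine ⟨⟨by omega, a2⟩, by omega, ⟨by omega, b2⟩, by omega, ⟨by omega, c2⟩, by omega, by omega,
    by omega, ⟨?_, by omega⟩⟩
  intro i' hi'
  simp only [St.put_a, St.set_a, reduceCtorEq, if_true, if_false, Function.update_apply]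
  by_cases h : i' = k * 26 ^ j + i
  · simp [h]
  · simp only [h, if_false]
    exact ht i' (by omega)

theorem wp_extend {E : Env} {c j W : ℕ} (hj : j < W) (hH : 26 ^ W + 9 ^ W + 100 < E.H) {s : St}
    (hT : Tables W s) (hc : s.r .c = j) (hsc : s.r .sc = c) (hscH : c < E.H)
    (hlen : s.r .len = 26 ^ j) (hs : Tuples c j s) :
    extend.wp E s fun s' t => (Tables W s' ∧ s'.r .c = j + 1 ∧ s'.r .sc = c ∧
      s'.r .len = 26 ^ (j + 1) ∧ Tuples c (j + 1) s') ∧ t ≤ 12000 * 26 ^ W := by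
  have hWW : W < 9 ^ W := Nat.lt_pow_self (by norm_num)
  have hp1 : 26 ^ j ≤ 26 ^ W := Nat.pow_le_pow_right (by norm_num) hj.le
  have hp2 : 26 ^ (j + 1) ≤ 26 ^ W := Nat.pow_le_pow_right (by norm_num) hj
  have hp3 : 0 < 26 ^ j := by positivity
  have hp4 : 9 ^ (j + 1) ≤ 9 ^ W := Nat.pow_le_pow_right (by norm_num) hj
  obtain ⟨off, hoff⟩ : ∃ off, off = if j = c then 26 else 0 := ⟨_, rfl⟩
  have hoff26 : off ≤ 26 := by rw [hoff]; split_ifs <;> omega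
  have hrel : ∀ k, relAt c j k = (opList ++ finalList).getD (off + k) (0, 0, 0) := by
    intro k; rw [hoff]; rfl
  -- The test for the special colour affects only `off`; the rest is treated once for both outcomes.
  suffices hloop : ∀ s₁ t₁, Tables W s₁ → s₁.r .c = j → s₁.r .sc = c → s₁.r .len = 26 ^ j →
      Tuples c j s₁ → s₁.r .wt = 9 ^ j → s₁.r .off = off → t₁ ≤ 40 →
      (block [.set .pos 0,
        .rep 26 (block [mulTo .xa .ra, mulTo .xb .rb, mulTo .xc .rc, .set .x 0,
          .rep Reg.len extendRow, .set .off (Reg.off + 1)]),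
        .set .len Reg.pos, .set .c (Reg.c + 1)]).wp E s₁ fun s' t => (Tables W s' ∧ s'.r .c = j + 1 ∧
          s'.r .sc = c ∧ s'.r .len = 26 ^ (j + 1) ∧ Tuples c (j + 1) s') ∧
          t₁ + t ≤ 12000 * 26 ^ W by
    have hpow := hT.pow j (by omega)
    have hevp : (Ex.arr .pow (Ex.reg .c)).ev E s = 9 ^ j := by simp only [Ex.ev, hc, hpow]
    refine ⟨⟨trivial, by simp only [Ex.ev, hc]; omega⟩, ?_⟩
    rw [hevp]
    refine ⟨⟨⟨trivial, trivial⟩, ⟨trivial, trivial⟩, ?_⟩, ?_, ?_⟩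
    · simp only [sub_eq, Ex.ev, St.set_r, reduceCtorEq, if_false, hc, hsc]; omega
    · intro hne
      simp only [add_eq, sub_eq, Ex.ev, St.set_r, reduceCtorEq, if_false, hc, hsc] at hne
      have hz : off = 0 := by rw [hoff, if_neg (by omega)]
      refine ⟨by simp only [ofNat_eq, Ex.ok]; omega, ?_⟩
      have := hloop ((s.set .wt (9 ^ j)).set .off 0) 25
        ⟨hT.w, hT.m, hT.pow, hT.ra, hT.rb, hT.rc⟩ hc hsc hlen ⟨hs.ta, hs.tb, hs.tc⟩
        (by simp [St.set_r]) (by simp [St.set_r, hz]) (by omega)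
      refine Cmd.wp_mono this fun s' t h => ⟨h.1, by
        have := h.2; simp only [ofNat_eq, add_eq, sub_eq, Ex.cost]; omega⟩
    · intro he
      simp only [add_eq, sub_eq, Ex.ev, St.set_r, reduceCtorEq, if_false, hc, hsc] at he
      have hz : off = 26 := by rw [hoff, if_pos (by omega)]
      refine ⟨by simp only [ofNat_eq, Ex.ok]; omega, ?_⟩
      have := hloop ((s.set .wt (9 ^ j)).set .off 26) 25
        ⟨hT.w, hT.m, hT.pow, hT.ra, hT.rb, hT.rc⟩ hc hsc hlen ⟨hs.ta, hs.tb, hs.tc⟩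
        (by simp [St.set_r]) (by simp [St.set_r, hz]) (by omega)
      refine Cmd.wp_mono this fun s' t h => ⟨h.1, by
        have := h.2; simp only [ofNat_eq, add_eq, sub_eq, Ex.cost]; omega⟩
  clear hT hc hsc hlen hs
  intro s₁ t₁ hT hc hsc hlen hs hwt ho ht₁
  refine ⟨by simp only [ofNat_eq, Ex.ok]; omega, ?_⟩
  refine wp_seq (fun s' t => (s'.r .pos = 26 * 26 ^ j ∧ TuplesOn (26 * 26 ^ j) c j s') ∧
    t ≤ 10000 * 26 ^ j) ?_ ?_
  · refine wp_rep (fun k s' => s'.r .pos = k * 26 ^ j ∧ s'.r .off = off + k ∧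
      TuplesOn (k * 26 ^ j) c j s') (103 * 26 ^ j + 250) (by simp only [ofNat_eq, Ex.ok]; omega) ?_ ?_ ?_
    · refine ⟨by simp [ofNat_eq, Ex.ev], by simp [St.set_r, ho], ?_⟩
      intro i hi
      have hi : i < 26 ^ j := by omega
      rw [tuple_succ_of_lt (colA_zero _ _) hi, tuple_succ_of_lt (colB_zero _ _) hi,
        tuple_succ_of_lt (colC_zero _ _) hi]
      exact ⟨hs.ta i hi, hs.tb i hi, hs.tc i hi⟩
    · rintro k s₂ (hk : k < 26) hfr ⟨hpos, hoff', htup⟩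
      have hwt2 : s₂.r .wt = 9 ^ j := by rw [hfr.r _ (by decide)]; simp [St.set_r, hwt]
      have hlen2 : s₂.r .len = 26 ^ j := by rw [hfr.r _ (by decide)]; simp [St.set_r, hlen]
      have hra : s₂.a .ra (off + k) = colA c j k := by
        rw [hfr.a _ (by decide), St.set_a, hT.ra _ (by omega), colA, hrel]
      have hrb : s₂.a .rb (off + k) = colB c j k := by
        rw [hfr.a _ (by decide), St.set_a, hT.rb _ (by omega), colB, hrel]
      have hrc : s₂.a .rc (off + k) = colC c j k := by
        rw [hfr.a _ (by decide), St.set_a, hT.rc _ (by omega), colC, hrel]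
      have hsm : ∀ v, v < 9 → v * 9 ^ j < E.H := by
        intro v hv
        have : v * 9 ^ j ≤ 9 * 9 ^ j := Nat.mul_le_mul_right _ (by omega)
        rw [pow_succ] at hp4
        omega
      have lA := colA_lt c j hk
      have lB := colB_lt c j hk
      have lC := colC_lt c j hk
      have sA := hsm _ lA
      have sB := hsm _ lB
      have sC := hsm _ lC
      simp only [wp_block_cons, block_singleton]
      refine wp_mulTo (by decide) (by decide) (by omega) (by omega) (by rw [hoff', hra, hwt2]; exact sA)
        (by rw [hoff', hra]; exact lA) fun u₁ hu₁ => ?_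
      rw [hoff', hra, hwt2]
      refine wp_mulTo (by decide) (by decide) (by omega)
        (by simp only [St.set_r, reduceCtorEq, if_false]; omega)
        (by simp only [St.set_r, St.set_a, reduceCtorEq, if_false, hoff', hrb, hwt2]; exact sB)
        (by simp only [St.set_r, St.set_a, reduceCtorEq, if_false, hoff', hrb]; exact lB)
        fun u₂ hu₂ => ?_
      simp only [St.set_r, St.set_a, reduceCtorEq, if_false, hoff', hrb, hwt2]
      refine wp_mulTo (by decide) (by decide) (by omega)
        (by simp only [St.set_r, reduceCtorEq, if_false]; omega)
        (by simp only [St.set_r, St.set_a, reduceCtorEq, if_false, hoff', hrc, hwt2]; exact sC)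
        (by simp only [St.set_r, St.set_a, reduceCtorEq, if_false, hoff', hrc]; exact lC)
        fun u₃ hu₃ => ?_
      simp only [St.set_r, St.set_a, reduceCtorEq, if_false, hoff', hrc, hwt2]
      refine ⟨by simp only [ofNat_eq, Ex.ok]; omega, ?_⟩
      refine wp_rep (p := extendRow) (fun i s' => s'.r .x = i ∧ s'.r .pos = k * 26 ^ j + i ∧
        TuplesOn (k * 26 ^ j + i) c j s') 100 (e := Reg.len) trivial ?_ ?_ ?_
      · simp only [St.set_r, ofNat_eq, Ex.ev, if_true, reduceCtorEq, if_false, hpos, add_zero,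
          true_and]
        exact htup
      · rintro i s₃ hi hfr₃ ⟨hx, hpos₃, htup₃⟩
        simp only [Ex.ev, St.set_r, reduceCtorEq, if_false, hlen2] at hi
        refine wp_extendRow hj hk hi hH hx hpos₃ ?_ ?_ ?_ htup₃ <;>
        · rw [hfr₃.r _ (by decide)]; simp [St.set_r]
      · rintro s₃ t₃ hfr₃ ⟨-, hpos₃, htup₃⟩ ht₃
        have hl : Ex.ev E ((((s₂.set Reg.xa (colA c j k * 9 ^ j)).set Reg.xb
            (colB c j k * 9 ^ j)).set Reg.xc (colC c j k * 9 ^ j)).set Reg.x (Ex.ev E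
            (((s₂.set Reg.xa (colA c j k * 9 ^ j)).set Reg.xb (colB c j k * 9 ^ j)).set Reg.xc
            (colC c j k * 9 ^ j)) 0)) (Ex.reg .len) = 26 ^ j := by
          simp [Ex.ev, St.set_r, hlen2]
        rw [hl] at hpos₃ htup₃ ht₃
        have ho₃ : s₃.r .off = off + k := by
          rw [hfr₃.r _ (by decide)]; simp [St.set_r, hoff']
        simp only [Cmd.wp, ofNat_eq, add_eq, Ex.ok, Ex.ev, Ex.cost, St.set_r, if_true, reduceCtorEq,
          if_false, ho₃, hpos₃, true_and] at ht₃ ⊢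
        refine ⟨by omega, ⟨by rw [add_mul, one_mul], by omega, ?_⟩, by omega⟩
        rw [add_mul, one_mul]
        exact htup₃
    · rintro s' t hfr ⟨hpos, -, htup⟩ ht
      simp only [ofNat_eq, Ex.ev, Ex.cost] at *
      exact ⟨⟨hpos, htup⟩, by omega⟩
  · rintro s' t' hfr ⟨⟨hpos, htup⟩, ht'⟩
    have hc' : s'.r .c = j := by rw [hfr.r _ (by decide)]; simp [St.set_r, hc]
    simp only [block, Cmd.wp, ofNat_eq, add_eq, Ex.ok, Ex.ev, Ex.cost, St.set_r, if_true,
      reduceCtorEq, if_false, hpos, hc', true_and, and_true]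
    have hT' := (hT.frame (p := .set .pos 0) ⟨fun x hx => St.set_r_ne _ _ (by simpa [Cmd.wr] using hx),
      fun _ _ => rfl⟩ (by decide) (by decide)).frame hfr (by decide) (by decide)
    refine ⟨by omega, ⟨⟨hT'.w, hT'.m, hT'.pow, hT'.ra, hT'.rb, hT'.rc⟩, ?_, by rw [pow_succ, mul_comm],
      ?_, ?_, ?_⟩, ?_⟩
    · rw [hfr.r _ (by decide)]; simp [St.set_r, hsc]
    · intro i hi; rw [pow_succ] at hi; exact (htup i (by omega)).1
    · intro i hi; rw [pow_succ] at hi; exact (htup i (by omega)).2.1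
    · intro i hi; rw [pow_succ] at hi; exact (htup i (by omega)).2.2
    · have : 10000 * 26 ^ j ≤ 12000 * 26 ^ W := by omega
      omega

end VM

namespace VM

/-- Each extension is charged with the full `26 ^ W`. The factor `W + 1` lost in this way disappears
when 26 is raised to 36. -/
theorem wp_buildTuples {E : Env} {c W : ℕ} (hH : 26 ^ W + 9 ^ W + 100 < E.H) {s : St}
    (hT : Tables W s) (hsc : s.r .sc = c) (hscH : c < E.H) :
    buildTuples.wp E s fun s' t => (Tables W s' ∧ s'.r .len = 26 ^ W ∧ Tuples c W s') ∧
      t ≤ 12100 * (W + 1) * 26 ^ W := by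
  have hp : 0 < 26 ^ W := by positivity
  have hp' : 0 < 9 ^ W := by positivity
  have h0 : 0 < E.H := by omega
  have h1 : 1 < E.H := by omega
  refine ⟨h0, h0, h0, h0, h0, h0, h0, h0, h0, h1, h0, ?_⟩
  refine wp_rep (e := Reg.W) (fun j s' => Tables W s' ∧ s'.r .c = j ∧ s'.r .sc = c ∧
    s'.r .len = 26 ^ j ∧ Tuples c j s') (12000 * 26 ^ W) trivial ?_ ?_ ?_
  · refine ⟨⟨hT.w, hT.m, hT.pow, hT.ra, hT.rb, hT.rc⟩, ?_, ?_, ?_, ?_, ?_, ?_⟩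
    · simp [St.set_r, Ex.ev, ofNat_eq]
    · simp [St.set_r, hsc]
    · simp [St.set_r, Ex.ev, ofNat_eq]
    all_goals
      intro i hi
      have : i = 0 := by simpa using hi
      simp [this, St.put_a, Ex.ev, ofNat_eq, tuple]
  · rintro j s' hj - ⟨hT', hc', hsc', hlen, hs'⟩
    have hj : j < W := by simpa [Ex.ev, St.set_r, hT.w] using hj
    exact wp_extend hj hH hT' hc' hsc' hscH hlen hs'
  · rintro s' t - ⟨hT', -, -, hlen, hs'⟩ ht
    have hw : s.r .W = W := hT.w
    simp only [ofNat_eq, Ex.ev, St.set_r, St.put_r, reduceCtorEq, if_false, hw, Ex.cost] at *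
    refine ⟨⟨hT', hlen, hs'⟩, ?_⟩
    have e1 : W * (12000 * 26 ^ W + 3) ≤ 12003 * (W * 26 ^ W) := by nlinarith
    have e2 : 12100 * (W + 1) * 26 ^ W = 12100 * (W * 26 ^ W) + 12100 * 26 ^ W := by ring
    omega

/-- The tables occupy the cells below `fp` of `tab`; no entry exceeds `big`. -/
structure Heap (big : ℕ) (s : St) : Prop where
  big_eq : s.r .big = big
  fresh : ∀ i, s.r .fp ≤ i → s.a .tab i = 0
  le : ∀ i, s.a .tab i ≤ big

/-- The loop body of `applyTuples`. -/
theorem wp_applyTuples {E : Env} {c W big : ℕ} {s : St} (hT : Tables W s)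
    (hlen : s.r .len = 26 ^ W) (hs : Tuples c W s) (hh : Heap big s)
    (hA : s.r .pA + 9 ^ W ≤ s.r .fp) (hB : s.r .pB + 9 ^ W ≤ s.r .fp)
    (hH : 26 ^ W + 100 + s.r .fp + 9 ^ W < E.H) (hbig : 2 * big < E.H) :
    applyTuples.wp E s fun s' t => (Heap big s' ∧ s'.r .pC = s.r .fp ∧ s'.r .fp = s.r .fp + 9 ^ W ∧
      (∀ i < s.r .fp, s'.a .tab i = s.a .tab i) ∧
      IsConv W big c (fun x => s.a .tab (s.r .pA + x)) (fun x => s.a .tab (s.r .pB + x))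
        (fun x => s'.a .tab (s.r .fp + x))) ∧ t ≤ 120 * 26 ^ W := by
  obtain ⟨fp, hfp⟩ : ∃ fp, s.r .fp = fp := ⟨_, rfl⟩
  obtain ⟨pA, hpA⟩ : ∃ p, s.r .pA = p := ⟨_, rfl⟩
  obtain ⟨pB, hpB⟩ : ∃ p, s.r .pB = p := ⟨_, rfl⟩
  obtain ⟨val, hval⟩ : ∃ val : ℕ → ℕ, val = fun x => s.a .tab (pA + tuple (colA c) W x) +
    s.a .tab (pB + tuple (colB c) W x) - big := ⟨_, rfl⟩
  have hp : 0 < 26 ^ W := by positivity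
  have hp' : 0 < 9 ^ W := by positivity
  rw [hfp] at hA hB hH ⊢
  rw [hpA] at hA ⊢
  rw [hpB] at hB ⊢
  refine ⟨trivial, ⟨trivial, trivial, ?_⟩, by show 0 < E.H; omega, ?_⟩
  · simp only [Ex.ev, St.set_r, reduceCtorEq, if_false, hfp, hT.m]; omega
  -- The last two clauses are the halves of `IsConv`: each tuple treated so far bounds its entry
  -- from below, and each positive entry is attained by some tuple.
  refine wp_rep (e := Reg.len) (fun x s' => s'.r .x = x ∧ s'.r .fp = fp + 9 ^ W ∧ s'.r .pC = fp ∧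
    (∀ i, i < fp ∨ fp + 9 ^ W ≤ i → s'.a .tab i = s.a .tab i) ∧
    (∀ i, s'.a .tab i ≤ big) ∧
    (∀ i < x, val i ≤ s'.a .tab (fp + tuple (colC c) W i)) ∧
    ∀ y < 9 ^ W, 0 < s'.a .tab (fp + y) → ∃ i < 26 ^ W, y = tuple (colC c) W i ∧
      s'.a .tab (fp + y) = val i) 90 trivial ?_ ?_ ?_
  · refine ⟨?_, ?_, ?_, fun i hi => rfl, hh.le, fun i hi => absurd hi (by omega), ?_⟩
    · simp [St.set_r, Ex.ev, ofNat_eq]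
    · simp [St.set_r, Ex.ev, add_eq, hfp, hT.m]
    · simp [St.set_r, Ex.ev, hfp]
    · intro y hy hpos
      have h1 : s.a .tab (fp + y) = 0 := hh.fresh _ (by rw [hfp]; omega)
      rw [show (((s.set Reg.pC _).set Reg.fp _).set Reg.x _).a .tab (fp + y) = s.a .tab (fp + y)
        from rfl] at hpos
      omega
  · rintro x s' hx hfr ⟨h1, h2, h3, h4, h5, h6, h7⟩
    have hx : x < 26 ^ W := by simpa [Ex.ev, St.set_r, hlen] using hx
    have eA : s'.r .pA = pA := by rw [hfr.r _ (by decide)]; simp [St.set_r, hpA]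
    have eB : s'.r .pB = pB := by rw [hfr.r _ (by decide)]; simp [St.set_r, hpB]
    have eb : s'.r .big = big := by rw [hfr.r _ (by decide)]; simp [St.set_r, hh.big_eq]
    have ta : s'.a .ta x = tuple (colA c) W x := by
      rw [hfr.a _ (by decide)]; exact hs.ta x hx
    have tb : s'.a .tb x = tuple (colB c) W x := by
      rw [hfr.a _ (by decide)]; exact hs.tb x hx
    have tc : s'.a .tc x = tuple (colC c) W x := by
      rw [hfr.a _ (by decide)]; exact hs.tc x hx
    have lA := tuple_lt (f := colA c) (fun p k => colA_lt c p) hx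
    have lB := tuple_lt (f := colB c) (fun p k => colB_lt c p) hx
    have lC := tuple_lt (f := colC c) (fun p k => colC_lt c p) hx
    have vA := h4 (pA + tuple (colA c) W x) (by omega)
    have vB := h4 (pB + tuple (colB c) W x) (by omega)
    have bA := hh.le (pA + tuple (colA c) W x)
    have bB := hh.le (pB + tuple (colB c) W x)
    have hv : val x = s.a .tab (pA + tuple (colA c) W x) +
      s.a .tab (pB + tuple (colB c) W x) - big := by rw [hval]
    simp only [block, Cmd.wp, ofNat_eq, add_eq, sub_eq, Ex.ok, Ex.ev, Ex.cost, St.set_r, St.set_a,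
      St.put_r, reduceCtorEq, if_true, if_false, h1, h3, eA, eB, eb, ta, tb, tc, vA, vB, ← hv,
      true_and, and_true]
    clear hT hlen hs hh hfr
    refine ⟨by omega, by omega, by omega, fun hlt => ⟨by omega, by omega, ?_⟩,
      fun hge => ⟨by omega, ?_⟩⟩
    · refine ⟨⟨h2, ?_, ?_, ?_, ?_⟩, by norm_num⟩
      · intro i hi
        simp only [St.set_a, St.put_a_self]
        rw [Function.update_of_ne (by omega)]
        exact h4 i hi
      · intro i
        simp only [St.set_a, St.put_a_self, Function.update_apply]
        split_ifs
        · omega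
        · exact h5 i
      · intro i hi
        simp only [St.set_a, St.put_a_self, Function.update_apply]
        split_ifs with he
        · rcases Nat.lt_succ_iff_lt_or_eq.mp hi with hi | rfl
          · have := h6 i hi; rw [he] at this; omega
          · exact le_rfl
        · refine h6 i ?_
          have : i ≠ x := by rintro rfl; exact he rfl
          omega
      · intro y hy
        simp only [St.set_a, St.put_a_self, Function.update_apply]
        split_ifs with he
        · intro _; exact ⟨x, hx, by omega, rfl⟩
        · exact h7 y hy
    · refine ⟨⟨h2, h4, h5, ?_, h7⟩, by norm_num⟩
      intro i hi
      rcases Nat.lt_succ_iff_lt_or_eq.mp hi with hi | rfl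
      · exact h6 i hi
      · omega
  · rintro s' t hfr ⟨h1, h2, h3, h4, h5, h6, h7⟩ ht
    have e : ∀ u v w, Ex.ev E (((s.set Reg.pC u).set Reg.fp v).set Reg.x w) (Ex.reg .len) =
      26 ^ W := by intro u v w; simp [Ex.ev, St.set_r, hlen]
    rw [e] at ht h6
    have eb : s'.r .big = big := by rw [hfr.r _ (by decide)]; simp [St.set_r, hh.big_eq]
    refine ⟨⟨⟨eb, fun i hi => ?_, h5⟩, h3, h2, fun i hi => h4 i (.inl hi), ?_, ?_⟩, ?_⟩
    · rw [h4 i (by omega)]; exact hh.fresh i (by rw [hfp]; omega)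
    · intro κ hκ
      obtain ⟨i, hi, h⟩ := exists_tuple W κ hκ
      have := h6 i hi
      rw [hval] at this
      simp only [h, colA, colB, colC] at this
      exact this
    · intro y hy hpos
      obtain ⟨i, hi, hyi, hv⟩ := h7 y hy hpos
      obtain ⟨κ, hκ, h⟩ := tuple_eq W i hi
      refine ⟨κ, hκ, by rw [hyi, h]; rfl, ?_⟩
      rw [hv, hval]
      simp only [h, colA, colB, colC]
    · simp only [ofNat_eq, add_eq, Ex.cost] at *
      omega

theorem wp_conv {E : Env} {c W big : ℕ} {s : St} (hT : Tables W s) (hh : Heap big s)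
    (hsc : s.r .sc = c) (hscH : c < E.H)
    (hA : s.r .pA + 9 ^ W ≤ s.r .fp) (hB : s.r .pB + 9 ^ W ≤ s.r .fp)
    (hH : 26 ^ W + 100 + s.r .fp + 9 ^ W < E.H) (hbig : 2 * big < E.H) :
    conv.wp E s fun s' t => (Heap big s' ∧ s'.r .pC = s.r .fp ∧ s'.r .fp = s.r .fp + 9 ^ W ∧
      (∀ i < s.r .fp, s'.a .tab i = s.a .tab i) ∧
      IsConv W big c (fun x => s.a .tab (s.r .pA + x)) (fun x => s.a .tab (s.r .pB + x))
        (fun x => s'.a .tab (s.r .fp + x))) ∧ t ≤ 13000 * (W + 1) * 26 ^ W := by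
  refine wp_seq _ (wp_buildTuples (c := c) (W := W) (by omega) hT hsc hscH) ?_
  rintro s₁ t₁ hfr ⟨⟨hT₁, hlen, hs⟩, ht₁⟩
  have e1 := hfr.r .fp (by decide)
  have e2 := hfr.r .pA (by decide)
  have e3 := hfr.r .pB (by decide)
  have e4 := hfr.r .big (by decide)
  have e5 := hfr.a .tab (by decide)
  have := wp_applyTuples (E := E) hT₁ hlen hs (big := big) ⟨by rw [e4, hh.big_eq],
    by rw [e1, e5]; exact hh.fresh, by rw [e5]; exact hh.le⟩ (by rw [e1, e2]; exact hA)
    (by rw [e1, e3]; exact hB) (by rw [e1]; exact hH) hbig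
  rw [e1, e2, e3, e5] at this
  refine Cmd.wp_mono this ?_
  rintro s' t ⟨h, ht⟩
  refine ⟨h, ?_⟩
  have h1 : 13000 * (W + 1) * 26 ^ W = 12100 * (W + 1) * 26 ^ W + 900 * (W * 26 ^ W) + 900 * 26 ^ W := by
    ring
  omega

end VM

/-! ### Bucket elimination -/

namespace VM

open ElimOrder

/-- The convolution of the table at `pA` with the one at `pB`. -/
def convStep (e : Ex) : Cmd := block [.set .sc e, conv, .set .pA Reg.pC]

/-- The table of an edge. -/
def edgeGadget : Cmd :=
  block [.set .pB Reg.fp,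
    .put .tab (Reg.pB + Reg.a) Reg.big,
    .put .tab (Reg.pB + Reg.b) Reg.big,
    .put .tab (Reg.pB + (Reg.a + Reg.a + (Reg.b + Reg.b + Reg.b))) Reg.big,
    .put .tab (Reg.pB + (Reg.a + Reg.a + Reg.a + (Reg.b + Reg.b))) Reg.big,
    .put .tab (Reg.pB + (Reg.a + Reg.a + Reg.a + Reg.a + (Reg.b + Reg.b + Reg.b + Reg.b))) Reg.big,
    .set .fp (Reg.fp + Reg.M)]

/-- The table of a triangle. -/
def triangleGadget : Cmd :=
  block [.set .pB Reg.fp,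
    .put .tab Reg.pB Reg.big,
    .put .tab (Reg.pB + ((Reg.a + Reg.a + Reg.a + Reg.a + Reg.a) +
      (Reg.b + Reg.b + Reg.b + Reg.b + Reg.b) + (Reg.h + Reg.h + Reg.h + Reg.h + Reg.h))) Reg.big,
    .set .fp (Reg.fp + Reg.M)]

/-- The table of the deletion of a vertex. -/
def deleteGadget : Cmd :=
  block [.set .pB Reg.fp,
    .put .tab Reg.pB Reg.big,
    .put .tab (Reg.pB + Reg.a) (Reg.big - 1),
    .set .fp (Reg.fp + Reg.M)]

/-- The item of `i`, `j` and `z`. -/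
def processItem : Cmd :=
  -- Equal `j` and `z` encode an edge, `z < j` encodes a triangle, and the opposite order is skipped
  -- because the triangle has been listed already.
  .ite ((Reg.j - Reg.z) + (Reg.z - Reg.j))
    (.ite (Reg.j - Reg.z)
      (.ite (.arr .adj (.arr .row Reg.i + Reg.j))
        (.ite (.arr .adj (.arr .row Reg.i + Reg.z))
          (.ite (.arr .adj (.arr .row Reg.j + Reg.z)) (.seq triangleGadget (convStep Reg.W)) .skip)
          .skip) .skip) .skip)
    (.ite (.arr .adj (.arr .row Reg.i + Reg.j)) (.seq edgeGadget (convStep Reg.W)) .skip)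

variable {O : ElimOrder} {W : ℕ}

/-- The state describes the elimination order `O` with the colouring `χ`. -/
structure Inst (E : Env) (χ : O.Colouring W) (s : St) : Prop extends Tables W s where
  n : s.r .n = O.n
  col : ∀ i, 1 ≤ i → i ≤ O.n → s.a .col i = χ.col i
  ben : ∀ i, 1 ≤ i → i ≤ O.n → s.a .ben i = s.a .bst i + (O.bl i).length
  ben_lt : ∀ i, 1 ≤ i → i ≤ O.n → s.a .ben i < E.H
  bls : ∀ i, 1 ≤ i → i ≤ O.n → ∀ x (h : x < (O.bl i).length), s.a .bls (s.a .bst i + x) = (O.bl i)[x]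
  adj : ∀ i j, 1 ≤ i → i ≤ O.n → 1 ≤ j → j ≤ O.n → (0 < s.a .adj (s.a .row i + j) ↔ O.adj i j)
  row : ∀ i j, 1 ≤ i → i ≤ O.n → 1 ≤ j → j ≤ O.n → s.a .row i + j < E.H

theorem Inst.frame {E : Env} {χ : O.Colouring W} {s s' : St} {p : Cmd} (h : Inst E χ s)
    (hf : Frame p s s') (hr : ∀ x ∈ [Reg.W, .M, .n], x ∉ p.wr)
    (ha : ∀ A ∈ [Arr.pow, .ra, .rb, .rc, .col, .bst, .ben, .bls, .adj, .row], A ∉ p.wa) :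
    Inst E χ s' := by
  have e : ∀ A ∈ [Arr.pow, .ra, .rb, .rc, .col, .bst, .ben, .bls, .adj, .row], s'.a A = s.a A :=
    fun A hA => hf.a _ (ha A hA)
  refine ⟨h.toTables.frame hf (fun x hx => hr x ?_) (fun A hA => ha A ?_), ?_, ?_, ?_, ?_, ?_, ?_, ?_⟩
  · simp only [List.mem_cons, List.not_mem_nil, or_false] at hx ⊢; tauto
  · simp only [List.mem_cons, List.not_mem_nil, or_false] at hA ⊢; tauto
  · rw [hf.r _ (hr _ (by simp)), h.n]
  · rw [e _ (by simp)]; exact h.col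
  · rw [e .ben (by simp), e .bst (by simp)]; exact h.ben
  · rw [e .ben (by simp)]; exact h.ben_lt
  · rw [e .bls (by simp), e .bst (by simp)]; exact h.bls
  · rw [e .adj (by simp), e .row (by simp)]; exact h.adj
  · rw [e .row (by simp)]; exact h.row

/-- The heap has grown. -/
structure Grow (k : ℕ) (s s' : St) : Prop where
  le : s.r .fp ≤ s'.r .fp
  le_add : s'.r .fp ≤ s.r .fp + k
  tab : ∀ i < s.r .fp, s'.a .tab i = s.a .tab i

theorem Grow.refl (k : ℕ) (s : St) : Grow k s s := ⟨le_rfl, by omega, fun _ _ => rfl⟩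

theorem Grow.trans {k l : ℕ} {s s' s'' : St} (h : Grow k s s') (h' : Grow l s' s'') :
    Grow (k + l) s s'' :=
  ⟨h.le.trans h'.le, by have := h.le_add; have := h'.le_add; omega,
    fun i hi => by rw [h'.tab i (by have := h.le; omega), h.tab i hi]⟩

theorem Grow.mono {k l : ℕ} {s s' : St} (h : Grow k s s') (hkl : k ≤ l) : Grow l s s' :=
  ⟨h.le, by have := h.le_add; omega, h.tab⟩

/-- The register `pA` points to a table that represents `R`. -/
structure Cur (χ : O.Colouring W) (big : ℕ) (R : Set Partial) (s : St) : Prop extends Heap big s where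
  pA : s.r .pA + 9 ^ W ≤ s.r .fp
  rep : Rep χ big (fun x => s.a .tab (s.r .pA + x)) R

theorem wp_convStep {E : Env} {c big : ℕ} {e : Ex} {s : St} (hT : Tables W s) (hh : Heap big s)
    (he : e.ev E s = c) (hok : e.ok E s) (hcost : e.cost ≤ 20) (hscH : c < E.H)
    (hA : s.r .pA + 9 ^ W ≤ s.r .fp) (hB : s.r .pB + 9 ^ W ≤ s.r .fp)
    (hH : 26 ^ W + 100 + s.r .fp + 9 ^ W < E.H) (hbig : 2 * big < E.H) :
    (convStep e).wp E s fun s' t => (Heap big s' ∧ s'.r .pA = s.r .fp ∧ s'.r .fp = s.r .fp + 9 ^ W ∧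
      (∀ i < s.r .fp, s'.a .tab i = s.a .tab i) ∧
      IsConv W big c (fun x => s.a .tab (s.r .pA + x)) (fun x => s.a .tab (s.r .pB + x))
        (fun x => s'.a .tab (s.r .fp + x))) ∧ t ≤ 13000 * (W + 1) * 26 ^ W + 40 := by
  refine ⟨hok, ?_⟩
  rw [he]
  have := wp_conv (E := E) (c := c) (W := W) (big := big) (s := s.set .sc c)
    ⟨hT.w, hT.m, hT.pow, hT.ra, hT.rb, hT.rc⟩ ⟨hh.big_eq, hh.fresh, hh.le⟩ (by simp) hscH hA hB hH hbig
  simp only [wp_block_cons, block_singleton]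
  refine Cmd.wp_mono (p := conv) this ?_
  rintro s' t ⟨⟨h1, h2, h3, h4, h5⟩, ht⟩
  refine ⟨trivial, ⟨⟨h1.big_eq, h1.fresh, h1.le⟩, ?_, h3, h4, h5⟩, ?_⟩
  · simp only [Ex.ev, St.set_r_self]; exact h2
  · simp only [Ex.cost]; omega

/-- The register `pB` points to a new table `g`. -/
structure NewTab (W big : ℕ) (g : ℕ → ℕ) (s s' : St) : Prop extends Heap big s' where
  pA : s'.r .pA = s.r .pA
  pB : s'.r .pB = s.r .fp
  fp : s'.r .fp = s.r .fp + 9 ^ W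
  tab : ∀ i < s.r .fp, s'.a .tab i = s.a .tab i
  eq : ∀ x < 9 ^ W, s'.a .tab (s.r .fp + x) = g x

/-- Writing five entries is enough, since the memory from `fp` on is still zero; `hlt` keeps the
entries inside the new block. -/
theorem wp_edgeGadget {E : Env} {big a b : ℕ} {s : St} (hT : Tables W s) (hh : Heap big s)
    (ha : s.r .a = a) (hb : s.r .b = b) (hlt : 4 * a + 4 * b < 9 ^ W) (hH : s.r .fp + 9 ^ W < E.H) :
    edgeGadget.wp E s fun s' t => NewTab W big (fun x => if x = a ∨ x = b ∨ x = 2 * a + 3 * b ∨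
      x = 3 * a + 2 * b ∨ x = 4 * a + 4 * b then big else 0) s s' ∧ t ≤ 200 := by
  obtain ⟨fp, hfp⟩ : ∃ fp, s.r .fp = fp := ⟨_, rfl⟩
  rw [hfp] at hH
  simp only [edgeGadget, block, Cmd.wp, ofNat_eq, add_eq, sub_eq, Ex.ok, Ex.ev, Ex.cost, St.set_r,
    St.put_r, reduceCtorEq, if_true, if_false, ha, hb, hfp, hh.big_eq, hT.m, true_and, and_true]
  refine ⟨by omega, by omega, by omega, by omega, by omega, by omega, by omega, by omega, by omega,
    by omega, hH, ⟨⟨?_, ?_, ?_⟩, ?_, ?_, ?_, ?_, ?_⟩, by norm_num⟩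
  · simp [St.set_r, hh.big_eq]
  · intro i hi
    simp only [St.set_r, if_true] at hi
    simp only [St.set_a, St.put_a_self]
    rw [Function.update_of_ne (by omega), Function.update_of_ne (by omega),
      Function.update_of_ne (by omega), Function.update_of_ne (by omega),
      Function.update_of_ne (by omega)]
    exact hh.fresh i (by omega)
  · intro i
    simp only [St.set_a, St.put_a_self, Function.update_apply]
    split_ifs <;> first | exact le_rfl | exact hh.le i
  · simp [St.set_r]
  · simp [St.set_r, hfp]
  · simp [St.set_r, hfp]
  · intro i hi
    rw [hfp] at hi
    simp only [St.set_a, St.put_a_self]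
    rw [Function.update_of_ne (by omega), Function.update_of_ne (by omega),
      Function.update_of_ne (by omega), Function.update_of_ne (by omega),
      Function.update_of_ne (by omega)]
  · intro x hx
    have h0 : s.a .tab (fp + x) = 0 := hh.fresh _ (by omega)
    simp only [St.set_a, St.put_a_self, Function.update_apply, hfp, h0, Nat.add_left_cancel_iff]
    have e1 : a + a + a + a + (b + b + b + b) = 4 * a + 4 * b := by ring
    have e2 : a + a + a + (b + b) = 3 * a + 2 * b := by ring
    have e3 : a + a + (b + b + b) = 2 * a + 3 * b := by ring
    rw [e1, e2, e3]
    by_cases h5 : x = 4 * a + 4 * b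
    · rw [if_pos h5, if_pos (by tauto)]
    by_cases h4 : x = 3 * a + 2 * b
    · rw [if_neg h5, if_pos h4, if_pos (by tauto)]
    by_cases h3 : x = 2 * a + 3 * b
    · rw [if_neg h5, if_neg h4, if_pos h3, if_pos (by tauto)]
    by_cases h2 : x = b
    · rw [if_neg h5, if_neg h4, if_neg h3, if_pos h2, if_pos (by tauto)]
    by_cases h1 : x = a
    · rw [if_neg h5, if_neg h4, if_neg h3, if_neg h2, if_pos h1, if_pos (by tauto)]
    rw [if_neg h5, if_neg h4, if_neg h3, if_neg h2, if_neg h1, if_neg (by tauto)]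

theorem wp_triangleGadget {E : Env} {big a b c : ℕ} {s : St} (hT : Tables W s) (hh : Heap big s)
    (ha : s.r .a = a) (hb : s.r .b = b) (hc : s.r .h = c) (hlt : 5 * a + 5 * b + 5 * c < 9 ^ W)
    (hH : s.r .fp + 9 ^ W < E.H) :
    triangleGadget.wp E s fun s' t => NewTab W big (fun x => if x = 0 ∨ x = 5 * a + 5 * b + 5 * c
      then big else 0) s s' ∧ t ≤ 200 := by
  obtain ⟨fp, hfp⟩ : ∃ fp, s.r .fp = fp := ⟨_, rfl⟩
  rw [hfp] at hH
  simp only [triangleGadget, block, Cmd.wp, ofNat_eq, add_eq, sub_eq, Ex.ok, Ex.ev, Ex.cost, St.set_r,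
    St.put_r, reduceCtorEq, if_true, if_false, ha, hb, hc, hfp, hh.big_eq, hT.m, true_and, and_true]
  have e1 : a + a + a + a + a + (b + b + b + b + b) + (c + c + c + c + c) =
    5 * a + 5 * b + 5 * c := by ring
  rw [e1]
  refine ⟨by omega, by omega, by omega, hH, ⟨⟨?_, ?_, ?_⟩, ?_, ?_, ?_, ?_, ?_⟩, by norm_num⟩
  · simp [St.set_r, hh.big_eq]
  · intro i hi
    simp only [St.set_r, if_true] at hi
    simp only [St.set_a, St.put_a_self]
    rw [Function.update_of_ne (by omega), Function.update_of_ne (by omega)]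
    exact hh.fresh i (by omega)
  · intro i
    simp only [St.set_a, St.put_a_self, Function.update_apply]
    split_ifs <;> first | exact le_rfl | exact hh.le i
  · simp [St.set_r]
  · simp [St.set_r, hfp]
  · simp [St.set_r, hfp]
  · intro i hi
    rw [hfp] at hi
    simp only [St.set_a, St.put_a_self]
    rw [Function.update_of_ne (by omega), Function.update_of_ne (by omega)]
  · intro x hx
    have h0 : s.a .tab (fp + x) = 0 := hh.fresh _ (by omega)
    simp only [St.set_a, St.put_a_self, Function.update_apply, hfp, h0, Nat.add_left_cancel_iff,
      Nat.add_eq_left]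
    by_cases h2 : x = 5 * a + 5 * b + 5 * c
    · rw [if_pos h2, if_pos (by tauto)]
    by_cases h1 : x = 0
    · rw [if_neg h2, if_pos h1, if_pos (by tauto)]
    rw [if_neg h2, if_neg h1, if_neg (by tauto)]

theorem wp_deleteGadget {E : Env} {big a : ℕ} {s : St} (hT : Tables W s) (hh : Heap big s)
    (ha : s.r .a = a) (h0 : 0 < a) (hlt : a < 9 ^ W) (hH : s.r .fp + 9 ^ W < E.H) :
    deleteGadget.wp E s fun s' t => NewTab W big (fun x => if x = 0 then big else if x = a
      then big - 1 else 0) s s' ∧ t ≤ 200 := by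
  obtain ⟨fp, hfp⟩ : ∃ fp, s.r .fp = fp := ⟨_, rfl⟩
  rw [hfp] at hH
  simp only [deleteGadget, block, Cmd.wp, ofNat_eq, add_eq, sub_eq, Ex.ok, Ex.ev, Ex.cost, St.set_r,
    St.put_r, reduceCtorEq, if_true, if_false, ha, hfp, hh.big_eq, hT.m, true_and, and_true]
  refine ⟨by omega, by omega, by omega, by omega, hH, ⟨⟨?_, ?_, ?_⟩, ?_, ?_, ?_, ?_, ?_⟩, by norm_num⟩
  · simp [St.set_r, hh.big_eq]
  · intro i hi
    simp only [St.set_r, if_true] at hi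
    simp only [St.set_a, St.put_a_self]
    rw [Function.update_of_ne (by omega), Function.update_of_ne (by omega)]
    exact hh.fresh i (by omega)
  · intro i
    simp only [St.set_a, St.put_a_self, Function.update_apply]
    split_ifs <;> first | omega | exact hh.le i
  · simp [St.set_r]
  · simp [St.set_r, hfp]
  · simp [St.set_r, hfp]
  · intro i hi
    rw [hfp] at hi
    simp only [St.set_a, St.put_a_self]
    rw [Function.update_of_ne (by omega), Function.update_of_ne (by omega)]
  · intro x hx
    have h1 : s.a .tab (fp + x) = 0 := hh.fresh _ (by omega)
    simp only [St.set_a, St.put_a_self, Function.update_apply, hfp, h1, Nat.add_left_cancel_iff,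
      Nat.add_eq_left]
    by_cases hx0 : x = 0
    · subst hx0; simp [h0.ne]
    · simp [hx0]

theorem _root_.IsConv.congr {big c : ℕ} {f f' g g' h : ℕ → ℕ} (hc : IsConv W big c f g h)
    (hf : ∀ x < 9 ^ W, f x = f' x) (hg : ∀ x < 9 ^ W, g x = g' x) : IsConv W big c f' g' h := by
  have lt : ∀ κ : ℕ → ℕ, (∀ p, κ p < 26) → (code9 W fun p => (relAt c p (κ p)).1) < 9 ^ W ∧
      (code9 W fun p => (relAt c p (κ p)).2.1) < 9 ^ W := fun κ hκ =>
    ⟨code9_lt fun p _ => (relAt_lt c p (hκ p)).1, code9_lt fun p _ => (relAt_lt c p (hκ p)).2.1⟩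
  refine ⟨fun κ hκ => ?_, fun x hx h0 => ?_⟩
  · rw [← hf _ (lt κ hκ).1, ← hg _ (lt κ hκ).2]; exact hc.le κ hκ
  · obtain ⟨κ, hκ, h1, h2⟩ := hc.ex x hx h0
    exact ⟨κ, hκ, h1, by rw [← hf _ (lt κ hκ).1, ← hg _ (lt κ hκ).2]; exact h2⟩

/-- A convolution step with a new table. -/
theorem wp_gadget {E : Env} {big c : ℕ} {p : Cmd} {e : Ex} {g : ℕ → ℕ} {s : St} {R R' : Set Partial}
    {χ : O.Colouring W} (hcur : Cur χ big R s) (hT : Tables W s)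
    (hp : p.wp E s fun s' t => NewTab W big g s s' ∧ t ≤ 200)
    (hr : ∀ x ∈ [Reg.W, .M], x ∉ p.wr) (ha : ∀ A ∈ [Arr.pow, .ra, .rb, .rc], A ∉ p.wa)
    (he : ∀ s', Frame p s s' → e.ev E s' = c ∧ e.ok E s') (hcost : e.cost ≤ 20) (hscH : c < E.H)
    (hH : 26 ^ W + 100 + s.r .fp + 9 ^ W + 9 ^ W < E.H) (hbig : 2 * big < E.H)
    (hR : ∀ h g', (∀ x < 9 ^ W, g' x = g x) →
      IsConv W big c (fun x => s.a .tab (s.r .pA + x)) g' h → Rep χ big h R') :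
    (Cmd.seq p (convStep e)).wp E s fun s' t => (Cur χ big R' s' ∧ Grow (2 * 9 ^ W) s s') ∧
      t ≤ 13000 * (W + 1) * 26 ^ W + 240 := by
  refine wp_seq _ hp ?_
  rintro s₁ t₁ hfr ⟨hn, ht₁⟩
  have hp9 : 0 < 9 ^ W := by positivity
  have hA : s₁.r .pA + 9 ^ W ≤ s₁.r .fp := by rw [hn.pA, hn.fp]; have := hcur.pA; omega
  have := wp_convStep (E := E) (hT.frame hfr hr ha) hn.toHeap (he _ hfr).1 (he _ hfr).2 hcost hscH hA
    (by rw [hn.pB, hn.fp]) (by rw [hn.fp]; omega) hbig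
  refine Cmd.wp_mono this ?_
  rintro s' t ⟨⟨h1, h2, h3, h4, h5⟩, ht⟩
  refine ⟨⟨⟨h1, by omega, hR _ (fun x => s₁.a .tab (s₁.r .pB + x)) ?_ ?_⟩, ?_, ?_, ?_⟩, by omega⟩
  · intro x hx; rw [hn.pB]; exact hn.eq x hx
  · rw [h2]
    refine h5.congr (fun x hx => ?_) (fun x _ => rfl)
    rw [hn.pA, hn.tab _ (by have := hcur.pA; omega)]
  · rw [h3, hn.fp]; omega
  · rw [h3, hn.fp]; omega
  · intro i hi; rw [h4 i (by rw [hn.fp]; omega), hn.tab i hi]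

end VM

/-! ### The forest of buckets -/

namespace ElimOrder

variable {O : ElimOrder} {W : ℕ}

/-- The scope of the tables at `i`; empty for `i = 0`. -/
def base (O : ElimOrder) (i : ℕ) : Finset ℕ := if i = 0 then ∅ else O.scope i

theorem base_subset {i : ℕ} (hi : i ≤ O.n) : O.base i ⊆ Finset.Icc 1 O.n := by
  unfold base
  split_ifs with h
  · simp
  · exact scope_subset (by omega) hi

theorem Colouring.injOn_base (χ : O.Colouring W) (i : ℕ) : Set.InjOn χ.col (O.base i) := by
  unfold base
  split_ifs
  · simp
  · exact χ.injOn i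

/-- The parent of `i`: the largest element of `bl i`, or `0`. -/
def parent (O : ElimOrder) (i : ℕ) : ℕ := (O.bl i).foldr max 0

theorem le_foldr_max (l : List ℕ) : ∀ x ∈ l, x ≤ l.foldr max 0 := by
  induction l with
  | nil => simp
  | cons a l ih =>
    intro x hx
    rcases List.mem_cons.mp hx with rfl | hx
    · simp
    · have := ih x hx; simp only [List.foldr_cons]; omega

theorem foldr_max_mem (l : List ℕ) : l.foldr max 0 = 0 ∨ l.foldr max 0 ∈ l := by
  induction l with
  | nil => simp
  | cons a l ih =>
    simp only [List.foldr_cons, List.mem_cons]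
    rcases le_total a (l.foldr max 0) with h | h
    · rw [max_eq_right h]; tauto
    · rw [max_eq_left h]; tauto

theorem le_parent {i v : ℕ} (hv : v ∈ O.bl i) : v ≤ O.parent i := le_foldr_max _ v hv

theorem parent_mem {i : ℕ} (h : O.parent i ≠ 0) : O.parent i ∈ O.bl i :=
  (foldr_max_mem (O.bl i)).resolve_left h

theorem parent_lt {i : ℕ} (hi : 1 ≤ i) : O.parent i < i := by
  by_cases h : O.parent i = 0
  · omega
  · exact (O.mem_lt _ _ (parent_mem h)).2

/-- By the clique property, once `i` is removed its table fits into the scope of the parent. -/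
theorem mem_bl_parent {i v : ℕ} (hv : v ∈ O.bl i) : v = O.parent i ∨ v ∈ O.bl (O.parent i) := by
  have h1 := le_parent hv
  have h2 := O.mem_lt _ _ hv
  rcases h1.lt_or_eq with h | h
  · exact .inr (O.clique _ _ _ hv (parent_mem (by omega)) h)
  · exact .inl h

/-- The sets `D j` with `j ≤ i` partition the vertices above `i`; the neighbourhoods of the members
of `D j` are contained in `D j` and the scope of `j`. -/
structure Forest (O : ElimOrder) (i : ℕ) (D : ℕ → Finset ℕ) : Prop where
  mem : ∀ d, (∃ j ≤ i, d ∈ D j) ↔ i < d ∧ d ≤ O.n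
  disj : ∀ j j', j ≤ i → j' ≤ i → j ≠ j' → Disjoint (D j) (D j')
  bl : ∀ j ≤ i, ∀ d ∈ D j, ∀ v ∈ O.bl d, v ∈ D j ∨ v = j ∨ v ∈ O.bl j

theorem Forest.lt {i : ℕ} {D : ℕ → Finset ℕ} (h : O.Forest i D) {j d : ℕ} (hj : j ≤ i) (hd : d ∈ D j) :
    i < d := ((h.mem d).mp ⟨j, hj, hd⟩).1

theorem forest_init : O.Forest O.n fun _ => ∅ where
  mem d := by simp
  disj := by simp
  bl := by simp

/-- Index `0` is a virtual root with empty scope: every neighbour of a member of `D 0` belongs to `D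
0` itself. -/
theorem Forest.on_base {i : ℕ} {D : ℕ → Finset ℕ} (h : O.Forest i D) {j : ℕ} (hj : j ≤ i) :
    On (O.base j) (O.midSet (D j) ∅) := by
  rintro p ⟨o, ho, -, h1, -, hg⟩
  refine ⟨fun v hv => ?_, hg⟩
  rw [h1, Finset.sum_empty, add_zero]
  by_cases hvD : v ∈ D j
  · simp [hvD]
  simp only [hvD, if_false]
  refine tot_apply_eq_zero ho hvD fun d hd hvd => ?_
  have h2 := h.bl j hj d hd v hvd
  have h3 := (O.mem_lt _ _ hvd).1
  unfold base at hv
  split_ifs at hv with h0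
  · subst h0
    rcases h2 with h2 | h2 | h2
    · exact hvD h2
    · omega
    · have := O.mem_lt _ _ h2; omega
  · simp only [scope, Finset.mem_insert, List.mem_toFinset] at hv
    tauto

theorem Forest.enc_lt {i : ℕ} {D : ℕ → Finset ℕ} (h : O.Forest i D) {j : ℕ} (hj : j ≤ i) (hi : i ≤ O.n)
    (χ : O.Colouring W) : ∀ p ∈ O.midSet (D j) ∅, enc χ p.1 < 9 ^ W := fun p hp =>
  ElimOrder.enc_lt (base_subset (hj.trans hi)) (χ.injOn_base j) (h.on_base hj p hp).1
    (h.on_base hj p hp).2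

theorem Rep.congr {χ : O.Colouring W} {big : ℕ} {f f' : ℕ → ℕ} {R : Set Partial} (h : Rep χ big f R)
    (hR : ∀ p ∈ R, enc χ p.1 < 9 ^ W) (hf : ∀ x < 9 ^ W, f' x = f x) : Rep χ big f' R where
  le p hp := by rw [hf _ (hR p hp)]; exact h.le p hp
  ex x hx h0 := by
    rw [hf x hx] at h0 ⊢
    exact h.ex x hx h0

theorem Forest.on_insert {i : ℕ} {D : ℕ → Finset ℕ} (h : O.Forest i D) (hi : 1 ≤ i) :
    On (O.base (O.parent i)) (O.midSet (insert i (D i)) ∅) := by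
  have h' : O.Forest i D := h
  rintro p ⟨o, ho, -, h1, -, hg⟩
  refine ⟨fun v hv => ?_, hg⟩
  rw [h1, Finset.sum_empty, add_zero]
  by_cases hvD : v ∈ insert i (D i)
  · simp [hvD]
  simp only [hvD, if_false]
  refine tot_apply_eq_zero ho hvD fun d hd hvd => hv ?_
  rw [Finset.mem_insert, not_or] at hvD
  have hb : v ∈ O.bl i := by
    rcases Finset.mem_insert.mp hd with rfl | hd
    · exact hvd
    · have := h.bl i le_rfl d hd v hvd; tauto
  have h2 := mem_bl_parent hb
  have h3 := (O.mem_lt _ _ hb).1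
  have h4 := le_parent hb
  unfold base
  rw [if_neg (by omega)]
  simp only [scope, Finset.mem_insert, List.mem_toFinset]
  exact h2

/-- List entries that leave a branch lead into the scope of its root and are thus at most that root,
while removed vertices are larger. Hence neither branch has list entries in the other. -/
theorem Forest.conv {i : ℕ} {D : ℕ → Finset ℕ} (h : O.Forest i D) (hi : 1 ≤ i) :
    convSet (O.midSet (D (O.parent i)) ∅) (O.midSet (insert i (D i)) ∅) =
      O.midSet (D (O.parent i) ∪ insert i (D i)) ∅ := by
  have hp := O.parent_lt hi
  have hpi : i ∉ D (O.parent i) := fun hd => lt_irrefl _ (h.lt hp.le hd)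
  have hdis := h.disj (O.parent i) i hp.le le_rfl hp.ne
  refine convSet_midSet ?_ ?_ ?_
  · rw [Finset.disjoint_insert_right]
    exact ⟨hpi, hdis⟩
  · intro d hd v hv hvd
    have h1 := h.bl _ hp.le d hd v hvd
    have h2 : v ∉ D (O.parent i) := by
      rcases Finset.mem_insert.mp hv with rfl | hv
      · exact hpi
      · exact Finset.disjoint_right.mp hdis hv
    have h3 : i ≤ v := by
      rcases Finset.mem_insert.mp hv with rfl | hv
      · exact le_rfl
      · exact (h.lt le_rfl hv).le
    rcases h1 with h1 | h1 | h1
    · exact h2 h1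
    · omega
    · have := O.mem_lt _ _ h1; omega
  · intro d hd v hv hvd
    have h3 := h.lt hp.le hv
    rcases Finset.mem_insert.mp hd with rfl | hd
    · have := O.mem_lt _ _ hvd; omega
    · rcases h.bl i le_rfl d hd v hvd with h1 | h1 | h1
      · exact Finset.disjoint_left.mp hdis hv h1
      · omega
      · have := O.mem_lt _ _ h1; omega

/-- The branch of `i + 1`, enlarged by `i + 1`, moves to the parent; no other set with index at most
`i` changes. -/
theorem Forest.step {i : ℕ} {D : ℕ → Finset ℕ} (h : O.Forest (i + 1) D) (hi : i + 1 ≤ O.n) :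
    O.Forest i (Function.update D (O.parent (i + 1))
      (D (O.parent (i + 1)) ∪ insert (i + 1) (D (i + 1)))) := by
  have hp := O.parent_lt (i := i + 1) (by omega)
  obtain ⟨p, hp'⟩ : ∃ p, O.parent (i + 1) = p := ⟨_, rfl⟩
  rw [hp'] at hp ⊢
  have hpi : ∀ j ≤ i, i + 1 ∉ D j := fun j hj hd => lt_irrefl _ (h.lt (by omega) hd)
  refine ⟨fun d => ?_, ?_, ?_⟩
  · constructor
    · rintro ⟨j, hj, hd⟩
      rw [Function.update_apply] at hd
      split_ifs at hd with hjp
      · rw [Finset.mem_union, Finset.mem_insert] at hd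
        rcases hd with hd | rfl | hd
        · have := (h.mem d).mp ⟨p, by omega, hd⟩; omega
        · omega
        · have := (h.mem d).mp ⟨i + 1, by omega, hd⟩; omega
      · have := (h.mem d).mp ⟨j, by omega, hd⟩; omega
    · rintro ⟨h1, h2⟩
      rcases Nat.lt_or_ge (i + 1) d with h3 | h3
      · obtain ⟨j, hj, hd⟩ := (h.mem d).mpr ⟨h3, h2⟩
        by_cases hji : j = i + 1
        · exact ⟨p, by omega, by rw [Function.update_self]; subst hji; simp [hd]⟩
        · refine ⟨j, by omega, ?_⟩
          rw [Function.update_apply]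
          split_ifs with hjp
          · subst hjp; simp [hd]
          · exact hd
      · exact ⟨p, by omega, by rw [Function.update_self]; simp; omega⟩
  · have key : ∀ j ≤ i, j ≠ p → Disjoint (D j) (D p ∪ insert (i + 1) (D (i + 1))) := by
      intro j hj hjp
      rw [Finset.disjoint_union_right, Finset.disjoint_insert_right]
      exact ⟨h.disj j p (by omega) (by omega) hjp, hpi j hj,
        h.disj j (i + 1) (by omega) le_rfl (by omega)⟩
    intro j j' hj hj' hne
    rw [Function.update_apply, Function.update_apply]
    split_ifs with h1 h2 h2
    · omega
    · exact (key j' hj' h2).symm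
    · exact key j hj h1
    · exact h.disj j j' (by omega) (by omega) hne
  · intro j hj d hd v hv
    rw [Function.update_apply] at hd ⊢
    split_ifs at hd ⊢ with hjp
    · subst hjp
      simp only [Finset.mem_union, Finset.mem_insert] at hd ⊢
      have aux : v ∈ O.bl (i + 1) → v = j ∨ v ∈ O.bl j := fun hv => by
        rw [← hp']; exact mem_bl_parent hv
      rcases hd with hd | rfl | hd
      · have := h.bl j (by omega) d hd v hv; tauto
      · exact .inr (aux hv)
      · have := h.bl (i + 1) le_rfl d hd v hv; tauto
    · exact h.bl j (by omega) d hd v hv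

theorem Forest.zero {D : ℕ → Finset ℕ} (h : O.Forest 0 D) : D 0 = Finset.Icc 1 O.n := by
  ext d
  rw [Finset.mem_Icc]
  constructor
  · intro hd; have := (h.mem d).mp ⟨0, le_rfl, hd⟩; omega
  · intro hd
    obtain ⟨j, hj, h'⟩ := (h.mem d).mpr (by omega)
    obtain rfl : j = 0 := by omega
    exact h'

theorem length_bl_le (χ : O.Colouring W) {i : ℕ} (hi : 1 ≤ i) (hn : i ≤ O.n) : (O.bl i).length ≤ W := by
  rw [← List.toFinset_card_of_nodup (O.nodup i)]
  calc (O.bl i).toFinset.card ≤ (O.scope i).card := Finset.card_le_card (Finset.subset_insert _ _)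
    _ = ((O.scope i).image χ.col).card := (Finset.card_image_of_injOn (χ.injOn i)).symm
    _ ≤ (Finset.range W).card := Finset.card_le_card fun c hc => by
        obtain ⟨v, hv, rfl⟩ := Finset.mem_image.mp hc
        have := Finset.mem_Icc.mp (scope_subset hi hn hv)
        exact Finset.mem_range.mpr (χ.lt v this.1 this.2)
    _ = W := Finset.card_range W

/-- Even for `p = q` the digit is only `8`, so the colours need not be different here. -/
theorem two_pow_lt {p q : ℕ} (hp : p < W) (hq : q < W) : 4 * 9 ^ p + 4 * 9 ^ q < 9 ^ W := by
  have key : ∀ p < W, 9 * 9 ^ p ≤ 9 ^ W := fun p hp => by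
    rw [← pow_succ']; exact Nat.pow_le_pow_right (by norm_num) hp
  have h1 := key p hp
  have h2 := key q hq
  have : 0 < 9 ^ W := by positivity
  omega

/-- Digits `5` at three different positions below `W` cause no carry; with a repeated position they
would. -/
theorem three_pow_lt {p q r : ℕ} (hp : p < W) (hq : q < W) (hr : r < W) (hpq : p ≠ q) (hpr : p ≠ r)
    (hqr : q ≠ r) : 5 * 9 ^ p + 5 * 9 ^ q + 5 * 9 ^ r < 9 ^ W := by
  have key : ∀ p q : ℕ, p < q → 9 * 9 ^ p ≤ 9 ^ q := fun p q hp => by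
    rw [← pow_succ']; exact Nat.pow_le_pow_right (by norm_num) hp
  have sorted : ∀ p q r : ℕ, p < q → q < r → r < W → 5 * 9 ^ p + 5 * 9 ^ q + 5 * 9 ^ r < 9 ^ W := by
    intro p q r h1 h2 h3
    have := key p q h1
    have := key q r h2
    have := key r W h3
    have : 0 < 9 ^ W := by positivity
    omega
  rcases lt_or_gt_of_ne hpq with h1 | h1 <;> rcases lt_or_gt_of_ne hpr with h2 | h2 <;>
    rcases lt_or_gt_of_ne hqr with h3 | h3
  · exact sorted p q r h1 h3 hr
  · have := sorted p r q h2 h3 hq; omega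
  · omega
  · have := sorted r p q h2 h1 hq; omega
  · have := sorted q p r h1 h2 hr; omega
  · omega
  · have := sorted q r p h3 h2 hp; omega
  · have := sorted r q p h3 h1 hp; omega

end ElimOrder

/-! ### The elimination of one vertex as a program -/

namespace VM

open ElimOrder

variable {O : ElimOrder} {W : ℕ}

/-- A pair that is neither an edge nor a triangle in decreasing order has the zero contribution as
its only option, and the table may stay as it is. Otherwise the item costs one convolution. -/
theorem wp_processItem {E : Env} {χ : O.Colouring W} {big i j z : ℕ} {D : Finset ℕ} {P : Finset Item}
    {s : St} (hI : Inst E χ s) (hcur : Cur χ big (O.midSet D P) s)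
    (hi : s.r .i = i) (hj : s.r .j = j) (hz : s.r .z = z) (ha : s.r .a = 9 ^ χ.col i)
    (hb : s.r .b = 9 ^ χ.col j) (hh : s.r .h = 9 ^ χ.col z) (hi1 : 1 ≤ i) (hin : i ≤ O.n)
    (hjm : j ∈ O.bl i) (hzm : z ∈ O.bl i) (hon : On (O.scope i) (O.midSet D P))
    (hP : (⟨i, (j, z)⟩ : Item) ∉ P) (hD : i ∉ D)
    (hH : 26 ^ W + 100 + s.r .fp + 9 ^ W + 9 ^ W < E.H) (hbig : 2 * big < E.H) (hn : O.n < E.H) :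
    processItem.wp E s fun s' t => (Cur χ big (O.midSet D (insert ⟨i, (j, z)⟩ P)) s' ∧
      Grow (2 * 9 ^ W) s s') ∧ t ≤ 13000 * (W + 1) * 26 ^ W + 500 := by
  have hj' := O.mem_lt _ _ hjm
  have hz' := O.mem_lt _ _ hzm
  have hscope : O.scope i ⊆ Finset.Icc 1 O.n := scope_subset hi1 hin
  have hit : (⟨i, (j, z)⟩ : Item) ∈ O.items {i} := by simp [mem_items, hjm, hzm]
  have hitD : (⟨i, (j, z)⟩ : Item) ∉ O.items D := by simp [mem_items, hD]
  have hp9 : 0 < 9 ^ W := by positivity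
  have hp26 : 0 < 26 ^ W := by positivity
  have hW : W < E.H := by
    have : W < 26 ^ W := Nat.lt_pow_self (by norm_num)
    omega
  have hev : ∀ p : Cmd, Reg.W ∉ p.wr → ∀ s', Frame p s s' →
      (Ex.reg .W).ev E s' = W ∧ (Ex.reg .W).ok E s' := fun p hp s' hf =>
    ⟨by simp only [Ex.ev]; rw [hf.r _ hp, hI.w], trivial⟩
  have hskip : (∀ δ, O.Opt ⟨i, (j, z)⟩ δ → δ = 0) →
      Cur χ big (O.midSet D (insert ⟨i, (j, z)⟩ P)) s ∧ Grow (2 * 9 ^ W) s s := fun h =>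
    ⟨by rw [midSet_insert_trivial h]; exact hcur, Grow.refl _ _⟩
  have ci := χ.lt i hi1 hin
  have cj := χ.lt j hj'.1 (by omega)
  have cz := χ.lt z hz'.1 (by omega)
  have aij := hI.adj i j hi1 hin hj'.1 (by omega)
  have aiz := hI.adj i z hi1 hin hz'.1 (by omega)
  have ajz := hI.adj j z hj'.1 (by omega) hz'.1 (by omega)
  have rij := hI.row i j hi1 hin hj'.1 (by omega)
  have riz := hI.row i z hi1 hin hz'.1 (by omega)
  have rjz := hI.row j z hj'.1 (by omega) hz'.1 (by omega)
  have hedge : j = z → O.adj i j → (Cmd.seq edgeGadget (convStep Reg.W)).wp E s fun s' t =>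
      (Cur χ big (O.midSet D (insert ⟨i, (j, z)⟩ P)) s' ∧ Grow (2 * 9 ^ W) s s') ∧
        t ≤ 13000 * (W + 1) * 26 ^ W + 240 := by
    intro hjz hadj
    have hlt := two_pow_lt ci cj
    refine wp_gadget hcur hI.toTables (wp_edgeGadget hI.toTables hcur.toHeap ha hb hlt (by omega))
      (by decide) (by decide) (hev _ (by decide)) (by simp [Ex.cost]) hW hH hbig ?_
    intro h g' hg' hc
    subst hjz
    rw [← convSet_optSet hP hitD]
    exact rep_convSet hscope (χ.injOn i) hon (on_optSet hit) hcur.rep (rep_edge hadj hg' hlt) hc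
  have htri : z < j → O.adj i j → O.adj i z → O.adj j z →
      (Cmd.seq triangleGadget (convStep Reg.W)).wp E s fun s' t =>
      (Cur χ big (O.midSet D (insert ⟨i, (j, z)⟩ P)) s' ∧ Grow (2 * 9 ^ W) s s') ∧
        t ≤ 13000 * (W + 1) * 26 ^ W + 240 := by
    intro hzj h1 h2 h3
    have hlt := three_pow_lt ci cj cz (χ.ne i j hjm).symm (χ.ne i z hzm).symm
      (χ.ne j z (O.edge _ _ h3 hzj)).symm
    refine wp_gadget hcur hI.toTables (wp_triangleGadget hI.toTables hcur.toHeap ha hb hh hlt (by omega))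
      (by decide) (by decide) (hev _ (by decide)) (by simp [Ex.cost]) hW hH hbig ?_
    intro h g' hg' hc
    rw [← convSet_optSet hP hitD]
    exact rep_convSet hscope (χ.injOn i) hon (on_optSet hit) hcur.rep
      (rep_triangle hzj h1 h2 h3 hg' hlt) hc
  clear hcur hon hscope hev hI
  have hopt : ∀ δ, O.Opt ⟨i, (j, z)⟩ δ → ¬ (j = z ∧ O.adj i j) →
      ¬ (z < j ∧ O.adj i j ∧ O.adj i z ∧ O.adj j z) → δ = 0 := by
    rintro δ (⟨h1, h2, -⟩ | ⟨h1, h2, -⟩ | ⟨-, -, h⟩) h3 h4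
    · exact absurd ⟨h1, h2⟩ h3
    · exact absurd ⟨h1, h2⟩ h4
    · exact h
  have eij : (Ex.arr .adj (Ex.arr .row Reg.i + Reg.j)).ev E s = s.a .adj (s.a .row i + j) := by
    simp only [Ex.ev, add_eq, hi, hj]
  have eiz : (Ex.arr .adj (Ex.arr .row Reg.i + Reg.z)).ev E s = s.a .adj (s.a .row i + z) := by
    simp only [Ex.ev, add_eq, hi, hz]
  have ejz : (Ex.arr .adj (Ex.arr .row Reg.j + Reg.z)).ev E s = s.a .adj (s.a .row j + z) := by
    simp only [Ex.ev, add_eq, hz, hj]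
  have oij : (Ex.arr .adj (Ex.arr .row Reg.i + Reg.j)).ok E s := by
    simp only [Ex.ok, Ex.ev, add_eq, hi, hj, true_and, and_true]; omega
  have oiz : (Ex.arr .adj (Ex.arr .row Reg.i + Reg.z)).ok E s := by
    simp only [Ex.ok, Ex.ev, add_eq, hi, hz, true_and, and_true]; omega
  have ojz : (Ex.arr .adj (Ex.arr .row Reg.j + Reg.z)).ok E s := by
    simp only [Ex.ok, Ex.ev, add_eq, hj, hz, true_and, and_true]; omega
  have e1 : (Ex.reg .j - Ex.reg .z).ev E s = j - z := by simp only [Ex.ev, sub_eq, hj, hz]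
  have e2 : ((Ex.reg .j - Ex.reg .z) + (Ex.reg .z - Ex.reg .j)).ev E s = (j - z) + (z - j) := by
    simp only [Ex.ev, sub_eq, add_eq, hj, hz]
  have c1 : (Ex.reg .j - Ex.reg .z).cost = 3 := rfl
  have c2 : ((Ex.reg .j - Ex.reg .z) + (Ex.reg .z - Ex.reg .j)).cost = 7 := rfl
  have c3 : (Ex.arr .adj (Ex.arr .row Reg.i + Reg.j)).cost = 21 := rfl
  have c4 : (Ex.arr .adj (Ex.arr .row Reg.i + Reg.z)).cost = 21 := rfl
  have c5 : (Ex.arr .adj (Ex.arr .row Reg.j + Reg.z)).cost = 21 := rfl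
  refine ⟨⟨⟨trivial, trivial⟩, ⟨trivial, trivial⟩, ?_⟩, fun h => ?_, fun h => ?_⟩
  · simp only [Ex.ev, sub_eq, hj, hz]; omega
  · rw [e2] at h
    have hjz : j ≠ z := by omega
    refine ⟨⟨trivial, trivial⟩, fun h => ?_, fun h => ?_⟩
    · rw [e1] at h
      refine ⟨oij, fun h1 => ?_, fun h1 => ?_⟩
      · rw [eij, aij] at h1
        refine ⟨oiz, fun h2 => ?_, fun h2 => ?_⟩
        · rw [eiz, aiz] at h2
          refine ⟨ojz, fun h3 => ?_, fun h3 => ?_⟩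
          · rw [ejz, ajz] at h3
            refine Cmd.wp_mono (htri (by omega) h1 h2 h3) fun s' t h => ⟨h.1, ?_⟩
            have := h.2
            omega
          · refine ⟨hskip fun δ hδ => hopt δ hδ (fun h => hjz h.1) fun h => ?_, by omega⟩
            have := ajz.mpr h.2.2.2; rw [ejz] at h3; omega
        · refine ⟨hskip fun δ hδ => hopt δ hδ (fun h => hjz h.1) fun h => ?_, by omega⟩
          have := aiz.mpr h.2.2.1; rw [eiz] at h2; omega
      · refine ⟨hskip fun δ hδ => hopt δ hδ (fun h => hjz h.1) fun h => ?_, by omega⟩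
        have := aij.mpr h.2.1; rw [eij] at h1; omega
    · rw [e1] at h
      exact ⟨hskip fun δ hδ => hopt δ hδ (fun h => hjz h.1) fun h => by omega, by omega⟩
  · rw [e2] at h
    have hjz : j = z := by omega
    refine ⟨oij, fun h1 => ?_, fun h1 => ?_⟩
    · rw [eij, aij] at h1
      refine Cmd.wp_mono (hedge hjz h1) fun s' t h => ⟨h.1, ?_⟩
      have := h.2
      omega
    · refine ⟨hskip fun δ hδ => hopt δ hδ (fun h => ?_) fun h => by omega, by omega⟩
      have := aij.mpr h.2; rw [eij] at h1; omega

end VM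

namespace VM

open ElimOrder

variable {O : ElimOrder} {W : ℕ}

/-- The body of the inner loop over the neighbours of `i`. -/
def innerBody : Cmd :=
  block [.set .z (.arr .bls (Reg.bp + Reg.v)), .set .h (.arr .pow (.arr .col Reg.z)), processItem,
    .set .v (Reg.v + 1)]

/-- The body of the outer loop over the neighbours of `i`. -/
def outerBody : Cmd :=
  block [.set .j (.arr .bls (Reg.bp + Reg.u)), .set .p (Reg.p + (Reg.j - Reg.p)),
    .set .b (.arr .pow (.arr .col Reg.j)), .set .v 0, .rep Reg.l innerBody, .set .u (Reg.u + 1)]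

/-- The elimination of `i`. -/
def bucket : Cmd :=
  block [.set .pA (.arr .acc Reg.i), .set .a (.arr .pow (.arr .col Reg.i)),
    .set .bp (.arr .bst Reg.i), .set .l (.arr .ben Reg.i - Reg.bp), .set .p 0, .set .u 0,
    .rep Reg.l outerBody,
    .seq deleteGadget (convStep (.arr .col Reg.i)),
    .set .pB (.arr .acc Reg.p), convStep Reg.W, .put .acc Reg.p Reg.pA]

/-- The items of `i` with ends in two lists. -/
def pairs (i : ℕ) (l l' : List ℕ) : Finset Item :=
  (l.toFinset ×ˢ l'.toFinset).image fun q => ⟨i, q⟩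

theorem mem_pairs {i : ℕ} {l l' : List ℕ} {it : Item} :
    it ∈ pairs i l l' ↔ it.1 = i ∧ it.2.1 ∈ l ∧ it.2.2 ∈ l' := by
  obtain ⟨a, b, c⟩ := it
  simp only [pairs, Finset.mem_image, Finset.mem_product, List.mem_toFinset, Sigma.mk.injEq,
    heq_eq_eq, Prod.exists, Prod.mk.injEq]
  constructor
  · rintro ⟨x, y, ⟨h1, h2⟩, rfl, rfl, rfl⟩; exact ⟨rfl, h1, h2⟩
  · rintro ⟨rfl, h1, h2⟩; exact ⟨b, c, ⟨h1, h2⟩, rfl, rfl, rfl⟩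

theorem pairs_self (i : ℕ) : pairs i (O.bl i) (O.bl i) = O.items {i} := by
  ext it
  rw [mem_pairs, mem_items, Finset.mem_singleton]
  constructor <;> rintro ⟨rfl, h⟩ <;> exact ⟨rfl, h⟩

theorem mem_take_succ {l : List ℕ} {u x : ℕ} (hu : u < l.length) :
    x ∈ l.take (u + 1) ↔ x ∈ l.take u ∨ x = l[u] := by
  rw [List.take_succ_eq_append_getElem hu, List.mem_append, List.mem_singleton]

theorem getElem_notMem_take {l : List ℕ} (hl : l.Nodup) {u : ℕ} (hu : u < l.length) :
    l[u] ∉ l.take u := by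
  have h := hl.sublist (List.take_sublist (u + 1) l)
  rw [List.take_succ_eq_append_getElem hu, List.nodup_append] at h
  intro hm
  exact h.2.2 _ hm _ (by simp) rfl

theorem pairs_take_succ {i j : ℕ} {l : List ℕ} {v : ℕ} (hv : v < l.length) :
    pairs i [j] (l.take (v + 1)) = insert ⟨i, (j, l[v])⟩ (pairs i [j] (l.take v)) := by
  ext ⟨a, b, c⟩
  rw [Finset.mem_insert, mem_pairs, mem_pairs, mem_take_succ hv, List.mem_singleton]
  simp only [Sigma.mk.injEq, heq_eq_eq, Prod.mk.injEq]
  tauto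

theorem pairs_take_succ_left {i : ℕ} {l l' : List ℕ} {u : ℕ} (hu : u < l.length) :
    pairs i (l.take (u + 1)) l' = pairs i (l.take u) l' ∪ pairs i [l[u]] l' := by
  ext ⟨a, b, c⟩
  rw [Finset.mem_union, mem_pairs, mem_pairs, mem_pairs, mem_take_succ hu, List.mem_singleton]
  tauto

/-- The registers that are fixed during the elimination of `i`. -/
structure AtI (E : Env) (χ : O.Colouring W) (i : ℕ) (s : St) : Prop extends Inst E χ s where
  i_eq : s.r .i = i
  a_eq : s.r .a = 9 ^ χ.col i
  bp_eq : s.r .bp = s.a .bst i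
  l_eq : s.r .l = (O.bl i).length

theorem AtI.frame {E : Env} {χ : O.Colouring W} {i : ℕ} {s s' : St} {p : Cmd} (h : AtI E χ i s)
    (hf : Frame p s s') (hr : ∀ x ∈ [Reg.W, .M, .n], x ∉ p.wr)
    (hr' : ∀ x ∈ [Reg.i, .a, .bp, .l], x ∉ p.wr)
    (ha : ∀ A ∈ [Arr.pow, .ra, .rb, .rc, .col, .bst, .ben, .bls, .adj, .row], A ∉ p.wa) :
    AtI E χ i s' := by
  refine ⟨h.toInst.frame hf hr ha, ?_, ?_, ?_, ?_⟩
  · rw [hf.r _ (hr' _ (by simp)), h.i_eq]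
  · rw [hf.r _ (hr' _ (by simp)), h.a_eq]
  · rw [hf.r _ (hr' _ (by simp)), hf.a _ (ha _ (by simp)), h.bp_eq]
  · rw [hf.r _ (hr' _ (by simp)), h.l_eq]

theorem loop_time {L T c t : ℕ} (hL : L ≤ W) (ht : t ≤ c + 1 + L * (T + 600 + 3)) :
    t ≤ c + 1 + W * (T + 603) :=
  ht.trans (Nat.add_le_add_left (Nat.mul_le_mul_right (T + 603) hL) _)

theorem wp_innerBody {E : Env} {χ : O.Colouring W} {big i j v : ℕ} {D : Finset ℕ} {P : Finset Item}
    {s : St} (hI : AtI E χ i s) (hcur : Cur χ big (O.midSet D P) s)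
    (hj : s.r .j = j) (hv : s.r .v = v) (hvl : v < (O.bl i).length)
    (hb : s.r .b = 9 ^ χ.col j) (hi1 : 1 ≤ i) (hin : i ≤ O.n)
    (hjm : j ∈ O.bl i) (hon : On (O.scope i) (O.midSet D P))
    (hP : (⟨i, (j, (O.bl i)[v])⟩ : Item) ∉ P) (hD : i ∉ D)
    (hH : 26 ^ W + 100 + s.r .fp + 2 * 9 ^ W < E.H) (hbig : 2 * big < E.H) (hn : O.n < E.H) :
    innerBody.wp E s fun s' t => (s'.r .v = v + 1 ∧
      Cur χ big (O.midSet D (insert ⟨i, (j, (O.bl i)[v])⟩ P)) s' ∧ Grow (2 * 9 ^ W) s s') ∧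
      t ≤ 13000 * (W + 1) * 26 ^ W + 600 := by
  have hzm : (O.bl i)[v] ∈ O.bl i := List.getElem_mem hvl
  obtain ⟨z, hz⟩ : ∃ z, (O.bl i)[v] = z := ⟨_, rfl⟩
  have hbls := hI.bls i hi1 hin v hvl
  rw [hz] at hzm hP hbls ⊢
  have hz' := O.mem_lt _ _ hzm
  have hben := hI.ben i hi1 hin
  have hbenlt := hI.ben_lt i hi1 hin
  have hcz := hI.col z hz'.1 (by omega)
  have hcl := χ.lt z hz'.1 (by omega)
  have hpow := hI.pow (χ.col z) hcl.le
  have hp9 : 0 < 9 ^ W := by positivity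
  have hW : W < 26 ^ W := Nat.lt_pow_self (by norm_num)
  have e1 : (Ex.arr .bls (Reg.bp + Reg.v : Ex)).ev E s = z := by
    simp only [Ex.ev, add_eq, hI.bp_eq, hv, hbls]
  simp only [innerBody, wp_block_cons, block_singleton]
  refine ⟨⟨⟨trivial, trivial, ?_⟩, ?_⟩, ?_⟩
  · simp only [Ex.ev, hI.bp_eq, hv]; omega
  · simp only [Ex.ev, add_eq, hI.bp_eq, hv]; omega
  rw [e1]
  have e2 : (Ex.arr .pow (.arr .col Reg.z)).ev E (s.set .z z) = 9 ^ χ.col z := by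
    simp only [Ex.ev, St.set_a, St.set_r_self, hcz, hpow]
  refine ⟨⟨⟨trivial, ?_⟩, ?_⟩, ?_⟩
  · simp only [Ex.ev, St.set_r_self]; omega
  · simp only [Ex.ev, St.set_a, St.set_r_self, hcz]; omega
  rw [e2]
  have hIs : Inst E χ ((s.set .z z).set .h (9 ^ χ.col z)) := by
    refine (hI.toInst.frame (p := .seq (.set .z 0) (.set .h 0)) ⟨fun x hx => ?_, fun _ _ => rfl⟩
      (by decide) (by decide))
    simp only [Cmd.wr, List.mem_append, List.mem_singleton, not_or] at hx
    rw [St.set_r_ne _ _ hx.2, St.set_r_ne _ _ hx.1]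
  have hcur' : Cur χ big (O.midSet D P) ((s.set .z z).set .h (9 ^ χ.col z)) :=
    ⟨⟨hcur.big_eq, hcur.fresh, hcur.le⟩, hcur.pA, hcur.rep⟩
  have := wp_processItem (E := E) (i := i) (j := j) (z := z) (P := P) (D := D) hIs hcur'
    (by simp [St.set_r, hI.i_eq]) (by simp [St.set_r, hj]) (by simp [St.set_r])
    (by simp [St.set_r, hI.a_eq]) (by simp [St.set_r, hb]) (by simp [St.set_r]) hi1 hin hjm hzm hon hP
    hD (by show 26 ^ W + 100 + s.r .fp + 9 ^ W + 9 ^ W < E.H; omega) hbig hn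
  refine Cmd.wp_mono (Cmd.wp_frame this) ?_
  rintro s' t ⟨⟨⟨h1, h2⟩, ht⟩, hf⟩
  have hv' : s'.r .v = v := by rw [hf.r _ (by decide)]; simp [St.set_r, hv]
  refine ⟨⟨trivial, by show 1 < E.H; omega, by simp only [Ex.ev, ofNat_eq, hv']; omega⟩, ⟨?_, ?_, ?_⟩, ?_⟩
  · simp only [Ex.ev, ofNat_eq, add_eq, St.set_r_self, hv']
  · exact ⟨⟨h1.big_eq, h1.fresh, h1.le⟩, h1.pA, h1.rep⟩
  · exact ⟨h2.le, h2.le_add, h2.tab⟩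
  · simp only [Ex.cost, ofNat_eq, add_eq]; omega

/-- The loop also keeps the maximum of the list entries seen: with truncated subtraction, `p + (j -
p)` is the maximum of `p` and `j`. After the last entry `p` is the parent. -/
theorem wp_outerBody {E : Env} {χ : O.Colouring W} {big i u : ℕ} {D : Finset ℕ}
    {s : St} (hI : AtI E χ i s) (hu : s.r .u = u) (hul : u < (O.bl i).length)
    (hcur : Cur χ big (O.midSet D (pairs i ((O.bl i).take u) (O.bl i))) s)
    (hp : s.r .p = ((O.bl i).take u).foldl max 0) (hi1 : 1 ≤ i) (hin : i ≤ O.n)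
    (hD' : ∀ d ∈ D, ∀ v ∈ O.bl d, v ∈ D ∨ v = i ∨ v ∈ O.bl i) (hD : i ∉ D)
    (hH : 26 ^ W + 100 + s.r .fp + W * (2 * 9 ^ W) < E.H) (hbig : 2 * big < E.H) (hn : O.n < E.H) :
    outerBody.wp E s fun s' t => (s'.r .u = u + 1 ∧
      s'.r .p = ((O.bl i).take (u + 1)).foldl max 0 ∧
      Cur χ big (O.midSet D (pairs i ((O.bl i).take (u + 1)) (O.bl i))) s' ∧
      Grow (W * (2 * 9 ^ W)) s s') ∧ t ≤ W * (13000 * (W + 1) * 26 ^ W + 603) + 200 := by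
  have hjm : (O.bl i)[u] ∈ O.bl i := List.getElem_mem hul
  have hjt : (O.bl i)[u] ∉ (O.bl i).take u := getElem_notMem_take (O.nodup i) hul
  have hlen := length_bl_le χ hi1 hin
  have hpairs := pairs_take_succ_left (i := i) (l' := O.bl i) hul
  have hfold : ((O.bl i).take (u + 1)).foldl max 0 = max (((O.bl i).take u).foldl max 0) (O.bl i)[u] := by
    rw [List.take_succ_eq_append_getElem hul, List.foldl_append]; rfl
  have hbls := hI.bls i hi1 hin u hul
  obtain ⟨j, hj⟩ : ∃ j, (O.bl i)[u] = j := ⟨_, rfl⟩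
  rw [hfold, ← hp]
  rw [hj] at hjm hbls hjt hpairs ⊢
  have hj' := O.mem_lt _ _ hjm
  have hben := hI.ben i hi1 hin
  have hbenlt := hI.ben_lt i hi1 hin
  have hcz := hI.col j hj'.1 (by omega)
  have hcl := χ.lt j hj'.1 (by omega)
  have hpow := hI.pow (χ.col j) hcl.le
  have hp9 : 0 < 9 ^ W := by positivity
  have hW : W < 26 ^ W := Nat.lt_pow_self (by norm_num)
  have e1 : (Ex.arr .bls (Reg.bp + Reg.u : Ex)).ev E s = j := by
    simp only [Ex.ev, add_eq, hI.bp_eq, hu, hbls]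
  simp only [outerBody, wp_block_cons, block_singleton]
  refine ⟨⟨⟨trivial, trivial, ?_⟩, ?_⟩, ?_⟩
  · simp only [Ex.ev, hI.bp_eq, hu]; omega
  · simp only [Ex.ev, add_eq, hI.bp_eq, hu]; omega
  rw [e1]
  have hpn : max (s.r .p) j ≤ O.n := by
    rw [hp]
    refine max_le ?_ (by omega)
    have key : ∀ (l : List ℕ) (m : ℕ), m ≤ O.n → (∀ x ∈ l, x ≤ O.n) → l.foldl max m ≤ O.n := by
      intro l
      induction l with
      | nil => intro m hm _; exact hm
      | cons a l ih =>
        intro m hm hl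
        exact ih _ (max_le hm (hl a (by simp))) fun x hx => hl x (by simp [hx])
    refine key _ 0 (Nat.zero_le _) fun x hx => ?_
    have := O.mem_lt _ _ (List.mem_of_mem_take hx)
    omega
  have e3 : (Ex.reg .p + (Ex.reg .j - Ex.reg .p)).ev E (s.set .j j) = max (s.r .p) j := by
    simp only [Ex.ev, sub_eq, add_eq, St.set_r, reduceCtorEq, if_true, if_false]; omega
  have e3' : (s.set .j j).r .p + (Ex.reg .j - Ex.reg .p).ev E (s.set .j j) = max (s.r .p) j := e3
  refine ⟨⟨trivial, ⟨trivial, trivial⟩, by show _ + _ < _; simp only [Ex.ev]; rw [e3']; omega⟩, ?_⟩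
  rw [e3]
  obtain ⟨m, hm⟩ : ∃ m, max (s.r .p) j = m := ⟨_, rfl⟩
  rw [hm]
  have e2 : (Ex.arr .pow (.arr .col Reg.j)).ev E ((s.set .j j).set .p m) = 9 ^ χ.col j := by
    simp [Ex.ev, St.set_r, hcz, hpow]
  refine ⟨⟨⟨trivial, ?_⟩, ?_⟩, ?_⟩
  · simp only [Ex.ev, St.set_r, reduceCtorEq, if_true, if_false]; omega
  · simp only [Ex.ev, St.set_r, St.set_a, reduceCtorEq, if_true, if_false, hcz]; omega
  rw [e2]
  refine ⟨by show 0 < E.H; omega, ?_⟩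
  have e4 : ∀ s', (0 : Ex).ev E s' = 0 := fun _ => rfl
  rw [e4]
  obtain ⟨s₁, hs₁⟩ : ∃ s₁, ((((s.set .j j).set .p m).set .b (9 ^ χ.col j)).set .v 0) = s₁ := ⟨_, rfl⟩
  rw [hs₁]
  have hI₁ : AtI E χ i s₁ := by
    refine (hI.frame (p := block [.set .j 0, .set .p 0, .set .b 0, .set .v 0])
      ⟨fun x hx => ?_, fun _ _ => by rw [← hs₁]; rfl⟩ (by decide) (by decide) (by decide))
    simp only [Cmd.wr, block, List.mem_append, List.mem_singleton, not_or] at hx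
    rw [← hs₁, St.set_r_ne _ _ hx.2.2.2, St.set_r_ne _ _ hx.2.2.1, St.set_r_ne _ _ hx.2.1,
      St.set_r_ne _ _ hx.1]
  have hu₁ : s₁.r .u = u := by rw [← hs₁]; simp [St.set_r, hu]
  have hj₁ : s₁.r .j = j := by rw [← hs₁]; simp [St.set_r]
  have hp₁ : s₁.r .p = m := by rw [← hs₁]; simp [St.set_r]
  have hb₁ : s₁.r .b = 9 ^ χ.col j := by rw [← hs₁]; simp [St.set_r]
  have hv₁ : s₁.r .v = 0 := by rw [← hs₁]; simp [St.set_r]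
  have hfp₁ : s₁.r .fp = s.r .fp := by rw [← hs₁]; simp [St.set_r]
  have htab₁ : s₁.a .tab = s.a .tab := by rw [← hs₁]; rfl
  have hcur₁ : Cur χ big (O.midSet D (pairs i ((O.bl i).take u) (O.bl i))) s₁ := by
    rw [← hs₁]
    exact ⟨⟨hcur.big_eq, hcur.fresh, hcur.le⟩, hcur.pA, hcur.rep⟩
  clear hs₁ e2 e3 e3' e1 hcur hI hfold
  have hsub : ∀ v, pairs i ((O.bl i).take u) (O.bl i) ∪ pairs i [j] ((O.bl i).take v) ⊆ O.items {i} := by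
    intro v it hit
    rw [Finset.mem_union, mem_pairs, mem_pairs] at hit
    rw [mem_items, Finset.mem_singleton]
    rcases hit with ⟨h1, h2, h3⟩ | ⟨h1, h2, h3⟩
    · rw [h1]; exact ⟨rfl, List.mem_of_mem_take h2, h3⟩
    · rw [List.mem_singleton] at h2
      rw [h1, h2]; exact ⟨rfl, hjm, List.mem_of_mem_take h3⟩
  refine wp_rep (e := Reg.l) (fun v s' => s'.r .v = v ∧ Cur χ big (O.midSet D
    (pairs i ((O.bl i).take u) (O.bl i) ∪ pairs i [j] ((O.bl i).take v))) s' ∧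
    Grow (v * (2 * 9 ^ W)) s₁ s') (13000 * (W + 1) * 26 ^ W + 600) trivial ?_ ?_ ?_
  · refine ⟨hv₁, ?_, Grow.refl _ _⟩
    have : pairs i [j] ((O.bl i).take 0) = ∅ := by
      ext it; rw [mem_pairs]; simp
    rw [this, Finset.union_empty]
    exact hcur₁
  · rintro v s₂ hv hf ⟨h1, h2, h3⟩
    have hv : v < (O.bl i).length := by simpa [Ex.ev, hI₁.l_eq] using hv
    have hz : (⟨i, (j, (O.bl i)[v])⟩ : Item) ∉
        pairs i ((O.bl i).take u) (O.bl i) ∪ pairs i [j] ((O.bl i).take v) := by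
      rw [Finset.mem_union, mem_pairs, mem_pairs, not_or]
      exact ⟨fun h => hjt h.2.1, fun h => getElem_notMem_take (O.nodup i) hv h.2.2⟩
    have hfp : s₂.r .fp ≤ s.r .fp + v * (2 * 9 ^ W) := by rw [← hfp₁]; exact h3.le_add
    have hvW : (v + 1) * (2 * 9 ^ W) ≤ W * (2 * 9 ^ W) := Nat.mul_le_mul_right _ (by omega)
    have := wp_innerBody (E := E) (χ := χ) (hI₁.frame hf (by decide) (by decide) (by decide)) h2
      (by rw [hf.r _ (by decide), hj₁]) h1 hv (by rw [hf.r _ (by decide), hb₁]) hi1 hin hjm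
      (on_midSet (hsub v) hD') hz hD (by rw [add_mul, one_mul] at hvW; omega) hbig hn
    refine Cmd.wp_mono this ?_
    rintro s₃ t ⟨⟨h4, h5, h6⟩, ht⟩
    refine ⟨⟨h4, ?_, ?_⟩, ht⟩
    · rw [pairs_take_succ hv, Finset.union_insert]; exact h5
    · have := h3.trans h6
      rwa [show v * (2 * 9 ^ W) + 2 * 9 ^ W = (v + 1) * (2 * 9 ^ W) by ring] at this
  · rintro s₂ t hf ⟨h1, h2, h3⟩ ht
    have hl : (Ex.reg .l).ev E s₁ = (O.bl i).length := hI₁.l_eq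
    have hu₂ : s₂.r .u = u := by rw [hf.r _ (by decide), hu₁]
    rw [hl] at h2 h3 ht
    have hunH : u + 1 < E.H := by
      omega
    refine ⟨⟨trivial, by show 1 < E.H; omega, by simp only [Ex.ev, ofNat_eq, hu₂]; exact hunH⟩,
      ⟨?_, ?_, ?_, ?_⟩, ?_⟩
    · simp only [Ex.ev, ofNat_eq, add_eq, St.set_r_self, hu₂]
    · rw [St.set_r_ne _ _ (by decide), hf.r _ (by decide), hp₁]
    · rw [hpairs]
      rw [List.take_length] at h2
      exact ⟨⟨h2.big_eq, h2.fresh, h2.le⟩, h2.pA, h2.rep⟩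
    · have hle : (O.bl i).length * (2 * 9 ^ W) ≤ W * (2 * 9 ^ W) := Nat.mul_le_mul_right _ hlen
      have h4 := h3.mono hle
      exact ⟨by rw [← hfp₁]; exact h4.le, by rw [← hfp₁]; exact h4.le_add,
        fun k hk => by rw [← htab₁]; exact h4.tab k (by rw [hfp₁]; exact hk)⟩
    · have hle := loop_time hlen ht
      simp only [Ex.cost, ofNat_eq, add_eq, sub_eq] at hle ⊢
      omega

end VM

namespace VM

open ElimOrder

variable {O : ElimOrder} {W : ℕ}

/-- For each vertex a table with the empty configuration. -/
def initAcc : Cmd :=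
  block [.set .fp 0, .set .i 0, .rep (Reg.n + 1) (block [.put .acc Reg.i Reg.fp,
    .put .tab Reg.fp Reg.big, .set .fp (Reg.fp + Reg.M), .set .i (Reg.i + 1)])]

/-- The elimination of all vertices. -/
def eliminate : Cmd :=
  block [.set .i Reg.n, .rep Reg.n (block [bucket, .set .i (Reg.i - 1)])]

/-- The solution of a loaded instance. -/
def solve : Cmd :=
  block [.set .big (Reg.n + 1), initAcc, eliminate,
    .set .opt (Reg.big - .arr .tab (.arr .acc 0)),
    .set .out (1 - (Reg.opt - .inp 4))]

/-- The tables that `acc` points to. -/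
structure Acc (χ : O.Colouring W) (big : ℕ) (D : ℕ → Finset ℕ) (i : ℕ) (s : St) : Prop
    extends Heap big s where
  ptr : ∀ j ≤ i, s.a .acc j + 9 ^ W ≤ s.r .fp
  rep : ∀ j ≤ i, Rep χ big (fun x => s.a .tab (s.a .acc j + x)) (O.midSet (D j) ∅)

theorem _root_.ElimOrder.convSet_comm (R S : Set Partial) : convSet R S = convSet S R := by
  have key : ∀ R S, convSet R S ⊆ convSet S R := by
    rintro R S p ⟨a, ha, b, hb, h1, h2⟩
    rw [add_comm a.1, add_comm a.2] at h1
    rw [add_comm a.1] at h2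
    exact ⟨b, hb, a, ha, h1, h2⟩
  exact (key R S).antisymm (key S R)

theorem loop_le {L T c t : ℕ} (hL : L ≤ W) (ht : t ≤ c + L * T) : t ≤ c + W * T :=
  ht.trans (Nat.add_le_add_left (Nat.mul_le_mul_right _ hL) _)

/-- `T` is the main term for one convolution: at most `W * W` of them for the items, one for the
removal of the vertex, and one for the transfer to the parent. -/
theorem time_bucket (W T t₁ t₂ t₃ : ℕ) (h₁ : t₁ ≤ 1 + 1 + W * (W * (T + 603) + 200 + 3)) (h₂ : t₂ ≤ T + 240)
    (h₃ : t₃ ≤ T + 40) : t₁ + t₂ + t₃ + 120 ≤ (W + 1) * (W + 1) * (2 * T + 1000) := by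
  nlinarith [Nat.zero_le (W * W * T), Nat.zero_le (W * T), Nat.zero_le (W * W)]

/-- One `Forest.step` in terms of tables. The space bound allots two blocks to each item and to the
removal, namely the gadget and the result, and one block to the convolution with the table of the
parent. -/
theorem wp_bucket {E : Env} {χ : O.Colouring W} {big i : ℕ} {D : ℕ → Finset ℕ} {s : St}
    (hI : Inst E χ s) (hi : s.r .i = i + 1) (hin : i + 1 ≤ O.n) (hF : O.Forest (i + 1) D)
    (hacc : Acc χ big D (i + 1) s)
    (hH : 26 ^ W + 100 + s.r .fp + (W * (W * (2 * 9 ^ W)) + 3 * 9 ^ W) < E.H) (hbig : 2 * big < E.H)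
    (hn : O.n < E.H) :
    bucket.wp E s fun s' t => (Acc χ big (Function.update D (O.parent (i + 1))
      (D (O.parent (i + 1)) ∪ insert (i + 1) (D (i + 1)))) i s' ∧
      s'.r .fp ≤ s.r .fp + (W * (W * (2 * 9 ^ W)) + 3 * 9 ^ W)) ∧
      t ≤ (W + 1) * (W + 1) * (2 * (13000 * (W + 1) * 26 ^ W) + 1000) := by
  have hi1 : 1 ≤ i + 1 := by omega
  have hp9 : 0 < 9 ^ W := by positivity
  have hW : W < 26 ^ W := Nat.lt_pow_self (by norm_num)
  have hci := hI.col (i + 1) hi1 hin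
  have hcl := χ.lt (i + 1) hi1 hin
  have hpow := hI.pow (χ.col (i + 1)) hcl.le
  have hben := hI.ben (i + 1) hi1 hin
  have hbenlt := hI.ben_lt (i + 1) hi1 hin
  simp only [bucket, wp_block_cons, block_singleton]
  refine ⟨⟨trivial, by simp only [Ex.ev, hi]; omega⟩, ?_⟩
  have e1 : (Ex.arr .acc Reg.i).ev E s = s.a .acc (i + 1) := by simp only [Ex.ev, hi]
  rw [e1]
  obtain ⟨q, hq⟩ : ∃ q, s.a .acc (i + 1) = q := ⟨_, rfl⟩
  rw [hq]
  have e2 : (Ex.arr .pow (.arr .col Reg.i)).ev E (s.set .pA q) = 9 ^ χ.col (i + 1) := by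
    simp [Ex.ev, St.set_r, hi, hci, hpow]
  refine ⟨⟨⟨trivial, ?_⟩, ?_⟩, ?_⟩
  · simp only [Ex.ev, St.set_r, reduceCtorEq, if_false, hi]; omega
  · simp only [Ex.ev, St.set_r, St.set_a, reduceCtorEq, if_false, hi, hci]; omega
  rw [e2]
  have e3 : (Ex.arr .bst Reg.i).ev E ((s.set .pA q).set .a (9 ^ χ.col (i + 1))) = s.a .bst (i + 1) := by
    simp [Ex.ev, St.set_r, hi]
  refine ⟨⟨trivial, ?_⟩, ?_⟩
  · simp only [Ex.ev, St.set_r, reduceCtorEq, if_false, hi]; omega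
  rw [e3]
  have e4 : (Ex.arr .ben Reg.i - Ex.reg .bp).ev E (((s.set .pA q).set .a (9 ^ χ.col (i + 1))).set .bp
      (s.a .bst (i + 1))) = (O.bl (i + 1)).length := by
    simp [Ex.ev, sub_eq, St.set_r, hi, hben]
  refine ⟨⟨⟨trivial, ?_⟩, trivial⟩, ?_⟩
  · simp only [Ex.ev, St.set_r, reduceCtorEq, if_false, hi]; omega
  rw [e4]
  refine ⟨by show 0 < E.H; omega, by show 0 < E.H; omega, ?_⟩
  have e5 : ∀ s', (0 : Ex).ev E s' = 0 := fun _ => rfl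
  rw [e5, e5]
  obtain ⟨s₁, hs₁⟩ : ∃ s₁, ((((((s.set .pA q).set .a (9 ^ χ.col (i + 1))).set .bp
      (s.a .bst (i + 1))).set .l (O.bl (i + 1)).length).set .p 0).set .u 0) = s₁ := ⟨_, rfl⟩
  rw [hs₁]
  have hI₁ : AtI E χ (i + 1) s₁ := by
    refine ⟨hI.frame (p := block [.set .pA 0, .set .a 0, .set .bp 0, .set .l 0, .set .p 0, .set .u 0])
      ⟨fun x hx => ?_, fun _ _ => by rw [← hs₁]; rfl⟩ (by decide) (by decide), ?_, ?_, ?_, ?_⟩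
    · simp only [Cmd.wr, block, List.mem_append, List.mem_singleton, not_or] at hx
      rw [← hs₁, St.set_r_ne _ _ hx.2.2.2.2.2, St.set_r_ne _ _ hx.2.2.2.2.1,
        St.set_r_ne _ _ hx.2.2.2.1, St.set_r_ne _ _ hx.2.2.1, St.set_r_ne _ _ hx.2.1,
        St.set_r_ne _ _ hx.1]
    all_goals rw [← hs₁]; simp [St.set_r, hi]
  have hu₁ : s₁.r .u = 0 := by rw [← hs₁]; simp [St.set_r]
  have hp₁ : s₁.r .p = 0 := by rw [← hs₁]; simp [St.set_r]
  have hpA₁ : s₁.r .pA = q := by rw [← hs₁]; simp [St.set_r]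
  have hfp₁ : s₁.r .fp = s.r .fp := by rw [← hs₁]; simp [St.set_r]
  have hbig₁ : s₁.r .big = big := by rw [← hs₁]; simp [St.set_r, hacc.big_eq]
  have hi₁ : s₁.r .i = i + 1 := by rw [← hs₁]; simp [St.set_r, hi]
  have ha₁ : s₁.a = s.a := by rw [← hs₁]; rfl
  clear hs₁ e1 e2 e3 e4
  have hlen := length_bl_le χ hi1 hin
  have hiD : i + 1 ∉ D (i + 1) := fun h => lt_irrefl _ (hF.lt le_rfl h)
  have hcur₁ : Cur χ big (O.midSet (D (i + 1)) (pairs (i + 1) ((O.bl (i + 1)).take 0) (O.bl (i + 1)))) s₁ := by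
    have : pairs (i + 1) ((O.bl (i + 1)).take 0) (O.bl (i + 1)) = ∅ := by
      ext it; rw [mem_pairs]; simp
    rw [this]
    refine ⟨⟨hbig₁, by rw [hfp₁, ha₁]; exact hacc.fresh, by rw [ha₁]; exact hacc.le⟩, ?_, ?_⟩
    · rw [hpA₁, hfp₁, ← hq]; exact hacc.ptr _ le_rfl
    · rw [hpA₁, ← hq, ha₁]; exact hacc.rep _ le_rfl
  have hmulW : ∀ u, u < W → (u + 1) * (W * (2 * 9 ^ W)) ≤ W * (W * (2 * 9 ^ W)) := fun u hu =>
    Nat.mul_le_mul_right _ hu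
  refine wp_rep (e := Reg.l) (fun u s' => s'.r .u = u ∧ s'.r .p = ((O.bl (i + 1)).take u).foldl max 0 ∧
    Cur χ big (O.midSet (D (i + 1)) (pairs (i + 1) ((O.bl (i + 1)).take u) (O.bl (i + 1)))) s' ∧
    Grow (u * (W * (2 * 9 ^ W))) s₁ s') (W * (13000 * (W + 1) * 26 ^ W + 603) + 200) trivial ?_ ?_ ?_
  · exact ⟨hu₁, by simp [hp₁], hcur₁, Grow.refl _ _⟩
  · rintro u s₂ hu hf ⟨h1, h2, h3, h4⟩
    have hu : u < (O.bl (i + 1)).length := by simpa [Ex.ev, hI₁.l_eq] using hu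
    have hfp : s₂.r .fp ≤ s.r .fp + u * (W * (2 * 9 ^ W)) := by rw [← hfp₁]; exact h4.le_add
    have hm := hmulW u (by omega)
    have := wp_outerBody (E := E) (χ := χ) (big := big) (D := D (i + 1))
      (hI₁.frame hf (by decide) (by decide) (by decide)) h1 hu h3 h2 hi1 hin
      (hF.bl (i + 1) le_rfl) hiD (by rw [add_mul, one_mul] at hm; omega) hbig hn
    refine Cmd.wp_mono this ?_
    rintro s₃ t ⟨⟨h5, h6, h7, h8⟩, ht⟩
    refine ⟨⟨h5, h6, h7, ?_⟩, ht⟩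
    have := h4.trans h8
    rwa [← Nat.succ_mul] at this
  · rintro s₂ t₂ hf₂ ⟨-, hp₂, hcur₂, hg₂⟩ ht₂
    have hl : (Ex.reg .l).ev E s₁ = (O.bl (i + 1)).length := hI₁.l_eq
    rw [hl] at hp₂ hcur₂ hg₂ ht₂
    rw [List.take_length] at hp₂ hcur₂
    rw [pairs_self] at hcur₂
    have hpp : s₂.r .p = O.parent (i + 1) := by
      rw [hp₂, parent, List.foldl_eq_foldr]
    have hg₂ := hg₂.mono (Nat.mul_le_mul_right (W * (2 * 9 ^ W)) hlen)
    have hfp₂ := hg₂.le_add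
    rw [hfp₁] at hfp₂
    have hI₂ : AtI E χ (i + 1) s₂ := hI₁.frame hf₂ (by decide) (by decide) (by decide)
    have hacc₂ : s₂.a .acc = s.a .acc := by rw [hf₂.a _ (by decide), ha₁]
    have hlt9 : 9 ^ χ.col (i + 1) < 9 ^ W := Nat.pow_lt_pow_right (by norm_num) hcl
    have hsub : O.scope (i + 1) ⊆ Finset.Icc 1 O.n := scope_subset hi1 hin
    have hdel := wp_gadget (E := E) (c := χ.col (i + 1)) (p := deleteGadget) (e := .arr .col Reg.i)
      (R' := O.midSet (insert (i + 1) (D (i + 1))) ∅) hcur₂ hI₂.toTables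
      (wp_deleteGadget hI₂.toTables hcur₂.toHeap hI₂.a_eq (by positivity) hlt9 (by omega))
      (by decide) (by decide) (fun s' hf => by
        have h1 : s'.r .i = i + 1 := by rw [hf.r _ (by decide), hI₂.i_eq]
        have h2 : s'.a .col = s₂.a .col := by rw [hf.a _ (by decide)]
        simp only [Ex.ev, Ex.ok, h1, h2, hI₂.col (i + 1) hi1 hin, true_and]
        omega) (by simp [Ex.cost]) (by omega) (by omega) hbig (by
        intro h g' hg' hc
        rw [← forgetSet_midSet fun d hd => hF.lt le_rfl hd]
        exact rep_forgetSet hsub (χ.injOn _) (Finset.mem_insert_self _ _)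
          (on_midSet (Finset.Subset.refl _) (hF.bl (i + 1) le_rfl)) hcur₂.rep
          (rep_delete (Finset.mem_Icc.mpr ⟨hi1, hin⟩) hg') hc)
    refine Cmd.wp_mono (p := .seq deleteGadget (convStep (.arr .col Reg.i))) (Cmd.wp_frame hdel) ?_
    rintro s₃ t₃ ⟨⟨⟨hcur₃, hg₃⟩, ht₃⟩, hf₃⟩
    have hpn := O.parent_lt hi1
    obtain ⟨p, hp⟩ : ∃ p, O.parent (i + 1) = p := ⟨_, rfl⟩
    have hpos₃ : s₃.r .p = p := by rw [hf₃.r _ (by decide), hpp, hp]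
    have hacc₃ : s₃.a .acc = s.a .acc := by rw [hf₃.a _ (by decide), hacc₂]
    have hI₃ : Inst E χ s₃ := hI₂.toInst.frame hf₃ (by decide) (by decide)
    have hg₁₃ : Grow (W * (W * (2 * 9 ^ W)) + 2 * 9 ^ W) s₁ s₃ := hg₂.trans hg₃
    -- New tables are always allocated at `fp`, so the table accumulated at the parent is still
    -- intact.
    have htab₃ : ∀ k < s.r .fp, s₃.a .tab k = s.a .tab k := fun k hk => by
      rw [hg₁₃.tab k (by rw [hfp₁]; exact hk), ha₁]
    have hfp₃ := hg₁₃.le_add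
    have hfp₃' := hg₁₃.le
    rw [hfp₁] at hfp₃ hfp₃'
    have e6 : (Ex.arr .acc Reg.p).ev E s₃ = s.a .acc p := by simp only [Ex.ev, hpos₃, hacc₃]
    refine ⟨⟨trivial, by simp only [Ex.ev, hpos₃]; omega⟩, ?_⟩
    rw [e6]
    rw [hp] at hpn
    have hptr := hacc.ptr p (by omega)
    have hconv := wp_convStep (E := E) (c := W) (e := Reg.W) (W := W) (big := big)
      (s := s₃.set .pB (s.a .acc p)) ⟨hI₃.w, hI₃.m, hI₃.pow, hI₃.ra, hI₃.rb, hI₃.rc⟩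
      ⟨hcur₃.big_eq, hcur₃.fresh, hcur₃.le⟩ hI₃.w trivial (by simp [Ex.cost]) (by omega) hcur₃.pA
      (by simp only [St.set_r, reduceCtorEq, if_true, if_false]; omega)
      (by simp only [St.set_r, reduceCtorEq, if_true, if_false]; omega) hbig
    refine Cmd.wp_mono (Cmd.wp_frame hconv) ?_
    rintro s₄ t₄ ⟨⟨⟨hh₄, hpA₄, hfp₄, htab₄, hc₄⟩, ht₄⟩, hf₄⟩
    simp only [St.set_r, reduceCtorEq, if_false, if_true, St.set_a] at hpA₄ hfp₄ htab₄ hc₄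
    have hacc₄ : s₄.a .acc = s.a .acc := by rw [hf₄.a _ (by decide), St.set_a, hacc₃]
    have hp₄ : s₄.r .p = p := by
      rw [hf₄.r _ (by decide), St.set_r_ne _ _ (by decide), hpos₃]
    refine ⟨trivial, trivial, by simp only [Ex.ev, hp₄]; omega, ⟨⟨⟨?_, ?_, ?_⟩, ?_, ?_⟩, ?_⟩, ?_⟩
    · exact hh₄.big_eq
    · simp only [St.put_r, St.put_a, reduceCtorEq, if_false]; exact hh₄.fresh
    · simp only [St.put_a, reduceCtorEq, if_false]; exact hh₄.le
    · intro j hj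
      simp only [St.put_r, St.put_a_self, Ex.ev, hp₄, Function.update_apply, hacc₄, hpA₄, hfp₄]
      split_ifs
      · exact le_rfl
      · have := hacc.ptr j (by omega); omega
    · intro j hj
      simp only [St.put_r, St.put_a, Ex.ev, hp₄, Function.update_apply, hacc₄, hpA₄, hp,
        reduceCtorEq, if_false, if_true]
      have hpi : p ≤ i := by omega
      split_ifs with hjp
      · have hrep := (hacc.rep p (by omega)).congr (hF.enc_lt (by omega) hin χ)
          (f' := fun x => s₃.a .tab (s.a .acc p + x)) fun x hx => htab₃ _ (by omega)
        have := rep_convSet (base_subset (hpi.trans (by omega))) (χ.injOn_base p)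
          (by rw [← hp]; exact hF.on_insert hi1) (hF.on_base (j := p) (by omega)) hcur₃.rep hrep hc₄
        rwa [convSet_comm, ← hp, hF.conv hi1, hp] at this
      · refine (hacc.rep j (by omega)).congr (hF.enc_lt (by omega) hin χ) fun x hx => ?_
        have := hacc.ptr j (by omega)
        rw [htab₄ _ (by omega), htab₃ _ (by omega)]
    · simp only [St.put_r, hfp₄]; omega
    · have ht₂ := loop_le hlen ht₂
      simp only [Ex.cost] at ht₂
      have := time_bucket W (13000 * (W + 1) * 26 ^ W) t₂ t₃ t₄ ht₂ ht₃ ht₄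
      refine le_trans ?_ this
      simp only [Ex.cost, ofNat_eq, add_eq, sub_eq]
      clear * -
      omega

end VM

/-! ### The elimination of all vertices and the optimum -/

namespace VM

open ElimOrder

variable {O : ElimOrder} {W : ℕ}

/-- Before anything is removed, every accumulator, including that of the virtual root `0`, holds
only the empty configuration of cost zero. -/
theorem wp_initAcc {E : Env} {χ : O.Colouring W} {big : ℕ} {s : St} (hI : Inst E χ s)
    (hbig : s.r .big = big) (h0 : ∀ i, s.a .tab i = 0) (hn : O.n + 1 < E.H)
    (hH : (O.n + 1) * 9 ^ W < E.H) :
    initAcc.wp E s fun s' t => (Acc χ big (fun _ => ∅) O.n s' ∧ s'.r .fp = (O.n + 1) * 9 ^ W) ∧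
      t ≤ 100 * (O.n + 1) := by
  have hp9 : 0 < 9 ^ W := by positivity
  refine ⟨by show 0 < E.H; omega, by show 0 < E.H; omega, ?_⟩
  have hok : (Ex.reg .n + 1 : Ex).ev E ((s.set .fp 0).set .i 0) = O.n + 1 := by
    simp [Ex.ev, add_eq, ofNat_eq, St.set_r, hI.n]
  refine wp_rep (e := Reg.n + 1) (fun x s' => s'.r .i = x ∧ s'.r .fp = x * 9 ^ W ∧
    (∀ j < x, s'.a .acc j = j * 9 ^ W ∧ ∀ y < 9 ^ W, s'.a .tab (j * 9 ^ W + y) =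
      if y = 0 then big else 0) ∧
    (∀ v, x * 9 ^ W ≤ v → s'.a .tab v = 0) ∧ ∀ v, s'.a .tab v ≤ big) 50 ?_ ?_ ?_ ?_
  · simp only [Ex.ok, ofNat_eq, add_eq, Ex.ev, St.set_r, reduceCtorEq, if_false, hI.n, true_and]
    omega
  · refine ⟨by simp [Ex.ev, ofNat_eq], by simp [Ex.ev, St.set_r, ofNat_eq], ?_, ?_, ?_⟩
    · intro j hj; omega
    · intro v _; exact h0 v
    · intro v; rw [St.set_a, St.set_a, h0 v]; omega
  · rintro x s' hx hf ⟨h1, h2, h3, h4, h5⟩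
    have hx : x < O.n + 1 := lt_of_lt_of_eq hx hok
    have hb : s'.r .big = big := by rw [hf.r _ (by decide)]; simp [St.set_r, hbig]
    have hm : s'.r .M = 9 ^ W := by rw [hf.r _ (by decide)]; simp [St.set_r, hI.m]
    have hle : (x + 1) * 9 ^ W ≤ (O.n + 1) * 9 ^ W := Nat.mul_le_mul_right _ hx
    have hx1 : (x + 1) * 9 ^ W = x * 9 ^ W + 9 ^ W := by ring
    simp only [block, Cmd.wp, ofNat_eq, add_eq, Ex.ok, Ex.ev, Ex.cost, St.set_r, St.set_a, St.put_r,
      reduceCtorEq, if_true, if_false, h1, h2, hb, hm, true_and, and_true]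
    refine ⟨by omega, by omega, by omega, by omega, ⟨hx1.symm, ?_, ?_, ?_⟩, by norm_num⟩
    · intro j hj
      simp only [St.put_a, reduceCtorEq, if_false, if_true, Function.update_apply]
      rcases Nat.lt_succ_iff_lt_or_eq.mp hj with hj | rfl
      · have hjx : (j + 1) * 9 ^ W ≤ x * 9 ^ W := Nat.mul_le_mul_right _ hj
        rw [add_mul, one_mul] at hjx
        refine ⟨by rw [if_neg (by omega)]; exact (h3 j hj).1, fun y hy => ?_⟩
        rw [if_neg (by omega)]
        exact (h3 j hj).2 y hy
      · refine ⟨by rw [if_pos rfl], fun y hy => ?_⟩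
        by_cases hy0 : y = 0
        · subst hy0; simp
        · rw [if_neg (by omega), if_neg hy0, h4 _ (by omega)]
    · intro v hv
      simp only [St.put_a, reduceCtorEq, if_false, if_true, Function.update_apply]
      rw [if_neg (by omega)]
      exact h4 v (by omega)
    · intro v
      simp only [St.put_a, reduceCtorEq, if_false, if_true, Function.update_apply]
      split_ifs
      · exact le_rfl
      · exact h5 v
  · rintro s' t hf ⟨h1, h2, h3, h4, h5⟩ ht
    have e : (Reg.n + 1 : Ex).ev E ((s.set Reg.fp (Ex.ev E s 0)).set Reg.i
      (Ex.ev E (s.set Reg.fp (Ex.ev E s 0)) 0)) = O.n + 1 := hok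
    rw [e] at h2 h3 h4 ht
    have hb : s'.r .big = big := by rw [hf.r _ (by decide)]; simp [St.set_r, hbig]
    refine ⟨⟨⟨⟨hb, fun v hv => h4 v (by omega), h5⟩, ?_, ?_⟩, h2⟩, ?_⟩
    · intro j hj
      have : (j + 1) * 9 ^ W ≤ (O.n + 1) * 9 ^ W := Nat.mul_le_mul_right _ (by omega)
      rw [(h3 j (by omega)).1, h2]
      rw [add_mul, one_mul] at this
      exact this
    · intro j hj
      rw [midSet_empty]
      refine rep_zero fun y hy => ?_
      rw [(h3 j (by omega)).1]
      exact (h3 j (by omega)).2 y hy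
    · simp only [Ex.cost, ofNat_eq, add_eq] at ht ⊢
      omega

/-- The time for the elimination of one vertex. -/
def bucketTime (W : ℕ) : ℕ := (W + 1) * (W + 1) * (2 * (13000 * (W + 1) * 26 ^ W) + 1000)

/-- The number of cells of the tables for one vertex. -/
def bucketSpace (W : ℕ) : ℕ := W * (W * (2 * 9 ^ W)) + 3 * 9 ^ W

theorem wp_eliminate {E : Env} {χ : O.Colouring W} {big : ℕ} {s : St} (hI : Inst E χ s)
    (hacc : Acc χ big (fun _ => ∅) O.n s) (hbig : 2 * big < E.H) (hn : O.n + 1 < E.H)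
    (hH : 26 ^ W + 100 + s.r .fp + O.n * bucketSpace W < E.H) :
    eliminate.wp E s fun s' t => ((∃ D, O.Forest 0 D ∧ Acc χ big D 0 s') ∧
      s'.r .fp ≤ s.r .fp + O.n * bucketSpace W) ∧ t ≤ (O.n + 1) * (bucketTime W + 20) := by
  refine ⟨trivial, ?_⟩
  have ev : ∀ v, (Ex.reg .n).ev E (s.set .i v) = O.n := fun v => by simp [Ex.ev, St.set_r, hI.n]
  refine wp_rep (e := Reg.n) (fun x s' => ∃ D, s'.r .i = O.n - x ∧ O.Forest (O.n - x) D ∧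
    Acc χ big D (O.n - x) s' ∧ s'.r .fp ≤ s.r .fp + x * bucketSpace W) (bucketTime W + 5) trivial
    ?_ ?_ ?_
  · exact ⟨fun _ => ∅, by simp [Ex.ev, hI.n], forest_init,
      ⟨⟨hacc.big_eq, hacc.fresh, hacc.le⟩, hacc.ptr, hacc.rep⟩, by simp [St.set_r]⟩
  · rintro x s' hx hf ⟨D, h1, h2, h3, h4⟩
    have hx : x < O.n := lt_of_lt_of_eq hx (ev _)
    have hI' : Inst E χ s' := (hI.frame (p := .set .i 0) ⟨fun y hy =>
      St.set_r_ne _ _ (by simpa [Cmd.wr] using hy), fun _ _ => rfl⟩ (by decide) (by decide)).frame hf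
      (by decide) (by decide)
    obtain ⟨i, hi⟩ : ∃ i, O.n - x = i + 1 := ⟨O.n - x - 1, by omega⟩
    have hle : (x + 1) * bucketSpace W ≤ O.n * bucketSpace W := Nat.mul_le_mul_right _ hx
    rw [add_mul, one_mul] at hle
    rw [hi] at h1 h2 h3
    have := wp_bucket (E := E) hI' h1 (by omega) h2 h3 (by
      change _ + bucketSpace W < _; omega) hbig (by omega)
    simp only [wp_block_cons, block_singleton]
    refine Cmd.wp_mono (Cmd.wp_frame this) ?_
    rintro s'' t ⟨⟨⟨h5, h6⟩, h7⟩, hf'⟩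
    change _ ≤ _ + bucketSpace W at h6
    change _ ≤ bucketTime W at h7
    have hi'' : s''.r .i = i + 1 := by rw [hf'.r _ (by decide), h1]
    rw [show O.n - (x + 1) = i by omega]
    refine ⟨⟨trivial, by show 1 < E.H; omega⟩, ⟨_, ?_, h2.step (by omega),
      ⟨⟨h5.big_eq, h5.fresh, h5.le⟩, h5.ptr, h5.rep⟩, ?_⟩, ?_⟩
    · simp [Ex.ev, sub_eq, ofNat_eq, hi'']
    · rw [St.set_r_ne _ _ (by decide), add_mul, one_mul]; omega
    · simp only [Ex.cost, sub_eq, ofNat_eq]; omega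
  · rintro s' t hf ⟨D, h1, h2, h3, h4⟩ ht
    have e : (Ex.reg .n).ev E (s.set .i ((Ex.reg .n).ev E s)) = O.n := ev _
    rw [e] at h2 h3 h4 ht
    rw [Nat.sub_self] at h2 h3
    refine ⟨⟨⟨D, h2, h3⟩, h4⟩, ?_⟩
    simp only [Ex.cost] at ht ⊢
    have e1 : O.n * (bucketTime W + 5 + 3) ≤ O.n * (bucketTime W + 20) :=
      Nat.mul_le_mul_left _ (by omega)
    rw [add_mul, one_mul]
    omega

/-- Together with `Hits.exists_mem`: each final cost is the size of a solution, and each solution is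
matched by a configuration that is no more expensive. So the smallest final cost is the optimum. -/
theorem _root_.ElimOrder.exists_hits_of_mem {k : ℕ}
    (h : ((0 : ℕ → Contrib), k) ∈ O.midSet (Finset.Icc 1 O.n) ∅) :
    ∃ S ⊆ Finset.Icc 1 O.n, O.Hits S ∧ S.card = k := by
  obtain ⟨o, ho, hf, -, h2, -⟩ := h
  refine ⟨_, Finset.filter_subset _ _, hits_of_config ho hf, ?_⟩
  rw [show k = _ from h2, Finset.card_filter]
  rfl

theorem _root_.ElimOrder.Hits.exists_mem {S : Finset ℕ} (hS : O.Hits S) :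
    ∃ k ≤ S.card, ((0 : ℕ → Contrib), k) ∈ O.midSet (Finset.Icc 1 O.n) ∅ := by
  refine ⟨_, cost_config_le, O.config S, fun it => opt_config hS it,
    fun v _ => isFinal_config hS v, ?_, rfl, fun v => by simp [lab_zero]⟩
  funext v
  by_cases hv : v ∈ Finset.Icc 1 O.n
  · simp only [hv, if_true, Finset.sum_empty, add_zero]
    rfl
  · simp only [Finset.sum_empty, add_zero, hv, if_false]
    refine (tot_apply_eq_zero (fun it => opt_config hS it) hv fun d hd hvd => hv ?_).symm
    have := O.mem_lt _ _ hvd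
    rw [Finset.mem_Icc] at hd ⊢
    omega

theorem wp_solve {E : Env} {χ : O.Colouring W} {s : St} (hI : Inst E χ s)
    (h0 : ∀ i, s.a .tab i = 0) (hβ : 4 < E.β)
    (hH : 26 ^ W + 200 + (O.n + 1) * 9 ^ W + O.n * bucketSpace W + 2 * O.n < E.H) :
    solve.wp E s fun s' t => ((∃ S ⊆ Finset.Icc 1 O.n, O.Hits S ∧ S.card = s'.r .opt) ∧
      (∀ S, O.Hits S → s'.r .opt ≤ S.card) ∧ s'.r .out = if s'.r .opt ≤ E.I 4 then 1 else 0) ∧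
      t ≤ (O.n + 1) * (bucketTime W + 200) := by
  have hp9 : 0 < 9 ^ W := by positivity
  have hp26 : 0 < 26 ^ W := by positivity
  simp only [solve, wp_block_cons, block_singleton]
  have ev : (Ex.reg .n + 1 : Ex).ev E s = O.n + 1 := by simp [Ex.ev, add_eq, ofNat_eq, hI.n]
  refine ⟨⟨trivial, by show 1 < E.H; omega, by
    simp only [Ex.ev, ofNat_eq, hI.n]; omega⟩, ?_⟩
  rw [ev]
  have hI' : Inst E χ (s.set .big (O.n + 1)) := hI.frame (p := .set .big 0) ⟨fun y hy =>
      St.set_r_ne _ _ (by simpa [Cmd.wr] using hy), fun _ _ => rfl⟩ (by decide) (by decide)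
  have hinit := wp_initAcc (E := E) (big := O.n + 1) hI' (by simp) h0 (by omega) (by omega)
  refine Cmd.wp_mono (Cmd.wp_frame hinit) ?_
  rintro s₁ t₁ ⟨⟨⟨hacc₁, hfp₁⟩, ht₁⟩, hf₁⟩
  have hI₁ := hI'.frame hf₁ (by decide) (by decide)
  have helim := wp_eliminate (E := E) hI₁ hacc₁ (by omega) (by omega) (by rw [hfp₁]; omega)
  refine Cmd.wp_mono helim ?_
  rintro s₂ t₂ ⟨⟨⟨D, hF, hacc₂⟩, hfp₂⟩, ht₂⟩
  have hptr := hacc₂.ptr 0 le_rfl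
  have hrep := hacc₂.rep 0 le_rfl
  have hbig := hacc₂.big_eq
  have hon := hF.on_base (j := 0) le_rfl
  rw [hF.zero] at hrep hon
  obtain ⟨q, hq⟩ : ∃ q, s₂.a .acc 0 = q := ⟨_, rfl⟩
  rw [hq] at hrep hptr
  -- Deleting everything is a solution, so some configuration costs at most `n`, which is less than
  -- `big`. Hence the only entry of interest is positive and encodes an actual configuration.
  have hfull : O.Hits (Finset.Icc 1 O.n) := fun a b c d _ _ _ hab _ _ ha _ _ _ =>
    ha (Finset.mem_Icc.mpr (O.le _ _ hab))
  have hq0 : ∀ k, ((0 : ℕ → Contrib), k) ∈ O.midSet (Finset.Icc 1 O.n) ∅ →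
      O.n + 1 - k ≤ s₂.a .tab q := fun k hk => by
    have := hrep.le _ hk
    simpa [enc_zero] using this
  have hle := hacc₂.le q
  obtain ⟨k, hk, hmem⟩ := hfull.exists_mem
  have hpos : 0 < s₂.a .tab q := by
    have := hq0 k hmem
    rw [Nat.card_Icc] at hk
    omega
  obtain ⟨⟨σ, l⟩, hl, -, hl'⟩ := hrep.ex 0 (by positivity) (by simpa using hpos)
  have hσ : σ = 0 := by
    funext v
    exact (hon _ hl).1 v (by simp [base])
  subst hσ
  simp only [add_zero] at hl'
  rw [hfp₁] at hfp₂
  have e1 : (Reg.big - Ex.arr .tab (.arr .acc 0) : Ex).ev E s₂ = l := by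
    simp only [Ex.ev, sub_eq, ofNat_eq, hq, hbig]
    omega
  refine ⟨⟨trivial, ⟨by show 0 < E.H; omega, by show 0 < E.H; omega⟩, ?_⟩, ?_⟩
  · have : (Ex.arr .acc 0).ev E s₂ = q := hq
    rw [this]
    omega
  rw [e1]
  refine ⟨⟨by show 1 < E.H; omega, trivial, by show 4 < E.H; omega, by show 4 < E.β; omega⟩, ?_⟩
  have e2 : (1 - (Reg.opt - .inp 4) : Ex).ev E (s₂.set .opt l) = if l ≤ E.I 4 then 1 else 0 := by
    simp only [Ex.ev, sub_eq, ofNat_eq, St.set_r_self]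
    split_ifs <;> omega
  rw [e2]
  have e3 : ∀ v, ((s₂.set .opt l).set .out v).r .opt = l := fun v => by simp [St.set_r]
  beta_reduce
  rw [e3, St.set_r_self]
  refine ⟨⟨exists_hits_of_mem hl, fun S hS => ?_, rfl⟩, ?_⟩
  · obtain ⟨k, hk, hmem⟩ := hS.exists_mem
    have := hq0 k hmem
    omega
  · simp only [Ex.cost, sub_eq, add_eq, ofNat_eq]
    have e4 : (O.n + 1) * (bucketTime W + 200) = (O.n + 1) * (bucketTime W + 20) + 180 * (O.n + 1) := by
      ring
    rw [e4]
    generalize (O.n + 1) * (bucketTime W + 20) = A at ht₂ ⊢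
    omega

end VM

/-! ### Orders of the vertices by first occurrence -/

/-- The vertices with non-zero index have been numbered; `bl i` lists the smaller members of the bag
in which the vertex with index `i` occurred first. Members of a bag in `A` know each other. -/
structure Order (n W : ℕ) (bag : ℕ → List ℕ) (A : Set ℕ) (cnt : ℕ) (idx : ℕ → ℕ) (bl : ℕ → List ℕ)
    (col : ℕ → ℕ) : Prop where
  le : ∀ v, idx v ≤ cnt
  inj : ∀ u v, idx u ≠ 0 → idx u = idx v → u = v
  surj : ∀ i, 1 ≤ i → i ≤ cnt → ∃ v < n, idx v = i
  bl_nodup : ∀ i, (bl i).Nodup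
  bl_lt : ∀ i, ∀ j ∈ bl i, 1 ≤ j ∧ j < i ∧ i ≤ cnt
  clique : ∀ i x u, x ∈ bl i → u ∈ bl i → x < u → x ∈ bl u
  col_lt : ∀ i, 1 ≤ i → i ≤ cnt → col i < W
  col_ne : ∀ i, ∀ j ∈ bl i, col j ≠ col i
  star : ∀ t ∈ A, ∀ u ∈ bag t, ∀ v ∈ bag t, idx u ≠ 0 → idx u < idx v → idx u ∈ bl (idx v)
  cover : ∀ v, idx v ≠ 0 → ∃ t ∈ A, v ∈ bag t

namespace Order

variable {n W : ℕ} {bag : ℕ → List ℕ} {A : Set ℕ} {cnt : ℕ} {idx : ℕ → ℕ} {bl : ℕ → List ℕ}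
  {col : ℕ → ℕ}

theorem empty : Order n W bag ∅ 0 (fun _ => 0) (fun _ => []) col := by
  refine ⟨?_, ?_, ?_, ?_, ?_, ?_, ?_, ?_, ?_, ?_⟩ <;> intros <;> simp_all

/-- The indices of the numbered members of a list. -/
def seen (idx : ℕ → ℕ) (l : List ℕ) : List ℕ := (l.map idx).filter (· ≠ 0)

theorem mem_seen {l : List ℕ} {i : ℕ} : i ∈ seen idx l ↔ i ≠ 0 ∧ ∃ v ∈ l, idx v = i := by
  simp [seen, and_comm]

theorem nodup_seen (h : Order n W bag A cnt idx bl col) {l : List ℕ} (hl : l.Nodup) :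
    (seen idx l).Nodup := by
  have e : seen idx l = (l.filter fun v => idx v ≠ 0).map idx := by
    simp [seen, List.filter_map, Function.comp_def]
  rw [e]
  refine List.Nodup.map_on ?_ (hl.filter _)
  intro u hu v hv huv
  simp only [List.mem_filter, decide_eq_true_eq] at hu hv
  exact h.inj u v hu.2 huv

/-- By `hfull` the current bag is the only one in `A` that contains `v`, so `star` requires nothing
of `v` beyond the numbered members of this bag. That these form a clique is `star` for the same bag
before the step. -/
theorem introduce (h : Order n W bag A cnt idx bl col) {t v c : ℕ} (ht : t ∈ A) (htn : (bag t).Nodup)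
    (hv : v ∈ bag t) (hvn : v < n) (h0 : idx v = 0) (hfull : ∀ a ∈ A, v ∈ bag a → a = t) (hc : c < W)
    (hcol : ∀ j ∈ seen idx (bag t), col j ≠ c) :
    Order n W bag A (cnt + 1) (Function.update idx v (cnt + 1))
      (Function.update bl (cnt + 1) (seen idx (bag t))) (Function.update col (cnt + 1) c) := by
  have hne : ∀ u, u ≠ v → Function.update idx v (cnt + 1) u = idx u := fun u hu =>
    Function.update_of_ne hu _ _
  have hlt : ∀ i, ∀ j ∈ Function.update bl (cnt + 1) (seen idx (bag t)) i,
      1 ≤ j ∧ j < i ∧ i ≤ cnt + 1 := by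
    intro i j hj
    by_cases hi : i = cnt + 1
    · subst hi
      rw [Function.update_self, mem_seen] at hj
      obtain ⟨hj, u, -, rfl⟩ := hj
      have := h.le u
      omega
    · rw [Function.update_of_ne hi] at hj
      have := h.bl_lt i j hj
      omega
  refine ⟨fun u => ?_, fun u u' hu huu => ?_, fun i h1 h2 => ?_, fun i => ?_, hlt, fun i x u hx hu hxu => ?_,
    fun i h1 h2 => ?_, fun i j hj => ?_, fun a ha u hu u' hu' hu0 huu => ?_, fun u hu => ?_⟩
  · by_cases hu : u = v
    · simp [hu]
    · rw [hne u hu]; have := h.le u; omega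
  · by_cases e1 : u = v <;> by_cases e2 : u' = v
    · rw [e1, e2]
    · rw [e1, Function.update_self, hne _ e2] at huu
      have := h.le u'; omega
    · rw [e2, Function.update_self, hne _ e1] at huu
      have := h.le u; omega
    · rw [hne _ e1] at hu
      rw [hne _ e1, hne _ e2] at huu
      exact h.inj _ _ hu huu
  · by_cases hi : i = cnt + 1
    · exact ⟨v, hvn, by simp [hi]⟩
    · obtain ⟨u, hun, hu⟩ := h.surj i h1 (by omega)
      refine ⟨u, hun, ?_⟩
      rw [hne, hu]
      rintro rfl
      omega
  · by_cases hi : i = cnt + 1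
    · subst hi; rw [Function.update_self]; exact h.nodup_seen htn
    · rw [Function.update_of_ne hi]; exact h.bl_nodup i
  · have hu' := (hlt i u hu).2
    rw [Function.update_of_ne (by omega)]
    by_cases hi : i = cnt + 1
    · subst hi
      rw [Function.update_self, mem_seen] at hx hu
      obtain ⟨hx0, a, ha, rfl⟩ := hx
      obtain ⟨hu0, b, hb, rfl⟩ := hu
      exact h.star t ht a ha b hb hx0 hxu
    · rw [Function.update_of_ne hi] at hx hu
      exact h.clique i x u hx hu hxu
  · by_cases hi : i = cnt + 1
    · subst hi; rw [Function.update_self]; exact hc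
    · rw [Function.update_of_ne hi]; exact h.col_lt i h1 (by omega)
  · have hj' := (hlt i j hj).2
    rw [Function.update_of_ne (a := j) (by omega)]
    by_cases hi : i = cnt + 1
    · subst hi
      rw [Function.update_self] at hj ⊢
      exact hcol j hj
    · rw [Function.update_of_ne hi] at hj ⊢
      exact h.col_ne i j hj
  · have huv : u ≠ v := by
      rintro rfl
      rw [Function.update_self] at huu
      by_cases e : u' = u
      · rw [e, Function.update_self] at huu; omega
      · rw [hne _ e] at huu; have := h.le u'; omega
    rw [hne _ huv] at hu0 huu ⊢
    by_cases e : u' = v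
    · subst e
      rw [Function.update_self, Function.update_self, mem_seen]
      rw [hfull a ha hu'] at hu
      exact ⟨hu0, u, hu, rfl⟩
    · rw [hne _ e] at huu ⊢
      rw [Function.update_of_ne (by have := h.le u'; omega)]
      exact h.star a ha u hu u' hu' hu0 huu
  · by_cases e : u = v
    · exact ⟨t, ht, e ▸ hv⟩
    · rw [hne _ e] at hu; exact h.cover u hu

/-- A further node adds nothing to `star` if its numbered members already lie together in one bag of
`A`; in the search this is the bag of the parent. -/
theorem extend (h : Order n W bag A cnt idx bl col) {t : ℕ}
    (hp : cnt = 0 ∨ ∃ p ∈ A, ∀ v ∈ bag t, idx v ≠ 0 → v ∈ bag p) :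
    Order n W bag (insert t A) cnt idx bl col := by
  refine ⟨h.le, h.inj, h.surj, h.bl_nodup, h.bl_lt, h.clique, h.col_lt, h.col_ne, ?_, fun v hv => ?_⟩
  · intro a ha u hu v hv hu0 huv
    rcases Set.mem_insert_iff.mp ha with rfl | ha
    · rcases hp with rfl | ⟨p, hp, hpv⟩
      · have := h.le u; omega
      · exact h.star p hp u (hpv u hu hu0) v (hpv v hv (by omega)) hu0 huv
    · exact h.star a ha u hu v hv hu0 huv
  · obtain ⟨a, ha, h'⟩ := h.cover v hv
    exact ⟨a, Set.mem_insert_of_mem _ ha, h'⟩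

theorem card_le (h : Order n W bag A cnt idx bl col) : cnt ≤ n := by
  have h1 : Finset.Icc 1 cnt ⊆ (Finset.range n).image idx := fun i hi => by
    rw [Finset.mem_Icc] at hi
    obtain ⟨v, hv, rfl⟩ := h.surj i hi.1 hi.2
    exact Finset.mem_image_of_mem _ (Finset.mem_range.mpr hv)
  have h2 := (Finset.card_le_card h1).trans Finset.card_image_le
  simpa using h2

theorem cnt_eq (h : Order n W bag A cnt idx bl col) (hall : ∀ v < n, idx v ≠ 0) : cnt = n := by
  refine h.card_le.antisymm ?_
  have h1 : (Finset.range n).image idx ⊆ Finset.Icc 1 cnt := fun i hi => by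
    obtain ⟨v, hv, rfl⟩ := Finset.mem_image.mp hi
    have := hall v (Finset.mem_range.mp hv)
    have := h.le v
    rw [Finset.mem_Icc]
    omega
  have h2 := Finset.card_le_card h1
  rw [Finset.card_image_of_injOn, Finset.card_range, Nat.card_Icc] at h2
  · omega
  · intro u hu v hv huv
    exact h.inj u v (hall u (Finset.mem_range.mp hu)) huv

/-- The elimination order of a graph all of whose vertices have been numbered. -/
def elimOrder (h : Order n W bag A cnt idx bl col) (adj : ℕ → ℕ → Prop)
    (hsymm : ∀ u v, adj u v → adj v u) (hne : ∀ u v, adj u v → u ≠ v)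
    (hadj : ∀ u v, adj u v → ∃ t ∈ A, u ∈ bag t ∧ v ∈ bag t)
    (hidx : ∀ u v, adj u v → idx u ≠ 0) : ElimOrder where
  n := cnt
  adj i j := ∃ u v, adj u v ∧ idx u = i ∧ idx v = j
  bl := bl
  symm := by rintro i j ⟨u, v, h1, h2, h3⟩; exact ⟨v, u, hsymm _ _ h1, h3, h2⟩
  ne := by
    rintro i j ⟨u, v, h1, h2, h3⟩ rfl
    exact hne u v h1 (h.inj u v (hidx u v h1) (by rw [h2, h3]))
  le := by
    rintro i j ⟨u, v, h1, rfl, h3⟩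
    have := hidx u v h1
    have := h.le u
    omega
  nodup := h.bl_nodup
  mem_lt i j hj := ⟨(h.bl_lt i j hj).1, (h.bl_lt i j hj).2.1⟩
  clique := h.clique
  edge := by
    rintro i j ⟨u, v, h1, rfl, rfl⟩ hlt
    obtain ⟨t, ht, hu, hv⟩ := hadj u v h1
    exact h.star t ht v hv u hu (hidx v u (hsymm _ _ h1)) hlt

/-- The colouring of the elimination order. -/
def colouring (h : Order n W bag A cnt idx bl col) (adj : ℕ → ℕ → Prop)
    (hsymm : ∀ u v, adj u v → adj v u) (hne : ∀ u v, adj u v → u ≠ v)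
    (hadj : ∀ u v, adj u v → ∃ t ∈ A, u ∈ bag t ∧ v ∈ bag t)
    (hidx : ∀ u v, adj u v → idx u ≠ 0) : (h.elimOrder adj hsymm hne hadj hidx).Colouring W where
  col := col
  lt := h.col_lt
  ne := h.col_ne

end Order

/-! ### Breadth-first search in a rooted tree -/

/-- The nodes of a rooted tree, by lists of children. -/
structure Arborescence (N root : ℕ) (ch : ℕ → List ℕ) : Prop where
  root_lt : root < N
  ch_lt : ∀ t < N, ∀ c ∈ ch t, c < N ∧ c ≠ root
  ch_nodup : ∀ t < N, (ch t).Nodup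
  ch_inj : ∀ t < N, ∀ t' < N, ∀ c ∈ ch t, c ∈ ch t' → t = t'
  reach : ∀ S : Set ℕ, root ∈ S → (∀ t ∈ S, t < N → ∀ c ∈ ch t, c ∈ S) → ∀ t < N, t ∈ S

/-- The queue of a breadth-first search after the first `h` nodes have been processed. -/
structure Queue (N root : ℕ) (ch : ℕ → List ℕ) (h : ℕ) (Q : List ℕ) : Prop where
  nodup : Q.Nodup
  lt : ∀ t ∈ Q, t < N
  root_eq : Q.head? = some root
  closed : ∀ t ∈ Q.take h, ∀ c ∈ ch t, c ∈ Q
  parent : ∀ x, 0 < x → ∀ hx : x < Q.length, ∃ y < x, ∃ hy : y < Q.length, y < h ∧ Q[x] ∈ ch Q[y]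

namespace Queue

variable {N root h : ℕ} {ch : ℕ → List ℕ} {Q : List ℕ}

theorem init (hr : root < N) : Queue N root ch 0 [root] where
  nodup := by simp
  lt := by simpa using hr
  root_eq := rfl
  closed := by simp
  parent x h0 hx := by simp at hx; omega

theorem length_le (hQ : Queue N root ch h Q) : Q.length ≤ N := by
  rw [← List.toFinset_card_of_nodup hQ.nodup, ← Finset.card_range N]
  exact Finset.card_le_card fun t ht => Finset.mem_range.mpr (hQ.lt t (List.mem_toFinset.mp ht))

theorem root_mem (hQ : Queue N root ch h Q) : root ∈ Q := List.mem_of_mem_head? hQ.root_eq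

/-- If all queued nodes had been treated, they would contain the root and be closed under children,
and thus be all `N` nodes. -/
theorem lt_length (hQ : Queue N root ch h Q) (ha : Arborescence N root ch) (hh : h < N) :
    h < Q.length := by
  by_contra hle
  rw [not_lt] at hle
  have hall := ha.reach {t | t ∈ Q} hQ.root_mem fun t ht _ c hc =>
    hQ.closed t (by rwa [List.take_of_length_le hle]) c hc
  have h1 : Finset.range N ⊆ Q.toFinset := fun t ht =>
    List.mem_toFinset.mpr (hall t (Finset.mem_range.mp ht))
  have h2 := Finset.card_le_card h1
  rw [Finset.card_range, List.toFinset_card_of_nodup hQ.nodup] at h2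
  omega

/-- A child of the node treated now is not in the queue yet: it is not the root, and any other
queued node has its unique parent at an earlier position. -/
theorem step (hQ : Queue N root ch h Q) (ha : Arborescence N root ch) (hh : h < Q.length) :
    Queue N root ch (h + 1) (Q ++ ch Q[h]) := by
  have hlt := hQ.lt _ (List.getElem_mem hh)
  refine ⟨?_, ?_, ?_, ?_, ?_⟩
  · rw [List.nodup_append]
    refine ⟨hQ.nodup, ha.ch_nodup _ hlt, ?_⟩
    rintro c hc _ hc' rfl
    obtain ⟨x, hx, rfl⟩ := List.getElem_of_mem hc
    rcases Nat.eq_zero_or_pos x with rfl | h0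
    · have h1 : Q[0] = root := by
        have := hQ.root_eq
        rw [List.head?_eq_getElem?, List.getElem?_eq_getElem hx] at this
        exact Option.some_injective _ this
      exact (ha.ch_lt _ hlt _ hc').2 h1
    · obtain ⟨y, hyx, hy, hyh, hmem⟩ := hQ.parent x h0 hx
      have := ha.ch_inj _ (hQ.lt _ (List.getElem_mem hy)) _ hlt _ hmem hc'
      have := (hQ.nodup.getElem_inj_iff).mp this
      omega
  · intro t ht
    rcases List.mem_append.mp ht with ht | ht
    · exact hQ.lt t ht
    · exact (ha.ch_lt _ hlt t ht).1
  · rw [List.head?_append, hQ.root_eq]; rfl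
  · intro t ht c hc
    rw [List.take_append_of_le_length hh, List.take_succ_eq_append_getElem hh, List.mem_append,
      List.mem_singleton] at ht
    rcases ht with ht | rfl
    · exact List.mem_append_left _ (hQ.closed t ht c hc)
    · exact List.mem_append_right _ hc
  · intro x h0 hx
    rcases Nat.lt_or_ge x Q.length with hxl | hxl
    · obtain ⟨y, hyx, hy, hyh, hmem⟩ := hQ.parent x h0 hxl
      refine ⟨y, hyx, by simp; omega, by omega, ?_⟩
      rwa [List.getElem_append_left hxl, List.getElem_append_left hy]
    · refine ⟨h, by omega, by simp; omega, by omega, ?_⟩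
      rw [List.getElem_append_right hxl, List.getElem_append_left hh]
      exact List.getElem_mem _

theorem mem_of_lt (hQ : Queue N root ch N Q) (ha : Arborescence N root ch) {t : ℕ} (ht : t < N) :
    t ∈ Q :=
  ha.reach {t | t ∈ Q} hQ.root_mem (fun t ht' _ c hc =>
    hQ.closed t (by rwa [List.take_of_length_le hQ.length_le]) c hc) t ht

end Queue

/-! ### Reading the input -/

/-- The input lists the edges, and the bag and the children of each node. -/
structure Input (I : ℕ → ℕ) (β n m N root : ℕ) (ed : ℕ → ℕ × ℕ) (bag ch : ℕ → List ℕ)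
    (pos : ℕ → ℕ) : Prop where
  n_eq : I 0 = n
  m_eq : I 1 = m
  N_eq : I 2 = N
  root_eq : I 3 = root
  ed_fst : ∀ e < m, I (5 + 2 * e) = (ed e).1
  ed_snd : ∀ e < m, I (5 + 2 * e + 1) = (ed e).2
  pos_zero : pos 0 = 5 + 2 * m
  pos_succ : ∀ t < N, pos (t + 1) = pos t + 1 + (bag t).length + 1 + (ch t).length
  bag_length : ∀ t < N, I (pos t) = (bag t).length
  bag_getElem : ∀ t < N, ∀ x (h : x < (bag t).length), I (pos t + 1 + x) = (bag t)[x]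
  ch_length : ∀ t < N, I (pos t + 1 + (bag t).length) = (ch t).length
  ch_getElem : ∀ t < N, ∀ x (h : x < (ch t).length), I (pos t + 1 + (bag t).length + 1 + x) = (ch t)[x]
  pos_le : ∀ t ≤ N, pos t ≤ β

namespace VM

variable {n W : ℕ} {bag : ℕ → List ℕ} {A : Set ℕ}

/-- Append the index of a member of the bag, if it is not zero. -/
def appendBody : Cmd :=
  block [.set .y (.arr .idx (.inp (Reg.p + 1 + Reg.z))), .put .bls Reg.bp Reg.y,
    .put .used (.arr .col Reg.y) Reg.cnt, .set .bp (Reg.bp + (Reg.y - (Reg.y - 1))),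
    .set .z (Reg.z + 1)]

/-- Number the vertex `v` of the current bag. -/
def introduce : Cmd :=
  block [.set .cnt (Reg.cnt + 1), .put .bst Reg.cnt Reg.bp, .set .z 0, .rep Reg.l appendBody,
    .put .ben Reg.cnt Reg.bp, .set .c 0,
    .rep Reg.W (.set .c (Reg.c + (1 - (Reg.cnt - .arr .used Reg.c)))),
    .put .col Reg.cnt Reg.c, .put .idx Reg.v Reg.cnt]

/-- The arrays contain the lists `bl`. -/
structure Enc (bl : ℕ → List ℕ) (s : St) : Prop where
  ben : ∀ i, 1 ≤ i → i ≤ s.r .cnt → s.a .ben i = s.a .bst i + (bl i).length ∧ s.a .ben i ≤ s.r .bp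
  bls : ∀ i, 1 ≤ i → i ≤ s.r .cnt → ∀ x (h : x < (bl i).length),
    s.a .bls (s.a .bst i + x) = (bl i)[x]

/-- The state during the numbering of the vertices. -/
structure Scan (n W : ℕ) (bag : ℕ → List ℕ) (A : Set ℕ) (bl : ℕ → List ℕ) (s : St) : Prop
    extends Enc bl s where
  ord : Order n W bag A (s.r .cnt) (s.a .idx) bl (s.a .col)
  col_zero : s.a .col 0 = W
  w : s.r .W = W
  bp_le : s.r .bp ≤ s.r .cnt * W
  used : ∀ c, s.a .used c ≤ s.r .cnt

theorem _root_.Order.seen_take_succ (idx : ℕ → ℕ) {l : List ℕ} {z : ℕ} (hz : z < l.length) :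
    Order.seen idx (l.take (z + 1)) =
      Order.seen idx (l.take z) ++ if idx l[z] = 0 then [] else [idx l[z]] := by
  rw [List.take_succ_eq_append_getElem hz]
  simp only [Order.seen, List.map_append, List.filter_append, List.map_cons, List.map_nil]
  by_cases h : idx l[z] = 0 <;> simp [h]

/-- No branch is needed for members without a number: they have index `y = 0`, the pointer advances
by `y - (y - 1) = 0`, and the stamp goes to the dummy colour `col 0 = W`. The stamp `cnt + 1` is new
for each vertex, so the array `used` is never reset. -/
theorem wp_appendBody {E : Env} {s : St} {p z cnt bp₀ : ℕ} {idx col : ℕ → ℕ} {l : List ℕ}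
    (hp : s.r .p = p) (hz : s.r .z = z) (hzl : z < l.length) (hcnt : s.r .cnt = cnt + 1)
    (hidx : s.a .idx = idx) (hcol : s.a .col = col) (hcol0 : col 0 = W)
    (hI : E.I (p + 1 + z) = l[z]) (hβ : p + 1 + z < E.β) (hln : l[z] < n)
    (hle : ∀ v, idx v ≤ cnt) (hcl : ∀ i, 1 ≤ i → i ≤ cnt → col i < W)
    (hbp : s.r .bp = bp₀ + (Order.seen idx (l.take z)).length)
    (hbls : ∀ x (h : x < (Order.seen idx (l.take z)).length),
      s.a .bls (bp₀ + x) = (Order.seen idx (l.take z))[x])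
    (hused : ∀ c, s.a .used c ≤ cnt + 1)
    (hst : ∀ c < W, s.a .used c = cnt + 1 ↔ ∃ y ∈ Order.seen idx (l.take z), col y = c)
    (hH : n + W + E.β + bp₀ + l.length + 20 < E.H) (hcH : cnt < E.H) :
    appendBody.wp E s fun s' t => (s'.r .z = z + 1 ∧
      s'.r .bp = bp₀ + (Order.seen idx (l.take (z + 1))).length ∧
      (∀ x (h : x < (Order.seen idx (l.take (z + 1))).length),
        s'.a .bls (bp₀ + x) = (Order.seen idx (l.take (z + 1)))[x]) ∧
      (∀ x < bp₀, s'.a .bls x = s.a .bls x) ∧ (∀ c, s'.a .used c ≤ cnt + 1) ∧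
      (∀ c < W, s'.a .used c = cnt + 1 ↔ ∃ y ∈ Order.seen idx (l.take (z + 1)), col y = c)) ∧
      t ≤ 80 := by
  have hlen : (Order.seen idx (l.take z)).length ≤ z := by
    refine (List.length_filter_le _ _).trans ?_
    simp
  have hy := hle l[z]
  have hs := Order.seen_take_succ idx hzl
  obtain ⟨y, hyy⟩ : ∃ y, idx l[z] = y := ⟨_, rfl⟩
  rw [hyy] at hs hy
  have hcy : col y ≤ W := by
    by_cases h : y = 0
    · rw [h, hcol0]
    · exact (hcl y (by omega) hy).le
  have hsl : (Order.seen idx (l.take (z + 1))).length =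
      (Order.seen idx (l.take z)).length + (y - (y - 1)) := by
    rw [hs, List.length_append]
    split_ifs with h
    · simp [h]
    · simp only [List.length_cons, List.length_nil]; omega
  simp only [appendBody, block, Cmd.wp, ofNat_eq, add_eq, sub_eq, Ex.ok, Ex.ev, Ex.cost, St.set_r,
    St.put_r, St.set_a, St.put_a, reduceCtorEq, if_true, if_false, hp, hz, hI, hcnt, hidx, hcol, hyy,
    hbp, true_and, and_true]
  refine ⟨by omega, by omega, by omega, by omega, by omega, by omega,
    ⟨by rw [hsl]; omega, ?_, ?_, ?_, ?_⟩, by norm_num⟩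
  · intro x hx
    rw [hsl] at hx
    by_cases hy0 : y = 0
    · have hs0 := hs.trans (by rw [if_pos hy0, List.append_nil])
      simp only [hs0]
      rw [Function.update_of_ne (by omega)]
      exact hbls x (by omega)
    · have hs0 := hs.trans (by rw [if_neg hy0])
      simp only [hs0]
      by_cases h1 : x = (Order.seen idx (l.take z)).length
      · subst h1
        simp
      · rw [Function.update_of_ne (by omega), List.getElem_append_left (by omega)]
        exact hbls x (by omega)
  · intro x hx
    rw [Function.update_of_ne (by omega)]
  · intro c
    rw [Function.update_apply]
    split_ifs
    · exact le_rfl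
    · exact hused c
  · intro c hc
    rw [Function.update_apply, hs]
    by_cases hy0 : y = 0
    · rw [if_neg (by rw [hy0, hcol0]; omega), if_pos hy0, List.append_nil]
      exact hst c hc
    · rw [if_neg hy0]
      simp only [List.mem_append, List.mem_singleton]
      by_cases h : c = col y
      · rw [if_pos h]
        exact ⟨fun _ => ⟨y, .inr rfl, h.symm⟩, fun _ => rfl⟩
      · rw [if_neg h, hst c hc]
        refine ⟨fun ⟨a, ha, h'⟩ => ⟨a, .inl ha, h'⟩, ?_⟩
        rintro ⟨a, ha | rfl, h'⟩
        · exact ⟨a, ha, h'⟩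
        · exact absurd h'.symm h

end VM

namespace VM

variable {n W : ℕ} {bag : ℕ → List ℕ} {A : Set ℕ}

theorem wp_appendLoop {E : Env} {s : St} {p cnt bp₀ : ℕ} {idx col : ℕ → ℕ} {l : List ℕ}
    (hp : s.r .p = p) (hz : s.r .z = 0) (hl : s.r .l = l.length) (hcnt : s.r .cnt = cnt + 1)
    (hidx : s.a .idx = idx) (hcol : s.a .col = col) (hcol0 : col 0 = W)
    (hI : ∀ x (h : x < l.length), E.I (p + 1 + x) = l[x]) (hβ : p + 1 + l.length ≤ E.β)
    (hln : ∀ v ∈ l, v < n) (hle : ∀ v, idx v ≤ cnt) (hcl : ∀ i, 1 ≤ i → i ≤ cnt → col i < W)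
    (hbp : s.r .bp = bp₀) (hused : ∀ c, s.a .used c ≤ cnt)
    (hH : n + W + E.β + bp₀ + l.length + 20 < E.H) (hcH : cnt < E.H) :
    (Cmd.rep Reg.l appendBody).wp E s fun s' t => (
      s'.r .bp = bp₀ + (Order.seen idx l).length ∧
      (∀ x (h : x < (Order.seen idx l).length), s'.a .bls (bp₀ + x) = (Order.seen idx l)[x]) ∧
      (∀ x < bp₀, s'.a .bls x = s.a .bls x) ∧ (∀ c, s'.a .used c ≤ cnt + 1) ∧
      (∀ c < W, s'.a .used c = cnt + 1 ↔ ∃ y ∈ Order.seen idx l, col y = c)) ∧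
      t ≤ 2 + l.length * 83 := by
  refine wp_rep (e := Reg.l) (fun z s' => s'.r .z = z ∧
      s'.r .bp = bp₀ + (Order.seen idx (l.take z)).length ∧
      (∀ x (h : x < (Order.seen idx (l.take z)).length),
        s'.a .bls (bp₀ + x) = (Order.seen idx (l.take z))[x]) ∧
      (∀ x < bp₀, s'.a .bls x = s.a .bls x) ∧ (∀ c, s'.a .used c ≤ cnt + 1) ∧
      (∀ c < W, s'.a .used c = cnt + 1 ↔ ∃ y ∈ Order.seen idx (l.take z), col y = c)) 80 trivial
    ?_ ?_ ?_
  · refine ⟨hz, by simp [Order.seen, hbp], by simp [Order.seen], fun _ _ => rfl,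
      fun c => (hused c).trans (by omega), fun c _ => ?_⟩
    have := hused c
    simp [Order.seen]
    omega
  · rintro z s' hzl hf ⟨h1, h2, h3, h4, h5, h6⟩
    have hzl : z < l.length := by simpa [Ex.ev, hl] using hzl
    refine Cmd.wp_mono (wp_appendBody (W := W) (n := n) (l := l) (p := p) (z := z) (idx := idx)
      (col := col) ((hf.r _ (by decide)).trans hp) h1 hzl ((hf.r _ (by decide)).trans hcnt)
      ((hf.a _ (by decide)).trans hidx) ((hf.a _ (by decide)).trans hcol) hcol0 (hI z hzl)
      (by omega) (hln _ (List.getElem_mem hzl)) hle hcl h2 h3 h5 h6 hH hcH) ?_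
    rintro s'' t ⟨⟨g1, g2, g3, g4, g5, g6⟩, ht⟩
    exact ⟨⟨g1, g2, g3, fun x hx => (g4 x hx).trans (h4 x hx), g5, g6⟩, ht⟩
  · rintro s' t - ⟨-, h2, h3, h4, h5, h6⟩ ht
    simp only [Ex.ev, hl, Ex.cost, List.take_length] at *
    exact ⟨⟨h2, h3, h4, h5, h6⟩, by omega⟩

/-- The first free colour. -/
theorem wp_firstFree {E : Env} {s : St} {cnt : ℕ} (hcnt : s.r .cnt = cnt + 1) (hW : s.r .W = W)
    (hc : s.r .c = 0) (hused : ∀ c, s.a .used c ≤ cnt + 1)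
    (hfree : ∃ c < W, s.a .used c ≠ cnt + 1) (hH : W + 20 < E.H) :
    (Cmd.rep Reg.W (.set .c (Reg.c + (1 - (Reg.cnt - .arr .used Reg.c))))).wp E s fun s' t =>
      (s'.r .c < W ∧ s.a .used (s'.r .c) ≠ cnt + 1) ∧ t ≤ 2 + W * 33 := by
  -- Stamps do not exceed the register `cnt`, so the increment is one at a taken colour and zero at
  -- a free one; `c` stops at the first free colour.
  refine wp_rep (e := Reg.W) (fun x s' => s'.r .c ≤ x ∧ (∀ c < s'.r .c, s.a .used c = cnt + 1) ∧
    (s'.r .c = x ∨ s.a .used (s'.r .c) ≠ cnt + 1)) 30 trivial ?_ ?_ ?_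
  · simp [hc]
  · rintro x s' hx hf ⟨h1, h2, h3⟩
    have hx : x < W := by simpa [Ex.ev, hW] using hx
    have h4 := hf.r .cnt (by decide)
    have h5 := hf.a .used (by decide)
    obtain ⟨c, hc⟩ : ∃ c, s'.r .c = c := ⟨_, rfl⟩
    rw [hc] at h1 h2 h3
    have h6 := hused c
    simp only [Cmd.wp, ofNat_eq, add_eq, sub_eq, Ex.ok, Ex.ev, St.set_r, if_true, hc, h4, h5, hcnt,
      true_and, and_true, Ex.cost]
    refine ⟨by omega, ⟨by omega, ?_, ?_⟩, by norm_num⟩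
    · intro c' hc'
      by_cases h : c' < c
      · exact h2 c' h
      · have : c' = c := by omega
        subst this
        omega
    · by_cases h : s.a .used c = cnt + 1
      · left
        rw [h]
        have : c = x := by tauto
        omega
      · right
        rwa [show c + (1 - (cnt + 1 - s.a .used c)) = c by omega]
  · rintro s' t - ⟨h1, h2, h3⟩ ht
    simp only [Ex.ev, hW, Ex.cost] at *
    obtain ⟨c, hcW, hc'⟩ := hfree
    have : s'.r .c ≤ c := by
      by_contra h
      exact hc' (h2 c (by omega))
    exact ⟨⟨by omega, by rcases h3 with h3 | h3; · omega
                         · exact h3⟩, by omega⟩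

/-- The bag has at most `W` members and `v` among them has no number, so fewer than `W` colours are
taken. -/
theorem _root_.Order.exists_free {idx col : ℕ → ℕ} {l : List ℕ} {v : ℕ} (hv : v ∈ l)
    (h0 : idx v = 0) (hl : l.length ≤ W) : ∃ c < W, ∀ y ∈ Order.seen idx l, col y ≠ c := by
  have h1 : (Order.seen idx l).length < W := by
    refine lt_of_lt_of_le ?_ (hl.trans' (List.length_map idx).le)
    rw [Order.seen, List.length_filter_lt_length_iff_exists]
    exact ⟨0, List.mem_map.mpr ⟨v, hv, h0⟩, by simp⟩
  by_contra! h
  have h2 : Finset.range W ⊆ (Order.seen idx l).toFinset.image col := fun c hc => by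
    obtain ⟨y, hy, h⟩ := h c (Finset.mem_range.mp hc)
    exact Finset.mem_image.mpr ⟨y, List.mem_toFinset.mpr hy, h⟩
  have h3 := (Finset.card_le_card h2).trans (Finset.card_image_le.trans (List.toFinset_card_le _))
  rw [Finset.card_range] at h3
  omega

theorem wp_introduce {E : Env} {s : St} {t p v : ℕ} {bl : ℕ → List ℕ} (hs : Scan n W bag A bl s)
    (ht : t ∈ A) (hnd : (bag t).Nodup) (hbn : ∀ u ∈ bag t, u < n) (hbW : (bag t).length ≤ W)
    (hp : s.r .p = p) (hl : s.r .l = (bag t).length) (hv : s.r .v = v) (hvb : v ∈ bag t)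
    (h0 : s.a .idx v = 0) (hfull : ∀ a ∈ A, v ∈ bag a → a = t)
    (hI : ∀ x (h : x < (bag t).length), E.I (p + 1 + x) = (bag t)[x])
    (hβ : p + 1 + (bag t).length ≤ E.β) (hH : n + 2 * W + E.β + n * W + 30 < E.H) :
    introduce.wp E s fun s' τ => (∃ bl', Scan n W bag A bl' s' ∧
      s'.a .idx = Function.update (s.a .idx) v (s.r .cnt + 1)) ∧ τ ≤ 200 * (W + 1) := by
  obtain ⟨cnt, hcnt⟩ : ∃ c, s.r .cnt = c := ⟨_, rfl⟩
  obtain ⟨idx, hidx⟩ : ∃ c, s.a .idx = c := ⟨_, rfl⟩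
  obtain ⟨col, hcol⟩ : ∃ c, s.a .col = c := ⟨_, rfl⟩
  obtain ⟨bp₀, hbp⟩ : ∃ c, s.r .bp = c := ⟨_, rfl⟩
  have hord := hs.ord
  have hcol0 := hs.col_zero
  have hused := hs.used
  have hbple := hs.bp_le
  rw [hcnt, hidx, hcol] at hord
  rw [hcol] at hcol0
  rw [hcnt] at hused
  rw [hidx] at h0 ⊢
  rw [hbp, hcnt] at hbple
  have hcn := hord.card_le
  have hle : cnt * W ≤ n * W := Nat.mul_le_mul_right _ hcn
  have hvn := hbn v hvb
  have hseen : (Order.seen idx (bag t)).length ≤ W := by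
    refine (List.length_filter_le _ _).trans ?_
    rwa [List.length_map]
  simp only [introduce, wp_block_cons, block_singleton]
  simp only [Cmd.wp.eq_2 E, Cmd.wp.eq_3 E, ofNat_eq, add_eq, Ex.ok, Ex.ev, Ex.cost, St.set_r,
    St.put_r, St.set_a, St.put_a, reduceCtorEq, if_true, if_false, hcnt, true_and, sub_eq]
  refine ⟨⟨by omega, by omega⟩, by omega, by omega, ?_⟩
  refine Cmd.wp_mono (p := .rep Reg.l appendBody) (Cmd.wp_frame (p := .rep Reg.l appendBody)
    (wp_appendLoop (W := W) (n := n) (l := bag t) (p := p) (cnt := cnt) (idx := idx) (col := col)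
      (bp₀ := bp₀) (by simp [St.set_r, hp]) (by simp) (by simp [St.set_r, hl])
      (by simp [St.set_r]) (by simp [St.put_a, hidx]) (by simp [St.put_a, hcol]) hcol0 hI hβ hbn
      hord.le hord.col_lt (by simp [St.set_r, hbp]) (by simpa [St.put_a] using hused)
      (by omega) (by omega))) ?_
  rintro s₁ t₁ ⟨⟨⟨h1, h2, h3, h4, h5⟩, ht₁⟩, hf₁⟩
  have c1 : s₁.r .cnt = cnt + 1 := by rw [hf₁.r _ (by decide)]; simp [St.set_r]
  have v1 : s₁.r .v = v := by rw [hf₁.r _ (by decide)]; simp [St.set_r, hv]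
  have W1 : s₁.r .W = W := by rw [hf₁.r _ (by decide)]; simp [St.set_r, hs.w]
  have idx1 : s₁.a .idx = idx := by rw [hf₁.a _ (by decide)]; simp [St.put_a, hidx]
  have col1 : s₁.a .col = col := by rw [hf₁.a _ (by decide)]; simp [St.put_a, hcol]
  have bst1 : s₁.a .bst = Function.update (s.a .bst) (cnt + 1) bp₀ := by
    rw [hf₁.a _ (by decide)]; simp [St.put_a, hbp]
  have ben1 : s₁.a .ben = s.a .ben := by rw [hf₁.a _ (by decide)]; simp [St.put_a]
  have bls1 : ∀ x < bp₀, s₁.a .bls x = s.a .bls x := by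
    intro x hx; rw [h3 x hx]; simp [St.put_a]
  rw [c1]
  obtain ⟨c₀, hc₀, hfree⟩ := Order.exists_free (col := col) hvb h0 hbW
  refine ⟨by omega, by omega, ?_⟩
  refine Cmd.wp_mono (Cmd.wp_frame (wp_firstFree (W := W) (cnt := cnt) (by simp [St.set_r, c1])
    (by simp [St.set_r, W1]) (by simp) (by simpa [St.put_a] using h4)
    ⟨c₀, hc₀, by simpa [St.put_a, h5 c₀ hc₀] using hfree⟩ (by omega))) ?_
  rintro s₂ t₂ ⟨⟨⟨g1, g2⟩, ht₂⟩, hf₂⟩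
  have c2 : s₂.r .cnt = cnt + 1 := by rw [hf₂.r _ (by decide)]; simp [St.set_r, c1]
  have v2 : s₂.r .v = v := by rw [hf₂.r _ (by decide)]; simp [St.set_r, v1]
  have W2 : s₂.r .W = W := by rw [hf₂.r _ (by decide)]; simp [St.set_r, W1]
  have bp2 : s₂.r .bp = bp₀ + (Order.seen idx (bag t)).length := by
    rw [hf₂.r _ (by decide)]; simp [St.set_r, h1]
  have idx2 : s₂.a .idx = idx := by rw [hf₂.a _ (by decide)]; simp [St.put_a, idx1]
  have col2 : s₂.a .col = col := by rw [hf₂.a _ (by decide)]; simp [St.put_a, col1]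
  have bst2 : s₂.a .bst = Function.update (s.a .bst) (cnt + 1) bp₀ := by
    rw [hf₂.a _ (by decide)]; simp [St.put_a, bst1]
  have ben2 : s₂.a .ben = Function.update (s.a .ben) (cnt + 1)
      (bp₀ + (Order.seen idx (bag t)).length) := by
    rw [hf₂.a _ (by decide)]; simp [St.put_a, ben1, h1]
  have bls2 : s₂.a .bls = s₁.a .bls := by rw [hf₂.a _ (by decide)]; simp [St.put_a]
  have used2 : s₂.a .used = s₁.a .used := by rw [hf₂.a _ (by decide)]; simp [St.put_a]
  have g3 : ∀ j ∈ Order.seen idx (bag t), col j ≠ s₂.r .c := by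
    intro j hj he
    refine g2 ?_
    simp only [St.set_a, St.put_a, reduceCtorEq, if_false]
    exact (h5 _ g1).mpr ⟨j, hj, he⟩
  rw [c2, v2, idx2]
  refine ⟨by omega, by omega, ⟨Function.update bl (cnt + 1) (Order.seen idx (bag t)), ?_, rfl⟩, ?_⟩
  · refine ⟨⟨?_, ?_⟩, ?_, ?_, ?_, ?_, ?_⟩
    · intro i h1i hi
      simp only [St.put_r, St.put_a, reduceCtorEq, if_false, c2, bp2, bst2, ben2] at hi ⊢
      by_cases h : i = cnt + 1
      · subst h
        simp
      · have := hs.ben i h1i (by omega)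
        rw [hbp] at this
        rw [Function.update_of_ne h, Function.update_of_ne h, Function.update_of_ne h]
        omega
    · intro i h1i hi x hx
      simp only [St.put_r, St.put_a, reduceCtorEq, if_false, c2, bls2, bst2] at hi ⊢
      by_cases h : i = cnt + 1
      · subst h
        simp only [Function.update_self] at hx ⊢
        exact h2 x hx
      · simp only [Function.update_of_ne h] at hx ⊢
        have h6 := hs.ben i h1i (by omega)
        rw [bls1 _ (by omega)]
        exact hs.bls i h1i (by omega) x hx
    · simp only [St.put_r, St.put_a, reduceCtorEq, if_false, if_true, c2, idx2, col2]
      exact hord.introduce ht hnd hvb hvn h0 hfull g1 g3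
    · simpa [St.put_a, col2] using hcol0
    · exact W2
    · simp only [St.put_r, c2, bp2, add_mul, one_mul]
      omega
    · intro x
      simp only [St.put_r, St.put_a, reduceCtorEq, if_false, c2, used2]
      exact h4 x
  · omega

end VM

/-- A rooted tree decomposition with bags of at most `W` vertices. -/
structure Decomp (n W N root : ℕ) (bag ch : ℕ → List ℕ) : Prop extends
    Arborescence N root ch where
  bag_lt : ∀ t < N, ∀ v ∈ bag t, v < n
  bag_nodup : ∀ t < N, (bag t).Nodup
  bag_length_le : ∀ t < N, (bag t).length ≤ W
  ch_length_le : ∀ t < N, (ch t).length ≤ 2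
  running : ∀ A : Set ℕ, root ∈ A → (∀ a ∈ A, a < N) →
    (∀ a ∈ A, a ≠ root → ∃ p ∈ A, a ∈ ch p) → ∀ p ∈ A, ∀ t ∈ ch p, t ∉ A → ∀ a ∈ A, ∀ v ∈ bag t,
      v ∈ bag a → v ∈ bag p

namespace VM

variable {n W : ℕ} {bag ch : ℕ → List ℕ} {A : Set ℕ}

/-- Number a member of the current bag. -/
def visit : Cmd :=
  block [.set .v (.inp (Reg.p + 1 + Reg.u)), .ite (.arr .idx Reg.v) .skip introduce,
    .set .u (Reg.u + 1)]

/-- Append a child to the queue. -/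
def enqueue : Cmd :=
  block [.put .que Reg.tail (.inp (Reg.p + 1 + Reg.u)), .set .tail (Reg.tail + 1),
    .set .u (Reg.u + 1)]

/-- Treat the next node of the queue. -/
def processNode : Cmd :=
  block [.set .t (.arr .que Reg.h), .set .p (.arr .ptr Reg.t), .set .l (.inp Reg.p), .set .u 0,
    .rep Reg.l visit, .set .p (Reg.p + 1 + Reg.l), .set .l (.inp Reg.p), .set .u 0,
    .rep Reg.l enqueue, .set .h (Reg.h + 1)]

theorem Scan.frame {bl : ℕ → List ℕ} {s s' : St} (h : Scan n W bag A bl s)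
    (hr : ∀ x ∈ [Reg.cnt, .bp, .W], s'.r x = s.r x)
    (ha : ∀ B ∈ [Arr.ben, .bst, .bls, .idx, .col, .used], s'.a B = s.a B) :
    Scan n W bag A bl s' := by
  simp only [List.mem_cons, List.not_mem_nil, or_false, forall_eq_or_imp, forall_eq] at hr ha
  obtain ⟨r1, r2, r3⟩ := hr
  obtain ⟨a1, a2, a3, a4, a5, a6⟩ := ha
  refine ⟨⟨?_, ?_⟩, ?_, ?_, ?_, ?_, ?_⟩
  · rw [r1, r2, a1, a2]; exact h.ben
  · rw [r1, a2, a3]; exact h.bls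
  · rw [r1, a4, a5]; exact h.ord
  · rw [a5]; exact h.col_zero
  · rw [r3]; exact h.w
  · rw [r1, r2]; exact h.bp_le
  · rw [r1, a6]; exact h.used

/-- All members of earlier bags are numbered, so an unnumbered member occurs in no earlier bag; this
is the hypothesis `hfull` of `Order.introduce`. -/
theorem wp_visit {E : Env} {s : St} {t p z : ℕ} {bl : ℕ → List ℕ}
    (hs : Scan n W bag (insert t A) bl s)
    (hnd : (bag t).Nodup) (hbn : ∀ u ∈ bag t, u < n) (hbW : (bag t).length ≤ W)
    (hp : s.r .p = p) (hl : s.r .l = (bag t).length) (hu : s.r .u = z) (hz : z < (bag t).length)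
    (hA : ∀ a ∈ A, ∀ v ∈ bag a, s.a .idx v ≠ 0)
    (hI : ∀ x (h : x < (bag t).length), E.I (p + 1 + x) = (bag t)[x])
    (hβ : p + 1 + (bag t).length ≤ E.β) (hH : n + 2 * W + E.β + n * W + 30 < E.H) :
    visit.wp E s fun s' τ => ((∃ bl', Scan n W bag (insert t A) bl' s') ∧ s'.r .u = z + 1 ∧
      s'.a .idx (bag t)[z] ≠ 0 ∧ ∀ v, s.a .idx v ≠ 0 → s'.a .idx v ≠ 0) ∧
      τ ≤ 200 * (W + 1) + 40 := by
  have hvn := hbn _ (List.getElem_mem hz)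
  simp only [visit, wp_block_cons, block_singleton]
  refine ⟨⟨⟨⟨trivial, ?_, ?_⟩, trivial, ?_⟩, ?_⟩, ?_⟩
  · show 1 < E.H; omega
  · show s.r .p + 1 < E.H; omega
  · show s.r .p + 1 + s.r .u < E.H; omega
  · show s.r .p + 1 + s.r .u < E.β; omega
  have ev : (Ex.inp (Ex.reg .p + 1 + Ex.reg .u)).ev E s = (bag t)[z] := by
    show E.I (s.r .p + 1 + s.r .u) = _
    rw [hp, hu]; exact hI z hz
  rw [ev]
  refine ⟨⟨trivial, ?_⟩, fun h => ?_, fun h => ?_⟩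
  · simp only [Ex.ev, St.set_r_self]; omega
  · simp only [Ex.ev, St.set_r_self, St.set_a] at h
    simp only [Cmd.wp, ofNat_eq, add_eq, Ex.ok, Ex.ev, Ex.cost, St.set_r, St.set_a, reduceCtorEq,
      if_true, if_false, hu, true_and]
    refine ⟨⟨by omega, by omega⟩, ⟨⟨bl, hs.frame (fun x hx => ?_) fun _ _ => rfl⟩, by omega,
      fun _ => id⟩, by omega⟩
    simp only [List.mem_cons, List.not_mem_nil, or_false] at hx
    rcases hx with rfl | rfl | rfl <;> simp [St.set_r]
  · simp only [Ex.ev, St.set_r_self, St.set_a] at h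
    refine Cmd.wp_mono (Cmd.wp_frame (wp_introduce (n := n) (W := W) (bag := bag) (A := insert t A)
      (bl := bl) (t := t) (p := p) (v := (bag t)[z]) (hs.frame (fun x hx => ?_) fun _ _ => rfl)
      (Set.mem_insert _ _) hnd hbn hbW (by simp [St.set_r, hp]) (by simp [St.set_r, hl])
      (by simp [St.set_r]) (List.getElem_mem hz) (by simpa using h) (fun a ha hv => ?_) hI hβ hH)) ?_
    · simp only [List.mem_cons, List.not_mem_nil, or_false] at hx
      rcases hx with rfl | rfl | rfl <;> simp [St.set_r]
    · rcases Set.mem_insert_iff.mp ha with rfl | ha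
      · rfl
      · exact absurd h (hA a ha _ hv)
    · rintro s₁ t₁ ⟨⟨⟨bl', h1, h2⟩, ht⟩, hf⟩
      have u1 : s₁.r .u = z := by rw [hf.r _ (by decide)]; simp [St.set_r, hu]
      simp only [Cmd.wp, ofNat_eq, add_eq, Ex.ok, Ex.ev, Ex.cost, St.set_r, St.set_a, reduceCtorEq,
        if_true, if_false, u1, true_and, h2]
      refine ⟨⟨by omega, by omega⟩, ⟨⟨bl', h1.frame (fun x hx => ?_) fun _ _ => rfl⟩, by simp,
        fun v hv => ?_⟩, by omega⟩
      · simp only [List.mem_cons, List.not_mem_nil, or_false] at hx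
        rcases hx with rfl | rfl | rfl <;> simp [St.set_r]
      · rw [Function.update_apply]
        split_ifs
        · simp
        · exact hv

theorem wp_visitLoop {E : Env} {s : St} {t p : ℕ} {bl : ℕ → List ℕ}
    (hs : Scan n W bag (insert t A) bl s)
    (hnd : (bag t).Nodup) (hbn : ∀ u ∈ bag t, u < n) (hbW : (bag t).length ≤ W)
    (hp : s.r .p = p) (hl : s.r .l = (bag t).length) (hu : s.r .u = 0)
    (hA : ∀ a ∈ A, ∀ v ∈ bag a, s.a .idx v ≠ 0)
    (hI : ∀ x (h : x < (bag t).length), E.I (p + 1 + x) = (bag t)[x])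
    (hβ : p + 1 + (bag t).length ≤ E.β) (hH : n + 2 * W + E.β + n * W + 30 < E.H) :
    (Cmd.rep Reg.l visit).wp E s fun s' τ => ((∃ bl', Scan n W bag (insert t A) bl' s') ∧
      ∀ a ∈ insert t A, ∀ v ∈ bag a, s'.a .idx v ≠ 0) ∧ τ ≤ 2 + W * (200 * (W + 1) + 43) := by
  refine wp_rep (e := Reg.l) (fun z s' => (∃ bl', Scan n W bag (insert t A) bl' s') ∧ s'.r .u = z ∧
    (∀ x (hx : x < (bag t).length), x < z → s'.a .idx (bag t)[x] ≠ 0) ∧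
    ∀ v, s.a .idx v ≠ 0 → s'.a .idx v ≠ 0) (200 * (W + 1) + 40) trivial ?_ ?_ ?_
  · exact ⟨⟨bl, hs⟩, hu, by simp, fun _ => id⟩
  · rintro z s' hz hf ⟨⟨bl', h1⟩, h2, h3, h4⟩
    have hz : z < (bag t).length := by simpa [Ex.ev, hl] using hz
    refine Cmd.wp_mono (wp_visit h1 hnd hbn hbW ((hf.r _ (by decide)).trans hp)
      ((hf.r _ (by decide)).trans hl) h2 hz (fun a ha v hv => h4 v (hA a ha v hv)) hI hβ hH) ?_
    rintro s'' τ ⟨⟨g1, g2, g3, g4⟩, hτ⟩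
    refine ⟨⟨g1, g2, fun x hx hxz => ?_, fun v hv => g4 v (h4 v hv)⟩, hτ⟩
    by_cases h : x = z
    · subst h; exact g3
    · exact g4 _ (h3 x hx (by omega))
  · rintro s' τ - ⟨h1, -, h3, h4⟩ hτ
    simp only [Ex.ev, hl, Ex.cost] at h3 hτ
    refine ⟨⟨h1, fun a ha v hv => ?_⟩, hτ.trans (by gcongr)⟩
    rcases Set.mem_insert_iff.mp ha with rfl | ha
    · obtain ⟨x, hx, rfl⟩ := List.getElem_of_mem hv
      exact h3 x hx hx
    · exact h4 v (hA a ha v hv)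

theorem wp_enqueueLoop {E : Env} {s : St} {p N : ℕ} {Q l : List ℕ}
    (hp : s.r .p = p) (hl : s.r .l = l.length) (hu : s.r .u = 0) (htl : s.r .tail = Q.length)
    (hQ : ∀ x (h : x < Q.length), s.a .que x = Q[x]) (hN : Q.length + l.length ≤ N)
    (hI : ∀ x (h : x < l.length), E.I (p + 1 + x) = l[x])
    (hβ : p + 1 + l.length ≤ E.β) (hH : N + E.β + 30 < E.H) :
    (Cmd.rep Reg.l enqueue).wp E s fun s' τ => (s'.r .tail = (Q ++ l).length ∧
      ∀ x (h : x < (Q ++ l).length), s'.a .que x = (Q ++ l)[x]) ∧ τ ≤ 2 + l.length * 53 := by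
  refine wp_rep (e := Reg.l) (fun z s' => s'.r .u = z ∧ s'.r .tail = Q.length + z ∧
    ∀ x (h : x < (Q ++ l).length), x < Q.length + z → s'.a .que x = (Q ++ l)[x]) 50 trivial ?_ ?_ ?_
  · refine ⟨hu, htl, fun x hx hx' => ?_⟩
    rw [List.getElem_append_left (by omega)]
    exact hQ x (by omega)
  · rintro z s' hz hf ⟨h1, h2, h3⟩
    have hz : z < l.length := by simpa [Ex.ev, hl] using hz
    have hp' := (hf.r .p (by decide)).trans hp
    simp only [enqueue, block, Cmd.wp, ofNat_eq, add_eq, Ex.ok, Ex.ev, Ex.cost, St.set_r, St.put_r,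
      St.set_a, St.put_a, reduceCtorEq, if_true, if_false, h1, h2, hp', true_and, hI z hz]
    refine ⟨by omega, by omega, by omega, by omega, ⟨by omega, fun x hx hxz => ?_⟩,
      by norm_num⟩
    by_cases h : x = Q.length + z
    · subst h
      simp
    · rw [Function.update_of_ne h]
      exact h3 x hx (by omega)
  · rintro s' τ - ⟨-, h2, h3⟩ hτ
    simp only [Ex.ev, hl, Ex.cost] at *
    refine ⟨⟨by simp [h2], fun x hx => h3 x hx (by simpa using hx)⟩, by omega⟩

end VM

namespace Queue

variable {N root h : ℕ} {ch : ℕ → List ℕ} {Q : List ℕ}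

theorem getElem_zero (hQ : Queue N root ch h Q) (h0 : 0 < Q.length) : Q[0] = root := by
  have := hQ.root_eq
  rw [List.head?_eq_getElem?, List.getElem?_eq_getElem h0] at this
  exact Option.some_injective _ this

theorem take_succ (hh : h < Q.length) (l : List ℕ) :
    {t | t ∈ (Q ++ l).take (h + 1)} = insert Q[h] {t | t ∈ Q.take h} := by
  ext t
  rw [List.take_append_of_le_length hh, List.take_succ_eq_append_getElem hh]
  simp only [Set.mem_setOf_eq, Set.mem_insert_iff, List.mem_append, List.mem_singleton, or_comm]

/-- A numbered member of the bag of the next node belongs to the bag of its parent. -/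
theorem exists_parent (hQ : Queue N root ch h Q) {n W : ℕ} {bag : ℕ → List ℕ}
    (hD : Decomp n W N root bag ch) (hh : h < Q.length) {cnt : ℕ} {idx : ℕ → ℕ} {bl : ℕ → List ℕ}
    {col : ℕ → ℕ} (ho : Order n W bag {t | t ∈ Q.take h} cnt idx bl col) :
    cnt = 0 ∨ ∃ p ∈ {t | t ∈ Q.take h}, ∀ v ∈ bag Q[h], idx v ≠ 0 → v ∈ bag p := by
  have mem : ∀ x (hx : x < Q.length), x < h → Q[x] ∈ {t | t ∈ Q.take h} := fun x hx hxh =>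
    List.mem_take_iff_getElem.mpr ⟨x, by omega, rfl⟩
  rcases Nat.eq_zero_or_pos h with rfl | h0
  · left
    by_contra hc
    obtain ⟨v, -, hv⟩ := ho.surj 1 le_rfl (by omega)
    obtain ⟨t, ht, -⟩ := ho.cover v (by omega)
    simp at ht
  · right
    obtain ⟨y, -, hy, hyh, hch⟩ := hQ.parent h h0 hh
    refine ⟨Q[y], mem y hy hyh, fun v hv hv0 => ?_⟩
    obtain ⟨a, ha, hva⟩ := ho.cover v hv0
    -- The nodes treated so far contain the root and the parents of all their other members, so the
    -- running intersection property applies to them.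
    refine hD.running {t | t ∈ Q.take h} ?_ (fun a ha => hQ.lt a (List.mem_of_mem_take ha)) ?_ _
      (mem y hy hyh) _ hch ?_ a ha v hv hva
    · have := mem 0 (by omega) h0
      rwa [hQ.getElem_zero] at this
    · intro a ha har
      obtain ⟨x, hx, rfl⟩ := List.mem_take_iff_getElem.mp ha
      obtain ⟨z, hzx, hz, hzh, hm⟩ := hQ.parent x (by
        rcases Nat.eq_zero_or_pos x with rfl | h
        · exact absurd (hQ.getElem_zero _) har
        · exact h) (by omega)
      exact ⟨_, mem z hz (by omega), hm⟩
    · intro hm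
      obtain ⟨x, hx, he⟩ := List.mem_take_iff_getElem.mp hm
      have := hQ.nodup.getElem_inj_iff.mp he
      omega

end Queue

namespace VM

variable {n W N root : ℕ} {bag ch : ℕ → List ℕ}

/-- The state of the search after `h` nodes. -/
structure Search (n W N root : ℕ) (bag ch : ℕ → List ℕ) (h : ℕ) (Q : List ℕ) (bl : ℕ → List ℕ)
    (s : St) : Prop where
  queue : Queue N root ch h Q
  h_eq : s.r .h = h
  tail : s.r .tail = Q.length
  que : ∀ x (hx : x < Q.length), s.a .que x = Q[x]
  scan : Scan n W bag {t | t ∈ Q.take h} bl s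
  all : ∀ t ∈ Q.take h, ∀ v ∈ bag t, s.a .idx v ≠ 0

theorem wp_processNode {E : Env} {s : St} {m h : ℕ} {ed : ℕ → ℕ × ℕ} {pos : ℕ → ℕ} {Q : List ℕ}
    {bl : ℕ → List ℕ} (hin : Input E.I E.β n m N root ed bag ch pos)
    (hD : Decomp n W N root bag ch) (hptr : ∀ t < N, s.a .ptr t = pos t) (hh : h < N)
    (hs : Search n W N root bag ch h Q bl s) (hH : n + 2 * W + E.β + n * W + N + 50 < E.H) :
    processNode.wp E s fun s' τ => (∃ Q' bl', Search n W N root bag ch (h + 1) Q' bl' s') ∧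
      τ ≤ W * (200 * (W + 1) + 43) + 300 := by
  have hhQ := hs.queue.lt_length hD.toArborescence hh
  have htN := hs.queue.lt _ (List.getElem_mem hhQ)
  -- The node joins `A` before its members are numbered, while all numbered members of its bag still
  -- lie in the bag of the parent.
  have hext := hs.scan.ord.extend (hs.queue.exists_parent hD hhQ hs.scan.ord)
  have hQ' := hs.queue.step hD.toArborescence hhQ
  have hQlen := hQ'.length_le
  have hset := Queue.take_succ hhQ (ch Q[h])
  have hquet := hs.que h hhQ
  obtain ⟨t, ht⟩ : ∃ t, Q[h] = t := ⟨_, rfl⟩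
  rw [ht] at htN hext hQ' hQlen hset hquet
  have hp := hptr t htN
  have hps := hin.pos_succ t htN
  have hple := hin.pos_le (t + 1) htN
  have hbl := hin.bag_length t htN
  have hcl := hin.ch_length t htN
  have hbW := hD.bag_length_le t htN
  have hc2 := hD.ch_length_le t htN
  obtain ⟨p, hpp⟩ : ∃ p, pos t = p := ⟨_, rfl⟩
  rw [hpp] at hp hps hbl hcl
  have hbe := hin.bag_getElem t htN
  have hce := hin.ch_getElem t htN
  rw [hpp] at hbe hce
  simp only [processNode, wp_block_cons, block_singleton]
  simp only [Cmd.wp.eq_2 E, Cmd.wp.eq_3 E, ofNat_eq, add_eq, sub_eq, Ex.ok, Ex.ev, Ex.cost, St.set_r,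
    St.put_r, St.set_a, St.put_a, reduceCtorEq, if_true, if_false, true_and, and_true, hs.h_eq, hquet,
    hp, hbl]
  refine ⟨by omega, by omega, by omega, by omega, ?_⟩
  refine Cmd.wp_mono (Cmd.wp_frame (wp_visitLoop (n := n) (W := W) (bag := bag)
    (A := {t | t ∈ Q.take h}) (t := t) (p := p) (bl := bl) ?_ (hD.bag_nodup t htN) (hD.bag_lt t htN)
    hbW (by simp [St.set_r]) (by simp [St.set_r]) (by simp) (by simpa using hs.all) hbe
    (by omega) (by omega))) ?_
  · have h1 := hs.scan
    have h2 : Scan n W bag (insert t {t | t ∈ Q.take h}) bl s :=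
      ⟨h1.toEnc, hext, h1.col_zero, h1.w, h1.bp_le, h1.used⟩
    refine h2.frame (fun x hx => ?_) fun _ _ => rfl
    simp only [List.mem_cons, List.not_mem_nil, or_false] at hx
    rcases hx with rfl | rfl | rfl <;> simp [St.set_r]
  rintro s₁ τ₁ ⟨⟨⟨⟨bl', h1⟩, h2⟩, hτ₁⟩, hf₁⟩
  have p1 : s₁.r .p = p := by rw [hf₁.r _ (by decide)]; simp [St.set_r]
  have l1 : s₁.r .l = (bag t).length := by rw [hf₁.r _ (by decide)]; simp [St.set_r]
  have t1 : s₁.r .tail = Q.length := by rw [hf₁.r _ (by decide)]; simp [St.set_r, hs.tail]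
  have e1 : s₁.r .h = h := by rw [hf₁.r _ (by decide)]; simp [St.set_r, hs.h_eq]
  have q1 : s₁.a .que = s.a .que := by rw [hf₁.a _ (by decide)]; rfl
  simp only [p1, l1, hcl]
  refine ⟨⟨⟨by omega, by omega⟩, by omega⟩, by omega, by omega, ?_⟩
  refine Cmd.wp_mono (Cmd.wp_frame (wp_enqueueLoop (p := p + 1 + (bag t).length) (N := N) (Q := Q)
    (l := ch t) (by simp [St.set_r]) (by simp [St.set_r]) (by simp) (by simp [St.set_r, t1])
    (by simpa [q1] using hs.que) (by simpa using hQlen) hce (by omega) (by omega))) ?_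
  rintro s₂ τ₂ ⟨⟨⟨g1, g2⟩, hτ₂⟩, hf₂⟩
  have e2 : s₂.r .h = h := by rw [hf₂.r _ (by decide)]; simp [St.set_r, e1]
  have i2 : s₂.a .idx = s₁.a .idx := by rw [hf₂.a _ (by decide)]; rfl
  rw [e2]
  refine ⟨⟨by omega, by omega⟩, ⟨Q ++ ch t, bl', ht ▸ hs.queue.step hD.toArborescence hhQ, by simp,
    by simp [St.set_r, g1], g2, ?_, ?_⟩, ?_⟩
  · rw [hset]
    refine h1.frame (fun x hx => ?_) (fun B hB => ?_)
    · simp only [List.mem_cons, List.not_mem_nil, or_false] at hx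
      rcases hx with rfl | rfl | rfl <;>
        (rw [St.set_r_ne _ _ (by decide), hf₂.r _ (by decide)]; simp [St.set_r])
    · simp only [List.mem_cons, List.not_mem_nil, or_false] at hB
      rcases hB with rfl | rfl | rfl | rfl | rfl | rfl <;>
        (rw [St.set_a, hf₂.a _ (by decide)]; rfl)
  · intro a ha
    have ha : a ∈ {t_1 | t_1 ∈ List.take (h + 1) (Q ++ ch t)} := ha
    rw [hset] at ha
    rw [St.set_a, i2]
    exact h2 a ha
  · clear * - hτ₁ hτ₂ hc2
    have : (ch t).length * 53 ≤ 106 := by omega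
    omega

/-- Number the vertices. -/
def number : Cmd :=
  block [.put .col 0 Reg.W, .put .que 0 (.inp 3), .set .tail 1, .rep Reg.N processNode]

/-- Introducing a vertex takes time `O(W)`, so a node takes `O(W ^ 2)`, without any exponential
factor. -/
theorem wp_number {E : Env} {s : St} {m : ℕ} {ed : ℕ → ℕ × ℕ} {pos : ℕ → ℕ}
    (hin : Input E.I E.β n m N root ed bag ch pos)
    (hD : Decomp n W N root bag ch) (hptr : ∀ t < N, s.a .ptr t = pos t) (hW : s.r .W = W)
    (hN : s.r .N = N) (h0 : ∀ B ∈ [Arr.idx, .used], ∀ i, s.a B i = 0)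
    (hr0 : ∀ x ∈ [Reg.h, .cnt, .bp], s.r x = 0) (hβ : 3 < E.β)
    (hH : n + 2 * W + E.β + n * W + N + 50 < E.H) :
    number.wp E s fun s' τ => ((∃ bl, Scan n W bag {t | t < N} bl s') ∧
      ∀ t < N, ∀ v ∈ bag t, s'.a .idx v ≠ 0) ∧ τ ≤ 100 + N * (W * (200 * (W + 1) + 43) + 300 + 3) := by
  simp only [List.mem_cons, List.not_mem_nil, or_false, forall_eq_or_imp, forall_eq] at h0 hr0
  obtain ⟨h01, h02⟩ := h0
  obtain ⟨r1, r2, r3⟩ := hr0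
  simp only [number, wp_block_cons, block_singleton]
  simp only [Cmd.wp.eq_2 E, Cmd.wp.eq_3 E, ofNat_eq, add_eq, sub_eq, Ex.ok, Ex.ev, Ex.cost, St.set_r,
    St.put_r, St.set_a, St.put_a, reduceCtorEq, if_true, if_false, true_and, and_true, hW, hin.root_eq]
  refine ⟨by omega, by omega, by omega, ⟨by omega, hβ⟩, by omega, by omega, ?_⟩
  refine wp_rep (e := Reg.N) (fun h s' => ∃ Q bl, Search n W N root bag ch h Q bl s')
    (W * (200 * (W + 1) + 43) + 300) trivial ?_ ?_ ?_
  · refine ⟨[root], fun _ => [], Queue.init hD.root_lt, ?_, ?_, ?_, ?_, by simp⟩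
    · simp [St.set_r, r1]
    · simp [St.set_r]
    · intro x hx
      have hx : x = 0 := by simpa using hx
      simp [hx, St.put_a]
    · have i0 : s.a .idx = fun _ => 0 := funext h01
      refine ⟨⟨?_, ?_⟩, ?_, ?_, ?_, ?_, ?_⟩
      · intro i hi hi'; simp [St.set_r, r2] at hi'; omega
      · intro i hi hi'; simp [St.set_r, r2] at hi'; omega
      · simp only [St.set_r, St.set_a, St.put_r, St.put_a, reduceCtorEq, if_false, r2, i0]
        simpa using Order.empty
      · simp [St.put_a]
      · simp [St.set_r, hW]
      · simp [St.set_r, r3]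
      · simp [St.put_a, h02]
  · rintro h s' hh hf ⟨Q, bl, hs'⟩
    have hh : h < N := by simpa [Ex.ev, St.set_r, hN] using hh
    refine wp_processNode hin hD (fun t ht => ?_) hh hs' hH
    rw [hf.a _ (by decide)]
    simpa [St.put_a] using hptr t ht
  · rintro s' τ - ⟨Q, bl, hs'⟩ hτ
    simp only [Ex.ev, Ex.cost, St.set_r, St.put_r, reduceCtorEq, if_false, hN] at hs' hτ
    have hset : {t | t ∈ Q.take N} = {t | t < N} := by
      ext t
      rw [List.take_of_length_le hs'.queue.length_le]
      exact ⟨hs'.queue.lt t, hs'.queue.mem_of_lt hD.toArborescence⟩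
    refine ⟨⟨⟨bl, hset ▸ hs'.scan⟩, fun t ht => hs'.all t ?_⟩, by omega⟩
    have : t ∈ {t | t < N} := ht
    rwa [← hset] at this

end VM

/-! ### Reading the instance and preparing the arrays -/

namespace VM

variable {n W N root : ℕ} {bag ch : ℕ → List ℕ}

/-- Find the description of a node. -/
def scanNode : Cmd :=
  block [.put .ptr Reg.t Reg.p, .set .l (.inp Reg.p), .set .W (Reg.W + (Reg.l - Reg.W)),
    .set .p (Reg.p + 1 + Reg.l), .set .p (Reg.p + 1 + .inp Reg.p), .set .t (Reg.t + 1)]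

/-- Find the descriptions of the nodes, and the largest size of a bag. -/
def scanNodes : Cmd :=
  block [.set .n (.inp 0), .set .m (.inp 1), .set .N (.inp 2), .set .p (Reg.m + Reg.m + 5),
    .set .t 0, .rep Reg.N scanNode]

/-- Descriptions of nodes differ in length, so their positions have to be recorded in a first pass.
On the way the largest size of a bag is found, again with the maximum as a sum with a truncated
difference. -/
theorem wp_scanNodes {E : Env} {s : St} {m : ℕ} {ed : ℕ → ℕ × ℕ} {pos : ℕ → ℕ}
    (hin : Input E.I E.β n m N root ed bag ch pos) (hW0 : s.r .W = 0) (hβ : 5 < E.β)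
    (hle : ∀ t < N, (bag t).length ≤ W) (hW : W = 0 ∨ ∃ t < N, (bag t).length = W)
    (hH : 2 * E.β + 2 * W + N + 10 < E.H) :
    scanNodes.wp E s fun s' τ => (s'.r .n = n ∧ s'.r .m = m ∧ s'.r .N = N ∧ s'.r .W = W ∧
      ∀ t < N, s'.a .ptr t = pos t) ∧ τ ≤ 100 + N * 103 := by
  have hm : 2 * m ≤ E.β := by have := hin.pos_le 0 (by omega); rw [hin.pos_zero] at this; omega
  simp only [scanNodes, wp_block_cons, block_singleton]
  simp only [Cmd.wp.eq_2 E, Cmd.wp.eq_3 E, ofNat_eq, add_eq, sub_eq, Ex.ok, Ex.ev, Ex.cost, St.set_r,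
    St.put_r, St.set_a, St.put_a, reduceCtorEq, if_true, if_false, true_and, and_true, hin.n_eq,
    hin.m_eq, hin.N_eq]
  refine ⟨⟨by omega, by omega⟩, ⟨by omega, by omega⟩, ⟨by omega, by omega⟩,
    ⟨by omega, by omega, by omega⟩, by omega, ?_⟩
  refine wp_rep (e := Reg.N) (fun t s' => s'.r .t = t ∧ s'.r .p = pos t ∧ s'.r .W ≤ W ∧
    ∀ a < t, (bag a).length ≤ s'.r .W ∧ s'.a .ptr a = pos a) 100 trivial ?_ ?_ ?_
  · refine ⟨by simp [St.set_r], ?_, by simp [St.set_r, hW0], by simp⟩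
    simp [St.set_r, hin.pos_zero]
    omega
  · rintro t s' ht hf ⟨h1, h2, h3, h4⟩
    have ht : t < N := by simpa [Ex.ev, St.set_r] using ht
    have e1 := hin.pos_succ t ht
    have e2 := hin.pos_le (t + 1) ht
    have e3 := hle t ht
    simp only [scanNode, block, Cmd.wp, ofNat_eq, add_eq, sub_eq, Ex.ok, Ex.ev, Ex.cost, St.set_r,
      St.put_r, St.set_a, St.put_a, reduceCtorEq, if_true, if_false, h1, h2, hin.bag_length t ht,
      hin.ch_length t ht, true_and, and_true]
    refine ⟨by omega, by omega, by omega, ⟨by omega, by omega⟩,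
      ⟨⟨by omega, by omega⟩, by omega, by omega⟩, by omega, ⟨by omega, by omega, ?_⟩, by norm_num⟩
    intro a ha
    by_cases h : a = t
    · subst h
      simp only [Function.update_self]
      exact ⟨by omega, trivial⟩
    · rw [Function.update_of_ne h]
      have := h4 a (by omega)
      omega
  · rintro s' τ hf ⟨-, -, h3, h4⟩ hτ
    have hN' : (Ex.reg Reg.N).ev E (((((s.set .n n).set .m m).set .N N).set .p (m + m + 5)).set .t 0)
      = N := by simp [Ex.ev, St.set_r]
    rw [hN'] at h4 hτ
    refine ⟨⟨?_, ?_, ?_, ?_, fun t ht => (h4 t ht).2⟩, ?_⟩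
    · rw [hf.r _ (by decide)]; simp [St.set_r]
    · rw [hf.r _ (by decide)]; simp [St.set_r]
    · rw [hf.r _ (by decide)]; simp [St.set_r]
    · rcases hW with rfl | ⟨t, ht, h⟩
      · omega
      · have := (h4 t ht).1
        omega
    · simp only [Ex.cost] at hτ
      omega

/-- The starts of the rows of the adjacency matrix. -/
def rows : Cmd :=
  block [.set .i 0, .set .x 0, .rep (Reg.n + 1) (block [.put .row Reg.i Reg.x,
    .set .x (Reg.x + Reg.n + 1), .set .i (Reg.i + 1)])]

theorem wp_rows {E : Env} {s : St} (hn : s.r .n = n) (hH : (n + 1) * (n + 1) + n + 10 < E.H) :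
    rows.wp E s fun s' τ => (∀ i ≤ n, s'.a .row i = i * (n + 1)) ∧ τ ≤ 20 + (n + 1) * 53 := by
  have h1 : n < E.H := by nlinarith
  simp only [rows, wp_block_cons, block_singleton]
  simp only [Cmd.wp.eq_2 E, ofNat_eq, add_eq, sub_eq, Ex.ok, Ex.ev, Ex.cost]
  refine ⟨by omega, by omega, ?_⟩
  refine wp_rep (e := (Reg.n : Ex).add (.lit 1)) (fun i s' => s'.r .i = i ∧ s'.r .x = i * (n + 1) ∧
    ∀ j < i, s'.a .row j = j * (n + 1)) 50 ?_ ?_ ?_ ?_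
  · simp only [Ex.ok, Ex.ev, St.set_r, reduceCtorEq, if_false, hn, true_and]
    omega
  · simp [St.set_r]
  · rintro i s' hi hf ⟨h1, h2, h3⟩
    have hi : i < n + 1 := by simpa [Ex.ev, St.set_r, hn] using hi
    have hn' : s'.r .n = n := by rw [hf.r _ (by decide)]; simp [St.set_r, hn]
    have e1 : (i + 1) * (n + 1) ≤ (n + 1) * (n + 1) := Nat.mul_le_mul_right _ hi
    have e2 : (i + 1) * (n + 1) = i * (n + 1) + n + 1 := by ring
    simp only [wp_block_cons, block_singleton, Cmd.wp, ofNat_eq, add_eq, sub_eq, Ex.ok, Ex.ev,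
      Ex.cost, St.set_r, St.put_r, St.set_a, St.put_a, reduceCtorEq, if_true, if_false, h1, h2, hn',
      true_and, and_true]
    refine ⟨by omega, ⟨by omega, by omega, by omega⟩, ⟨by omega, by omega⟩,
      ⟨e2.symm, fun j hj => ?_⟩, by norm_num⟩
    by_cases h : j = i
    · subst h; simp
    · rw [Function.update_of_ne h]; exact h3 j (by omega)
  · rintro s' τ - ⟨-, -, h3⟩ hτ
    simp only [Ex.ev, Ex.cost, St.set_r, reduceCtorEq, if_false, hn] at h3 hτ
    exact ⟨fun i hi => h3 i (by omega), by omega⟩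

/-- The adjacency matrix. -/
def edges : Cmd :=
  block [.set .p 5, .rep Reg.m (block [.set .u (.arr .idx (.inp Reg.p)),
    .set .v (.arr .idx (.inp (Reg.p + 1))), .put .adj (.arr .row Reg.u + Reg.v) 1,
    .put .adj (.arr .row Reg.v + Reg.u) 1, .set .p (Reg.p + 2)])]

theorem row_inj {i j i' j' : ℕ} (hj : j ≤ n) (hj' : j' ≤ n)
    (h : i * (n + 1) + j = i' * (n + 1) + j') : i = i' ∧ j = j' := by
  have h1 := congrArg (· / (n + 1)) h
  have h2 := congrArg (· % (n + 1)) h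
  simp only [Nat.mul_add_mod_self_right] at h2
  rw [Nat.mod_eq_of_lt (by omega), Nat.mod_eq_of_lt (by omega)] at h2
  subst h2
  exact ⟨Nat.eq_of_mul_eq_mul_right (by omega) (Nat.add_right_cancel h), rfl⟩

/-- The matrix occupies quadratically many cells, but only those belonging to edges are touched: the
others are zero from the beginning. Hence the time is linear in the number of edges. -/
theorem wp_edges {E : Env} {s : St} {m : ℕ} {ed : ℕ → ℕ × ℕ} {pos : ℕ → ℕ}
    (hin : Input E.I E.β n m N root ed bag ch pos) (hm : s.r .m = m)
    (hrow : ∀ i ≤ n, s.a .row i = i * (n + 1)) (hidx : ∀ v, s.a .idx v ≤ n)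
    (hed : ∀ e < m, (ed e).1 < n ∧ (ed e).2 < n) (h0 : ∀ x, s.a .adj x = 0)
    (hH : (n + 1) * (n + 1) + E.β + n + 20 < E.H) :
    edges.wp E s fun s' τ => (∀ i ≤ n, ∀ j ≤ n, 0 < s'.a .adj (s.a .row i + j) ↔ ∃ e < m,
      (s.a .idx (ed e).1 = i ∧ s.a .idx (ed e).2 = j) ∨
      (s.a .idx (ed e).2 = i ∧ s.a .idx (ed e).1 = j)) ∧ τ ≤ 20 + m * 103 := by
  have hmβ : 5 + 2 * m ≤ E.β := by have := hin.pos_le 0 (by omega); rwa [hin.pos_zero] at this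
  have hsq : n < (n + 1) * (n + 1) := by nlinarith
  have hrle : ∀ i ≤ n, ∀ j ≤ n, i * (n + 1) + j < (n + 1) * (n + 1) := fun i hi j hj => by
    have : (i + 1) * (n + 1) ≤ (n + 1) * (n + 1) := Nat.mul_le_mul_right _ (by omega)
    rw [add_mul, one_mul] at this
    omega
  simp only [edges, wp_block_cons, block_singleton]
  simp only [Cmd.wp.eq_2 E, ofNat_eq, add_eq, sub_eq, Ex.ok, Ex.ev, Ex.cost]
  refine ⟨by omega, ?_⟩
  refine wp_rep (e := Reg.m) (fun k s' => s'.r .p = 5 + 2 * k ∧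
    ∀ i ≤ n, ∀ j ≤ n, 0 < s'.a .adj (i * (n + 1) + j) ↔ ∃ e < k,
      (s.a .idx (ed e).1 = i ∧ s.a .idx (ed e).2 = j) ∨
      (s.a .idx (ed e).2 = i ∧ s.a .idx (ed e).1 = j)) 100 trivial ?_ ?_ ?_
  · simp [h0]
  · rintro k s' hk hf ⟨h1, h2⟩
    have hk : k < m := by simpa [Ex.ev, St.set_r, hm] using hk
    have i' : s'.a .idx = s.a .idx := by rw [hf.a _ (by decide)]; rfl
    have r' : s'.a .row = s.a .row := by rw [hf.a _ (by decide)]; rfl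
    obtain ⟨b1, b2⟩ := hed k hk
    have u1 := hidx (ed k).1
    have v1 := hidx (ed k).2
    obtain ⟨u, hu⟩ : ∃ u, s.a .idx (ed k).1 = u := ⟨_, rfl⟩
    obtain ⟨v, hv⟩ : ∃ v, s.a .idx (ed k).2 = v := ⟨_, rfl⟩
    rw [hu] at u1
    rw [hv] at v1
    have l1 := hrle u u1 v v1
    have l2 := hrle v v1 u u1
    simp only [wp_block_cons, block_singleton, Cmd.wp, ofNat_eq, add_eq, sub_eq, Ex.ok, Ex.ev,
      Ex.cost, St.set_r, St.put_r, St.set_a, St.put_a, reduceCtorEq, if_true, if_false, h1,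
      hin.ed_fst k hk, hin.ed_snd k hk, i', r', hu, hv, hrow u u1, hrow v v1, true_and, and_true]
    refine ⟨⟨by omega, by omega⟩, ⟨⟨⟨by omega, by omega⟩, by omega⟩, by omega⟩,
      ⟨by omega, by omega⟩, by omega, by omega, ⟨by omega, by omega⟩, by omega, by omega,
      ⟨by omega, by omega⟩, ⟨by omega, fun i hi j hj => ?_⟩, by norm_num⟩
    have e1 : ∀ a ≤ n, ∀ b ≤ n, i * (n + 1) + j = a * (n + 1) + b ↔ a = i ∧ b = j :=
      fun a _ b hb => ⟨fun h => by have := row_inj hj hb h; tauto, by rintro ⟨rfl, rfl⟩; rfl⟩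
    rw [Function.update_apply, Function.update_apply, Nat.exists_lt_succ_right, ← h2 i hi j hj, hu, hv,
      ← e1 u u1 v v1, ← e1 v v1 u u1]
    split_ifs <;> tauto
  · rintro s' τ - ⟨-, h2⟩ hτ
    simp only [Ex.ev, Ex.cost, St.set_r, reduceCtorEq, if_false, hm] at h2 hτ
    exact ⟨fun i hi j hj => by rw [hrow i hi]; exact h2 i hi j hj, by omega⟩

/-- The powers of `9`. -/
def powers : Cmd :=
  block [.put .pow 0 1, .set .i 0, .rep Reg.W (block [.set .x (.arr .pow Reg.i),
    .set .y (Reg.x + Reg.x), .set .y (Reg.y + Reg.y), .set .y (Reg.y + Reg.y),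
    .set .i (Reg.i + 1), .put .pow Reg.i (Reg.y + Reg.x)]), .set .M (.arr .pow Reg.W)]

/-- Three doublings and one addition multiply by nine. -/
theorem wp_powers {E : Env} {s : St} (hW : s.r .W = W) (hH : 9 ^ W + 10 < E.H) :
    powers.wp E s fun s' τ => (s'.r .M = 9 ^ W ∧ ∀ p ≤ W, s'.a .pow p = 9 ^ p) ∧
      τ ≤ 50 + W * 103 := by
  have hWp : W < 9 ^ W := Nat.lt_pow_self (by norm_num)
  simp only [powers, wp_block_cons, block_singleton]
  simp only [Cmd.wp.eq_2 E, Cmd.wp.eq_3 E, ofNat_eq, add_eq, sub_eq, Ex.ok, Ex.ev, Ex.cost]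
  refine ⟨by omega, by omega, by omega, by omega, ?_⟩
  refine wp_rep (e := Reg.W) (fun i s' => s'.r .i = i ∧ ∀ j ≤ i, s'.a .pow j = 9 ^ j) 100 trivial
    ?_ ?_ ?_
  · simp [St.put_a]
  · rintro i s' hi hf ⟨h1, h2⟩
    have hi : i < W := by simpa [Ex.ev, St.set_r, hW] using hi
    have e1 : 9 ^ (i + 1) ≤ 9 ^ W := Nat.pow_le_pow_right (by norm_num) hi
    rw [pow_succ] at e1
    simp only [wp_block_cons, block_singleton, Cmd.wp, ofNat_eq, add_eq, sub_eq, Ex.ok, Ex.ev,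
      Ex.cost, St.set_r, St.put_r, St.set_a, St.put_a, reduceCtorEq, if_true, if_false, h1,
      h2 i le_rfl, true_and, and_true]
    refine ⟨by omega, by omega, by omega, by omega, ⟨by omega, by omega⟩, by omega, by omega,
      fun j hj => ?_, by norm_num⟩
    by_cases h : j = i + 1
    · subst h
      rw [Function.update_self, pow_succ]
      omega
    · rw [Function.update_of_ne h]; exact h2 j (by omega)
  · rintro s' τ hf ⟨-, h2⟩ hτ
    have hW' : s'.r .W = W := by rw [hf.r _ (by decide)]; simp [St.set_r, hW]
    simp only [Ex.ev, Ex.cost, St.set_r, St.put_r, reduceCtorEq, if_false, hW] at h2 hτ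
    simp only [Ex.ok, Ex.ev, hW', St.set_r, St.set_a, if_true, true_and, h2 W le_rfl]
    exact ⟨by omega, h2, by omega⟩

/-- Write a list into an array, from the cell `i` on. -/
def putList (B : Arr) : List ℕ → ℕ → Cmd
  | [], _ => .skip
  | x :: l, i => .seq (.put B (.lit i) (.lit x)) (putList B l (i + 1))

theorem wp_putList {E : Env} {B : Arr} {l : List ℕ} (hl : ∀ x ∈ l, x < E.H) :
    ∀ {i : ℕ} {s : St}, i + l.length < E.H → (putList B l i).wp E s fun s' τ =>
      (∀ x (h : x < l.length), s'.a B (i + x) = l[x]) ∧ (∀ x < i, s'.a B x = s.a B x) ∧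
        s'.r = s.r ∧ (∀ C, C ≠ B → s'.a C = s.a C) ∧ τ = 1 + l.length * 11 := by
  induction l with
  | nil => intro i s _; exact ⟨by simp, by simp, rfl, fun _ _ => rfl, rfl⟩
  | cons x l ih =>
    intro i s hi
    simp only [List.length_cons] at hi
    refine ⟨?_, hl x (by simp), ?_, ?_⟩
    · show i < E.H; omega
    · show i < E.H; omega
    refine Cmd.wp_mono (ih (fun y hy => hl y (by simp [hy])) (i := i + 1) (by omega)) ?_
    rintro s' τ ⟨h1, h2, h3, h4, h5⟩
    refine ⟨fun y hy => ?_, fun y hy => ?_, h3, fun C hC => ?_, ?_⟩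
    · rcases y with - | y
      · rw [h2 _ (by omega)]; simp [Ex.ev]
      · rw [show i + (y + 1) = i + 1 + y by ring, h1 y (by simpa using hy)]; rfl
    · rw [h2 _ (by omega), St.put_a_self, Function.update_of_ne]
      simp only [Ex.ev]; omega
    · rw [h4 C hC, St.put_a_ne _ _ _ hC]
    · simp only [Ex.cost, h5, List.length_cons]; ring

end VM

namespace VM

variable {n W N root : ℕ} {bag ch : ℕ → List ℕ}

/-- The relation between the labels. -/
def relations : Cmd :=
  block [putList .ra ((opList ++ finalList).map (·.1)) 0,
    putList .rb ((opList ++ finalList).map (·.2.1)) 0,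
    putList .rc ((opList ++ finalList).map (·.2.2)) 0]

theorem wp_relations {E : Env} {s : St} (hH : 100 < E.H) :
    relations.wp E s fun s' τ => (
      (∀ k < 52, s'.a .ra k = ((opList ++ finalList).getD k (0, 0, 0)).1) ∧
      (∀ k < 52, s'.a .rb k = ((opList ++ finalList).getD k (0, 0, 0)).2.1) ∧
      (∀ k < 52, s'.a .rc k = ((opList ++ finalList).getD k (0, 0, 0)).2.2) ∧
      s'.r = s.r ∧ ∀ B, B ≠ .ra → B ≠ .rb → B ≠ .rc → s'.a B = s.a B) ∧ τ ≤ 2000 := by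
  have hlen : (opList ++ finalList).length = 52 := by decide
  have hlt : ∀ t ∈ opList ++ finalList, t.1 < 100 ∧ t.2.1 < 100 ∧ t.2.2 < 100 := by decide
  obtain ⟨l, hl⟩ : ∃ l, opList ++ finalList = l := ⟨_, rfl⟩
  simp only [relations, wp_block_cons, block_singleton]
  rw [hl] at hlen hlt ⊢
  have hget : ∀ {f : ℕ × ℕ × ℕ → ℕ} {g : ℕ → ℕ},
      (∀ x (h : x < (l.map f).length), g (0 + x) = (l.map f)[x]) →
      ∀ k < 52, g k = f (l.getD k (0, 0, 0)) := by
    intro f g h k hk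
    have := h k (by simpa [hlen] using hk)
    rw [zero_add] at this
    rw [this, List.getElem_map, List.getD_eq_getElem _ _ (by omega)]
  refine Cmd.wp_mono (wp_putList (B := .ra) (l := l.map (·.1)) ?_ (i := 0) ?_) ?_
  · intro x hx
    obtain ⟨t, ht, rfl⟩ := List.mem_map.mp hx
    have := hlt t ht
    omega
  · rw [List.length_map]; omega
  rintro s₁ τ₁ ⟨a1, -, a2, a3, a4⟩
  refine Cmd.wp_mono (wp_putList (B := .rb) (l := l.map (·.2.1)) ?_ (i := 0) ?_) ?_
  · intro x hx
    obtain ⟨t, ht, rfl⟩ := List.mem_map.mp hx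
    have := hlt t ht
    omega
  · rw [List.length_map]; omega
  rintro s₂ τ₂ ⟨b1, -, b2, b3, b4⟩
  refine Cmd.wp_mono (wp_putList (B := .rc) (l := l.map (·.2.2)) ?_ (i := 0) ?_) ?_
  · intro x hx
    obtain ⟨t, ht, rfl⟩ := List.mem_map.mp hx
    have := hlt t ht
    omega
  · rw [List.length_map]; omega
  rintro s₃ τ₃ ⟨c1, -, c2, c3, c4⟩
  refine ⟨⟨?_, ?_, hget c1, by rw [c2, b2, a2], fun B h1 h2 h3 => by rw [c3 B h3, b3 B h2, a3 B h1]⟩, ?_⟩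
  · rw [c3 _ (by decide), b3 _ (by decide)]
    exact hget a1
  · rw [c3 _ (by decide)]
    exact hget b1
  · rw [List.length_map, hlen] at a4 b4 c4
    omega

/-- The whole algorithm. -/
def main : Cmd := block [scanNodes, number, rows, edges, powers, relations, solve]

/-- A bound for the running time of `main`. -/
def mainTime (n m N W : ℕ) : ℕ :=
  2290 + N * 103 + N * (W * (200 * (W + 1) + 43) + 300 + 3) + (n + 1) * 53 + m * 103 + W * 103 +
    (n + 1) * (bucketTime W + 200)

/-- Since every vertex lies in a bag, the numbering `idx` reaches all vertices and identifies the
input graph with the graph of the elimination order `O`; the optimum is stated for the latter. -/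
theorem wp_main {E : Env} {m : ℕ} {ed : ℕ → ℕ × ℕ} {pos : ℕ → ℕ}
    (hin : Input E.I E.β n m N root ed bag ch pos) (hD : Decomp n W N root bag ch)
    (hW : W = 0 ∨ ∃ t < N, (bag t).length = W) (hcov : ∀ v < n, ∃ t < N, v ∈ bag t)
    (hed : ∀ e < m, (ed e).1 ≠ (ed e).2 ∧ ∃ t < N, (ed e).1 ∈ bag t ∧ (ed e).2 ∈ bag t)
    (hβ : 5 < E.β)
    (hH : 2 * E.β + 26 ^ W + (n + 1) * 9 ^ W + n * bucketSpace W + n * W + (n + 1) * (n + 1) + 2 * n +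
      2 * W + N + 200 < E.H) :
    main.wp E ⟨fun _ => 0, fun _ _ => 0⟩ fun s' τ => (∃ (idx : ℕ → ℕ) (O : ElimOrder), O.n = n ∧
      (∀ v < n, 1 ≤ idx v ∧ idx v ≤ n) ∧ (∀ u < n, ∀ v < n, idx u = idx v → u = v) ∧
      (∀ i j, O.adj i j ↔ ∃ e < m, (idx (ed e).1 = i ∧ idx (ed e).2 = j) ∨
        (idx (ed e).2 = i ∧ idx (ed e).1 = j)) ∧
      (∃ S ⊆ Finset.Icc 1 n, O.Hits S ∧ S.card = s'.r .opt) ∧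
      (∀ S, O.Hits S → s'.r .opt ≤ S.card) ∧
      s'.r .out = if s'.r .opt ≤ E.I 4 then 1 else 0) ∧ τ ≤ mainTime n m N W := by
  have h9 : 0 < 9 ^ W := by positivity
  have h9' : 9 ^ W ≤ (n + 1) * 9 ^ W := Nat.le_mul_of_pos_left _ (by omega)
  have h26 : 0 < 26 ^ W := by positivity
  simp only [main, wp_block_cons, block_singleton]
  refine Cmd.wp_mono (Cmd.wp_frame (wp_scanNodes (W := W) hin rfl hβ hD.bag_length_le hW (by omega))) ?_
  rintro s₁ τ₁ ⟨⟨⟨n1, m1, N1, W1, ptr1⟩, hτ₁⟩, hf₁⟩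
  refine Cmd.wp_mono (Cmd.wp_frame (wp_number hin hD ptr1 W1 N1 ?_ ?_ (by omega) (by omega))) ?_
  · intro B hB i
    simp only [List.mem_cons, List.not_mem_nil, or_false] at hB
    rcases hB with rfl | rfl <;> rw [hf₁.a _ (by decide)]
  · intro x hx
    simp only [List.mem_cons, List.not_mem_nil, or_false] at hx
    rcases hx with rfl | rfl | rfl <;> rw [hf₁.r _ (by decide)]
  rintro s₂ τ₂ ⟨⟨⟨⟨bl, hs⟩, hall⟩, hτ₂⟩, hf₂⟩
  have n2 : s₂.r .n = n := (hf₂.r _ (by decide)).trans n1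
  have m2 : s₂.r .m = m := (hf₂.r _ (by decide)).trans m1
  have adj2 : s₂.a .adj = fun _ => 0 := (hf₂.a _ (by decide)).trans (hf₁.a _ (by decide))
  have tab2 : s₂.a .tab = fun _ => 0 := (hf₂.a _ (by decide)).trans (hf₁.a _ (by decide))
  have hidx0 : ∀ v < n, s₂.a .idx v ≠ 0 := fun v hv => by
    obtain ⟨t, ht, hvt⟩ := hcov v hv
    exact hall t ht v hvt
  have hcnt := hs.ord.cnt_eq hidx0
  have hord := hs.ord
  have hbpW := hs.bp_le
  rw [hcnt] at hord hbpW
  refine Cmd.wp_mono (Cmd.wp_frame (wp_rows (n := n) n2 (by omega))) ?_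
  rintro s₃ τ₃ ⟨⟨row3, hτ₃⟩, hf₃⟩
  have idx3 : s₃.a .idx = s₂.a .idx := hf₃.a _ (by decide)
  have m3 : s₃.r .m = m := (hf₃.r _ (by decide)).trans m2
  have adj3 : s₃.a .adj = fun _ => 0 := (hf₃.a _ (by decide)).trans adj2
  have hedn : ∀ e < m, (ed e).1 < n ∧ (ed e).2 < n := fun e he => by
    obtain ⟨-, t, ht, h1, h2⟩ := hed e he
    exact ⟨hD.bag_lt t ht _ h1, hD.bag_lt t ht _ h2⟩
  refine Cmd.wp_mono (Cmd.wp_frame (wp_edges hin m3 row3 (by rw [idx3]; exact hord.le) hedn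
    (by simp [adj3]) (by omega))) ?_
  rintro s₄ τ₄ ⟨⟨adj4, hτ₄⟩, hf₄⟩
  have W4 : s₄.r .W = W := (hf₄.r _ (by decide)).trans ((hf₃.r _ (by decide)).trans hs.w)
  refine Cmd.wp_mono (Cmd.wp_frame (wp_powers W4 (by omega))) ?_
  rintro s₅ τ₅ ⟨⟨⟨M5, pow5⟩, hτ₅⟩, hf₅⟩
  refine Cmd.wp_mono (wp_relations (by omega)) ?_
  rintro s₆ τ₆ ⟨⟨ra6, rb6, rc6, r6, a6⟩, hτ₆⟩
  have ar : ∀ B, B ∉ [Arr.ra, .rb, .rc, .pow, .adj, .row] → s₆.a B = s₂.a B := by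
    intro B hB
    simp only [List.mem_cons, List.not_mem_nil, or_false, not_or] at hB
    obtain ⟨h1, h2, h3, h4, h5, h6⟩ := hB
    rw [a6 B h1 h2 h3, hf₅.a B, hf₄.a B, hf₃.a B]
    · simp [rows, block, Cmd.wa, h6]
    · simp [edges, block, Cmd.wa, h5]
    · simp [powers, block, Cmd.wa, h4]
  have row6 : s₆.a .row = s₃.a .row := by
    rw [a6 _ (by decide) (by decide) (by decide), hf₅.a _ (by decide), hf₄.a _ (by decide)]
  have adj6 : s₆.a .adj = s₄.a .adj := by
    rw [a6 _ (by decide) (by decide) (by decide), hf₅.a _ (by decide)]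
  have n6 : s₆.r .n = n := by
    rw [r6, hf₅.r _ (by decide), hf₄.r _ (by decide), hf₃.r _ (by decide), n2]
  obtain ⟨idx, hidx⟩ : ∃ f, s₂.a .idx = f := ⟨_, rfl⟩
  rw [hidx] at hidx0 hord idx3
  rw [idx3] at adj4
  let adj : ℕ → ℕ → Prop := fun u v => ∃ e < m, ((ed e).1 = u ∧ (ed e).2 = v) ∨
    ((ed e).2 = u ∧ (ed e).1 = v)
  have hsymm : ∀ u v, adj u v → adj v u := fun u v ⟨e, he, h⟩ => ⟨e, he, by tauto⟩
  have hne : ∀ u v, adj u v → u ≠ v := by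
    rintro u v ⟨e, he, ⟨rfl, rfl⟩ | ⟨rfl, rfl⟩⟩
    exacts [(hed e he).1, (hed e he).1.symm]
  have hadj : ∀ u v, adj u v → ∃ t ∈ {t | t < N}, u ∈ bag t ∧ v ∈ bag t := by
    rintro u v ⟨e, he, h⟩
    obtain ⟨-, t, ht, h1, h2⟩ := hed e he
    rcases h with ⟨rfl, rfl⟩ | ⟨rfl, rfl⟩
    exacts [⟨t, ht, h1, h2⟩, ⟨t, ht, h2, h1⟩]
  have hidx' : ∀ u v, adj u v → idx u ≠ 0 := by
    rintro u v ⟨e, he, ⟨rfl, rfl⟩ | ⟨rfl, rfl⟩⟩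
    exacts [hidx0 _ (hedn e he).1, hidx0 _ (hedn e he).2]
  have hOadj : ∀ i j, (hord.elimOrder adj hsymm hne hadj hidx').adj i j ↔
      ∃ e < m, (idx (ed e).1 = i ∧ idx (ed e).2 = j) ∨ (idx (ed e).2 = i ∧ idx (ed e).1 = j) := by
    intro i j
    constructor
    · rintro ⟨u, v, ⟨e, he, ⟨rfl, rfl⟩ | ⟨rfl, rfl⟩⟩, rfl, rfl⟩
      exacts [⟨e, he, .inl ⟨rfl, rfl⟩⟩, ⟨e, he, .inr ⟨rfl, rfl⟩⟩]
    · rintro ⟨e, he, ⟨rfl, rfl⟩ | ⟨rfl, rfl⟩⟩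
      exacts [⟨_, _, ⟨e, he, .inl ⟨rfl, rfl⟩⟩, rfl, rfl⟩, ⟨_, _, ⟨e, he, .inr ⟨rfl, rfl⟩⟩, rfl, rfl⟩]
  have hinst : Inst E (hord.colouring adj hsymm hne hadj hidx') s₆ := by
    refine ⟨⟨?_, ?_, ?_, ra6, rb6, rc6⟩, n6, ?_, ?_, ?_, ?_, ?_, ?_⟩
    · rw [r6, hf₅.r _ (by decide), W4]
    · rw [r6, M5]
    · rw [a6 _ (by decide) (by decide) (by decide)]; exact pow5
    · intro i _ _
      rw [ar _ (by decide)]; rfl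
    · intro i h1 h2
      rw [ar _ (by decide), ar _ (by decide)]
      exact (hs.ben i h1 (h2.trans hcnt.ge)).1
    · intro i h1 h2
      rw [ar _ (by decide)]
      have := (hs.ben i h1 (h2.trans hcnt.ge)).2
      omega
    · intro i h1 h2 x hx
      rw [ar _ (by decide), ar _ (by decide)]
      exact hs.bls i h1 (h2.trans hcnt.ge) x hx
    · intro i j _ hi _ hj
      rw [row6, adj6, ← hf₄.a _ (by decide), hOadj]
      have := adj4 i hi j hj
      rwa [← hf₄.a .row (by decide)] at this
    · intro i j _ hi _ hj
      have hi : i ≤ n := hi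
      have hj : j ≤ n := hj
      rw [row6, row3 i hi]
      have : (i + 1) * (n + 1) ≤ (n + 1) * (n + 1) := Nat.mul_le_mul_right _ (by omega)
      rw [add_mul, one_mul] at this
      omega
  refine Cmd.wp_mono (wp_solve hinst (by rw [ar _ (by decide), tab2]; simp) (by omega) ?_) ?_
  · show 26 ^ W + 200 + (n + 1) * 9 ^ W + n * bucketSpace W + 2 * n < E.H
    omega
  · rintro s₇ τ₇ ⟨⟨h1, h2, h3⟩, hτ₇⟩
    refine ⟨⟨idx, _, rfl, fun v hv => ⟨Nat.pos_of_ne_zero (hidx0 v hv), hord.le v⟩,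
      fun u hu v _ h => hord.inj u v (hidx0 u hu) h, hOadj, h1, h2, h3⟩, ?_⟩
    have hτ₇ : τ₇ ≤ (n + 1) * (bucketTime W + 200) := hτ₇
    rw [mainTime]
    omega

end VM

/-! ### The program of the random access machine -/

namespace RAM

/-- Write an upper bound on the length of the input into register `1`. -/
def measure : Program :=
  .seq (.seq (.seq (.seq (.const 3 2) (.load 3 3)) (.seq (.const 5 0) (.load 5 5)))
    (.seq (.seq (.const 7 4) (.add 5 5 7)) (.seq (.const 1 5) (.const 7 1))))
    (.seq (.seq (.load 9 7) (.seq (.add 1 1 9) (.add 1 1 9)))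
      (.whilePos 3 (.seq (.add 1 1 5) (.sub 3 3 7))))

theorem exec_measureLoop {b c : ℕ} (N : ℕ) : ∀ (σ : State), σ.reg 3 = N → σ.reg 5 = c → σ.reg 7 = 1 →
    σ.reg 1 + N * c < 2 ^ b →
    ∃ σ', Exec b (.whilePos 3 (.seq (.add 1 1 5) (.sub 3 3 7))) σ σ' (3 * N + 1) ∧
      σ'.mem = σ.mem ∧ σ'.reg 1 = σ.reg 1 + N * c ∧ ∀ x, σ'.reg (2 * x) = σ.reg (2 * x) := by
  induction N with
  | zero =>
    intro σ h3 _ _ _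
    exact ⟨σ, .whilePos_zero h3, rfl, by simp, fun _ => rfl⟩
  | succ N ih =>
    intro σ h3 h5 h7 hb
    rw [add_mul, one_mul] at hb
    obtain ⟨σ', h1, h2, h4, h6⟩ := ih
      ((σ.setReg 1 (σ.reg 1 + σ.reg 5)).setReg 3
        ((σ.setReg 1 (σ.reg 1 + σ.reg 5)).reg 3 - (σ.setReg 1 (σ.reg 1 + σ.reg 5)).reg 7))
      (by simp [State.setReg, h3, h7]) (by simpa [State.setReg] using h5)
      (by simpa [State.setReg] using h7)
      (by simp [State.setReg, h5]; omega)
    refine ⟨σ', ?_, by rw [h2]; rfl, ?_, fun x => ?_⟩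
    · have := Exec.whilePos_pos (by omega) (Exec.seq (Exec.add (b := b) σ 1 1 5 (by omega))
        (Exec.sub _ 3 3 7)) h1
      rwa [show 1 + 1 + (3 * N + 1) + 1 = 3 * (N + 1) + 1 by ring] at this
    · rw [h4]
      simp [State.setReg, h5]
      ring
    · rw [h6 x]
      simp only [State.setReg]
      rw [Function.update_of_ne (by omega), Function.update_of_ne (by omega)]

/-- A node takes at most `n + 4` cells: two lengths, at most `n` members of its bag, and at most two
children. Only odd registers are used, so all named registers are still zero afterwards. -/
theorem exec_measure {b n m N : ℕ} (σ : State) (h0 : σ.mem 0 = n) (h1 : σ.mem 1 = m)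
    (h2 : σ.mem 2 = N) (hb : 5 + 2 * m + N * (n + 4) + n + 10 < 2 ^ b) :
    ∃ σ', Exec b measure σ σ' (3 * N + 12) ∧ σ'.mem = σ.mem ∧
      σ'.reg 1 = 5 + 2 * m + N * (n + 4) ∧ ∀ x, σ'.reg (2 * x) = σ.reg (2 * x) := by
  have key : ∃ σ₁, Exec b (.seq (.seq (.seq (.const 3 2) (.load 3 3)) (.seq (.const 5 0) (.load 5 5)))
      (.seq (.seq (.const 7 4) (.add 5 5 7)) (.seq (.const 1 5) (.const 7 1)))) σ σ₁ 8 ∧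
      σ₁.mem = σ.mem ∧ σ₁.reg 1 = 5 ∧ σ₁.reg 3 = N ∧ σ₁.reg 5 = n + 4 ∧ σ₁.reg 7 = 1 ∧
      ∀ x, σ₁.reg (2 * x) = σ.reg (2 * x) := by
    refine ⟨_, .seq (.seq (.seq (.const _ _ _ (by omega)) (.load _ _ _))
      (.seq (.const _ _ _ (by omega)) (.load _ _ _))) (.seq (.seq (.const _ _ _ (by omega))
      (.add _ _ _ _ ?_)) (.seq (.const _ _ _ (by omega)) (.const _ _ _ (by omega)))), rfl, ?_, ?_, ?_,
      ?_, fun x => ?_⟩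
    · simp [State.setReg, h0]; omega
    · simp [State.setReg]
    · simp [State.setReg, h2]
    · simp [State.setReg, h0]
    · simp [State.setReg]
    · simp only [State.setReg]
      repeat rw [Function.update_of_ne (by omega)]
  obtain ⟨σ₁, e1, m1, r1, r3, r5, r7, r0⟩ := key
  have key : ∃ σ₂, Exec b (.seq (.load 9 7) (.seq (.add 1 1 9) (.add 1 1 9))) σ₁ σ₂ 3 ∧
      σ₂.mem = σ.mem ∧ σ₂.reg 1 = 5 + 2 * m ∧ σ₂.reg 3 = N ∧ σ₂.reg 5 = n + 4 ∧ σ₂.reg 7 = 1 ∧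
      ∀ x, σ₂.reg (2 * x) = σ.reg (2 * x) := by
    refine ⟨_, .seq (.load _ _ _) (.seq (.add _ _ _ _ ?_) (.add _ _ _ _ ?_)), m1, ?_, ?_, ?_, ?_,
      fun x => ?_⟩
    · simp [State.setReg, r1, r7, m1, h1]; omega
    · simp [State.setReg, r1, r7, m1, h1]; omega
    · simp [State.setReg, r1, r7, m1, h1]; omega
    · simpa [State.setReg] using r3
    · simpa [State.setReg] using r5
    · simpa [State.setReg] using r7
    · rw [← r0 x]
      simp only [State.setReg]
      repeat rw [Function.update_of_ne (by omega)]
  obtain ⟨σ₂, e2, m2, s1, s3, s5, s7, s0⟩ := key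
  obtain ⟨σ₃, e3, m3, u1, u0⟩ := exec_measureLoop (b := b) N σ₂ s3 s5 s7 (by omega)
  refine ⟨σ₃, ?_, by rw [m3, m2], by rw [u1, s1], fun x => by rw [u0, s0]⟩
  have := Exec.seq e1 (Exec.seq e2 e3)
  rwa [show 8 + (3 + (3 * N + 1)) = 3 * N + 12 by ring] at this

/-- The program of the theorem. -/
def program : Program := .seq measure (.seq (VM.main.comp 0) (.copy 1 2))

end RAM

open VM in
theorem RAM.exec_program {n m N root W H b : ℕ} {input : List ℕ} {ed : ℕ → ℕ × ℕ}
    {bag ch : ℕ → List ℕ} {pos : ℕ → ℕ}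
    (hin : Input (fun i => input.getD i 0) (5 + 2 * m + N * (n + 4)) n m N root ed bag ch pos)
    (hlen : input.length ≤ 5 + 2 * m + N * (n + 4)) (hD : Decomp n W N root bag ch)
    (hW : W = 0 ∨ ∃ t < N, (bag t).length = W) (hcov : ∀ v < n, ∃ t < N, v ∈ bag t)
    (hed : ∀ e < m, (ed e).1 ≠ (ed e).2 ∧ ∃ t < N, (ed e).1 ∈ bag t ∧ (ed e).2 ∈ bag t)
    (hH : 2 * (5 + 2 * m + N * (n + 4)) + 26 ^ W + (n + 1) * 9 ^ W + n * bucketSpace W + n * W +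
      (n + 1) * (n + 1) + 2 * n + 2 * W + N + 200 < H)
    (hb : 5 + 2 * m + N * (n + 4) + 32 * H + 32 ≤ 2 ^ b) :
    ∃ (σ : State) (τ : ℕ), Exec b program (State.init input) σ τ ∧ τ ≤ mainTime n m N W + 3 * N + 13 ∧
      ∃ (idx : ℕ → ℕ) (O : ElimOrder), O.n = n ∧
      (∀ v < n, 1 ≤ idx v ∧ idx v ≤ n) ∧ (∀ u < n, ∀ v < n, idx u = idx v → u = v) ∧
      (∀ i j, O.adj i j ↔ ∃ e < m, (idx (ed e).1 = i ∧ idx (ed e).2 = j) ∨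
        (idx (ed e).2 = i ∧ idx (ed e).1 = j)) ∧
      (∃ S ⊆ Finset.Icc 1 n, O.Hits S ∧ S.card = σ.reg 1) ∧
      (∀ S, O.Hits S → σ.reg 1 ≤ S.card) ∧
      σ.reg 0 = if σ.reg 1 ≤ input.getD 4 0 then 1 else 0 := by
  have h26 : 0 < 26 ^ W := by positivity
  obtain ⟨σ₁, e1, m1, r1, r0⟩ := exec_measure (b := b) (State.init input) hin.n_eq hin.m_eq hin.N_eq
    (by omega)
  have hN : 0 < N := Nat.zero_lt_of_lt hD.root_lt
  have hpos : 0 < N * (n + 4) := by positivity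
  let E : Env := ⟨fun i => input.getD i 0, 5 + 2 * m + N * (n + 4), H⟩
  have hrel : Rel E ⟨fun _ => 0, fun _ _ => 0⟩ σ₁ := by
    refine ⟨fun x => by rw [r0]; rfl, r1, fun i _ => by rw [m1]; rfl, fun A i => ?_⟩
    rw [m1]
    show input.getD (5 + 2 * m + N * (n + 4) + 32 * i + A.ctorIdx) 0 = 0
    rw [List.getD_eq_default _ _ (by omega)]
  obtain ⟨s', σ₂, τ, e2, hrel', ⟨⟨idx, O, h1, h2, h3, h4, h5, h6, h7⟩, hτ⟩, -⟩ :=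
    Cmd.comp_exec (E := E) hb main 0 hrel
      (wp_main (E := E) hin hD hW hcov hed (show 5 < 5 + 2 * m + N * (n + 4) by omega) hH)
  -- `out` and `opt` are the first two named registers, hence registers 0 and 2; the final copy
  -- brings the optimum to register 1.
  have hopt : σ₂.reg 2 = s'.r .opt := hrel'.reg .opt
  have hout : σ₂.reg 0 = s'.r .out := hrel'.reg .out
  refine ⟨σ₂.setReg 1 (σ₂.reg 2), _, .seq e1 (.seq e2 (.copy _ _ _)), by omega, idx, O, h1, h2, h3, h4,
    ?_, ?_, ?_⟩
  · simpa [State.setReg, hopt] using h5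
  · simpa [State.setReg, hopt] using h6
  · have h0 : (σ₂.setReg 1 (σ₂.reg 2)).reg 0 = s'.r .out := by simp [State.setReg, hout]
    have h1 : (σ₂.setReg 1 (σ₂.reg 2)).reg 1 = s'.r .opt := by simp [State.setReg, hopt]
    rw [h0, h1]
    exact h7

/-! ### Rooted tree decompositions -/

namespace TreeDecomposition

variable {V τ : Type*} {G : SimpleGraph V} (D : TreeDecomposition G τ) (r : τ)

theorem ne_root {t c : τ} (hc : c ∈ D.children r t) : c ≠ r := by
  rintro rfl
  have := hc.2
  rw [SimpleGraph.dist_self] at this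
  omega

/-- Shortest paths from the root to `t` and to `t'` can be prolonged to `c`. In a tree the two
results coincide, and so do their penultimate vertices. -/
theorem parent_unique {t t' c : τ} (h : c ∈ D.children r t) (h' : c ∈ D.children r t') : t = t' := by
  obtain ⟨p, hp⟩ := D.isTree.connected.exists_walk_length_eq_dist r t
  obtain ⟨q, hq⟩ := D.isTree.connected.exists_walk_length_eq_dist r t'
  have h1 : (p.concat h.1).IsPath := SimpleGraph.Walk.isPath_of_length_eq_dist _ (by
    rw [SimpleGraph.Walk.length_concat, hp, h.2])
  have h2 : (q.concat h'.1).IsPath := SimpleGraph.Walk.isPath_of_length_eq_dist _ (by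
    rw [SimpleGraph.Walk.length_concat, hq, h'.2])
  have := (D.isTree.isAcyclic.subsingleton_path r c).elim ⟨_, h1⟩ ⟨_, h2⟩
  obtain ⟨hv, -⟩ := SimpleGraph.Walk.concat_inj (congrArg Subtype.val this)
  exact hv

theorem exists_parent {c : τ} (hc : c ≠ r) : ∃ t, c ∈ D.children r t := by
  obtain ⟨p, hp⟩ := D.isTree.connected.exists_walk_length_eq_dist r c
  have hnil : ¬ p.Nil := fun h => hc h.eq.symm
  have hpos : 0 < p.length := Nat.pos_of_ne_zero fun h => hnil (SimpleGraph.Walk.length_eq_zero_iff.mp h)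
  have hadj := p.adj_penultimate hnil
  refine ⟨p.penultimate, hadj, ?_⟩
  have h1 : D.tree.dist r p.penultimate ≤ p.length - 1 := by
    rw [← p.length_dropLast]
    exact SimpleGraph.dist_le _
  have h2 := D.isTree.connected.dist_triangle (u := r) (v := p.penultimate) (w := c)
  rw [SimpleGraph.dist_eq_one_iff_adj.mpr hadj] at h2
  omega

theorem mem_of_closed {S : Set τ} (hr : r ∈ S) (hS : ∀ t ∈ S, ∀ c ∈ D.children r t, c ∈ S) (t : τ) :
    t ∈ S := by
  induction hd : D.tree.dist r t using Nat.strong_induction_on generalizing t with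
  | _ d ih =>
    by_cases h : t = r
    · exact h ▸ hr
    · obtain ⟨p, hp⟩ := D.exists_parent r h
      have := hp.2
      exact hS p (ih _ (by omega) p rfl) t hp

theorem exists_walk_root {A : Set τ} (hr : r ∈ A)
    (hA : ∀ a ∈ A, a ≠ r → ∃ p ∈ A, a ∈ D.children r p) (a : τ) (ha : a ∈ A) :
    ∃ w : D.tree.Walk a r, ∀ x ∈ w.support, x ∈ A := by
  induction hd : D.tree.dist r a using Nat.strong_induction_on generalizing a with
  | _ d ih =>
    by_cases h : a = r
    · subst h
      exact ⟨.nil, by simpa using hr⟩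
    · obtain ⟨p, hpA, hp⟩ := hA a ha h
      have := hp.2
      obtain ⟨w, hw⟩ := ih _ (by omega) p hpA rfl
      refine ⟨.cons hp.1.symm w, fun x hx => ?_⟩
      rw [SimpleGraph.Walk.support_cons, List.mem_cons] at hx
      rcases hx with rfl | hx
      exacts [ha, hw x hx]

/-- `A` contains the root and is closed under parents, hence connected. The path from `t` to `a`
therefore steps to `p` and then stays in `A`, which `t` does not meet, so the path condition of the
decomposition places `v` in the bag of `p`. -/
theorem mem_bag_parent [DecidableEq τ] {A : Set τ} (hr : r ∈ A)
    (hA : ∀ a ∈ A, a ≠ r → ∃ p ∈ A, a ∈ D.children r p) {p t a : τ} (hp : p ∈ A)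
    (ht : t ∈ D.children r p) (htA : t ∉ A) (ha : a ∈ A) {v : V} (hvt : v ∈ D.bag t)
    (hva : v ∈ D.bag a) : v ∈ D.bag p := by
  obtain ⟨w₁, h₁⟩ := D.exists_walk_root r hr hA p hp
  obtain ⟨w₂, h₂⟩ := D.exists_walk_root r hr hA a ha
  have hw : ∀ x ∈ (w₁.append w₂.reverse).bypass.support, x ∈ A := fun x hx => by
    have := SimpleGraph.Walk.support_bypass_subset_support _ hx
    rw [SimpleGraph.Walk.mem_support_append_iff, SimpleGraph.Walk.support_reverse,
      List.mem_reverse] at this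
    exact this.elim (h₁ x) (h₂ x)
  refine D.path_mem t a p (.cons ht.1.symm (w₁.append w₂.reverse).bypass) ?_ ?_ v hvt hva
  · rw [SimpleGraph.Walk.cons_isPath_iff]
    exact ⟨SimpleGraph.Walk.bypass_isPath _, fun h => htA (hw t h)⟩
  · rw [SimpleGraph.Walk.support_cons]
    exact List.mem_cons_of_mem _ (SimpleGraph.Walk.start_mem_support _)

/-- A vertex is forgotten only once. -/
theorem forget_unique [DecidableEq τ] {t c t' c' : τ} (h : c ∈ D.children r t)
    (h' : c' ∈ D.children r t') {v : V} (hv : v ∈ D.bag c) (hv' : v ∈ D.bag c') (hn : v ∉ D.bag t)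
    (hn' : v ∉ D.bag t') : t = t' := by
  by_cases hc : c = c'
  · subst hc
    exact D.parent_unique r h h'
  exfalso
  have key : ∀ {t c t' c' : τ}, c ∈ D.children r t → c' ∈ D.children r t' → v ∈ D.bag c →
      v ∈ D.bag c' → v ∉ D.bag t' → c ≠ c' → D.tree.dist r c ≤ D.tree.dist r c' → False := by
    intro t c t' c' h h' hv hv' hn' hc hd
    have e := h.2
    have e' := h'.2
    -- The nodes no deeper than `t'`, together with `c`, are closed under parents because `c` is no
    -- deeper than `c'`, and they do not contain `c'`. Since `v` occurs at both `c` and `c'`, it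
    -- would have to occur at `t'`.
    refine hn' (D.mem_bag_parent r (A := {a | D.tree.dist r a ≤ D.tree.dist r t' ∨ a = c}) ?_ ?_ ?_ h'
      ?_ (.inr rfl) hv' hv)
    · left
      rw [SimpleGraph.dist_self]
      omega
    · rintro a ha har
      obtain ⟨p, hp⟩ := D.exists_parent r har
      have := hp.2
      refine ⟨p, .inl ?_, hp⟩
      rcases ha with ha | rfl <;> omega
    · exact .inl le_rfl
    · rintro (h2 | h2)
      · omega
      · exact hc h2.symm
  rcases le_total (D.tree.dist r c) (D.tree.dist r c') with hd | hd
  · exact key h h' hv hv' hn' hc hd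
  · exact key h' h hv' hv hn (Ne.symm hc) hd

/-! ### The number of nodes of a nice tree decomposition -/

section Count

variable [Fintype τ] [DecidableEq τ]

open Classical in
/-- The children of a node. -/
noncomputable def childFinset (t : τ) : Finset τ := Finset.univ.filter (· ∈ D.children r t)

theorem mem_childFinset {t c : τ} : c ∈ D.childFinset r t ↔ c ∈ D.children r t := by
  simp [childFinset]

theorem coe_childFinset (t : τ) : (D.childFinset r t : Set τ) = D.children r t := by
  ext; simp [mem_childFinset]

theorem sum_children (f : τ → ℕ) :
    ∑ t, ∑ c ∈ D.childFinset r t, f c + f r = ∑ t, f t := by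
  rw [← Finset.sum_erase_add _ f (Finset.mem_univ r)]
  congr 1
  rw [← Finset.sum_biUnion]
  · refine Finset.sum_congr ?_ fun _ _ => rfl
    ext c
    simp only [Finset.mem_biUnion, Finset.mem_univ, true_and, Finset.mem_erase, and_true,
      mem_childFinset]
    exact ⟨fun ⟨t, h⟩ => D.ne_root r h, fun h => D.exists_parent r h⟩
  · intro t _ t' _ htt
    rw [Function.onFun, Finset.disjoint_left]
    intro c hc hc'
    rw [mem_childFinset] at hc hc'
    exact htt (D.parent_unique r hc hc')

variable [DecidableEq V] {D} {r}

/-- A nice tree decomposition has few nodes. -/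
theorem IsNice.card_le [Fintype V] {W : ℕ} (h : D.IsNice r) (hW : ∀ t, (D.bag t).card ≤ W) :
    Fintype.card τ ≤ 2 * ((D.leaves r).ncard + Fintype.card V) + (D.leaves r).ncard * W := by
  classical
  have hc2 : ∀ t, (D.childFinset r t).card ≤ 2 := fun t => by
    have := h.atMostTwo t
    rw [← D.coe_childFinset r t, Set.encard_coe_eq_coe_finsetCard] at this
    exact_mod_cast this
  let L := Finset.univ.filter fun t => (D.childFinset r t).card = 0
  let F := Finset.univ.filter fun t => ∃ c v, c ∈ D.children r t ∧ v ∈ D.bag c ∧ v ∉ D.bag t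
  have hL : (D.leaves r).ncard = L.card := by
    rw [← Set.ncard_coe_finset]
    congr 1
    ext t
    simp only [leaves, Set.mem_ofPred_eq, L, Finset.coe_filter, Finset.mem_univ, true_and,
      Finset.card_eq_zero]
    rw [← D.coe_childFinset r t, Finset.coe_eq_empty]
  -- Choosing a forgotten vertex for each forget node is injective by `forget_unique`.
  have hF : F.card ≤ Fintype.card V := by
    have hex : ∀ t : F, ∃ v c, c ∈ D.children r t ∧ v ∈ D.bag c ∧ v ∉ D.bag (t : τ) := fun t => by
      obtain ⟨c, v, h⟩ := (Finset.mem_filter.mp t.2).2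
      exact ⟨v, c, h⟩
    choose f g hf using hex
    rw [← Fintype.card_coe]
    refine Fintype.card_le_of_injective f fun t t' e => Subtype.ext ?_
    have h1 := hf t
    have h2 := hf t'
    rw [← e] at h2
    exact D.forget_unique r h1.1 h2.1 h1.2.1 h2.2.1 h1.2.2 h2.2.2
  -- The size of the bag acts as a potential. An introduce node has one vertex more than its child,
  -- which pays for the node; a forget node needs two extra units, a leaf one, and a join node at
  -- most `W + 1`. Summed over the tree the bag sizes cancel, since the bag of the root is empty.
  have hpt : ∀ t, 1 + ∑ c ∈ D.childFinset r t, (D.bag c).card ≤ (D.bag t).card +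
      2 * (if ∃ c v, c ∈ D.children r t ∧ v ∈ D.bag c ∧ v ∉ D.bag t then 1 else 0) +
      (if (D.childFinset r t).card = 0 then 1 else 0) +
      (W + 1) * (if (D.childFinset r t).card = 2 then 1 else 0) := by
    intro t
    have hcoe := D.coe_childFinset r t
    have h2 := hc2 t
    interval_cases hk : (D.childFinset r t).card
    · rw [Finset.card_eq_zero] at hk
      simp only [hk, Finset.sum_empty, if_true]
      omega
    · obtain ⟨c, hc⟩ := Finset.card_eq_one.mp hk
      rw [hc, Finset.coe_singleton] at hcoe
      rw [hc, Finset.sum_singleton]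
      rcases h.introduceOrForget t c hcoe.symm with ⟨v, hv, e⟩ | ⟨v, hv, e⟩
      · rw [e, Finset.card_insert_of_notMem hv]
        omega
      · rw [if_pos ⟨c, v, hcoe ▸ rfl, hv, by simp [e]⟩, e, Finset.card_erase_of_mem hv]
        omega
    · obtain ⟨c, c', hcc, hc⟩ := Finset.card_eq_two.mp hk
      rw [hc, Finset.coe_pair] at hcoe
      obtain ⟨e1, e2⟩ := h.join t c c' hcc hcoe.symm
      rw [hc, Finset.sum_pair hcc, ← e1, ← e2, if_pos rfl]
      have := hW t
      omega
  -- Every node except the root is a child exactly once, so there is one join node fewer than there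
  -- are leaves.
  have hpt' : ∀ t, 1 + (if (D.childFinset r t).card = 2 then 1 else 0) =
      ∑ c ∈ D.childFinset r t, 1 + (if (D.childFinset r t).card = 0 then 1 else 0) := by
    intro t
    rw [Finset.sum_const, smul_eq_mul, mul_one]
    have h2 := hc2 t
    interval_cases hk : (D.childFinset r t).card <;> rfl
  have s1 := Finset.sum_le_sum fun t (_ : t ∈ Finset.univ) => hpt t
  have s2 := Finset.sum_congr (s₁ := Finset.univ) rfl fun t _ => hpt' t
  have s3 := D.sum_children r fun _ => 1
  have s4 := D.sum_children r fun t => (D.bag t).card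
  simp only [Finset.sum_add_distrib, ← Finset.mul_sum, ← Finset.card_filter] at s1 s2
  rw [h.root, Finset.card_empty, add_zero] at s4
  rw [hL]
  obtain ⟨B, hB⟩ : ∃ B, (Finset.univ.filter fun t => (D.childFinset r t).card = 2).card = B := ⟨_, rfl⟩
  have hL' : L.card = (Finset.univ.filter fun t => (D.childFinset r t).card = 0).card := rfl
  have hF' : F.card = (Finset.univ.filter fun t => ∃ c v, c ∈ D.children r t ∧ v ∈ D.bag c ∧
    v ∉ D.bag t).card := rfl
  have hN : ∑ _t : τ, 1 = Fintype.card τ := by simp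
  rw [hN] at s1 s2 s3
  rw [s4, ← hL', ← hF', hB] at s1
  rw [← hL', hB] at s2
  have hBL : (W + 1) * B ≤ (W + 1) * L.card := Nat.mul_le_mul_left _ (by omega)
  rw [show (W + 1) * L.card = L.card * W + L.card by ring] at hBL
  omega

end Count

end TreeDecomposition

/-! ### The input word -/

theorem length_flatMap_range (g : ℕ → List ℕ) (N : ℕ) :
    ((List.range N).flatMap g).length = ∑ i ∈ Finset.range N, (g i).length := by
  induction N with
  | zero => simp
  | succ N ih =>
    rw [List.range_succ, List.flatMap_append, List.length_append, ih, Finset.sum_range_succ]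
    simp

theorem getD_flatMap_range (g : ℕ → List ℕ) {N t x : ℕ} (ht : t < N) (hx : x < (g t).length) :
    ((List.range N).flatMap g).getD (∑ i ∈ Finset.range t, (g i).length + x) 0 = (g t)[x] := by
  induction N with
  | zero => omega
  | succ N ih =>
    rw [List.range_succ, List.flatMap_append]
    rcases Nat.lt_succ_iff_lt_or_eq.mp ht with h | rfl
    · rw [List.getD_append _ _ _ _ ?_, ih h]
      rw [length_flatMap_range]
      have h1 : ∑ i ∈ Finset.range (t + 1), (g i).length ≤ ∑ i ∈ Finset.range N, (g i).length :=
        Finset.sum_le_sum_of_subset (Finset.range_subset_range.mpr h)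
      rw [Finset.sum_range_succ] at h1
      omega
    · rw [List.getD_append_right _ _ _ _ (by rw [length_flatMap_range]; omega),
        length_flatMap_range, Nat.add_sub_cancel_left]
      simp [hx]

theorem getD_flatMap_pair {α : Type*} (f g : α → ℕ) (l : List α) (e : ℕ) (he : e < l.length) :
    (l.flatMap fun a => [f a, g a]).getD (2 * e) 0 = f l[e] ∧
      (l.flatMap fun a => [f a, g a]).getD (2 * e + 1) 0 = g l[e] := by
  induction l generalizing e with
  | nil => simp at he
  | cons a l ih =>
    rcases e with - | e
    · simp
    · have := ih e (by simpa using he)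
      simp only [List.flatMap_cons, List.cons_append, List.nil_append, List.getElem_cons_succ]
      exact this

namespace Listing

variable {n N : ℕ} {G : SimpleGraph (Fin n)} {D : TreeDecomposition G (Fin N)} {r : Fin N}
  (L : Listing G D r)

/-- The bag of a node. -/
def bagList (t : ℕ) : List ℕ := if h : t < N then (L.bag ⟨t, h⟩).map Fin.val else []

/-- The children of a node. -/
def childList (t : ℕ) : List ℕ :=
  if h : t < N then (L.children ⟨t, h⟩).map Fin.val else []

/-- The description of a node. -/
def node (t : ℕ) : List ℕ :=
  (L.bagList t).length :: L.bagList t ++ (L.childList t).length :: L.childList t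

/-- The edges. -/
def edge (e : ℕ) : ℕ × ℕ := (L.edges.map fun e => ((e.1 : ℕ), (e.2 : ℕ))).getD e (0, 0)

/-- The position of the description of a node. -/
def pos (t : ℕ) : ℕ := 5 + 2 * L.edges.length + ∑ i ∈ Finset.range t, (L.node i).length

theorem bagList_fin (t : Fin N) : L.bagList t = (L.bag t).map Fin.val := by
  simp [bagList]

theorem childList_fin (t : Fin N) : L.childList t = (L.children t).map Fin.val := by
  simp [childList]

theorem length_node (t : ℕ) :
    (L.node t).length = 1 + (L.bagList t).length + 1 + (L.childList t).length := by
  simp [node]; ring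

theorem encode_eq (k : ℕ) : L.encode k = ([n, L.edges.length, N, (r : ℕ), k] ++
    L.edges.flatMap (fun e => [(e.1 : ℕ), (e.2 : ℕ)])) ++ (List.range N).flatMap L.node := by
  rw [encode, ← List.map_coe_finRange_eq_range, List.flatMap_map]
  congr 2
  funext t
  have e : ∀ {m : ℕ} (l : List (Fin m)), l.flatMap (fun a : Fin m => [(a : ℕ)]) = l.map Fin.val :=
    fun l => List.map_eq_flatMap.symm
  simp [node, bagList_fin, childList_fin, e]
  rfl

theorem length_pairs : (L.edges.flatMap (fun e => [(e.1 : ℕ), (e.2 : ℕ)])).length =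
    2 * L.edges.length := by
  rw [List.length_flatMap]
  simp [mul_comm]

theorem encode_length (k : ℕ) : (L.encode k).length = L.pos N := by
  rw [encode_eq, List.length_append, List.length_append, length_pairs, length_flatMap_range, pos]
  simp

theorem getD_encode_node (k : ℕ) {t x : ℕ} (ht : t < N) (hx : x < (L.node t).length) :
    (L.encode k).getD (L.pos t + x) 0 = (L.node t)[x] := by
  have hlen : ([n, L.edges.length, N, (r : ℕ), k] ++
      L.edges.flatMap (fun e => [(e.1 : ℕ), (e.2 : ℕ)])).length = 5 + 2 * L.edges.length := by
    rw [List.length_append, length_pairs]; rfl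
  rw [encode_eq, List.getD_append_right _ _ _ _ (by rw [hlen, pos]; omega), hlen, pos,
    show ∀ a b c : ℕ, a + b + c - a = b + c by omega]
  exact getD_flatMap_range _ ht hx

theorem getD_encode_edge (k : ℕ) {e : ℕ} (he : e < L.edges.length) :
    (L.encode k).getD (5 + 2 * e) 0 = (L.edge e).1 ∧
      (L.encode k).getD (5 + 2 * e + 1) 0 = (L.edge e).2 := by
  have h := getD_flatMap_pair (fun a : Fin n × Fin n => (a.1 : ℕ)) (fun a => (a.2 : ℕ)) L.edges e he
  have hed : L.edge e = ((L.edges[e].1 : ℕ), (L.edges[e].2 : ℕ)) := by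
    rw [edge, List.getD_eq_getElem _ _ (by simpa using he), List.getElem_map]
  have hlen := L.length_pairs
  have key : ∀ x < 2 * L.edges.length, (L.encode k).getD (5 + x) 0 =
      (L.edges.flatMap (fun e => [(e.1 : ℕ), (e.2 : ℕ)])).getD x 0 := by
    intro x hx
    have h1 : 5 + x < ([n, L.edges.length, N, (r : ℕ), k] ++
        L.edges.flatMap (fun e => [(e.1 : ℕ), (e.2 : ℕ)])).length := by
      rw [List.length_append, hlen]
      exact Nat.add_lt_add_left hx 5
    rw [encode_eq, List.getD_append _ _ _ _ h1, List.getD_append_right _ _ _ _ (by simp)]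
    congr 1
    simp
  rw [key _ (by omega), add_assoc, key _ (by omega), hed]
  exact h

theorem input (k : ℕ) {β : ℕ} (hβ : L.pos N ≤ β) :
    Input (fun i => (L.encode k).getD i 0) β n L.edges.length N r L.edge L.bagList L.childList
      L.pos := by
  have hn := fun t ht x hx => L.getD_encode_node k (t := t) (x := x) ht hx
  refine ⟨by simp [encode], by simp [encode], by simp [encode], by simp [encode],
    fun e he => (L.getD_encode_edge k he).1, fun e he => (L.getD_encode_edge k he).2, by simp [pos],
    fun t ht => ?_, fun t ht => ?_, fun t ht x hx => ?_, fun t ht => ?_, fun t ht x hx => ?_,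
    fun t ht => ?_⟩
  · rw [pos, Finset.sum_range_succ, length_node, pos]; ring
  · simpa [node] using hn t ht 0 (by rw [length_node]; omega)
  · have := hn t ht (1 + x) (by rw [length_node]; omega)
    rw [add_assoc]
    refine this.trans ?_
    simp only [node, List.cons_append, Nat.add_comm 1 x, List.getElem_cons_succ]
    exact List.getElem_append_left hx
  · have := hn t ht (1 + (L.bagList t).length) (by rw [length_node]; omega)
    rw [add_assoc]
    refine this.trans ?_
    simp only [node, List.cons_append, Nat.add_comm 1, List.getElem_cons_succ]
    rw [List.getElem_append_right le_rfl]
    simp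
  · have := hn t ht ((L.bagList t).length + (x + 1) + 1) (by rw [length_node]; omega)
    rw [show L.pos t + 1 + (L.bagList t).length + 1 + x =
      L.pos t + ((L.bagList t).length + (x + 1) + 1) by ring]
    refine this.trans ?_
    simp only [node, List.cons_append, List.getElem_cons_succ]
    rw [List.getElem_append_right (by omega)]
    simp
  · refine le_trans ?_ hβ
    rw [pos, pos]
    exact Nat.add_le_add_left (Finset.sum_le_sum_of_subset (Finset.range_subset_range.mpr ht)) _

end Listing

/-! ### The listed decomposition as an input of the program -/

namespace Listing

variable {n N : ℕ} {G : SimpleGraph (Fin n)} {D : TreeDecomposition G (Fin N)} {r : Fin N}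
  (L : Listing G D r)

theorem mem_bagList {t v : ℕ} :
    v ∈ L.bagList t ↔ ∃ (ht : t < N) (hv : v < n), (⟨v, hv⟩ : Fin n) ∈ D.bag ⟨t, ht⟩ := by
  constructor
  · intro h
    by_cases ht : t < N
    · rw [bagList, dif_pos ht, List.mem_map] at h
      obtain ⟨u, hu, rfl⟩ := h
      exact ⟨ht, u.2, (L.mem_bag _ _).mp hu⟩
    · simp [bagList, ht] at h
  · rintro ⟨ht, hv, h⟩
    rw [bagList, dif_pos ht, List.mem_map]
    exact ⟨⟨v, hv⟩, (L.mem_bag _ _).mpr h, rfl⟩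

theorem mem_childList {t c : ℕ} :
    c ∈ L.childList t ↔ ∃ (ht : t < N) (hc : c < N), (⟨c, hc⟩ : Fin N) ∈ D.children r ⟨t, ht⟩ := by
  constructor
  · intro h
    by_cases ht : t < N
    · rw [childList, dif_pos ht, List.mem_map] at h
      obtain ⟨u, hu, rfl⟩ := h
      exact ⟨ht, u.2, (L.mem_children _ _).mp hu⟩
    · simp [childList, ht] at h
  · rintro ⟨ht, hc, h⟩
    rw [childList, dif_pos ht, List.mem_map]
    exact ⟨⟨c, hc⟩, (L.mem_children _ _).mpr h, rfl⟩

theorem bagList_length {t : ℕ} (ht : t < N) : (L.bagList t).length = (D.bag ⟨t, ht⟩).card := by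
  rw [bagList, dif_pos ht, List.length_map, ← List.toFinset_card_of_nodup (L.bag_nodup _)]
  congr 1
  ext v
  rw [List.mem_toFinset, L.mem_bag]

theorem childList_length (hD : D.IsNice r) {t : ℕ} (ht : t < N) : (L.childList t).length ≤ 2 := by
  have h := hD.atMostTwo ⟨t, ht⟩
  have e : D.children r ⟨t, ht⟩ = ((L.children ⟨t, ht⟩).toFinset : Set (Fin N)) := by
    ext c
    rw [Finset.mem_coe, List.mem_toFinset, L.mem_children]
  rw [e, Set.encard_coe_eq_coe_finsetCard, List.toFinset_card_of_nodup (L.children_nodup _)] at h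
  rw [childList, dif_pos ht, List.length_map]
  exact_mod_cast h

theorem decomp (hD : D.IsNice r) {W : ℕ} (hW : ∀ t, (D.bag t).card ≤ W) :
    Decomp n W N r L.bagList L.childList := by
  refine ⟨⟨r.2, fun t _ c hc => ?_, fun t ht => ?_, fun t _ t' _ c hc hc' => ?_, fun S hr hS t ht => ?_⟩,
    fun t _ v hv => ?_, fun t ht => ?_, fun t ht => ?_, fun t ht => L.childList_length hD ht,
    fun A hr hA hcl p hp t ht htA a ha v hvt hva => ?_⟩
  · obtain ⟨ht, hc, h⟩ := L.mem_childList.mp hc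
    exact ⟨hc, fun e => D.ne_root r h (Fin.ext e)⟩
  · rw [childList, dif_pos ht]
    exact (L.children_nodup _).map Fin.val_injective
  · obtain ⟨ht, hc, h⟩ := L.mem_childList.mp hc
    obtain ⟨ht', _, h'⟩ := L.mem_childList.mp hc'
    exact congrArg Fin.val (D.parent_unique r h h')
  · exact D.mem_of_closed r (S := {t | (t : ℕ) ∈ S}) hr
      (fun t ht c hc => hS t ht t.2 c (L.mem_childList.mpr ⟨t.2, c.2, hc⟩)) ⟨t, ht⟩
  · exact (L.mem_bagList.mp hv).2.1
  · rw [bagList, dif_pos ht]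
    exact (L.bag_nodup _).map Fin.val_injective
  · rw [L.bagList_length ht]
    exact hW _
  · obtain ⟨htp, htN, h⟩ := L.mem_childList.mp ht
    obtain ⟨_, hvn, hvt⟩ := L.mem_bagList.mp hvt
    obtain ⟨haN, _, hva⟩ := L.mem_bagList.mp hva
    refine L.mem_bagList.mpr ⟨htp, hvn, D.mem_bag_parent r (A := {a | (a : ℕ) ∈ A}) hr ?_ hp h htA
      (a := ⟨a, haN⟩) ha hvt hva⟩
    intro b hb hbr
    obtain ⟨q, hq, hb'⟩ := hcl b hb fun e => hbr (Fin.ext e)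
    obtain ⟨hqN, _, h⟩ := L.mem_childList.mp hb'
    exact ⟨⟨q, hqN⟩, hq, h⟩

theorem edge_eq {e : ℕ} (he : e < L.edges.length) :
    L.edge e = ((L.edges[e].1 : ℕ), (L.edges[e].2 : ℕ)) := by
  rw [edge, List.getD_eq_getElem _ _ (by simpa using he), List.getElem_map]

theorem adj_edge {e : ℕ} (he : e < L.edges.length) : G.Adj L.edges[e].1 L.edges[e].2 :=
  (L.mem_edges _ _).mpr (List.mem_map.mpr ⟨_, List.getElem_mem he, rfl⟩)

theorem adj_iff (u v : Fin n) : G.Adj u v ↔ ∃ e < L.edges.length,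
    (L.edge e = ((u : ℕ), (v : ℕ)) ∨ L.edge e = ((v : ℕ), (u : ℕ))) := by
  constructor
  · intro h
    obtain ⟨p, hp, h⟩ := List.mem_map.mp ((L.mem_edges u v).mp h)
    obtain ⟨e, he, rfl⟩ := List.getElem_of_mem hp
    refine ⟨e, he, ?_⟩
    rw [L.edge_eq he]
    rcases Sym2.eq_iff.mp h with ⟨h1, h2⟩ | ⟨h1, h2⟩ <;> simp [h1, h2]
  · rintro ⟨e, he, h⟩
    have ha := L.adj_edge he
    rw [L.edge_eq he] at h
    rcases h with h | h
    · rw [Prod.mk.injEq, ← Fin.ext_iff, ← Fin.ext_iff] at h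
      rwa [h.1, h.2] at ha
    · rw [Prod.mk.injEq, ← Fin.ext_iff, ← Fin.ext_iff] at h
      rw [h.1, h.2] at ha
      exact ha.symm

theorem edge_mem_bag {e : ℕ} (he : e < L.edges.length) : (L.edge e).1 ≠ (L.edge e).2 ∧
    ∃ t < N, (L.edge e).1 ∈ L.bagList t ∧ (L.edge e).2 ∈ L.bagList t := by
  have ha := L.adj_edge he
  rw [L.edge_eq he]
  obtain ⟨t, h1, h2⟩ := D.edge_mem _ _ ha
  exact ⟨fun h => ha.ne (Fin.ext h), t, t.2, L.mem_bagList.mpr ⟨t.2, Fin.is_lt _, h1⟩,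
    L.mem_bagList.mpr ⟨t.2, Fin.is_lt _, h2⟩⟩

/-- Every edge lies inside a bag, and a bag has at most `W * W` pairs. -/
theorem edges_length_le {W : ℕ} (hW : ∀ t, (D.bag t).card ≤ W) : L.edges.length ≤ N * (W * W) := by
  have hnd := L.edges_nodup.of_map
  rw [← List.toFinset_card_of_nodup hnd]
  have hsub : L.edges.toFinset ⊆ Finset.univ.biUnion fun t => D.bag t ×ˢ D.bag t := by
    intro p hp
    obtain ⟨e, he, rfl⟩ := List.getElem_of_mem (List.mem_toFinset.mp hp)
    obtain ⟨t, h1, h2⟩ := D.edge_mem _ _ (L.adj_edge he)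
    exact Finset.mem_biUnion.mpr ⟨t, Finset.mem_univ _, Finset.mem_product.mpr ⟨h1, h2⟩⟩
  refine (Finset.card_le_card hsub).trans (Finset.card_biUnion_le.trans ?_)
  refine (Finset.sum_le_card_nsmul _ _ (W * W) fun t _ => ?_).trans (by simp)
  rw [Finset.card_product]
  exact Nat.mul_le_mul (hW t) (hW t)

/-- The right-hand side is the number computed by `RAM.measure`. -/
theorem pos_le (hD : D.IsNice r) : L.pos N ≤ 5 + 2 * L.edges.length + N * (n + 4) := by
  rw [pos]
  refine Nat.add_le_add_left ((Finset.sum_le_card_nsmul _ _ (n + 4) fun t ht => ?_).trans (by simp)) _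
  have ht := Finset.mem_range.mp ht
  have h1 := L.childList_length hD ht
  have h2 : (L.bagList t).length ≤ n := by
    rw [L.bagList_length ht]
    exact (Finset.card_le_univ _).trans (by simp)
  rw [length_node]
  omega

/-- The optimum does not change when the vertices are renamed. -/
theorem isLeast_of_hits {idx : ℕ → ℕ} {O : ElimOrder} {opt : ℕ}
    (hinj : ∀ u < n, ∀ v < n, idx u = idx v → u = v)
    (hadj : ∀ i j, O.adj i j ↔ ∃ e < L.edges.length, (idx (L.edge e).1 = i ∧ idx (L.edge e).2 = j) ∨
      (idx (L.edge e).2 = i ∧ idx (L.edge e).1 = j))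
    (hopt : ∃ S : Finset ℕ, O.Hits S ∧ S.card = opt) (hmin : ∀ S, O.Hits S → opt ≤ S.card) :
    IsLeast {l | ∃ S : Finset (Fin n), S.card = l ∧ ¬ HasPath4 (G.induce {v : Fin n | v ∉ S})} opt := by
  have hG : ∀ u v : Fin n, G.Adj u v → O.adj (idx u) (idx v) := by
    intro u v h
    obtain ⟨e, he, h⟩ := (L.adj_iff u v).mp h
    exact (hadj _ _).mpr ⟨e, he, by rcases h with h | h <;> simp [h]⟩
  have hO : ∀ i j, O.adj i j → ∃ u v : Fin n, G.Adj u v ∧ idx u = i ∧ idx v = j := by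
    intro i j h
    obtain ⟨e, he, h⟩ := (hadj i j).mp h
    have ha := L.adj_edge he
    rw [L.edge_eq he] at h
    rcases h with h | h
    exacts [⟨_, _, ha, h⟩, ⟨_, _, ha.symm, h⟩]
  have hidx : ∀ u v : Fin n, idx u = idx v → u = v := fun u v h => Fin.ext (hinj u u.2 v v.2 h)
  have hlow : ∀ S : Finset (Fin n), ¬ HasPath4 (G.induce {v : Fin n | v ∉ S}) → opt ≤ S.card := by
    intro S hS
    refine (hmin (S.image fun v : Fin n => idx v) ?_).trans Finset.card_image_le
    intro a b c d hac had hbd hab hbc hcd ha hb hc hd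
    obtain ⟨a', b', h1, rfl, rfl⟩ := hO _ _ hab
    obtain ⟨b'', c', h2, e, rfl⟩ := hO _ _ hbc
    obtain rfl := hidx _ _ e
    obtain ⟨c'', d', h3, e, rfl⟩ := hO _ _ hcd
    obtain rfl := hidx _ _ e
    have mem : ∀ v : Fin n, idx v ∉ S.image (fun v : Fin n => idx v) → v ∉ S := fun v h hv =>
      h (Finset.mem_image_of_mem (fun v : Fin n => idx v) hv)
    refine hS ⟨⟨a', mem _ ha⟩, ⟨_, mem _ hb⟩, ⟨_, mem _ hc⟩, ⟨d', mem _ hd⟩, ?_, ?_, ?_, h1, h2, h3⟩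
    · intro h; exact hac (congrArg (fun v => idx v.1) h)
    · intro h; exact had (congrArg (fun v => idx v.1) h)
    · intro h; exact hbd (congrArg (fun v => idx v.1) h)
  refine ⟨?_, ?_⟩
  · obtain ⟨S, hS, hc⟩ := hopt
    have hS' : ¬ HasPath4 (G.induce {v : Fin n | v ∉ Finset.univ.filter fun v : Fin n => idx v ∈ S}) := by
      rintro ⟨a, b, c, d, hac, had, hbd, hab, hbc, hcd⟩
      have mem : ∀ v : {v : Fin n | v ∉ Finset.univ.filter fun v : Fin n => idx v ∈ S},
          idx v.1 ∉ S := fun v hv => v.2 (Finset.mem_filter.mpr ⟨Finset.mem_univ _, hv⟩)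
      exact hS (idx a.1) (idx b.1) (idx c.1) (idx d.1) (fun h => hac (Subtype.ext (hidx _ _ h)))
        (fun h => had (Subtype.ext (hidx _ _ h))) (fun h => hbd (Subtype.ext (hidx _ _ h)))
        (hG _ _ hab) (hG _ _ hbc) (hG _ _ hcd) (mem a) (mem b) (mem c) (mem d)
    -- The preimage of `S` has at most as many elements as `S`; equality follows since no solution
    -- is smaller than `opt`.
    refine ⟨_, le_antisymm ?_ (hlow _ hS'), hS'⟩
    rw [← hc]
    refine Finset.card_le_card_of_injOn (fun v => idx v) (fun v hv => ?_) fun u _ v _ h => hidx u v h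
    exact (Finset.mem_filter.mp hv).2
  · rintro l ⟨S, rfl, hS⟩
    exact hlow S hS

end Listing

/-! ### Bounds -/

/-- For `w < 7` the cube is at most `9 ^ 3 = 729`. From `w = 7` on, a step multiplies the cube by at
most `(10 / 9) ^ 3`, which is less than `36 / 26`. -/
theorem cube_mul_pow_le (w : ℕ) : (w + 2) ^ 3 * 26 ^ w ≤ 729 * 36 ^ w := by
  rcases Nat.lt_or_ge w 7 with h | h
  · exact Nat.mul_le_mul ((Nat.pow_le_pow_left (by omega : w + 2 ≤ 9) 3).trans (by norm_num))
      (Nat.pow_le_pow_left (by norm_num) w)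
  · induction w, h using Nat.le_induction with
    | base => norm_num
    | succ w h ih =>
      obtain ⟨j, rfl⟩ := Nat.exists_eq_add_of_le h
      have h1 : 26 * (7 + j + 1 + 2) ^ 3 ≤ 36 * (7 + j + 2) ^ 3 := by
        ring_nf
        nlinarith [Nat.zero_le (j ^ 3), Nat.zero_le (j ^ 2), Nat.zero_le j]
      calc (7 + j + 1 + 2) ^ 3 * 26 ^ (7 + j + 1)
          = 26 * (7 + j + 1 + 2) ^ 3 * 26 ^ (7 + j) := by rw [pow_succ]; ring
        _ ≤ 36 * (7 + j + 2) ^ 3 * 26 ^ (7 + j) := Nat.mul_le_mul_right _ h1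
        _ = 36 * ((7 + j + 2) ^ 3 * 26 ^ (7 + j)) := by ring
        _ ≤ 36 * (729 * 36 ^ (7 + j)) := Nat.mul_le_mul_left _ ih
        _ = 729 * 36 ^ (7 + j + 1) := by rw [pow_succ]; ring

/-- Bags may have `w + 1` elements, which costs one more factor 26, and `18954 = 26 * 729`. -/
theorem cube_mul_pow_le' {w W : ℕ} (hW : W ≤ w + 1) : (W + 1) ^ 3 * 26 ^ W ≤ 18954 * 36 ^ w :=
  calc (W + 1) ^ 3 * 26 ^ W ≤ (w + 2) ^ 3 * 26 ^ (w + 1) :=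
        Nat.mul_le_mul (Nat.pow_le_pow_left (by omega) 3) (Nat.pow_le_pow_right (by norm_num) hW)
    _ = 26 * ((w + 2) ^ 3 * 26 ^ w) := by rw [pow_succ]; ring
    _ ≤ 26 * (729 * 36 ^ w) := Nat.mul_le_mul_left _ (cube_mul_pow_le w)
    _ = 18954 * 36 ^ w := by ring

namespace VM

/-- The eliminations dominate with `(n + 1) * (W + 1) ^ 3 * 26 ^ W`. The terms with `N` or `m` carry
at most `W ^ 2`, and `N` brings one more factor `W + 1`, so a cube is enough for them as well. -/
theorem mainTime_le {n m N W c : ℕ} (hN : N ≤ c * (n + 1) * (W + 1)) (hm : m ≤ N * (W * W)) :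
    mainTime n m N W + 3 * N + 13 ≤ (30000 + 1000 * c) * ((n + 1) * ((W + 1) ^ 3 * 26 ^ W)) := by
  obtain ⟨A, hA⟩ : ∃ A, W + 1 = A := ⟨_, rfl⟩
  obtain ⟨X, hX⟩ : ∃ X, 26 ^ W = X := ⟨_, rfl⟩
  obtain ⟨v, hv⟩ : ∃ v, n + 1 = v := ⟨_, rfl⟩
  have hX1 : 1 ≤ X := hX ▸ Nat.one_le_pow _ _ (by norm_num)
  have hA1 : 1 ≤ A := by omega
  have hv1 : 1 ≤ v := by omega
  have hWA : W ≤ A := by omega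
  simp only [mainTime, bucketTime, hA, hX, hv] at *
  have hAA : A ≤ A * A := Nat.le_mul_of_pos_left _ hA1
  have hA3 : A * A ≤ A ^ 3 := by rw [pow_succ, sq]; exact Nat.le_mul_of_pos_right _ hA1
  have hA31 : 1 ≤ A ^ 3 := Nat.one_le_pow _ _ hA1
  obtain ⟨Y, hY⟩ : ∃ Y, v * (A ^ 3 * X) = Y := ⟨_, rfl⟩
  have e1 : v * A ^ 3 ≤ Y := by
    rw [← hY]; exact Nat.mul_le_mul_left _ (Nat.le_mul_of_pos_right _ hX1)
  have e2 : A ^ 3 ≤ Y := (Nat.le_mul_of_pos_left _ hv1).trans e1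
  have e3 : v ≤ Y := (Nat.le_mul_of_pos_right _ hA31).trans e1
  have hNA : N * (A * A) ≤ c * Y := by
    calc N * (A * A) ≤ c * v * A * (A * A) := Nat.mul_le_mul_right _ hN
      _ = c * (v * A ^ 3) := by ring
      _ ≤ c * Y := Nat.mul_le_mul_left _ e1
  have hNN : N ≤ N * (A * A) := Nat.le_mul_of_pos_right _ (by positivity)
  have hmN : m ≤ N * (A * A) := hm.trans (Nat.mul_le_mul_left _ (Nat.mul_le_mul hWA hWA))
  have t1 : N * (W * (200 * A + 43) + 300 + 3) ≤ 600 * (N * (A * A)) := by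
    have : W * (200 * A + 43) + 300 + 3 ≤ 600 * (A * A) := by
      have : W * (200 * A + 43) ≤ A * (200 * A + 43) := Nat.mul_le_mul_right _ hWA
      nlinarith
    calc _ ≤ N * (600 * (A * A)) := Nat.mul_le_mul_left _ this
      _ = _ := by ring
  have t2 : v * (A * A * (2 * (13000 * A * X) + 1000) + 200) ≤ 27200 * Y := by
    have h1 : v * (A * A) ≤ Y := (Nat.mul_le_mul_left _ hA3).trans e1
    calc _ = 26000 * (v * (A ^ 3 * X)) + 1000 * (v * (A * A)) + 200 * v := by ring
      _ ≤ 27200 * Y := by rw [hY]; omega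
  rw [hY, add_mul, mul_assoc 1000]
  omega

/-- The square of `n + 1` comes from the adjacency matrix and from the crude bound on the length of
the input. It affects only the word length and not the time. -/
theorem space_le {n m N W c : ℕ} (hN : N ≤ c * (n + 1) * (W + 1)) (hm : m ≤ N * (W * W)) :
    5 + 2 * m + N * (n + 4) + 32 * (2 * (5 + 2 * m + N * (n + 4)) + 26 ^ W + (n + 1) * 9 ^ W +
      n * bucketSpace W + n * W + (n + 1) * (n + 1) + 2 * n + 2 * W + N + 200 + 1) + 32 ≤
      (10000 + 1000 * c) * ((n + 1) * (n + 1) * ((W + 1) ^ 3 * 26 ^ W)) := by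
  obtain ⟨A, hA⟩ : ∃ A, W + 1 = A := ⟨_, rfl⟩
  obtain ⟨v, hv⟩ : ∃ v, n + 1 = v := ⟨_, rfl⟩
  have h9 : 9 ^ W ≤ 26 ^ W := Nat.pow_le_pow_left (by norm_num) W
  obtain ⟨X, hX⟩ : ∃ X, 26 ^ W = X := ⟨_, rfl⟩
  have hX1 : 1 ≤ X := hX ▸ Nat.one_le_pow _ _ (by norm_num)
  obtain ⟨x, hx⟩ : ∃ x, 9 ^ W = x := ⟨_, rfl⟩
  have hA1 : 1 ≤ A := by omega
  have hv1 : 1 ≤ v := by omega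
  have hWA : W ≤ A := by omega
  have hnv : n ≤ v := by omega
  have hnv4 : n + 4 ≤ 4 * v := by omega
  simp only [bucketSpace, hA, hX, hv, hx] at *
  have hAA : A ≤ A * A := Nat.le_mul_of_pos_left _ hA1
  have hA3 : A * A ≤ A ^ 3 := by rw [pow_succ, sq]; exact Nat.le_mul_of_pos_right _ hA1
  have hA31 : 1 ≤ A ^ 3 := Nat.one_le_pow _ _ hA1
  have hvv : v ≤ v * v := Nat.le_mul_of_pos_left _ hv1
  obtain ⟨Y, hY⟩ : ∃ Y, v * v * (A ^ 3 * X) = Y := ⟨_, rfl⟩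
  have e1 : v * v * A ^ 3 ≤ Y := by
    rw [← hY]; exact Nat.mul_le_mul_left _ (Nat.le_mul_of_pos_right _ hX1)
  have e2 : A ^ 3 ≤ Y := (Nat.le_mul_of_pos_left _ (Nat.mul_pos hv1 hv1)).trans e1
  have e3 : v * v ≤ Y := (Nat.le_mul_of_pos_right _ hA31).trans e1
  have e4 : v * (A * A * X) ≤ Y := by
    rw [← hY]; exact Nat.mul_le_mul hvv (Nat.mul_le_mul_right _ hA3)
  have e5 : v * X ≤ Y := by
    refine le_trans (Nat.mul_le_mul_left _ ?_) e4
    exact Nat.le_mul_of_pos_left _ (Nat.mul_pos hA1 hA1)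
  have e6 : X ≤ Y := (Nat.le_mul_of_pos_left _ hv1).trans e5
  have hNv : N * v * (A * A) ≤ c * Y := by
    calc N * v * (A * A) ≤ c * v * A * v * (A * A) :=
          Nat.mul_le_mul_right _ (Nat.mul_le_mul_right _ hN)
      _ = c * (v * v * A ^ 3) := by ring
      _ ≤ c * Y := Nat.mul_le_mul_left _ e1
  have hNv' : N * v ≤ N * v * (A * A) := Nat.le_mul_of_pos_right _ (by positivity)
  have hNN : N ≤ N * v := Nat.le_mul_of_pos_right _ hv1
  have hmN : m ≤ N * v * (A * A) :=
    hm.trans (Nat.mul_le_mul hNN (Nat.mul_le_mul hWA hWA))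
  have t1 : N * (n + 4) ≤ 4 * (N * v) := by
    calc _ ≤ N * (4 * v) := Nat.mul_le_mul_left _ hnv4
      _ = _ := by ring
  have t2 : v * x ≤ v * X := Nat.mul_le_mul_left _ h9
  have t3 : n * (W * (W * (2 * x)) + 3 * x) ≤ 5 * (v * (A * A * X)) := by
    have h1 : W * (W * x) ≤ A * (A * X) := Nat.mul_le_mul hWA (Nat.mul_le_mul hWA h9)
    have h2 : X ≤ A * A * X := Nat.le_mul_of_pos_left _ (Nat.mul_pos hA1 hA1)
    calc n * (W * (W * (2 * x)) + 3 * x) ≤ v * (5 * (A * A * X)) := by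
          refine Nat.mul_le_mul hnv ?_
          rw [show W * (W * (2 * x)) = 2 * (W * (W * x)) by ring, mul_assoc A A X] at *
          omega
      _ = _ := by ring
  have t4 : n * W ≤ Y := by
    refine (Nat.mul_le_mul hnv hWA).trans (le_trans ?_ e1)
    exact Nat.mul_le_mul hvv (hAA.trans hA3)
  rw [hY, add_mul, mul_assoc 1000]
  omega

end VM

/-- Every factor is at most a power of two with exponent linear in `w + l`: `36 ≤ 2 ^ 6`, the two
factors `n + 1` take `4 * l` together, and the constant satisfies `K ≤ 2 ^ (K * l)` because the
logarithm `l` of a number that is at least 2 is positive. -/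
theorem two_pow_bound {n k w K b Z : ℕ} (hZ : Z ≤ K * ((n + 1) * (n + 1) * 36 ^ w))
    (hb : (K + 6) * (w + Nat.log 2 (n + k + 2)) ≤ b) : Z ≤ 2 ^ b := by
  obtain ⟨l, hl⟩ : ∃ l, Nat.log 2 (n + k + 2) = l := ⟨_, rfl⟩
  have hl1 : 1 ≤ l := hl ▸ Nat.log_pos (by norm_num) (by omega)
  have h1 : n + k + 2 < 2 ^ (l + 1) := hl ▸ Nat.lt_pow_succ_log_self (by norm_num) _
  have h2 : n + 1 ≤ 2 ^ (2 * l) :=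
    (show n + 1 ≤ 2 ^ (l + 1) by omega).trans (Nat.pow_le_pow_right (by norm_num) (by omega))
  have h3 : 36 ^ w ≤ 2 ^ (6 * w) := by
    rw [pow_mul]; exact Nat.pow_le_pow_left (by norm_num) w
  have h4 : K ≤ 2 ^ (K * l) :=
    (Nat.lt_two_pow_self (n := K)).le.trans
      (Nat.pow_le_pow_right (by norm_num) (Nat.le_mul_of_pos_right _ hl1))
  rw [hl] at hb
  calc Z ≤ K * ((n + 1) * (n + 1) * 36 ^ w) := hZ
    _ ≤ 2 ^ (K * l) * (2 ^ (2 * l) * 2 ^ (2 * l) * 2 ^ (6 * w)) :=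
      Nat.mul_le_mul h4 (Nat.mul_le_mul (Nat.mul_le_mul h2 h2) h3)
    _ = 2 ^ (K * l + (2 * l + 2 * l + 6 * w)) := by simp only [pow_add]
    _ ≤ 2 ^ b := Nat.pow_le_pow_right (by norm_num) (by nlinarith)

/-- Here `W` is the exact maximum of the bag sizes, at most the width plus one, and the bound on the
leaves turns `IsNice.card_le` into `N ≤ (2 * C + 2) * (n + 1) * (W + 1)`. -/
theorem Listing.exec_program {n N : ℕ} {G : SimpleGraph (Fin n)} {D : TreeDecomposition G (Fin N)}
    {r : Fin N} (L : Listing G D r) (hD : D.IsNice r) {C k b : ℕ}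
    (hC : (D.leaves r).ncard ≤ C * (n + 1))
    (hb : ((10000 + 1000 * (2 * C + 2)) * 18954 + 6) * (D.width + Nat.log 2 (n + k + 2)) ≤ b) :
    ∃ (σ : RAM.State) (τ : ℕ), RAM.Exec b RAM.program (RAM.State.init (L.encode k)) σ τ ∧
      τ ≤ (30000 + 1000 * (2 * C + 2)) * 18954 * (36 ^ D.width * (n + 1)) ∧
      IsLeast {l | ∃ S : Finset (Fin n), S.card = l ∧ ¬ HasPath4 (G.induce {v : Fin n | v ∉ S})}
        (σ.reg 1) ∧
      σ.reg 0 = if σ.reg 1 ≤ k then 1 else 0 := by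
  have hne : (Finset.univ : Finset (Fin N)).Nonempty := ⟨r, Finset.mem_univ _⟩
  obtain ⟨W, hW⟩ : ∃ W, (Finset.univ.sup fun t => (D.bag t).card) = W := ⟨_, rfl⟩
  have hWw : W ≤ D.width + 1 := by rw [TreeDecomposition.width, hW]; omega
  have hle : ∀ t, (D.bag t).card ≤ W := fun t =>
    hW ▸ Finset.le_sup (f := fun t => (D.bag t).card) (Finset.mem_univ t)
  have hmax : ∃ t < N, (L.bagList t).length = W := by
    obtain ⟨t, -, ht⟩ := Finset.exists_mem_eq_sup _ hne fun t => (D.bag t).card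
    exact ⟨t, t.2, by rw [L.bagList_length t.2, ← hW, ht]⟩
  have hN : N ≤ (2 * C + 2) * (n + 1) * (W + 1) := by
    have h1 := hD.card_le hle
    rw [Fintype.card_fin, Fintype.card_fin] at h1
    have h2 := Nat.mul_le_mul_right W hC
    calc N ≤ 2 * (C * (n + 1) + n) + C * (n + 1) * W := by omega
      _ ≤ (2 * C + 2) * (n + 1) * (W + 1) := by nlinarith [Nat.zero_le (C * n * W), Nat.zero_le (n * W)]
  have hm := L.edges_length_le hle
  have hpow := cube_mul_pow_le' hWw
  have hpos := L.pos_le hD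
  have hmul : ∀ K v : ℕ, K * (v * ((W + 1) ^ 3 * 26 ^ W)) ≤ K * 18954 * (v * 36 ^ D.width) :=
    fun K v => (Nat.mul_le_mul_left K (Nat.mul_le_mul_left v hpow)).trans (le_of_eq (by ring))
  obtain ⟨σ, τ, he, hτ, idx, O, -, -, hinj, hadj, ⟨S, -, hS⟩, hmin, hout⟩ :=
    RAM.exec_program (b := b) (L.input k hpos) (by rw [L.encode_length]; exact hpos) (L.decomp hD hle)
      (.inr hmax) (fun v hv => by
        obtain ⟨t, ht⟩ := D.vertex_mem ⟨v, hv⟩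
        exact ⟨t, t.2, L.mem_bagList.mpr ⟨t.2, hv, ht⟩⟩)
      (fun e he => L.edge_mem_bag he) (Nat.lt_succ_self _)
      (two_pow_bound ((VM.space_le hN hm).trans (hmul _ _)) hb)
  refine ⟨σ, τ, he, (hτ.trans (VM.mainTime_le hN hm)).trans ?_,
    L.isLeast_of_hits hinj hadj ⟨S, hS⟩ hmin, ?_⟩
  · rw [mul_comm (36 ^ D.width)]
    exact hmul _ _
  · simpa [Listing.encode] using hout

theorem mainTheorem10 :
    ∃ P : RAM.Program, ∀ C : ℕ, ∃ K : ℕ,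
      ∀ (n N k : ℕ) (G : SimpleGraph (Fin n)) (D : TreeDecomposition G (Fin N)) (r : Fin N),
        D.IsNice r → (D.leaves r).ncard ≤ C * (n + 1) →
        ∀ (L : Listing G D r) (b : ℕ), K * (D.width + Nat.log 2 (n + k + 2)) ≤ b →
          ∃ (s : RAM.State) (t : ℕ),
            RAM.Exec b P (RAM.State.init (L.encode k)) s t ∧
            t ≤ K * (36 ^ D.width * (D.width + 1) * (n + 1)) ∧
            (s.reg 0 = 0 ∨ s.reg 0 = 1) ∧
            (s.reg 0 = 1 ↔ ∃ S : Finset (Fin n), S.card ≤ k ∧ IsTMSolution collectionP4 G S) ∧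
            (s.reg 0 = 1 ↔ ∃ S : Finset (Fin n), S.card ≤ k ∧ IsMSolution collectionP4 G S) ∧
            IsLeast {l | ∃ S : Finset (Fin n), S.card = l ∧ IsTMSolution collectionP4 G S}
              (s.reg 1) ∧
            IsLeast {l | ∃ S : Finset (Fin n), S.card = l ∧ IsMSolution collectionP4 G S}
              (s.reg 1) := by

  -- The summand `6` is the one in `two_pow_bound`, and `18954` is the constant of
  -- `cube_mul_pow_le'`.
  refine ⟨RAM.program, fun C => ⟨(30000 + 1000 * (2 * C + 2)) * 18954 + 6, ?_⟩⟩
  have hK : ∀ C, (10000 + 1000 * (2 * C + 2)) * 18954 + 6 ≤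
      (30000 + 1000 * (2 * C + 2)) * 18954 + 6 := fun C =>
    Nat.add_le_add_right (Nat.mul_le_mul_right _ (Nat.add_le_add_right (by norm_num) _)) _
  intro n N k G D r hD hC L b hb
  obtain ⟨σ, τ, he, hτ, hopt, hout⟩ := L.exec_program (k := k) hD hC
    (le_trans (Nat.mul_le_mul_right _ (hK C)) hb)
  have hdec : σ.reg 0 = 1 ↔ ∃ S : Finset (Fin n), S.card ≤ k ∧
      ¬ HasPath4 (G.induce {v : Fin n | v ∉ S}) := by
    have h1 : σ.reg 0 = 1 ↔ σ.reg 1 ≤ k := by rw [hout]; split_ifs <;> simp [*]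
    rw [h1]
    constructor
    · obtain ⟨S, hS, h⟩ := hopt.1
      exact fun hk => ⟨S, hS.trans_le hk, h⟩
    · rintro ⟨S, hS, h⟩
      exact (hopt.2 ⟨S, rfl, h⟩).trans hS
  simp only [isTMSolution_collectionP4, isMSolution_collectionP4]
  refine ⟨σ, τ, he, hτ.trans ?_, ?_, hdec, hdec, hopt, hopt⟩
  -- The bound obtained does not have the factor `w + 1`, which is only added here.
  · refine Nat.mul_le_mul (Nat.le_add_right _ _) (Nat.mul_le_mul_right _ ?_)
    exact Nat.le_mul_of_pos_right _ (by omega)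
  · rw [hout]
    split_ifs
    · exact .inr rfl
    · exact .inl rfl
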